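/- Let $(u,r,x)$, with $u\in I$ ($I\ni 0$ an open interval), $r>R$, $x\in S^2$, be a Bondi–Sachs coordinate system of a vacuum spacetime (zero Ricci curvature), with metric $$-UV\,du^2-2U\,du\,dr+r^2h_{AB}(dx^A+W^A du)(dx^B+W^B du),\qquad \det h=\det\sigma ,$$ where $\sigma$ is the round metric of $S^2$ and $U,V,W,h$ extend smoothly in $(u,1/r,x)$ up to $1/r=0$ with $$U=1+\tfrac{U^{(-2)}}{r^2}+O(r^{-3}),\quad V=1-\tfrac{2m}{r}+O(r^{-2}),\quad W^A=\tfrac{W^{A(-2)}}{r^2}+\tfrac{W^{A(-3)}}{r^3}+O(r^{-4}),\quad h_{AB}=\sigma_{AB}+\tfrac{C_{AB}}{r}+O(r^{-2}).$$ Indices are raised and lowered with $\sigma$, and $\nabla$ is the Levi-Civita connection of $\sigma$. Let $N_A$ be the angular momentum aspect, defined by $W^{A(-3)}=\tfrac23N^A-C^A{}_BW^{B(-2)}+\nabla^AU^{(-2)}$, let $N_{AB}=\partial_uC_{AB}$ and $P_{BA}=\nabla_B\nabla^DC_{DA}-\nabla_A\nabla^DC_{DB}$. Let $Y$ be a rotation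 Killing field on $S^2\subset\mathbb R^3$, that is $Y(x)=a\times x$ for some $a\in\mathbb R^3$, and let $$\mathcal L_YC_{AB}=Y^D\nabla_DC_{AB}+\nabla_AY^D\,C_{DB}+\nabla_BY^D\,C_{AD},$$ $$V^D=Y^Dm+\tfrac12Y^AC_{AB}N^{BD}-\tfrac14Y^AP^D{}_A+\tfrac12\nabla^DY^A\,\nabla^BC_{BA}+\tfrac12Y^AC^D{}_A$$ (this vector field $V$ on $S^2$, depending on $u$, is not the metric coefficient above). Let $\epsilon$ be the area form of $(S^2,\sigma)$, and define on null infinity $\mathscr I^+=I\times S^2$ the 2-form $$\omega=Y^A\Big(N_A-\tfrac14C_{AB}\nabla_DC^{BD}\Big)\epsilon-(V\lrcorner\epsilon)\wedge du .$$ (1) On $\mathscr I^+$, $$d\omega=-\tfrac14\,N^{AB}\mathcal L_YC_{AB}\;\epsilon\wedge du .$$ (2) For every smooth $f:S^2\to I$ (of any sign), the Dray–Streubel angular momentum of the section $u=f(x)$, defined as $$J(u=f)=\int_{S^2}Y^A\Big(N_A-\tfrac14C_{AB}\nabla_DC^{BD}\Big)(0,x)\;-\;\tfrac14\int_{S^2}\int_0^{f(x)}\big(N^{AB}\mathcal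 L_YC_{AB}\big)(u,x)\,du$$ (with integration over $S^2$ with respect to the area measure of $\sigma$), equals the integral over the section $u=f(x)$, oriented as $S^2$, of the restriction of $\omega$: $$J(u=f)=\int_{\{u=f(x)\}}\omega .$$ -/

import Mathlib

open Set MeasureTheory Metric
open scoped ContDiff

noncomputable section

namespace BondiSachs

/-! ### The unit sphere and its tensors

`S²` is the unit sphere of `E = ℝ³` with the induced round metric `σ`. A tensor on `S²` is given by
its ambient Cartesian components, all contractions with the tangent normal `x` being zero; since `σ`
is the restriction of the Euclidean metric, raising and lowering an index does not change ambient
components, and a contraction over a tangential index is a sum over `Fin 3`. A function "on `S²`" is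
represented by a function on `E` of which only the values at unit vectors are ever used. -/

/-- Euclidean three-space. -/
abbrev E : Type := EuclideanSpace ℝ (Fin 3)

/-- The unit sphere `S²`. -/
abbrev S2 : Set E := sphere (0 : E) 1

/-- Radial retraction `y ↦ y / |y|` of `ℝ³ ∖ {0}` onto `S²`. -/
def unit (y : E) : E := ‖y‖⁻¹ • y

/-- The orthogonal projection onto `T_x S²`, in components `δ_ij - x_i x_j`. These are also the
ambient components of `σ` at `x`. -/
def proj (x : E) : Matrix (Fin 3) (Fin 3) ℝ :=
  fun i j => (if i = j then 1 else 0) - x i * x j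

/-- Smoothness of a function on `S²`: its extension constant along rays is smooth off the origin. -/
def SmoothOnSphere (f : E → ℝ) : Prop :=
  ContDiffOn ℝ ∞ (fun y => f (unit y)) {0}ᶜ

/-- The ambient components of the gradient `∇_k f` of a function on `S²`. -/
def grad (f : E → ℝ) (x : E) (k : Fin 3) : ℝ :=
  fderiv ℝ (fun y => f (unit y)) x (EuclideanSpace.single k 1)

/-- Levi-Civita derivative `∇_k X_i` of a vector field (or 1-form) on `S²`: the tangential
projection of the ambient derivative. -/
def cov1 (X : E → E) (x : E) (k i : Fin 3) : ℝ :=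
  ∑ b, proj x i b * grad (fun y => X y b) x k

/-- Levi-Civita derivative `∇_k T_ij` of a 2-tensor on `S²`. -/
def cov2 (T : E → Matrix (Fin 3) (Fin 3) ℝ) (x : E) (k i j : Fin 3) : ℝ :=
  ∑ b, ∑ c, proj x i b * proj x j c * grad (fun y => T y b c) x k

/-- Divergence `∇^D T_{DA}` of a 2-tensor on `S²`. -/
def div2 (T : E → Matrix (Fin 3) (Fin 3) ℝ) (x : E) : E :=
  WithLp.toLp 2 fun i => ∑ k, cov2 T x k k i

/-- Lie derivative of a 2-tensor on `S²` along `Y`: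
`Y^D ∇_D T_AB + T_DB ∇_A Y^D + T_AD ∇_B Y^D`. -/
def lie2 (Y : E → E) (T : E → Matrix (Fin 3) (Fin 3) ℝ) (x : E) (i j : Fin 3) : ℝ :=
  ∑ k, (Y x k * cov2 T x k i j + cov1 Y x i k * T x k j + cov1 Y x j k * T x i k)

/-- The cross product of `ℝ³`. -/
def cross (a b : E) : E := WithLp.toLp 2 (crossProduct a.ofLp b.ofLp)

/-- The rotation Killing field of `S²` with axis (angular velocity) `a`: `x ↦ a × x`. -/
def rotation (a : E) (x : E) : E := cross a x

/-! ### Ricci curvature in coordinates -/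

/-- Partial derivative in `ℝ⁴`. -/
def pd (i : Fin 4) (F : (Fin 4 → ℝ) → ℝ) (p : Fin 4 → ℝ) : ℝ :=
  fderiv ℝ F p (Pi.single i 1)

/-- Christoffel symbols `Γ^k_ij` of a metric on an open subset of `ℝ⁴`. -/
def christoffel (G : (Fin 4 → ℝ) → Matrix (Fin 4) (Fin 4) ℝ) (k i j : Fin 4) (p : Fin 4 → ℝ) : ℝ :=
  (1 / 2) * ∑ l, (G p)⁻¹ k l *
    (pd i (fun q => G q j l) p + pd j (fun q => G q i l) p - pd l (fun q => G q i j) p)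

/-- Ricci tensor
`R_ij = ∂_k Γ^k_ij - ∂_j Γ^k_ik + Γ^k_kl Γ^l_ij - Γ^k_jl Γ^l_ik`. -/
def ricci (G : (Fin 4 → ℝ) → Matrix (Fin 4) (Fin 4) ℝ) (i j : Fin 4) (p : Fin 4 → ℝ) : ℝ :=
  ∑ k, (pd k (christoffel G k i j) p - pd j (christoffel G k i k) p) +
  ∑ k, ∑ l, (christoffel G k k l p * christoffel G l i j p
    - christoffel G k j l p * christoffel G l i k p)

/-! ### Bondi–Sachs metrics -/

/-- Smoothness in `(u, ρ, x)`, `ρ = 1/r`, up to and including null infinity `ρ = 0`, expressed by a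
smooth continuation to a neighbourhood `|ρ| < ρ₀` of `ρ = 0`. -/
def SmoothCoeff (I : Set ℝ) (ρ₀ : ℝ) (F : ℝ → ℝ → E → ℝ) : Prop :=
  ContDiffOn ℝ ∞ (fun q : ℝ × ℝ × E => F q.1 q.2.1 (unit q.2.2)) (I ×ˢ Ioo (-ρ₀) ρ₀ ×ˢ {0}ᶜ)

/-- The coefficients, as functions of `(u, ρ, x)` with `ρ = 1/r`, of a metric in Bondi–Sachs form
`-U V du² - 2 U du dr + r² h_AB (dx^A + W^A du) (dx^B + W^B du)` on `u ∈ I`, `r > 1/ρ₀`, `x ∈ S²`,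
with the determinant condition and the asymptotically Minkowskian boundary conditions at `ρ = 0`.
Only values with `0 ≤ ρ < ρ₀` have a meaning; those with `ρ < 0` are an arbitrary smooth
continuation. -/
structure BondiSachsMetric (I : Set ℝ) (ρ₀ : ℝ) where
  U : ℝ → ℝ → E → ℝ
  V : ℝ → ℝ → E → ℝ
  W : ℝ → ℝ → E → E
  h : ℝ → ℝ → E → Matrix (Fin 3) (Fin 3) ℝ
  smooth_U : SmoothCoeff I ρ₀ U
  smooth_V : SmoothCoeff I ρ₀ V
  smooth_W : ∀ i, SmoothCoeff I ρ₀ (fun u ρ x => W u ρ x i)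
  smooth_h : ∀ i j, SmoothCoeff I ρ₀ (fun u ρ x => h u ρ x i j)
  U_pos : ∀ u ∈ I, ∀ ρ ∈ Ioo 0 ρ₀, ∀ x ∈ S2, 0 < U u ρ x
  W_tangent : ∀ u ∈ I, ∀ ρ ∈ Ioo 0 ρ₀, ∀ x ∈ S2, ∑ i, W u ρ x i * x i = 0
  h_symm : ∀ u ∈ I, ∀ ρ ∈ Ioo 0 ρ₀, ∀ x ∈ S2, ∀ i j, h u ρ x i j = h u ρ x j i
  h_tangent : ∀ u ∈ I, ∀ ρ ∈ Ioo 0 ρ₀, ∀ x ∈ S2, ∀ i, ∑ j, h u ρ x i j * x j = 0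
  /-- `det h = det σ`: the Gram determinant of `h` in every `σ`-orthonormal basis is one. -/
  h_det : ∀ u ∈ I, ∀ ρ ∈ Ioo 0 ρ₀, ∀ x ∈ S2, ∀ v w : E, Orthonormal ℝ ![x, v, w] →
    (∑ i, ∑ j, h u ρ x i j * v i * v j) * (∑ i, ∑ j, h u ρ x i j * w i * w j)
      - (∑ i, ∑ j, h u ρ x i j * v i * w j) ^ 2 = 1
  U_zero : ∀ u ∈ I, ∀ x ∈ S2, U u 0 x = 1
  U_one : ∀ u ∈ I, ∀ x ∈ S2, deriv (fun ρ => U u ρ x) 0 = 0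
  V_zero : ∀ u ∈ I, ∀ x ∈ S2, V u 0 x = 1
  W_zero : ∀ u ∈ I, ∀ x ∈ S2, W u 0 x = 0
  W_one : ∀ u ∈ I, ∀ x ∈ S2, ∀ i, deriv (fun ρ => W u ρ x i) 0 = 0
  h_zero : ∀ u ∈ I, ∀ x ∈ S2, h u 0 x = proj x

/-- The coordinate `y = r x ∈ ℝ³` of the point `p = (u, y)` of `ℝ⁴`. -/
def spatial (p : Fin 4 → ℝ) : E := WithLp.toLp 2 fun i => p i.succ

/-- `du` in the coordinates `(u, y)`. -/
def duCo : Fin 4 → ℝ := Fin.cons 1 0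

/-- `dr` in the coordinates `(u, y)`, `r = |y|`. -/
def drCo (p : Fin 4 → ℝ) : Fin 4 → ℝ := Fin.cons 0 fun i => unit (spatial p) i

/-- `dx^k` in the coordinates `(u, y)`, `x = y / |y|`. -/
def dxCo (p : Fin 4 → ℝ) (k : Fin 3) : Fin 4 → ℝ :=
  Fin.cons 0 fun i => ‖spatial p‖⁻¹ * proj (unit (spatial p)) k i

namespace BondiSachsMetric

variable {I : Set ℝ} {ρ₀ : ℝ} (g : BondiSachsMetric I ρ₀)

/-- The component matrix of the spacetime metric in the global coordinates `p = (u, y)`, `y = r x`,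
on `u ∈ I`, `|y| > 1/ρ₀`. -/
def metric (p : Fin 4 → ℝ) : Matrix (Fin 4) (Fin 4) ℝ := fun μ ν =>
  let u := p 0
  let x := unit (spatial p)
  let ρ := ‖spatial p‖⁻¹
  ‖spatial p‖ ^ 2 * (∑ k, ∑ l, g.h u ρ x k l *
      ((dxCo p k μ + g.W u ρ x k * duCo μ) * (dxCo p l ν + g.W u ρ x l * duCo ν)))
    - g.U u ρ x * g.V u ρ x * (duCo μ * duCo ν)
    - g.U u ρ x * (duCo μ * drCo p ν + drCo p μ * duCo ν)

/-- The vacuum Einstein equation. -/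
def IsVacuum : Prop :=
  ∀ p : Fin 4 → ℝ, p 0 ∈ I → 1 / ρ₀ < ‖spatial p‖ → ∀ i j, ricci g.metric i j p = 0

/-! ### The Bondi data on null infinity -/

/-- Mass aspect: `V = 1 - 2m/r + O(r⁻²)`. -/
def m (u : ℝ) (x : E) : ℝ := -(1 / 2) * deriv (fun ρ => g.V u ρ x) 0

/-- Shear tensor: `h = σ + C/r + O(r⁻²)`. -/
def C (u : ℝ) (x : E) : Matrix (Fin 3) (Fin 3) ℝ :=
  fun i j => deriv (fun ρ => g.h u ρ x i j) 0

/-- News tensor `N_AB = ∂_u C_AB`. -/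
def news (u : ℝ) (x : E) : Matrix (Fin 3) (Fin 3) ℝ :=
  fun i j => deriv (fun s => g.C s x i j) u

/-- The coefficient of `r⁻²` in `U`. -/
def U2 (u : ℝ) (x : E) : ℝ := (1 / 2) * iteratedDeriv 2 (fun ρ => g.U u ρ x) 0

/-- The coefficient of `r⁻²` in `W`. -/
def W2 (u : ℝ) (x : E) (i : Fin 3) : ℝ := (1 / 2) * iteratedDeriv 2 (fun ρ => g.W u ρ x i) 0

/-- The coefficient of `r⁻³` in `W`. -/
def W3 (u : ℝ) (x : E) (i : Fin 3) : ℝ := (1 / 6) * iteratedDeriv 3 (fun ρ => g.W u ρ x i) 0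

/-- Angular momentum aspect, solved from
`W^{A(-3)} = (2/3) N^A - C^A_B W^{B(-2)} + ∇^A U^{(-2)}`. -/
def N (u : ℝ) (x : E) (i : Fin 3) : ℝ :=
  (3 / 2) * (g.W3 u x i + ∑ j, g.C u x i j * g.W2 u x j - grad (g.U2 u) x i)

/-- `P_BA = ∇_B ∇^D C_DA - ∇_A ∇^D C_DB`. -/
def P (u : ℝ) (x : E) (b a : Fin 3) : ℝ :=
  cov1 (div2 (g.C u)) x b a - cov1 (div2 (g.C u)) x a b

/-- The charge density `Y^A (N_A - (1/4) C_AB ∇_D C^BD)`. -/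
def density (Y : E → E) (u : ℝ) (x : E) : ℝ :=
  ∑ i, Y x i * (g.N u x i - (1 / 4) * ∑ j, g.C u x i j * div2 (g.C u) x j)

/-- The flux density `N^AB L_Y C_AB`. -/
def newsLie (Y : E → E) (u : ℝ) (x : E) : ℝ :=
  ∑ i, ∑ j, g.news u x i j * lie2 Y (g.C u) x i j

/-- The vector field
`V^D = Y^D m + (1/2) Y^A C_AB N^BD - (1/4) Y^A P^D_A + (1/2) ∇^D Y^A ∇^B C_BA + (1/2) Y^A C^D_A`
on `S²` (depending on `u`). -/
def fluxVec (Y : E → E) (u : ℝ) (x : E) : E := WithLp.toLp 2 fun d =>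
  Y x d * g.m u x
    + (1 / 2) * ∑ i, ∑ j, Y x i * g.C u x i j * g.news u x j d
    - (1 / 4) * ∑ i, Y x i * g.P u x d i
    + (1 / 2) * ∑ i, cov1 Y x d i * div2 (g.C u) x i
    + (1 / 2) * ∑ i, Y x i * g.C u x d i

end BondiSachsMetric

/-! ### Differential forms on null infinity

Null infinity is `I × S² ⊆ ℝ × E`. A differential form on it is given at each of its points by an
alternating form on `ℝ × E`, of which only the values on tangent vectors matter. -/

/-- The wedge product `β ∧ α` of an `n`-form `β` with a 1-form `α`:
`(β ∧ α)(v₀, …, vₙ) = ∑ᵢ (-1)^(n+i) α(vᵢ) β(…, v̂ᵢ, …)`. -/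
def wedge {F : Type*} [NormedAddCommGroup F] [NormedSpace ℝ F] {n : ℕ}
    (β : F [⋀^Fin n]→L[ℝ] ℝ) (α : F →L[ℝ] ℝ) : F [⋀^Fin (n + 1)]→L[ℝ] ℝ :=
  (-1 : ℝ) ^ n • ContinuousAlternatingMap.alternatizeUncurryFin (α.smulRight β)

/-- The 1-form `du`. -/
def du : ℝ × E →L[ℝ] ℝ := ContinuousLinearMap.fst ℝ ℝ E

/-- The 1-form `dx^i`. -/
def dx (i : Fin 3) : ℝ × E →L[ℝ] ℝ :=
  (EuclideanSpace.proj i : E →L[ℝ] ℝ).comp (ContinuousLinearMap.snd ℝ ℝ E)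

/-- The area form of `S²` at `x` (outward orientation):
`x⁰ dx¹ ∧ dx² + x¹ dx² ∧ dx⁰ + x² dx⁰ ∧ dx¹`, that is `(v, w) ↦ det (x, v, w)`. -/
def areaForm (x : E) : (ℝ × E) [⋀^Fin 2]→L[ℝ] ℝ :=
  ∑ i : Fin 3, x i •
    wedge (ContinuousAlternatingMap.ofSubsingleton ℝ (ℝ × E) ℝ (0 : Fin 1) (dx (i + 1))) (dx (i + 2))

/-- The retraction `(u, y) ↦ (u, y/|y|)` onto `ℝ × S²`. -/
def retract (p : ℝ × E) : ℝ × E := (p.1, unit p.2)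

/-- Exterior derivative of a form on `ℝ × S²`: extend the form to a neighbourhood by pulling it back
along the retraction and take the exterior derivative there. -/
def scriExtDeriv {n : ℕ} (η : ℝ × E → (ℝ × E) [⋀^Fin n]→L[ℝ] ℝ) (p : ℝ × E) :
    (ℝ × E) [⋀^Fin (n + 1)]→L[ℝ] ℝ :=
  extDeriv (fun q => (η (retract q)).compContinuousLinearMap (fderiv ℝ retract q)) p

/-- The integral over `S²` (outward orientation) of a 2-form `α`. The integrand is
`α_x(e₁, e₂)` for any positively oriented orthonormal basis of `T_x S²`, written without choosing
one; the measure is the surface measure of `S²`. -/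
def sphereFormIntegral (α : E → E [⋀^Fin 2]→L[ℝ] ℝ) : ℝ :=
  ∫ x : S2, (1 / 2) * ∑ i : Fin 3,
    α x ![WithLp.toLp 2 (fun k => proj x k i), cross x (EuclideanSpace.single i 1)]
    ∂(volume : Measure E).toSphere

/-- The section `u = f(x)`, as a map `x ↦ (f(x), x)`, extended constantly along rays. -/
def sectionMap (f : E → ℝ) (y : E) : ℝ × E := (f (unit y), unit y)

/-- The integral over the section `u = f(x)` of the restriction of a 2-form. -/
def sectionIntegral (f : E → ℝ) (η : ℝ × E → (ℝ × E) [⋀^Fin 2]→L[ℝ] ℝ) : ℝ :=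
  sphereFormIntegral fun x =>
    (η (sectionMap f x)).compContinuousLinearMap (fderiv ℝ (sectionMap f) x)

namespace BondiSachsMetric

variable {I : Set ℝ} {ρ₀ : ℝ} (g : BondiSachsMetric I ρ₀)

/-- The 2-form `ω = Y^A (N_A - (1/4) C_AB ∇_D C^BD) ε - (V ⌟ ε) ∧ du`. -/
def omega (Y : E → E) (p : ℝ × E) : (ℝ × E) [⋀^Fin 2]→L[ℝ] ℝ :=
  g.density Y p.1 p.2 • areaForm p.2
    - wedge ((areaForm p.2).curryLeft (0, g.fluxVec Y p.1 p.2)) du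

/-- Dray–Streubel angular momentum of the section `u = 0`. -/
def angMomZero (Y : E → E) : ℝ :=
  ∫ x : S2, g.density Y 0 x ∂(volume : Measure E).toSphere

/-- Dray–Streubel angular momentum of the section `u = f(x)`: that of `u = 0` plus the
Ashtekar–Streubel flux `-(1/4) ∫_Ω N^AB L_Y C_AB` through the region `Ω` between the two sections,
where `∫_Ω F = ∫_{S²} ∫_0^{f(x)} F(u, x) du` (an oriented integral if `f` takes negative values). -/
def angMom (Y : E → E) (f : E → ℝ) : ℝ :=
  g.angMomZero Y - (1 / 4) *
    ∫ x : S2, (∫ u in (0 : ℝ)..(f x), g.newsLie Y u x) ∂(volume : Measure E).toSphere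

end BondiSachsMetric

end BondiSachs

end

/-!
Write `ρ` for the charge density `Y^A (N_A - ¼ C_AB ∇_D C^BD)` and `V` for the flux vector field. Both
assertions follow from one pointwise identity on null infinity, the balance law (`balance`)

  `∂_u ρ = div V - ¼ N^AB L_Y C_AB`.

*From the balance law to the theorem.* For any function `ρ` and any tangential vector field `V`
depending on `u`, the 2-form `ρ ε - (V ⌟ ε) ∧ du` has exterior derivative `(∂_u ρ - div V) ε ∧ du`
(`scriExtDeriv_scriForm`), which gives the first assertion. Its restriction to a section `u = f(x)` is
`(ρ + ⟨V, ∇f⟩) ε` (`sectionIntegral_scriForm`). Along the sections `u = t f(x)` the `t`-derivatives of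
`∫ (ρ + t ⟨V, ∇f⟩)` and of the accumulated flux `-¼ ∫∫ N^AB L_Y C_AB` differ by the integral of the
divergence of the vector field `f V(t f, ·)`, so they agree (`integral_section`); since the region
between the sections is parametrised by `t ∈ [0, 1]`, the sign of `f` plays no role. The divergence
theorem on the sphere (`integral_divergence`) is obtained by integrating by parts, in `ℝ³`, the product
of the radial extension of the vector field with a radial cutoff, and by passing to polar coordinates.

*The balance law.* It is a consequence of the vacuum equations at null infinity, with `ρ = 1/r` now the
boundary defining function. In the coordinates `(u, y)`, `y = r x`, the Ricci tensor is an explicit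
polynomial in the inverse metric and the first two derivatives of the metric (`ricci_eq`). On the polar
axis `y = (0, 0, 1/t)` these derivatives are finite combinations of powers of `t` and of derivatives, at
`(u, t, e₃)`, of the metric components as functions of `(u, ρ, x)`
(`IsShift.ricci_pole`, `IsShift.ricci_pole_eq`), so that each component of the vacuum equation can be
expanded at `t = 0` by the calculus of one-sided first-order jets (`Jet`). The outcome is
* `R_rr = 0`: the coefficient of `r⁻²` in `U` is `-|C|²/16` (`IsShift.ricci_rr`, `U2_eq`);
* `R_rA = 0`: the coefficient of `r⁻²` in `W` is half the divergence of `C`, together with a constraint on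
  the coefficient of `r⁻²` in `h`; and `R_uA = 0`: the evolution of the angular momentum aspect
  (`IsShift.ricci_coeff`, `div2_C`, `momentum_pole`).

Substituting these into the derivatives of `ρ` and `V` leaves an algebraic identity at the pole, in which
the antisymmetry of the matrix of the Killing field enters (`balance_pole`). The pole is not special: a
Bondi–Sachs metric can be rotated by any linear isometry `Q` of `ℝ³` (`rotate`), the rotated metric is
vacuum because the Ricci tensor is natural under linear isometries (`ricci_pull`, `IsVacuum.rotate`), and
all the data on null infinity are carried along equivariantly. Choosing `Q` to move the pole to a given
point yields the balance law everywhere on the sphere. Working only on the axis keeps all computations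
free of coordinate charts of the sphere; tangential derivatives of normal components, which do not
vanish, are recovered by differentiating the tangency conditions (`tan_pole`).
-/

noncomputable section

namespace BondiSachs

open Filter Topology

/-! ### Directional derivatives of smooth functions -/

section DirectionalDerivative

variable {F : Type*} [NormedAddCommGroup F] [NormedSpace ℝ F]

/-- The derivative of a scalar function in the direction of a fixed vector `v`. -/
def dd (v : F) (f : F → ℝ) (q : F) : ℝ := fderiv ℝ f q v

variable {O : Set F} {f g : F → ℝ} {q v w : F}

lemma smooth_differentiableAt (hO : IsOpen O) (hf : ContDiffOn ℝ ∞ f O) (hq : q ∈ O) :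
    DifferentiableAt ℝ f q :=
  (hf.contDiffAt (hO.mem_nhds hq)).differentiableAt (by simp)

lemma smooth_dd (hO : IsOpen O) (hf : ContDiffOn ℝ ∞ f O) (v : F) :
    ContDiffOn ℝ ∞ (dd v f) O :=
  (hf.fderiv_of_isOpen hO (by simp)).clm_apply contDiffOn_const

lemma dd_comm (hO : IsOpen O) (hf : ContDiffOn ℝ ∞ f O) (hq : q ∈ O) (v w : F) :
    dd v (dd w f) q = dd w (dd v f) q := by
  have hs : IsSymmSndFDerivAt ℝ f q :=
    (hf.contDiffAt (hO.mem_nhds hq)).isSymmSndFDerivAt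
      (by simpa using WithTop.coe_le_coe.2 (le_top : (2 : ℕ∞) ≤ ⊤))
  have hd : DifferentiableAt ℝ (fderiv ℝ f) q :=
    ((hf.fderiv_of_isOpen (m := ∞) hO (by simp)).contDiffAt (hO.mem_nhds hq)).differentiableAt
      (by simp)
  have key : ∀ a b : F, dd a (dd b f) q = fderiv ℝ (fderiv ℝ f) q a b := by
    intro a b
    change fderiv ℝ (fun y => fderiv ℝ f y b) q a = _
    rw [fderiv_clm_apply hd (differentiableAt_const b)]
    simp
  rw [key, key]
  exact hs v w

lemma dd_congr (hO : IsOpen O) (h : ∀ p ∈ O, f p = g p) (hq : q ∈ O) (v : F) :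
    dd v f q = dd v g q := by
  have : f =ᶠ[𝓝 q] g := Filter.eventually_of_mem (hO.mem_nhds hq) h
  simp [dd, this.fderiv_eq]

lemma dd_add (hf : DifferentiableAt ℝ f q) (hg : DifferentiableAt ℝ g q) :
    dd v (fun p => f p + g p) q = dd v f q + dd v g q := by
  simp [dd, fderiv_fun_add hf hg]

lemma dd_sub (hf : DifferentiableAt ℝ f q) (hg : DifferentiableAt ℝ g q) :
    dd v (fun p => f p - g p) q = dd v f q - dd v g q := by
  simp [dd, fderiv_fun_sub hf hg]

lemma dd_mul (hf : DifferentiableAt ℝ f q) (hg : DifferentiableAt ℝ g q) :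
    dd v (fun p => f p * g p) q = dd v f q * g q + f q * dd v g q := by
  simp [dd, fderiv_fun_mul hf hg]; ring

lemma dd_const_mul (hf : DifferentiableAt ℝ f q) (c : ℝ) :
    dd v (fun p => c * f p) q = c * dd v f q := by
  simp [dd, fderiv_const_mul hf]

lemma dd_sum {ι : Type*} {s : Finset ι} {f : ι → F → ℝ} (hf : ∀ i ∈ s, DifferentiableAt ℝ (f i) q) :
    dd v (fun p => ∑ i ∈ s, f i p) q = ∑ i ∈ s, dd v (f i) q := by
  simp [dd, fderiv_fun_sum hf]

@[simp] lemma dd_const (c : ℝ) : dd v (fun _ => c) q = 0 := by simp [dd]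

lemma dd_clm (L : F →L[ℝ] ℝ) : dd v (fun p => L p) q = L v := by
  simp [dd]

lemma hasDerivAt_dd (hf : DifferentiableAt ℝ f q) (v : F) {c : ℝ → F} {s : ℝ} (hc : HasDerivAt c v s)
    (hq : c s = q) : HasDerivAt (fun t => f (c t)) (dd v f q) s := by
  subst hq
  exact hf.hasFDerivAt.comp_hasDerivAt s hc

end DirectionalDerivative

/-! ### The radial retraction -/

lemma norm_pos_of_mem {y : E} (hy : y ∈ ({0}ᶜ : Set E)) : 0 < ‖y‖ := norm_pos_iff.2 hy

lemma ne_zero_of_mem_S2 {x : E} (hx : x ∈ S2) : x ≠ 0 := by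
  rintro rfl; simp at hx

lemma norm_of_mem_S2 {x : E} (hx : x ∈ S2) : ‖x‖ = 1 := by simpa using hx

lemma unit_mem {y : E} (hy : y ≠ 0) : unit y ∈ S2 := by
  simp [unit, norm_smul, norm_ne_zero_iff.2 hy]

lemma unit_ne_zero {y : E} (hy : y ≠ 0) : unit y ≠ 0 := ne_zero_of_mem_S2 (unit_mem hy)

lemma unit_of_mem {x : E} (hx : x ∈ S2) : unit x = x := by
  simp [unit, norm_of_mem_S2 hx]

lemma unit_smul {c : ℝ} (hc : 0 < c) (y : E) : unit (c • y) = unit y := by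
  simp only [unit, norm_smul, Real.norm_eq_abs, abs_of_pos hc, mul_inv, smul_smul]
  rw [mul_right_comm, inv_mul_cancel₀ hc.ne', one_mul]

lemma unit_unit (y : E) : unit (unit y) = unit y := by
  by_cases hy : y = 0
  · simp [hy, unit]
  · exact unit_of_mem (unit_mem hy)

lemma norm_smul_unit {y : E} (hy : y ≠ 0) : ‖y‖ • unit y = y := by
  simp [unit, smul_smul, norm_ne_zero_iff.2 hy]

lemma smooth_norm : ContDiffOn ℝ ∞ (fun y : E => ‖y‖) {0}ᶜ :=
  fun _ hy => (contDiffAt_norm ℝ hy).contDiffWithinAt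

lemma smooth_unit : ContDiffOn ℝ ∞ unit {0}ᶜ :=
  (smooth_norm.inv fun _ hy => norm_ne_zero_iff.2 hy).smul contDiffOn_id

lemma isOpen_ne0 : IsOpen ({0}ᶜ : Set E) := isOpen_compl_singleton

lemma norm_sq_eq (y : E) : ‖y‖ ^ 2 = y 0 ^ 2 + y 1 ^ 2 + y 2 ^ 2 := by
  simp [EuclideanSpace.norm_sq_eq, Fin.sum_univ_three]

lemma sum_sq_of_mem {x : E} (hx : x ∈ S2) : x 0 ^ 2 + x 1 ^ 2 + x 2 ^ 2 = 1 := by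
  rw [← norm_sq_eq, norm_of_mem_S2 hx]; norm_num

/-- The standard basis vectors of `ℝ³`. -/
abbrev bv (k : Fin 3) : E := EuclideanSpace.single k 1

lemma sum_smul_bv (y : E) : ∑ k, y k • bv k = y := by
  ext i; simp [Fin.sum_univ_three, bv]; fin_cases i <;> simp

lemma hasFDerivAt_norm {y : E} (hy : y ≠ 0) (v : E) :
    fderiv ℝ (fun y : E => ‖y‖) y v = (∑ i, y i * v i) / ‖y‖ := by
  have h0 : ‖y‖ ≠ 0 := norm_ne_zero_iff.2 hy
  have h := ((hasStrictFDerivAt_norm_sq y).hasFDerivAt).sqrt (by simpa using hy)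
  simp only [Real.sqrt_sq (norm_nonneg _)] at h
  rw [h.fderiv]
  simp [PiLp.inner_apply, Fin.sum_univ_three]
  field_simp

lemma fderiv_unit {y : E} (hy : y ≠ 0) (v : E) (i : Fin 3) :
    fderiv ℝ unit y v i = ‖y‖⁻¹ * (v i - unit y i * ∑ j, unit y j * v j) := by
  have hn : DifferentiableAt ℝ (fun y : E => ‖y‖) y := (contDiffAt_norm ℝ hy (n := 1)).differentiableAt
    (by simp)
  have hn0 : ‖y‖ ≠ 0 := norm_ne_zero_iff.2 hy
  have h := ((hasDerivAt_inv hn0).comp_hasFDerivAt y hn.hasFDerivAt).smul (hasFDerivAt_id y)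
  have h' : HasFDerivAt unit _ y := h
  rw [h'.fderiv]
  simp [hasFDerivAt_norm hy, unit, Fin.sum_univ_three]
  field_simp
  ring

/-! ### Smooth division by the boundary defining function -/

/-- Differentiation under the integral sign for an integrand that is smooth near `[0, 1] × {q}`. -/
lemma hasFDerivAt_integral_of_smooth {F G : Type} [NormedAddCommGroup F] [NormedSpace ℝ F]
    [NormedAddCommGroup G] [NormedSpace ℝ G] {K : ℝ × F → G}
    {U : Set (ℝ × F)} (hU : IsOpen U) (hK : ContDiffOn ℝ ∞ K U) {q : F}
    (hq : Icc (0 : ℝ) 1 ×ˢ {q} ⊆ U) :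
    HasFDerivAt (fun q => ∫ s in (0 : ℝ)..1, K (s, q))
      (∫ s in (0 : ℝ)..1, (fderiv ℝ K (s, q)).comp (ContinuousLinearMap.inr ℝ ℝ F)) q := by
  set K' : ℝ × F → F →L[ℝ] G := fun p => (fderiv ℝ K p).comp (ContinuousLinearMap.inr ℝ ℝ F) with hK'
  have hc : ContinuousOn K U := hK.continuousOn
  have hc' : ContinuousOn K' U :=
    (hK.continuousOn_fderiv_of_isOpen hU (by simp)).clm_comp continuousOn_const
  have hcompact : IsCompact (Icc (0 : ℝ) 1 ×ˢ ({q} : Set F)) := isCompact_Icc.prod isCompact_singleton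
  obtain ⟨M, hM⟩ := hcompact.exists_bound_of_continuousOn (hc'.mono hq)
  have hopen : IsOpen (U ∩ (fun p => ‖K' p‖) ⁻¹' Iio (M + 1)) :=
    hc'.norm.isOpen_inter_preimage hU isOpen_Iio
  obtain ⟨a, b, ha, hb, hsa, hqb, hab⟩ := generalized_tube_lemma isCompact_Icc
    (isCompact_singleton (x := q)) hopen
    (fun p hp => ⟨hq hp, lt_of_le_of_lt (hM p hp) (lt_add_one M)⟩)
  have hqb' : q ∈ b := hqb rfl
  have hcs : ∀ p ∈ b, ContinuousOn (fun s => K (s, p)) (Icc 0 1) := fun p hp =>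
    hc.comp (by fun_prop) fun s hs => (hab ⟨hsa hs, hp⟩).1
  have hcs' : ContinuousOn (fun s => K' (s, q)) (Icc 0 1) :=
    hc'.comp (by fun_prop) fun s hs => (hab ⟨hsa hs, hqb'⟩).1
  have hsub : uIoc (0 : ℝ) 1 ⊆ Icc 0 1 := by
    rw [uIoc_of_le zero_le_one]; exact Ioc_subset_Icc_self
  have hint : ∀ {G' : Type} [NormedAddCommGroup G'] {f : ℝ → G'}, ContinuousOn f (Icc 0 1) →
      IntervalIntegrable f volume 0 1 := fun h =>
    ContinuousOn.intervalIntegrable (by rwa [uIcc_of_le zero_le_one])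
  refine intervalIntegral.hasFDerivAt_integral_of_dominated_of_fderiv_le (𝕜 := ℝ)
    (F := fun q s => K (s, q)) (F' := fun q s => K' (s, q)) (bound := fun _ => M + 1)
    (hb.mem_nhds hqb') ?_ (hint (hcs q hqb')) (intervalIntegrable_iff.1 (hint hcs')).1
    ?_ (by simp) ?_
  · filter_upwards [hb.mem_nhds hqb'] with p hp
    exact (intervalIntegrable_iff.1 (hint (hcs p hp))).1
  · exact .of_forall fun s hs p hp => (hab ⟨hsa (hsub hs), hp⟩).2.le
  · refine .of_forall fun s hs p hp => ?_
    have hd : DifferentiableAt ℝ K (s, p) :=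
      (hK.contDiffAt (hU.mem_nhds (hab ⟨hsa (hsub hs), hp⟩).1)).differentiableAt (by simp)
    exact hd.hasFDerivAt.comp p (hasFDerivAt_prodMk_right s p)

lemma contDiffOn_integral_nat {F : Type} [NormedAddCommGroup F] [NormedSpace ℝ F] (n : ℕ) :
    ∀ {G : Type} [NormedAddCommGroup G] [NormedSpace ℝ G] {K : ℝ × F → G}
    {U : Set (ℝ × F)} (_ : IsOpen U) (_ : ContDiffOn ℝ ∞ K U) {O : Set F} (_ : IsOpen O)
    (_ : Icc (0 : ℝ) 1 ×ˢ O ⊆ U), ContDiffOn ℝ n (fun q => ∫ s in (0 : ℝ)..1, K (s, q)) O := by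
  induction n with
  | zero =>
    intro G _ _ K U hU hK O hO hOU
    refine contDiffOn_zero.2 fun q hq => ContinuousAt.continuousWithinAt ?_
    exact (hasFDerivAt_integral_of_smooth hU hK fun p hp => hOU ⟨hp.1, by rw [hp.2]; exact hq⟩).continuousAt
  | succ n ih =>
    intro G _ _ K U hU hK O hO hOU
    have hder : ∀ q ∈ O, HasFDerivAt (fun q => ∫ s in (0 : ℝ)..1, K (s, q)) _ q := fun q hq =>
      hasFDerivAt_integral_of_smooth hU hK fun p hp => hOU ⟨hp.1, by rw [hp.2]; exact hq⟩
    push_cast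
    refine (contDiffOn_succ_iff_fderiv_of_isOpen hO).2
      ⟨fun q hq => (hder q hq).differentiableAt.differentiableWithinAt, by simp, ?_⟩
    refine (ih (K := fun p => (fderiv ℝ K p).comp (ContinuousLinearMap.inr ℝ ℝ F)) hU ?_ hO hOU).congr fun q hq => (hder q hq).fderiv
    exact (hK.fderiv_of_isOpen hU (by simp)).clm_comp contDiffOn_const

/-- An integral over `[0, 1]` depends smoothly on parameters if its integrand is smooth. -/
lemma contDiffOn_integral {F G : Type} [NormedAddCommGroup F] [NormedSpace ℝ F]
    [NormedAddCommGroup G] [NormedSpace ℝ G] {K : ℝ × F → G}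
    {U : Set (ℝ × F)} (hU : IsOpen U) (hK : ContDiffOn ℝ ∞ K U) {O : Set F} (hO : IsOpen O)
    (hOU : Icc (0 : ℝ) 1 ×ˢ O ⊆ U) : ContDiffOn ℝ ∞ (fun q => ∫ s in (0 : ℝ)..1, K (s, q)) O :=
  contDiffOn_infty.2 fun n => contDiffOn_integral_nat n hU hK hO hOU

/-- The space of the coordinates `(u, ρ, y)`; functions of `(u, ρ, x)` with `x ∈ S²` are extended
to it constantly along the rays of the last factor. -/
abbrev X : Type := ℝ × ℝ × E

/-- The coordinate direction `∂_u`. -/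
def eu : X := (1, 0, 0)

/-- The coordinate direction `∂_ρ`. -/
def er : X := (0, 1, 0)

/-- The coordinate direction `∂_{y_k}`. -/
def es (k : Fin 3) : X := (0, 0, bv k)

/-- The domain `u ∈ I`, `|ρ| < ρ₀`, `y ≠ 0`. -/
def dom (I : Set ℝ) (ρ₀ : ℝ) : Set X := I ×ˢ Ioo (-ρ₀) ρ₀ ×ˢ {0}ᶜ

lemma isOpen_dom {I : Set ℝ} (hI : IsOpen I) (ρ₀ : ℝ) : IsOpen (dom I ρ₀) :=
  hI.prod (isOpen_Ioo.prod isOpen_ne0)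

lemma hasDerivAt_rho (u ρ : ℝ) (y : E) : HasDerivAt (fun ρ : ℝ => ((u, ρ, y) : X)) er ρ :=
  (hasDerivAt_const ρ u).prodMk ((hasDerivAt_id ρ).prodMk (hasDerivAt_const ρ y))

/-- Hadamard's lemma: a smooth function that vanishes at `ρ = 0` is `ρ` times a smooth one. -/
lemma exists_smooth_div {I : Set ℝ} (hI : IsOpen I) {ρ₀ : ℝ} {f : X → ℝ}
    (hf : ContDiffOn ℝ ∞ f (dom I ρ₀)) (h0 : ∀ u ∈ I, ∀ y ≠ 0, f (u, 0, y) = 0) :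
    ∃ g : X → ℝ, ContDiffOn ℝ ∞ g (dom I ρ₀) ∧
      ∀ q ∈ dom I ρ₀, f q = q.2.1 * g q := by
  set m : ℝ × X → X := fun p => (p.2.1, p.1 * p.2.2.1, p.2.2.2) with hm
  have hmc : ContDiff ℝ ∞ m := by fun_prop
  have hdom := isOpen_dom hI ρ₀
  have hmem : ∀ s ∈ Icc (0 : ℝ) 1, ∀ q ∈ dom I ρ₀, m (s, q) ∈ dom I ρ₀ := by
    rintro s ⟨hs0, hs1⟩ ⟨u, ρ, y⟩ ⟨hu, ⟨hρ1, hρ2⟩, hy⟩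
    refine ⟨hu, ⟨?_, ?_⟩, hy⟩ <;> simp only [hm] <;> simp only at hρ1 hρ2 <;> nlinarith
  refine ⟨fun q => ∫ s in (0 : ℝ)..1, dd er f (m (s, q)), ?_, ?_⟩
  · refine contDiffOn_integral (K := fun p => dd er f (m p)) (U := m ⁻¹' dom I ρ₀)
      (hdom.preimage hmc.continuous) ?_ hdom ?_
    · exact (smooth_dd hdom hf er).comp hmc.contDiffOn fun p hp => hp
    · rintro ⟨s, q⟩ ⟨hs, hq⟩; exact hmem s hs q hq
  · rintro ⟨u, ρ, y⟩ hq
    have hderiv : ∀ s ∈ uIcc (0 : ℝ) 1, HasDerivAt (fun s => f (u, s * ρ, y))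
        (ρ * dd er f (m (s, (u, ρ, y)))) s := by
      intro s hs
      rw [uIcc_of_le zero_le_one] at hs
      have hd := smooth_differentiableAt hdom hf (hmem s hs _ hq)
      have hc := (hasDerivAt_rho u (s * ρ) y).scomp s ((hasDerivAt_id s).mul_const ρ)
      have := hasDerivAt_dd hd _ hc rfl
      simpa [dd] using this
    have hcont : ContinuousOn (fun s => ρ * dd er f (m (s, (u, ρ, y)))) (uIcc 0 1) := by
      rw [uIcc_of_le zero_le_one]
      refine continuousOn_const.mul ((smooth_dd hdom hf er).continuousOn.comp
        (hmc.continuous.comp (by fun_prop)).continuousOn fun s hs => hmem s hs _ hq)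
    have := intervalIntegral.integral_eq_sub_of_hasDerivAt hderiv hcont.intervalIntegrable
    rw [intervalIntegral.integral_const_mul] at this
    simp only [one_mul, zero_mul, h0 u hq.1 y hq.2.2, sub_zero] at this
    exact this.symm

/-! ### The Ricci tensor in terms of the second jet of the metric -/

section RicciFormula

/-- The coordinate basis of `ℝ⁴`. -/
abbrev cv (k : Fin 4) : Fin 4 → ℝ := Pi.single k 1

/-- Christoffel symbols of the first kind `Γ_{l,ij}`, computed from the array
`g₁ k i j = ∂_k G_ij` of first derivatives. -/
def gam (g₁ : Fin 4 → Fin 4 → Fin 4 → ℝ) (l i j : Fin 4) : ℝ :=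
  (1 / 2) * (g₁ i j l + g₁ j i l - g₁ l i j)

/-- The part of the Ricci tensor linear in the second derivatives `g₂ k l i j = ∂_k ∂_l G_ij`. -/
def ricLin (H : Fin 4 → Fin 4 → ℝ) (g₂ : Fin 4 → Fin 4 → Fin 4 → Fin 4 → ℝ) (i j : Fin 4) : ℝ :=
  (1 / 2) * ∑ k, ∑ l, H k l * (g₂ k i l j + g₂ l j i k - g₂ k l i j - g₂ i j k l)

/-- The part of the Ricci tensor quadratic in the Christoffel symbols. -/
def ricQuad (H : Fin 4 → Fin 4 → ℝ) (Γ : Fin 4 → Fin 4 → Fin 4 → ℝ) (i j : Fin 4) : ℝ :=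
  ∑ k, ∑ l, ∑ b, ∑ c, H k l * H b c * (Γ b j l * Γ c i k - Γ b k l * Γ c i j)

variable {G : (Fin 4 → ℝ) → Matrix (Fin 4) (Fin 4) ℝ} {O : Set (Fin 4 → ℝ)} {p : Fin 4 → ℝ}

lemma smooth_det {n : ℕ} {F : Type*} [NormedAddCommGroup F] [NormedSpace ℝ F] {O : Set F}
    {M : F → Matrix (Fin n) (Fin n) ℝ}
    (hM : ∀ i j, ContDiffOn ℝ ∞ (fun q => M q i j) O) : ContDiffOn ℝ ∞ (fun q => (M q).det) O := by
  simp only [Matrix.det_apply]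
  exact ContDiffOn.sum fun σ _ => (contDiffOn_prod fun i _ => hM _ _).const_smul _

lemma smooth_inv {n : ℕ} {F : Type*} [NormedAddCommGroup F] [NormedSpace ℝ F] {O : Set F}
    {M : F → Matrix (Fin n) (Fin n) ℝ}
    (hM : ∀ i j, ContDiffOn ℝ ∞ (fun q => M q i j) O) (h0 : ∀ q ∈ O, (M q).det ≠ 0) (i j : Fin n) :
    ContDiffOn ℝ ∞ (fun q => (M q)⁻¹ i j) O := by
  have : (fun q => (M q)⁻¹ i j) = fun q => (M q).det⁻¹ * ((M q).updateRow j (Pi.single i 1)).det := by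
    ext q
    rw [Matrix.inv_def, Matrix.smul_apply, Matrix.adjugate_apply, Ring.inverse_eq_inv', smul_eq_mul]
  rw [this]
  refine ((smooth_det hM).inv h0).mul (smooth_det fun a b => ?_)
  by_cases h : a = j
  · subst h; simpa using contDiffOn_const
  · simpa [Matrix.updateRow_ne h] using hM a b

/-- The Ricci tensor at a point where `H` is the inverse metric. -/
lemma ricci_eq (hO : IsOpen O) (hG : ∀ i j, ContDiffOn ℝ ∞ (fun q => G q i j) O)
    (hsymm : ∀ q ∈ O, ∀ i j, G q i j = G q j i) (hp : p ∈ O) {H : Matrix (Fin 4) (Fin 4) ℝ}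
    (hH : G p * H = 1) (i j : Fin 4) :
    ricci G i j p = ricLin H (fun k l a b => dd (cv k) (dd (cv l) fun q => G q a b) p) i j +
      ricQuad H (gam fun k a b => dd (cv k) (fun q => G q a b) p) i j := by
  set g₁ : Fin 4 → Fin 4 → Fin 4 → (Fin 4 → ℝ) → ℝ := fun k a b => dd (cv k) fun q => G q a b with hg₁
  have hGH : (G p)⁻¹ = H := Matrix.inv_eq_right_inv hH
  have hdet : (G p).det ≠ 0 := fun h => by simpa [h] using congrArg Matrix.det hH
  -- on a smaller neighbourhood the metric stays invertible
  set O' := O ∩ (fun q => (G q).det) ⁻¹' {0}ᶜ with hO'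
  have hO'o : IsOpen O' := (smooth_det hG).continuousOn.isOpen_inter_preimage hO isOpen_compl_singleton
  have hpO' : p ∈ O' := ⟨hp, hdet⟩
  have hG' : ∀ a b, ContDiffOn ℝ ∞ (fun q => G q a b) O' := fun a b => (hG a b).mono inter_subset_left
  have hinv := smooth_inv hG' fun q hq => hq.2
  have dG : ∀ a b, DifferentiableAt ℝ (fun q => G q a b) p := fun a b =>
    smooth_differentiableAt hO'o (hG' a b) hpO'
  have dI : ∀ a b, DifferentiableAt ℝ (fun q => (G q)⁻¹ a b) p := fun a b =>
    smooth_differentiableAt hO'o (hinv a b) hpO'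
  have dg₁ : ∀ k a b, DifferentiableAt ℝ (g₁ k a b) p := fun k a b =>
    smooth_differentiableAt hO'o (smooth_dd hO'o (hG' a b) _) hpO'
  have sg₁ : ∀ k a b, g₁ k a b p = g₁ k b a p := fun k a b =>
    dd_congr hO (fun q hq => hsymm q hq a b) hp _
  -- derivative of the inverse metric
  have hdH : ∀ n, (Matrix.of fun a b => dd (cv n) (fun q => (G q)⁻¹ a b) p) =
      -(H * (Matrix.of fun a b => g₁ n a b p) * H) := by
    intro n
    have h1 : (Matrix.of fun a b => g₁ n a b p) * H +
        G p * (Matrix.of fun a b => dd (cv n) (fun q => (G q)⁻¹ a b) p) = 0 := by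
      ext a c
      have h2 : dd (cv n) (fun q => ∑ b, G q a b * (G q)⁻¹ b c) p =
          dd (cv n) (fun _ => (1 : Matrix (Fin 4) (Fin 4) ℝ) a c) p := by
        refine dd_congr hO'o (fun q hq => ?_) hpO' _
        rw [← Matrix.mul_apply, Matrix.mul_nonsing_inv _ (isUnit_iff_ne_zero.2 hq.2)]
      have hd : ∀ b ∈ Finset.univ, DifferentiableAt ℝ (fun q => G q a b * (G q)⁻¹ b c) p :=
        fun b _ => (dG a b).mul (dI b c)
      rw [dd_const, dd_sum hd] at h2
      simp only [Matrix.add_apply, Matrix.mul_apply, Matrix.of_apply, Matrix.zero_apply]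
      rw [← h2, ← Finset.sum_add_distrib]
      refine Finset.sum_congr rfl fun b _ => ?_
      rw [dd_mul (dG a b) (dI b c), hGH]
    have h3 : H * G p = 1 := mul_eq_one_comm.1 hH
    calc _ = H * (G p * (Matrix.of fun a b => dd (cv n) (fun q => (G q)⁻¹ a b) p)) := by
            rw [← Matrix.mul_assoc, h3, Matrix.one_mul]
      _ = _ := by rw [eq_neg_of_add_eq_zero_right h1, Matrix.mul_neg, Matrix.mul_assoc]
  have hdH' : ∀ n k l, dd (cv n) (fun q => (G q)⁻¹ k l) p =
      -∑ b, (∑ a, H k a * g₁ n a b p) * H b l := by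
    intro n k l
    have := congrFun (congrFun (hdH n) k) l
    simpa [Matrix.mul_apply] using this
  set Γ := gam fun k a b => g₁ k a b p with hΓ
  have hgΓ : ∀ n a b, g₁ n a b p = Γ a n b + Γ b n a := by
    intro n a b
    simp only [hΓ, gam]
    rw [sg₁ n b a, sg₁ b n a, sg₁ a n b]; ring
  have hchr : ∀ k a b, christoffel G k a b p = ∑ l, H k l * Γ l a b := by
    intro k a b
    simp only [christoffel, hGH, Finset.mul_sum]
    refine Finset.sum_congr rfl fun l _ => ?_
    simp only [hΓ, gam, hg₁, dd, pd]; ring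
  set dΓ : Fin 4 → Fin 4 → Fin 4 → Fin 4 → ℝ := fun n l a b =>
    (1 / 2) * (dd (cv n) (g₁ a b l) p + dd (cv n) (g₁ b a l) p - dd (cv n) (g₁ l a b) p) with hdΓ
  have hdchr : ∀ n k a b, pd n (christoffel G k a b) p =
      ∑ l, H k l * dΓ n l a b - ∑ c, ∑ d, H k d * g₁ n d c p * ∑ l, H c l * Γ l a b := by
    intro n k a b
    have h1 : christoffel G k a b = fun q => ∑ l, (G q)⁻¹ k l *
        ((1 / 2) * (g₁ a b l q + g₁ b a l q - g₁ l a b q)) := by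
      ext q
      simp only [christoffel, Finset.mul_sum]
      refine Finset.sum_congr rfl fun l _ => ?_
      simp only [hg₁, dd, pd]; ring
    have dsum : ∀ l, DifferentiableAt ℝ (fun q => g₁ a b l q + g₁ b a l q - g₁ l a b q) p := fun l =>
      ((dg₁ a b l).add (dg₁ b a l)).sub (dg₁ l a b)
    change dd (cv n) (christoffel G k a b) p = _
    have hd : ∀ l ∈ Finset.univ, DifferentiableAt ℝ (fun q => (G q)⁻¹ k l *
        ((1 / 2) * (g₁ a b l q + g₁ b a l q - g₁ l a b q))) p :=
      fun l _ => (dI k l).mul ((dsum l).const_mul _)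
    rw [h1, dd_sum hd]
    have h2 : ∀ l, dd (cv n) (fun q => (G q)⁻¹ k l *
        ((1 / 2) * (g₁ a b l q + g₁ b a l q - g₁ l a b q))) p =
        H k l * dΓ n l a b - ∑ c, ∑ d, H k d * g₁ n d c p * (H c l * Γ l a b) := by
      intro l
      rw [dd_mul (dI k l) ((dsum l).const_mul _), dd_const_mul (dsum l),
        dd_sub (f := fun q => g₁ a b l q + g₁ b a l q) ((dg₁ a b l).add (dg₁ b a l)) (dg₁ l a b), dd_add (dg₁ a b l) (dg₁ b a l), hdH', hGH]
      simp only [hdΓ, hΓ, gam, Finset.sum_mul, neg_mul, mul_assoc]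
      ring
    simp only [h2, Finset.sum_sub_distrib]
    congr 1
    rw [Finset.sum_comm]
    refine Finset.sum_congr rfl fun c _ => ?_
    rw [Finset.sum_comm]
    refine Finset.sum_congr rfl fun d _ => ?_
    rw [Finset.mul_sum]
  have hfirst : ∀ k (u : Fin 4 → ℝ) n, -(∑ c, ∑ d, H k d * g₁ n d c p * u c) +
      ∑ l, (∑ d, H k d * Γ d n l) * u l = -∑ c, ∑ d, H k d * Γ c n d * u c := by
    intro k u n
    simp only [← Finset.sum_neg_distrib, ← Finset.sum_add_distrib]
    refine Finset.sum_congr rfl fun c _ => ?_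
    rw [Finset.sum_mul, ← Finset.sum_add_distrib]
    refine Finset.sum_congr rfl fun d _ => ?_
    rw [hgΓ]; ring
  have hΓs : ∀ l a b, Γ l a b = Γ l b a := by
    intro l a b
    simp only [hΓ, gam]; rw [sg₁ l a b]; ring
  have step : ricci G i j p = ∑ k, (∑ l, H k l * (dΓ k l i j - dΓ j l i k) +
      ∑ c, ∑ d, H k d * (Γ c j d * ∑ l, H c l * Γ l i k - Γ c k d * ∑ l, H c l * Γ l i j)) := by
    rw [ricci, ← Finset.sum_add_distrib]
    refine Finset.sum_congr rfl fun k _ => ?_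
    have e1 := hfirst k (fun c => ∑ l, H c l * Γ l i j) k
    have e2 := hfirst k (fun c => ∑ l, H c l * Γ l i k) j
    rw [hdchr, hdchr]
    simp only [hchr, Finset.sum_sub_distrib]
    simp only [mul_sub, Finset.sum_sub_distrib, ← mul_assoc]
    linear_combination e1 - e2
  rw [step]
  simp only [ricLin, ricQuad, Finset.mul_sum]
  rw [← Finset.sum_add_distrib]
  refine Finset.sum_congr rfl fun k _ => ?_
  congr 1
  · refine Finset.sum_congr rfl fun l _ => ?_
    have c1 : ∀ a b c d, dd (cv a) (g₁ b c d) p = dd (cv b) (g₁ a c d) p := fun a b c d =>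
      dd_comm hO'o (hG' c d) hpO' _ _
    have s2 : ∀ a b c d, dd (cv a) (g₁ b c d) p = dd (cv a) (g₁ b d c) p := fun a b c d =>
      dd_congr hO (fun q hq => dd_congr hO (fun q hq => hsymm q hq c d) hq _) hp _
    change _ = 1 / 2 * (H k l * (dd (cv k) (g₁ i l j) p + dd (cv l) (g₁ j i k) p
      - dd (cv k) (g₁ l i j) p - dd (cv i) (g₁ j k l) p))
    simp only [hdΓ]
    rw [s2 k i l j, c1 l j i k, c1 i j k l, c1 k j i l]
    ring
  · rw [Finset.sum_comm]
    refine Finset.sum_congr rfl fun d _ => Finset.sum_congr rfl fun c _ => ?_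
    rw [← Finset.sum_sub_distrib, Finset.mul_sum]
    refine Finset.sum_congr rfl fun l _ => ?_
    ring

end RicciFormula

/-! ### Cartesian derivatives of functions of `(u, 1/r, x)` -/

section Pullback

variable {I : Set ℝ} {ρ₀ : ℝ} {f : X → ℝ}

/-- The pole `(0, 0, 1)` of `S²`. -/
abbrev e3 : E := bv 2

lemma e3_mem : e3 ∈ S2 := by simp

lemma e3_ne : e3 ≠ 0 := ne_zero_of_mem_S2 e3_mem

@[simp] lemma unit_e3 : unit e3 = e3 := unit_of_mem e3_mem

/-- The function does not change along the rays of the factor `E`. -/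
def RayConst (f : X → ℝ) : Prop :=
  ∀ (u ρ : ℝ) (y : E) (c : ℝ), 0 < c → f (u, ρ, c • y) = f (u, ρ, y)

/-- The derivative of a ray `c ↦ c y` in the last factor, in the coordinate directions. -/
lemma hasDerivAt_ray (u ρ : ℝ) (y : E) (s : ℝ) :
    HasDerivAt (fun c : ℝ => ((u, ρ, c • y) : X)) (∑ j, y j • es j) s := by
  have h : HasDerivAt (fun c : ℝ => ((u, ρ, c • y) : X)) (0, 0, (1 : ℝ) • y) s :=
    (hasDerivAt_const s u).prodMk ((hasDerivAt_const s ρ).prodMk ((hasDerivAt_id s).smul_const y))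
  convert h using 1
  rw [one_smul]
  conv_rhs => rw [← sum_smul_bv y]
  simp [Fin.sum_univ_three, es]

/-- Euler's identity for functions constant along rays. -/
lemma RayConst.euler (hI : IsOpen I) (hf : ContDiffOn ℝ ∞ f (dom I ρ₀)) (hr : RayConst f) {q : X}
    (hq : q ∈ dom I ρ₀) : ∑ j, q.2.2 j * dd (es j) f q = 0 := by
  obtain ⟨u, ρ, y⟩ := q
  have hd := smooth_differentiableAt (isOpen_dom hI ρ₀) hf hq
  have h1 := hasDerivAt_dd hd _ (hasDerivAt_ray u ρ y 1) (by simp)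
  have h2 : HasDerivAt (fun c : ℝ => f (u, ρ, c • y)) 0 1 := by
    refine (hasDerivAt_const (1 : ℝ) (f (u, ρ, y))).congr_of_eventuallyEq ?_
    filter_upwards [lt_mem_nhds one_pos] with c hc using hr u ρ y c hc
  have h3 := h1.unique h2
  simpa [dd, map_sum, map_smul] using h3

/-- The point `(u, 1/r, c y)` of `X` attached to the point `(u, y)` of `ℝ⁴`, `r = |y|`. -/
def kap (c : ℝ) (p : Fin 4 → ℝ) : X := (p 0, ‖spatial p‖⁻¹, c • spatial p)

/-- The region `u ∈ I`, `r > 1/ρ₀` of `ℝ⁴`. -/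
def region (I : Set ℝ) (ρ₀ : ℝ) : Set (Fin 4 → ℝ) := {p | p 0 ∈ I ∧ 1 / ρ₀ < ‖spatial p‖}

/-- `spatial` as a continuous linear map. -/
def spatialL : (Fin 4 → ℝ) →L[ℝ] E :=
  LinearMap.toContinuousLinearMap
    { toFun := spatial
      map_add' := fun _ _ => rfl
      map_smul' := fun _ _ => rfl }

@[simp] lemma spatialL_apply (p : Fin 4 → ℝ) : spatialL p = spatial p := rfl

lemma isOpen_region (hI : IsOpen I) (ρ₀ : ℝ) : IsOpen (region I ρ₀) :=
  (hI.preimage (continuous_apply 0)).inter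
    (isOpen_lt continuous_const (spatialL.continuous.norm))

lemma spatial_ne_zero (hρ₀ : 0 < ρ₀) {p : Fin 4 → ℝ} (hp : p ∈ region I ρ₀) : spatial p ≠ 0 :=
  norm_pos_iff.1 (lt_trans (by positivity) hp.2)

lemma kap_mem (hρ₀ : 0 < ρ₀) {c : ℝ} (hc : 0 < c) {p : Fin 4 → ℝ} (hp : p ∈ region I ρ₀) :
    kap c p ∈ dom I ρ₀ := by
  have h0 := norm_pos_iff.2 (spatial_ne_zero hρ₀ hp)
  have h1 : ‖spatial p‖⁻¹ < ρ₀ := by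
    rw [inv_lt_comm₀ h0 hρ₀, ← one_div]; exact hp.2
  exact ⟨hp.1, ⟨lt_trans (by linarith) (inv_pos.2 h0), h1⟩,
    smul_ne_zero hc.ne' (spatial_ne_zero hρ₀ hp)⟩

lemma kap_mem_pos (hρ₀ : 0 < ρ₀) {p : Fin 4 → ℝ} (hp : p ∈ region I ρ₀) :
    ‖spatial p‖⁻¹ ∈ Ioo 0 ρ₀ :=
  ⟨inv_pos.2 (norm_pos_iff.2 (spatial_ne_zero hρ₀ hp)),
    (kap_mem hρ₀ one_pos hp).2.1.2⟩

/-- The operator on functions on `X` that represents the partial derivative `∂_k` of `ℝ⁴`. -/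
def op (c : ℝ) (k : Fin 4) (f : X → ℝ) : X → ℝ :=
  Fin.cases (dd eu f)
    (fun i q => c * dd (es i) f q - c⁻¹ * (q.2.1 ^ 3 * q.2.2 i) * dd er f q) k

lemma op_zero (c : ℝ) (f : X → ℝ) : op c 0 f = dd eu f := rfl

lemma op_succ (c : ℝ) (i : Fin 3) (f : X → ℝ) : op c i.succ f =
    fun q => c * dd (es i) f q - c⁻¹ * (q.2.1 ^ 3 * q.2.2 i) * dd er f q := rfl

lemma smooth_op (hI : IsOpen I) (hf : ContDiffOn ℝ ∞ f (dom I ρ₀)) (c : ℝ) (k : Fin 4) :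
    ContDiffOn ℝ ∞ (op c k f) (dom I ρ₀) := by
  have hd := isOpen_dom hI ρ₀
  refine Fin.cases ?_ (fun i => ?_) k
  · exact smooth_dd hd hf _
  · rw [op_succ]
    have h : ContDiff ℝ ∞ fun q : X => q.2.2 i := by fun_prop
    exact (contDiffOn_const.mul (smooth_dd hd hf _)).sub ((contDiffOn_const.mul
      (ContDiffOn.mul (by fun_prop) h.contDiffOn)).mul (smooth_dd hd hf _))

lemma hasDerivAt_kap {c : ℝ} {p : Fin 4 → ℝ} (hp : spatial p ≠ 0) (k : Fin 4) :
    HasDerivAt (fun s : ℝ => kap c (p + s • cv k))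
      (Fin.cases eu (fun i => c • es i - (‖spatial p‖⁻¹ ^ 3 * spatial p i) • er) k) 0 := by
  have hlin : HasDerivAt (fun s : ℝ => p + s • cv k) (cv k) 0 := by
    simpa using ((hasDerivAt_id (0 : ℝ)).smul_const (cv k)).const_add p
  have h0 : HasDerivAt (fun s : ℝ => (p + s • cv k) 0) (cv k 0) 0 := (hasDerivAt_pi.1 hlin) 0
  have hs : HasDerivAt (fun s : ℝ => spatial (p + s • cv k)) (spatial (cv k)) 0 :=
    spatialL.hasFDerivAt.comp_hasDerivAt 0 hlin
  have hn : DifferentiableAt ℝ (fun y : E => ‖y‖) (spatial (p + (0 : ℝ) • cv k)) :=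
    (contDiffAt_norm ℝ (n := 1) (by simpa using hp)).differentiableAt (by simp)
  have hnorm := (hn.hasFDerivAt.comp_hasDerivAt (0 : ℝ) hs).inv (by simpa using hp)
  have := h0.prodMk (hnorm.prodMk (hs.const_smul c))
  refine this.congr_deriv ?_
  have h3 : spatial (p + (0 : ℝ) • cv k) = spatial p := by simp
  have hn0 : ‖spatial p‖ ≠ 0 := norm_ne_zero_iff.2 hp
  refine Fin.cases ?_ (fun i => ?_) k
  · have : spatial (cv 0) = 0 := by ext j; simp [spatial]
    simp [this, eu]
  · have : spatial (cv i.succ) = bv i := by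
      ext j; by_cases hij : j = i
      · subst hij; simp [spatial]
      · simp [spatial, hij, Pi.single_apply]
    ext j
    · simp [es, er]
    · have h4 : fderiv ℝ (fun y : E => ‖y‖) (spatial (p + (0 : ℝ) • cv i.succ)) (bv i) =
          spatial p i / ‖spatial p‖ := by
        rw [zero_smul, add_zero, hasFDerivAt_norm hp]; simp
      simp only [Function.comp_apply, this, h4]
      simp [es, er]
      field_simp
    · simp [this, es, er]

/-- The chain rule for functions of `(u, 1/r, x)`. -/
lemma dd_comp_kap (hI : IsOpen I) (hρ₀ : 0 < ρ₀) (hf : ContDiffOn ℝ ∞ f (dom I ρ₀)) {c : ℝ}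
    (hc : 0 < c) {p : Fin 4 → ℝ} (hp : p ∈ region I ρ₀) (k : Fin 4) :
    dd (cv k) (fun p => f (kap c p)) p = op c k f (kap c p) := by
  have hy := spatial_ne_zero hρ₀ hp
  have hfd := smooth_differentiableAt (isOpen_dom hI ρ₀) hf (kap_mem hρ₀ hc hp)
  have h1 := hasDerivAt_dd hfd _ (hasDerivAt_kap (c := c) hy k) (by simp)
  have hkd : DifferentiableAt ℝ (kap c) p := by
    have hn : DifferentiableAt ℝ (fun p => ‖spatial p‖) p :=
      ((contDiffAt_norm ℝ (n := 1) hy).differentiableAt (by simp)).comp p spatialL.differentiableAt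
    exact (differentiableAt_apply 0 p).prodMk
      ((hn.inv (norm_ne_zero_iff.2 hy)).prodMk (spatialL.differentiableAt.const_smul c))
  have hlin : HasDerivAt (fun s : ℝ => p + s • cv k) (cv k) 0 := by
    simpa using ((hasDerivAt_id (0 : ℝ)).smul_const (cv k)).const_add p
  have h2 := hasDerivAt_dd (f := fun p => f (kap c p)) (q := p) (DifferentiableAt.comp p hfd hkd) _ hlin
    (by simp)
  rw [h2.unique h1]
  refine Fin.cases rfl (fun i => ?_) k
  simp only [op_succ, Fin.cases_succ, dd, map_sub, map_smul, smul_eq_mul, kap, PiLp.smul_apply]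
  have := hc.ne'
  field_simp

lemma dd_dd_comp_kap (hI : IsOpen I) (hρ₀ : 0 < ρ₀) (hf : ContDiffOn ℝ ∞ f (dom I ρ₀)) {c : ℝ}
    (hc : 0 < c) {p : Fin 4 → ℝ} (hp : p ∈ region I ρ₀) (k l : Fin 4) :
    dd (cv k) (dd (cv l) fun p => f (kap c p)) p = op c k (op c l f) (kap c p) := by
  rw [dd_congr (isOpen_region hI ρ₀) (fun p hp => dd_comp_kap hI hρ₀ hf hc hp l) hp,
    dd_comp_kap hI hρ₀ (smooth_op hI hf c l) hc hp]

lemma dd_op_succ (hI : IsOpen I) (hf : ContDiffOn ℝ ∞ f (dom I ρ₀)) {c : ℝ} {q : X}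
    (hq : q ∈ dom I ρ₀) (v : X) (i : Fin 3) :
    dd v (op c i.succ f) q = c * dd v (dd (es i) f) q
      - c⁻¹ * (3 * q.2.1 ^ 2 * v.2.1 * q.2.2 i + q.2.1 ^ 3 * v.2.2 i) * dd er f q
      - c⁻¹ * (q.2.1 ^ 3 * q.2.2 i) * dd v (dd er f) q := by
  have hd := isOpen_dom hI ρ₀
  have d1 := smooth_differentiableAt hd (smooth_dd hd hf (es i)) hq
  have d2 := smooth_differentiableAt hd (smooth_dd hd hf er) hq
  have d3 : DifferentiableAt ℝ (fun q : X => c⁻¹ * (q.2.1 ^ 3 * q.2.2 i)) q := by fun_prop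
  have hρ : dd v (fun q : X => q.2.1) q = v.2.1 :=
    dd_clm ((ContinuousLinearMap.fst ℝ ℝ E).comp (ContinuousLinearMap.snd ℝ ℝ (ℝ × E)))
  have hy : dd v (fun q : X => q.2.2 i) q = v.2.2 i :=
    dd_clm ((EuclideanSpace.proj i : E →L[ℝ] ℝ).comp ((ContinuousLinearMap.snd ℝ ℝ E).comp
      (ContinuousLinearMap.snd ℝ ℝ (ℝ × E))))
  have h3 : dd v (fun q : X => q.2.1 ^ 3) q = 3 * q.2.1 ^ 2 * v.2.1 := by
    have : (fun q : X => q.2.1 ^ 3) = fun q => q.2.1 * (q.2.1 * q.2.1) := by ext; ring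
    rw [this, dd_mul (by fun_prop) (by fun_prop), dd_mul (by fun_prop) (by fun_prop), hρ]; ring
  rw [op_succ, dd_sub (g := fun q => c⁻¹ * (q.2.1 ^ 3 * q.2.2 i) * dd er f q) (d1.const_mul c) (d3.mul d2), dd_const_mul d1, dd_mul d3 d2,
    dd_const_mul (by fun_prop), dd_mul (by fun_prop) (by fun_prop), h3, hy]
  ring

/-- The array of first Cartesian derivatives at distance `1/t` from the origin along the polar
axis. -/
def d1 (f : X → ℝ) (q : X) : Fin 4 → ℝ :=
  ![dd eu f q, q.2.1 * dd (es 0) f q, q.2.1 * dd (es 1) f q, -q.2.1 ^ 2 * dd er f q]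

/-- The array of second Cartesian derivatives at distance `1/t` from the origin along the polar
axis. -/
def d2 (f : X → ℝ) (q : X) : Fin 4 → Fin 4 → ℝ :=
  let t := q.2.1
  ![![dd eu (dd eu f) q, t * dd eu (dd (es 0) f) q, t * dd eu (dd (es 1) f) q,
      -t ^ 2 * dd eu (dd er f) q],
    ![t * dd eu (dd (es 0) f) q, t ^ 2 * dd (es 0) (dd (es 0) f) q - t ^ 3 * dd er f q,
      t ^ 2 * dd (es 0) (dd (es 1) f) q, -t ^ 2 * dd (es 0) f q - t ^ 3 * dd er (dd (es 0) f) q],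
    ![t * dd eu (dd (es 1) f) q, t ^ 2 * dd (es 0) (dd (es 1) f) q,
      t ^ 2 * dd (es 1) (dd (es 1) f) q - t ^ 3 * dd er f q,
      -t ^ 2 * dd (es 1) f q - t ^ 3 * dd er (dd (es 1) f) q],
    ![-t ^ 2 * dd eu (dd er f) q, -t ^ 2 * dd (es 0) f q - t ^ 3 * dd er (dd (es 0) f) q,
      -t ^ 2 * dd (es 1) f q - t ^ 3 * dd er (dd (es 1) f) q,
      t ^ 4 * dd er (dd er f) q + 2 * t ^ 3 * dd er f q]]

/-- Radial derivatives of a function constant along rays, at the pole. -/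
lemma RayConst.pole (hI : IsOpen I) (hf : ContDiffOn ℝ ∞ f (dom I ρ₀)) (hr : RayConst f)
    {u t : ℝ} (hq : ((u, t, e3) : X) ∈ dom I ρ₀) :
    dd (es 2) f (u, t, e3) = 0 ∧ dd (es 0) (dd (es 2) f) (u, t, e3) = -dd (es 0) f (u, t, e3) ∧
    dd (es 1) (dd (es 2) f) (u, t, e3) = -dd (es 1) f (u, t, e3) ∧
    dd (es 2) (dd (es 2) f) (u, t, e3) = 0 ∧ dd eu (dd (es 2) f) (u, t, e3) = 0 ∧
    dd er (dd (es 2) f) (u, t, e3) = 0 := by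
  have hd := isOpen_dom hI ρ₀
  have h0 := hr.euler hI hf hq
  have key : ∀ v : X, ∑ j, (v.2.2 j * dd (es j) f (u, t, e3) +
      e3 j * dd v (dd (es j) f) (u, t, e3)) = 0 := by
    intro v
    have dj : ∀ j, DifferentiableAt ℝ (dd (es j) f) (u, t, e3) := fun j =>
      smooth_differentiableAt hd (smooth_dd hd hf (es j)) hq
    have dy : ∀ j, DifferentiableAt ℝ (fun q : X => q.2.2 j) (u, t, e3) := fun j => by fun_prop
    have hy : ∀ j, dd v (fun q : X => q.2.2 j) (u, t, e3) = v.2.2 j := fun j =>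
      dd_clm ((EuclideanSpace.proj j : E →L[ℝ] ℝ).comp ((ContinuousLinearMap.snd ℝ ℝ E).comp
        (ContinuousLinearMap.snd ℝ ℝ (ℝ × E))))
    have h1 := dd_congr hd (fun q hq => hr.euler hI hf hq) hq v
    have hds : ∀ j ∈ Finset.univ, DifferentiableAt ℝ (fun q : X => q.2.2 j * dd (es j) f q) (u, t, e3) :=
      fun j _ => (dy j).mul (dj j)
    rw [dd_const, dd_sum hds] at h1
    rw [← h1]
    refine Finset.sum_congr rfl fun j _ => ?_
    rw [dd_mul (dy j) (dj j), hy]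
  have k0 := key (es 0)
  have k1 := key (es 1)
  have k2 := key (es 2)
  have ku := key eu
  have kr := key er
  simp [Fin.sum_univ_three, es, eu, er] at h0 k0 k1 k2 ku kr
  simp only [es, eu, er]
  refine ⟨h0, by linarith, by linarith, ?_, ku, kr⟩
  rw [h0] at k2; linarith

/-- The point of `ℝ⁴` at retarded time `u` and distance `1/t` from the origin on the polar axis. -/
def polePoint (u t : ℝ) : Fin 4 → ℝ := ![u, 0, 0, t⁻¹]

lemma spatial_polePoint (u t : ℝ) : spatial (polePoint u t) = t⁻¹ • e3 := by
  ext i; fin_cases i <;> simp [spatial, polePoint]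

lemma kap_polePoint {u t : ℝ} (ht : 0 < t) : kap t (polePoint u t) = (u, t, e3) := by
  rw [kap, spatial_polePoint, norm_smul]
  simp [polePoint, abs_of_pos ht, smul_smul, ht.ne']

lemma polePoint_mem {u t : ℝ} (hu : u ∈ I) (ht : t ∈ Ioo 0 ρ₀) : polePoint u t ∈ region I ρ₀ := by
  refine ⟨by simpa [polePoint] using hu, ?_⟩
  rw [spatial_polePoint, norm_smul]
  simpa [abs_of_pos ht.1] using (inv_lt_inv₀ (ht.1.trans ht.2) ht.1).2 ht.2

lemma pole_mem_dom {u t : ℝ} (hu : u ∈ I) (ht : t ∈ Ioo (-ρ₀) ρ₀) : ((u, t, e3) : X) ∈ dom I ρ₀ :=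
  ⟨hu, ht, e3_ne⟩

/-- First Cartesian derivatives on the polar axis, in terms of derivatives at the pole. Derivatives along
the sphere and `∂_ρ` enter with the powers of `t = 1/r` recorded in `d1`. -/
lemma dd_pole (hI : IsOpen I) (hf : ContDiffOn ℝ ∞ f (dom I ρ₀)) (hr : RayConst f)
    {u t : ℝ} (hu : u ∈ I) (ht : t ∈ Ioo 0 ρ₀) (k : Fin 4) :
    dd (cv k) (fun p => f (kap t p)) (polePoint u t) = d1 f (u, t, e3) k := by
  have hρ₀ : 0 < ρ₀ := ht.1.trans ht.2
  have hq : ((u, t, e3) : X) ∈ dom I ρ₀ := pole_mem_dom hu ⟨by linarith [ht.1], ht.2⟩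
  have ht0 := ht.1.ne'
  obtain ⟨r0, -⟩ := hr.pole hI hf hq
  rw [dd_comp_kap hI hρ₀ hf ht.1 (polePoint_mem hu ht), kap_polePoint ht.1]
  have s1 : (1 : Fin 4) = Fin.succ 0 := rfl
  have s2 : (2 : Fin 4) = Fin.succ 1 := rfl
  have s3 : (3 : Fin 4) = Fin.succ 2 := rfl
  fin_cases k
  · rfl
  · simp only [Fin.mk_one]; rw [s1, op_succ]; simp [d1]
  · simp only [Fin.reduceFinMk]; rw [s2, op_succ]; simp [d1]
  · simp only [Fin.reduceFinMk]; rw [s3, op_succ]; simp only [r0]; simp [d1]; field_simp; simp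

/-- Second Cartesian derivatives on the polar axis, in terms of derivatives at the pole. -/
lemma dd_dd_pole (hI : IsOpen I) (hf : ContDiffOn ℝ ∞ f (dom I ρ₀)) (hr : RayConst f)
    {u t : ℝ} (hu : u ∈ I) (ht : t ∈ Ioo 0 ρ₀) (k l : Fin 4) :
    dd (cv k) (dd (cv l) fun p => f (kap t p)) (polePoint u t) = d2 f (u, t, e3) k l := by
  have hρ₀ : 0 < ρ₀ := ht.1.trans ht.2
  have hd := isOpen_dom hI ρ₀
  have hq : ((u, t, e3) : X) ∈ dom I ρ₀ := pole_mem_dom hu ⟨by linarith [ht.1], ht.2⟩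
  have hp := polePoint_mem hu ht
  have ht0 := ht.1.ne'
  obtain ⟨r0, r1, r2, r3, r4, r5⟩ := hr.pole hI hf hq
  have hsm := smooth_op hI hf t
  have s1 : (1 : Fin 4) = Fin.succ 0 := rfl
  have s2 : (2 : Fin 4) = Fin.succ 1 := rfl
  have s3 : (3 : Fin 4) = Fin.succ 2 := rfl
  -- by symmetry of second derivatives it is enough to treat `k ≤ l`
  suffices H : ∀ k l : Fin 4, k ≤ l →
      dd (cv k) (dd (cv l) fun p => f (kap t p)) (polePoint u t) = d2 f (u, t, e3) k l by
    rcases le_total k l with h | h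
    · exact H k l h
    · have hc : ContDiffOn ℝ ∞ (fun p => f (kap t p)) (region I ρ₀) := by
        refine hf.comp (fun p hp => ContDiffAt.contDiffWithinAt ?_) fun p hp => kap_mem hρ₀ ht.1 hp
        have hs : ContDiff ℝ ∞ spatial := spatialL.contDiff
        have hy := spatial_ne_zero hρ₀ hp
        have hn : ContDiffAt ℝ ∞ (fun p => ‖spatial p‖) p := hs.contDiffAt.norm ℝ hy
        exact (contDiff_apply ℝ ℝ 0).contDiffAt.prodMk
          ((hn.inv (norm_ne_zero_iff.2 hy)).prodMk (hs.contDiffAt.const_smul t))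
      rw [dd_comm (isOpen_region hI ρ₀) hc hp, H l k h]
      fin_cases k <;> fin_cases l <;> rfl
  intro k l hkl
  rw [dd_dd_comp_kap hI hρ₀ hf ht.1 hp, kap_polePoint ht.1]
  have c1 : ∀ v w, dd v (dd w f) (u, t, e3) = dd w (dd v f) (u, t, e3) := fun v w =>
    dd_comm hd hf hq v w
  fin_cases k <;> fin_cases l <;>
    first
    | (exfalso; revert hkl; decide)
    | skip
  all_goals simp only [Fin.zero_eta, Fin.mk_one, Fin.reduceFinMk, op_zero]
  · rfl
  · rw [s1, dd_op_succ hI hf hq]; simp [d2, eu]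
  · rw [s2, dd_op_succ hI hf hq]; simp [d2, eu]
  · rw [s3, dd_op_succ hI hf hq, r4]; simp [d2, eu]; field_simp; simp
  · rw [s1, op_succ]; simp only [dd_op_succ hI hf hq]; simp [d2, es]; field_simp
  · rw [s1, s2, op_succ]; simp only [dd_op_succ hI hf hq]; simp [d2, es]; field_simp
  · rw [s1, s3, op_succ]; simp only [dd_op_succ hI hf hq, r1, c1 (es 0) er]; simp [d2, es]; field_simp
  · rw [s2, op_succ]; simp only [dd_op_succ hI hf hq]; simp [d2, es]; field_simp
  · rw [s2, s3, op_succ]; simp only [dd_op_succ hI hf hq, r2, c1 (es 1) er]; simp [d2, es]; field_simp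
  · rw [s3, op_succ]; simp only [dd_op_succ hI hf hq, r3, r5, c1 (es 2) er]; simp [d2, es, er]
    field_simp; ring

end Pullback

/-! ### The metric components as functions of `(u, 1/r, x)` -/

namespace BondiSachsMetric

variable {I : Set ℝ} {ρ₀ : ℝ} (g : BondiSachsMetric I ρ₀)

/-- The ray-constant extension of `U` to `X`. -/
def Uh (q : X) : ℝ := g.U q.1 q.2.1 (unit q.2.2)

/-- The ray-constant extension of `V` to `X`. -/
def Vh (q : X) : ℝ := g.V q.1 q.2.1 (unit q.2.2)

/-- The ray-constant extension of `W` to `X`. -/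
def Wh (i : Fin 3) (q : X) : ℝ := g.W q.1 q.2.1 (unit q.2.2) i

/-- The ray-constant extension of `h` to `X`. -/
def hh (i j : Fin 3) (q : X) : ℝ := g.h q.1 q.2.1 (unit q.2.2) i j

/-- The quotient `W/ρ`, smooth up to null infinity, extended to `X`. -/
structure IsShift (w : Fin 3 → X → ℝ) : Prop where
  smooth : ∀ i, ContDiffOn ℝ ∞ (w i) (dom I ρ₀)
  ray : ∀ i, RayConst (w i)
  eq : ∀ i, ∀ q ∈ dom I ρ₀, g.Wh i q = q.2.1 * w i q

/-- Since `W` vanishes at null infinity, it is divisible by `ρ`. -/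
lemma exists_isShift (hI : IsOpen I) : ∃ w, g.IsShift w := by
  have h : ∀ i, ∃ w : X → ℝ, ContDiffOn ℝ ∞ w (dom I ρ₀) ∧ RayConst w ∧
      ∀ q ∈ dom I ρ₀, g.Wh i q = q.2.1 * w q := by
    intro i
    obtain ⟨w, hw, hwe⟩ := exists_smooth_div hI (f := g.Wh i) (g.smooth_W i) (by
      intro u hu y hy
      simp [Wh, g.W_zero u hu _ (unit_mem hy)])
    refine ⟨fun q => w (q.1, q.2.1, unit q.2.2), ?_, fun u ρ y c hc => by simp [unit_smul hc], ?_⟩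
    · refine hw.comp ?_ fun q hq => ⟨hq.1, hq.2.1, unit_ne_zero hq.2.2⟩
      exact contDiffOn_fst.prodMk ((contDiff_snd.fst).contDiffOn.prodMk
        (smooth_unit.comp contDiff_snd.snd.contDiffOn fun q hq => hq.2.2))
    · rintro ⟨u, ρ, y⟩ hq
      rw [← hwe (u, ρ, unit y) ⟨hq.1, hq.2.1, unit_ne_zero hq.2.2⟩]
      simp [Wh, unit_unit]
  choose w hw using h
  exact ⟨w, fun i => (hw i).1, fun i => (hw i).2.1, fun i => (hw i).2.2⟩

/-- The Cartesian components of the position vector on the sphere, extended to `X`. -/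
def xh (i : Fin 3) (q : X) : ℝ := unit q.2.2 i

/-- The Cartesian components `G_{0,i+1}` of the metric. -/
def Bh (w : Fin 3 → X → ℝ) (i : Fin 3) (q : X) : ℝ := ∑ k, g.hh i k q * w k q - g.Uh q * xh i q

/-- The Cartesian component `G_00` of the metric. -/
def Sh (w : Fin 3 → X → ℝ) (q : X) : ℝ :=
  ∑ k, ∑ l, g.hh k l q * (w k q * w l q) - g.Uh q * g.Vh q

/-- The Cartesian components of the metric as functions on `X`. -/
def gtab (w : Fin 3 → X → ℝ) (μ ν : Fin 4) : X → ℝ :=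
  Fin.cases (Fin.cases (g.Sh w) (fun j => g.Bh w j) ν)
    (fun i => Fin.cases (g.Bh w i) (fun j => g.hh i j) ν) μ

variable {g} {w : Fin 3 → X → ℝ}

/-- In Cartesian coordinates the powers of `r` in the metric cancel: its components are functions of
`(u, 1/r, x)` that are smooth up to null infinity. Here `c` is an arbitrary rescaling of the last
argument, on which these functions do not depend. -/
lemma metric_eq (hρ₀ : 0 < ρ₀) (hw : g.IsShift w) {p : Fin 4 → ℝ} (hp : p ∈ region I ρ₀)
    {c : ℝ} (hc : 0 < c) (μ ν : Fin 4) : g.metric p μ ν = g.gtab w μ ν (kap c p) := by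
  have hy := spatial_ne_zero hρ₀ hp
  have hu := hp.1
  have hρ := kap_mem_pos hρ₀ hp
  set r := ‖spatial p‖ with hr
  have hr0 : r ≠ 0 := norm_ne_zero_iff.2 hy
  set x := unit (spatial p) with hx
  have hxm : x ∈ S2 := unit_mem hy
  have hkx : unit (c • spatial p) = x := unit_smul hc _
  have hsym := g.h_symm _ hu _ hρ x hxm
  have htan := g.h_tangent _ hu _ hρ x hxm
  have htan' : ∀ j, ∑ i, g.h (p 0) r⁻¹ x i j * x i = 0 := fun j => by
    rw [← htan j]; exact Finset.sum_congr rfl fun i _ => by rw [hsym i j]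
  have hW : ∀ i, g.W (p 0) r⁻¹ x i = r⁻¹ * w i (kap c p) := by
    intro i
    have := hw.eq i _ (kap_mem hρ₀ hc hp)
    simpa [Wh, kap, hkx] using this
  -- contraction of `h` with `dx` in its second argument
  have hpr : ∀ k j : Fin 3, ∑ l, g.h (p 0) r⁻¹ x k l * proj x l j = g.h (p 0) r⁻¹ x k j := by
    intro k j
    have := htan k
    simp only [proj, mul_sub, Finset.sum_sub_distrib, mul_ite, mul_one, mul_zero,
      Finset.sum_ite_eq', Finset.mem_univ, if_true]
    simp only [← mul_assoc, ← Finset.sum_mul, this]; ring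
  have hpr' : ∀ i l : Fin 3, ∑ k, proj x k i * g.h (p 0) r⁻¹ x k l = g.h (p 0) r⁻¹ x i l := by
    intro i l
    have := htan' l
    simp only [proj, sub_mul, Finset.sum_sub_distrib, ite_mul, one_mul, zero_mul,
      Finset.sum_ite_eq', Finset.mem_univ, if_true]
    have h2 : ∑ k, x k * x i * g.h (p 0) r⁻¹ x k l = (∑ k, g.h (p 0) r⁻¹ x k l * x k) * x i := by
      rw [Finset.sum_mul]; exact Finset.sum_congr rfl fun k _ => by ring
    rw [h2, this]; ring
  simp only [metric, ← hr, ← hx]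
  refine Fin.cases (Fin.cases ?_ (fun j => ?_) ν) (fun i => Fin.cases ?_ (fun j => ?_) ν) μ
  · simp only [gtab, Fin.cases_zero, Sh, Uh, Vh, hh, dxCo, duCo, drCo, Fin.cons_zero, kap, hkx, ← hr]
    simp only [hW, kap, ← hr]
    simp only [Finset.mul_sum, zero_add, mul_one, mul_zero, sub_zero, add_zero]
    congr 1
    refine Finset.sum_congr rfl fun k _ => Finset.sum_congr rfl fun l _ => ?_
    field_simp
  · simp only [gtab, Fin.cases_zero, Fin.cases_succ, Bh, Uh, hh, dxCo, duCo, drCo, Fin.cons_zero,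
      Fin.cons_succ, kap, hkx, ← hr, ← hx, xh]
    simp only [hW, kap, ← hr, Pi.zero_apply]
    have e : ∀ k, ∑ l, g.h (p 0) r⁻¹ x k l * ((0 + r⁻¹ * w k (p 0, r⁻¹, c • spatial p) * 1) *
        (r⁻¹ * proj x l j + r⁻¹ * w l (p 0, r⁻¹, c • spatial p) * 0)) =
        r⁻¹ ^ 2 * (g.h (p 0) r⁻¹ x j k * w k (p 0, r⁻¹, c • spatial p)) := by
      intro k
      rw [hsym j k, ← hpr k j, Finset.sum_mul, Finset.mul_sum]
      exact Finset.sum_congr rfl fun l _ => by ring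
    simp only [e, ← Finset.mul_sum]
    field_simp; ring
  · simp only [gtab, Fin.cases_zero, Fin.cases_succ, Bh, Uh, hh, dxCo, duCo, drCo, Fin.cons_zero,
      Fin.cons_succ, kap, hkx, ← hr, ← hx, xh]
    simp only [hW, kap, ← hr, Pi.zero_apply]
    rw [Finset.sum_comm]
    have e : ∀ l, ∑ k, g.h (p 0) r⁻¹ x k l * ((r⁻¹ * proj x k i + r⁻¹ * w k (p 0, r⁻¹, c • spatial p) * 0)
        * (0 + r⁻¹ * w l (p 0, r⁻¹, c • spatial p) * 1)) =
        r⁻¹ ^ 2 * (g.h (p 0) r⁻¹ x i l * w l (p 0, r⁻¹, c • spatial p)) := by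
      intro l
      rw [← hpr' i l, Finset.sum_mul, Finset.mul_sum]
      exact Finset.sum_congr rfl fun l _ => by ring
    simp only [e, ← Finset.mul_sum]
    field_simp; ring
  · simp only [gtab, Fin.cases_succ, hh, dxCo, duCo, drCo, Fin.cons_succ, kap, hkx, ← hr, ← hx,
      Pi.zero_apply, mul_zero, add_zero, zero_mul, sub_zero]
    have e : ∀ k, ∑ l, g.h (p 0) r⁻¹ x k l * (r⁻¹ * proj x k i * (r⁻¹ * proj x l j)) =
        r⁻¹ ^ 2 * (proj x k i * g.h (p 0) r⁻¹ x k j) := by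
      intro k
      rw [← hpr k j, Finset.mul_sum, Finset.mul_sum]
      exact Finset.sum_congr rfl fun l _ => by ring
    simp only [e, ← Finset.mul_sum, hpr']
    field_simp

lemma smooth_xh (i : Fin 3) : ContDiffOn ℝ ∞ (xh i) (dom I ρ₀) := by
  have h : ContDiffOn ℝ ∞ (fun q : X => unit q.2.2) (dom I ρ₀) :=
    smooth_unit.comp contDiff_snd.snd.contDiffOn fun q hq => hq.2.2
  exact (contDiffOn_euclidean.1 h) i

variable (g) in
lemma smooth_hh (i j : Fin 3) : ContDiffOn ℝ ∞ (g.hh i j) (dom I ρ₀) := g.smooth_h i j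

variable (g) in
lemma smooth_Uh : ContDiffOn ℝ ∞ g.Uh (dom I ρ₀) := g.smooth_U

variable (g) in
lemma smooth_Vh : ContDiffOn ℝ ∞ g.Vh (dom I ρ₀) := g.smooth_V

variable (g) in
lemma smooth_Wh (i : Fin 3) : ContDiffOn ℝ ∞ (g.Wh i) (dom I ρ₀) := g.smooth_W i

lemma IsShift.smooth_Bh (hw : g.IsShift w) (i : Fin 3) : ContDiffOn ℝ ∞ (g.Bh w i) (dom I ρ₀) :=
  (ContDiffOn.sum fun k _ => (g.smooth_hh i k).mul (hw.smooth k)).sub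
    (g.smooth_Uh.mul (smooth_xh i))

lemma IsShift.smooth_Sh (hw : g.IsShift w) : ContDiffOn ℝ ∞ (g.Sh w) (dom I ρ₀) :=
  (ContDiffOn.sum fun k _ => ContDiffOn.sum fun l _ =>
    (g.smooth_hh k l).mul ((hw.smooth k).mul (hw.smooth l))).sub (g.smooth_Uh.mul g.smooth_Vh)

lemma IsShift.smooth_gtab (hw : g.IsShift w) (μ ν : Fin 4) :
    ContDiffOn ℝ ∞ (g.gtab w μ ν) (dom I ρ₀) := by
  refine Fin.cases (Fin.cases hw.smooth_Sh (fun j => ?_) ν)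
    (fun i => Fin.cases ?_ (fun j => ?_) ν) μ
  · exact hw.smooth_Bh j
  · exact hw.smooth_Bh i
  · exact g.smooth_hh i j

variable (g) in
lemma rayConst_hh (i j : Fin 3) : RayConst (g.hh i j) :=
  fun u ρ y c hc => by simp [hh, unit_smul hc]

lemma IsShift.rayConst_gtab (hw : g.IsShift w) (μ ν : Fin 4) : RayConst (g.gtab w μ ν) := by
  have hB : ∀ i, RayConst (g.Bh w i) := fun i u ρ y c hc => by
    simp [Bh, hh, xh, Uh, unit_smul hc, hw.ray _ u ρ y c hc]
  refine Fin.cases (Fin.cases ?_ (fun j => hB j) ν)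
    (fun i => Fin.cases (hB i) (fun j => g.rayConst_hh i j) ν) μ
  intro u ρ y c hc
  simp [gtab, Sh, hh, Vh, Uh, unit_smul hc, hw.ray _ u ρ y c hc]

lemma IsShift.gtab_symm (hw : g.IsShift w) (hρ₀ : 0 < ρ₀) {c : ℝ} (hc : 0 < c) {p : Fin 4 → ℝ}
    (hp : p ∈ region I ρ₀) (μ ν : Fin 4) : g.metric p μ ν = g.metric p ν μ := by
  rw [metric_eq hρ₀ hw hp hc, metric_eq hρ₀ hw hp hc]
  refine Fin.cases (Fin.cases rfl (fun j => rfl) ν)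
    (fun i => Fin.cases rfl (fun j => ?_) ν) μ
  exact g.h_symm _ hp.1 _ (kap_mem_pos hρ₀ hp) _ (unit_mem (smul_ne_zero hc.ne'
    (spatial_ne_zero hρ₀ hp))) i j

/-- The Ricci tensor on the polar axis in terms of the jets of the components at the pole. -/
lemma IsShift.ricci_pole (hI : IsOpen I) (hw : g.IsShift w) {u t : ℝ} (hu : u ∈ I)
    (ht : t ∈ Ioo 0 ρ₀) {H : Matrix (Fin 4) (Fin 4) ℝ}
    (hH : (Matrix.of fun μ ν => g.gtab w μ ν (u, t, e3)) * H = 1) (i j : Fin 4) :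
    ricci g.metric i j (polePoint u t) =
      ricLin H (fun k l a b => d2 (g.gtab w a b) (u, t, e3) k l) i j +
      ricQuad H (gam fun k a b => d1 (g.gtab w a b) (u, t, e3) k) i j := by
  have hρ₀ : 0 < ρ₀ := ht.1.trans ht.2
  have hp := polePoint_mem hu ht
  have ho := isOpen_region hI ρ₀
  have hsm : ∀ μ ν, ContDiffOn ℝ ∞ (fun p => g.gtab w μ ν (kap t p)) (region I ρ₀) := by
    intro μ ν
    refine (hw.smooth_gtab μ ν).comp (fun p hp => ContDiffAt.contDiffWithinAt ?_)
      fun p hp => kap_mem hρ₀ ht.1 hp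
    have hs : ContDiff ℝ ∞ spatial := spatialL.contDiff
    have hy := spatial_ne_zero hρ₀ hp
    have hn : ContDiffAt ℝ ∞ (fun p => ‖spatial p‖) p := hs.contDiffAt.norm ℝ hy
    exact (contDiff_apply ℝ ℝ 0).contDiffAt.prodMk
      ((hn.inv (norm_ne_zero_iff.2 hy)).prodMk (hs.contDiffAt.const_smul t))
  have heq : ∀ μ ν, ∀ p ∈ region I ρ₀, g.metric p μ ν = g.gtab w μ ν (kap t p) := fun μ ν p hp =>
    metric_eq hρ₀ hw hp ht.1 μ ν
  have hH' : g.metric (polePoint u t) * H = 1 := by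
    rw [← hH]; congr 1; ext μ ν
    rw [heq μ ν _ hp, kap_polePoint ht.1]; rfl
  rw [ricci_eq ho (fun μ ν => (hsm μ ν).congr (heq μ ν))
    (fun q hq μ ν => hw.gtab_symm hρ₀ ht.1 hq μ ν) hp hH']
  have e1 : ∀ k a b, dd (cv k) (fun q => g.metric q a b) (polePoint u t) =
      d1 (g.gtab w a b) (u, t, e3) k := fun k a b => by
    rw [dd_congr ho (heq a b) hp, dd_pole hI (hw.smooth_gtab a b) (hw.rayConst_gtab a b) hu ht]
  have e2 : ∀ k l a b, dd (cv k) (dd (cv l) fun q => g.metric q a b) (polePoint u t) =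
      d2 (g.gtab w a b) (u, t, e3) k l := fun k l a b => by
    rw [dd_congr ho (fun q hq => dd_congr ho (heq a b) hq (cv l)) hp,
      dd_dd_pole hI (hw.smooth_gtab a b) (hw.rayConst_gtab a b) hu ht]
  simp only [e1, e2]

end BondiSachsMetric

/-! ### One-sided first-order jets at `ρ = 0` -/

/-- The function `f` has the expansion `f t = a + b t + o(t)` as `t → 0⁺`. -/
def Jet (f : ℝ → ℝ) (a b : ℝ) : Prop := Tendsto (fun t => (f t - a) / t) (𝓝[>] 0) (𝓝 b)

namespace Jet

variable {f g : ℝ → ℝ} {a b c d : ℝ}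

lemma tendsto_id : Tendsto (fun t : ℝ => t) (𝓝[>] 0) (𝓝 0) := tendsto_nhdsWithin_of_tendsto_nhds Filter.tendsto_id

lemma ne : ∀ᶠ t : ℝ in 𝓝[>] 0, t ≠ 0 := eventually_nhdsWithin_of_forall fun _ ht => ne_of_gt ht

lemma tendsto (hf : Jet f a b) : Tendsto f (𝓝[>] 0) (𝓝 a) := by
  have h := (hf.mul tendsto_id).add_const a
  simp only [mul_zero, zero_add] at h
  refine h.congr' ?_
  filter_upwards [ne] with t ht
  field_simp; ring

lemma congr (hf : Jet f a b) (h : ∀ᶠ t in 𝓝[>] 0, f t = g t) : Jet g a b :=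
  Tendsto.congr' (by filter_upwards [h] with t ht; rw [ht]) hf

lemma eq (hf : Jet f a b) (h1 : a = c) (h2 : b = d) : Jet f c d := by subst h1 h2; exact hf

lemma const (a : ℝ) : Jet (fun _ => a) a 0 := by simp [Jet]

lemma id : Jet (fun t => t) 0 1 := by
  refine Tendsto.congr' ?_ tendsto_const_nhds
  filter_upwards [ne] with t ht
  field_simp; simp

lemma add (hf : Jet f a b) (hg : Jet g c d) : Jet (fun t => f t + g t) (a + c) (b + d) := by
  refine (Tendsto.add hf hg).congr fun t => ?_
  ring

lemma sub (hf : Jet f a b) (hg : Jet g c d) : Jet (fun t => f t - g t) (a - c) (b - d) := by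
  refine (Tendsto.sub hf hg).congr fun t => ?_
  ring

lemma neg (hf : Jet f a b) : Jet (fun t => -f t) (-a) (-b) := by
  refine (Tendsto.neg hf).congr fun t => ?_
  ring

lemma mul (hf : Jet f a b) (hg : Jet g c d) : Jet (fun t => f t * g t) (a * c) (b * c + a * d) := by
  refine ((Tendsto.mul hf hg.tendsto).add (Tendsto.const_mul a hg)).congr fun t => ?_
  ring

lemma const_mul (k : ℝ) (hf : Jet f a b) : Jet (fun t => k * f t) (k * a) (k * b) := by
  refine (Tendsto.const_mul k hf).congr fun t => ?_
  ring

lemma inv (hf : Jet f a b) (ha : a ≠ 0) : Jet (fun t => (f t)⁻¹) a⁻¹ (-b / a ^ 2) := by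
  have h1 : ∀ᶠ t in 𝓝[>] 0, f t ≠ 0 := hf.tendsto.eventually_ne ha
  have h2 : Tendsto (fun t => -((f t - a) / t) * ((f t)⁻¹ * a⁻¹)) (𝓝[>] 0) (𝓝 (-b * (a⁻¹ * a⁻¹))) :=
    (Tendsto.neg hf).mul ((hf.tendsto.inv₀ ha).mul_const _)
  have h3 : -b / a ^ 2 = -b * (a⁻¹ * a⁻¹) := by field_simp
  rw [Jet, h3]
  refine h2.congr' ?_
  filter_upwards [h1, ne] with t ht ht'
  field_simp; ring

lemma sum {ι : Type*} {s : Finset ι} {f : ι → ℝ → ℝ} {a b : ι → ℝ} (h : ∀ i ∈ s, Jet (f i) (a i) (b i)) :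
    Jet (fun t => ∑ i ∈ s, f i t) (∑ i ∈ s, a i) (∑ i ∈ s, b i) := by
  classical
  induction s using Finset.induction_on with
  | empty => simpa using const 0
  | insert i s hi ih =>
    simp only [Finset.sum_insert hi]
    exact (h i (by simp)).add (ih fun j hj => h j (by simp [hj]))

lemma eq_zero (hf : Jet f a b) (h : ∀ᶠ t in 𝓝[>] 0, f t = 0) : a = 0 ∧ b = 0 := by
  have ha : a = 0 := tendsto_nhds_unique hf.tendsto (Tendsto.congr' (by
    filter_upwards [h] with t ht using ht.symm) tendsto_const_nhds)
  subst ha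
  refine ⟨rfl, tendsto_nhds_unique hf (Tendsto.congr' ?_ tendsto_const_nhds)⟩
  filter_upwards [h] with t ht
  simp [ht]

lemma of_hasDerivAt (h : HasDerivAt f b 0) : Jet f (f 0) b := by
  have := (hasDerivAt_iff_tendsto_slope_zero.1 h).mono_left
    (nhdsWithin_mono 0 (fun t (ht : 0 < t) => ht.ne'))
  refine this.congr fun t => ?_
  simp [div_eq_inv_mul]

/-- Second-order Taylor expansion of a function vanishing at `0`, divided by `t`. -/
lemma div_of_hasDerivAt {f' : ℝ → ℝ} {b : ℝ} (h : ∀ᶠ t in 𝓝 0, HasDerivAt f (f' t) t)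
    (h2 : HasDerivAt f' b 0) (h0 : f 0 = 0) : Jet (fun t => f t / t) (f' 0) (1 / 2 * b) := by
  have hF : ∀ᶠ t in 𝓝[>] 0, HasDerivAt (fun t => f t - f' 0 * t) (f' t - f' 0) t := by
    filter_upwards [h.filter_mono nhdsWithin_le_nhds] with t ht
    simpa using HasDerivAt.fun_sub ht ((hasDerivAt_id t).const_mul (f' 0))
  have hG : ∀ᶠ t : ℝ in 𝓝[>] 0, HasDerivAt (fun t : ℝ => t ^ 2) (2 * t) t := by
    filter_upwards with t
    simpa using hasDerivAt_pow 2 t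
  have hc : ContinuousAt (fun t => f t - f' 0 * t) 0 :=
    h.self_of_nhds.continuousAt.sub (by fun_prop)
  have hF0 : Tendsto (fun t => f t - f' 0 * t) (𝓝[>] 0) (𝓝 0) := by
    have := hc.tendsto.mono_left (nhdsWithin_le_nhds (s := Ioi 0))
    simpa [h0] using this
  have hG0 : Tendsto (fun t : ℝ => t ^ 2) (𝓝[>] 0) (𝓝 0) := by
    simpa using tendsto_id.pow 2
  have hJ : Tendsto (fun t => (f' t - f' 0) / (2 * t)) (𝓝[>] 0) (𝓝 (1 / 2 * b)) := by
    refine (Tendsto.const_mul (1 / 2) (of_hasDerivAt h2)).congr fun t => ?_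
    ring
  have := HasDerivAt.lhopital_zero_nhdsGT hF hG (by
    filter_upwards [ne] with t ht; simpa using ht) hF0 hG0 hJ
  refine this.congr' ?_
  filter_upwards [ne] with t ht
  field_simp

end Jet

/-! ### Taylor coefficients at null infinity -/

section Coefficients

variable {I : Set ℝ} {ρ₀ : ℝ} {f : X → ℝ}

/-- The restriction of a function of `(u, ρ, y)` to `ρ = 0`. -/
def sc (f : X → ℝ) (p : ℝ × E) : ℝ := f (p.1, 0, p.2)

/-- Null infinity, thickened in the radial direction of the factor `E`. -/
def sdom (I : Set ℝ) : Set (ℝ × E) := I ×ˢ {0}ᶜ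

/-- The direction `∂_u` on null infinity. -/
def su : ℝ × E := (1, 0)

/-- The direction `∂_{y_k}` on null infinity. -/
def ss (k : Fin 3) : ℝ × E := (0, bv k)

/-- The Taylor coefficient of order one at `ρ = 0`. -/
def c1 (f : X → ℝ) : ℝ × E → ℝ := sc (dd er f)

/-- The Taylor coefficient of order two at `ρ = 0`. -/
def c2 (f : X → ℝ) (p : ℝ × E) : ℝ := 1 / 2 * sc (dd er (dd er f)) p

lemma isOpen_sdom (hI : IsOpen I) : IsOpen (sdom I) := hI.prod isOpen_ne0

lemma zero_mem_dom (hρ₀ : 0 < ρ₀) {p : ℝ × E} (hp : p ∈ sdom I) :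
    ((p.1, 0, p.2) : X) ∈ dom I ρ₀ := ⟨hp.1, ⟨by simpa using hρ₀, hρ₀⟩, hp.2⟩

lemma smooth_sc (hρ₀ : 0 < ρ₀) (hf : ContDiffOn ℝ ∞ f (dom I ρ₀)) :
    ContDiffOn ℝ ∞ (sc f) (sdom I) :=
  hf.comp (f := fun p : ℝ × E => ((p.1, 0, p.2) : X)) (by fun_prop) fun _ hp => zero_mem_dom hρ₀ hp

lemma dd_sc (hI : IsOpen I) (hρ₀ : 0 < ρ₀) (hf : ContDiffOn ℝ ∞ f (dom I ρ₀)) {p : ℝ × E}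
    (hp : p ∈ sdom I) (v : ℝ × E) : dd v (sc f) p = sc (dd (v.1, 0, v.2) f) p := by
  have hd := smooth_differentiableAt (isOpen_dom hI ρ₀) hf (zero_mem_dom hρ₀ hp)
  set L : ℝ × E →L[ℝ] X := (ContinuousLinearMap.fst ℝ ℝ E).prod
    ((0 : ℝ × E →L[ℝ] ℝ).prod (ContinuousLinearMap.snd ℝ ℝ E)) with hL
  have h : HasFDerivAt (sc f) ((fderiv ℝ f (L p)).comp L) p :=
    HasFDerivAt.comp p (f := L) hd.hasFDerivAt L.hasFDerivAt
  rw [dd, h.fderiv]; rfl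

lemma smooth_c1 (hI : IsOpen I) (hρ₀ : 0 < ρ₀) (hf : ContDiffOn ℝ ∞ f (dom I ρ₀)) :
    ContDiffOn ℝ ∞ (c1 f) (sdom I) := smooth_sc hρ₀ (smooth_dd (isOpen_dom hI ρ₀) hf er)

lemma smooth_c2 (hI : IsOpen I) (hρ₀ : 0 < ρ₀) (hf : ContDiffOn ℝ ∞ f (dom I ρ₀)) :
    ContDiffOn ℝ ∞ (c2 f) (sdom I) :=
  contDiffOn_const.mul (smooth_sc hρ₀ (smooth_dd (isOpen_dom hI ρ₀) (smooth_dd (isOpen_dom hI ρ₀) hf er) er))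

/-- Taylor coefficients commute with derivatives tangent to null infinity. -/
lemma c1_dd (hI : IsOpen I) (hρ₀ : 0 < ρ₀) (hf : ContDiffOn ℝ ∞ f (dom I ρ₀)) {p : ℝ × E}
    (hp : p ∈ sdom I) (v : ℝ × E) : c1 (dd (v.1, 0, v.2) f) p = dd v (c1 f) p := by
  have hd := isOpen_dom hI ρ₀
  have e : c1 f = sc (dd er f) := rfl
  rw [e, dd_sc hI hρ₀ (smooth_dd hd hf er) hp]
  exact dd_comm hd hf (zero_mem_dom hρ₀ hp) _ _

lemma c2_dd (hI : IsOpen I) (hρ₀ : 0 < ρ₀) (hf : ContDiffOn ℝ ∞ f (dom I ρ₀)) {p : ℝ × E}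
    (hp : p ∈ sdom I) (v : ℝ × E) : c2 (dd (v.1, 0, v.2) f) p = dd v (c2 f) p := by
  have hd := isOpen_dom hI ρ₀
  have h1 := smooth_dd hd hf er
  have h2 := smooth_dd hd h1 er
  have e : c2 f = fun p => 1 / 2 * sc (dd er (dd er f)) p := rfl
  rw [e, dd_const_mul (smooth_differentiableAt (isOpen_sdom hI) (smooth_sc hρ₀ h2) hp),
    dd_sc hI hρ₀ h2 hp]
  simp only [c2, sc]
  rw [dd_comm hd h1 (zero_mem_dom hρ₀ hp),
    dd_congr hd (fun q hq => dd_comm hd hf hq er (v.1, 0, v.2)) (zero_mem_dom hρ₀ hp)]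

lemma hasDerivAt_line (hI : IsOpen I) (hf : ContDiffOn ℝ ∞ f (dom I ρ₀)) {u t : ℝ} {y : E}
    (hq : ((u, t, y) : X) ∈ dom I ρ₀) : HasDerivAt (fun t => f (u, t, y)) (dd er f (u, t, y)) t :=
  hasDerivAt_dd (smooth_differentiableAt (isOpen_dom hI ρ₀) hf hq) _ (hasDerivAt_rho u t y) rfl

lemma eventually_mem_dom (hρ₀ : 0 < ρ₀) {p : ℝ × E} (hp : p ∈ sdom I) :
    ∀ᶠ t in 𝓝 (0 : ℝ), ((p.1, t, p.2) : X) ∈ dom I ρ₀ := by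
  filter_upwards [Ioo_mem_nhds (by linarith : -ρ₀ < 0) hρ₀] with t ht using ⟨hp.1, ht, hp.2⟩

/-- The one-sided jet at null infinity of a smooth function consists of its Taylor coefficients. -/
lemma jet_line (hI : IsOpen I) (hρ₀ : 0 < ρ₀) (hf : ContDiffOn ℝ ∞ f (dom I ρ₀)) {p : ℝ × E}
    (hp : p ∈ sdom I) : Jet (fun t => f (p.1, t, p.2)) (sc f p) (c1 f p) :=
  Jet.of_hasDerivAt (hasDerivAt_line hI hf (zero_mem_dom hρ₀ hp))

/-- For a function vanishing at null infinity, division by `ρ` shifts the Taylor coefficients. -/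
lemma jet_line_div (hI : IsOpen I) (hρ₀ : 0 < ρ₀) (hf : ContDiffOn ℝ ∞ f (dom I ρ₀)) {p : ℝ × E}
    (hp : p ∈ sdom I) (h0 : sc f p = 0) : Jet (fun t => f (p.1, t, p.2) / t) (c1 f p) (c2 f p) := by
  refine Jet.div_of_hasDerivAt (f' := fun t => dd er f (p.1, t, p.2)) ?_
    (hasDerivAt_line hI (smooth_dd (isOpen_dom hI ρ₀) hf er) (zero_mem_dom hρ₀ hp)) h0
  filter_upwards [eventually_mem_dom hρ₀ hp] with t ht using hasDerivAt_line hI hf ht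

/-- A smooth function that vanishes for `ρ > 0` vanishes at `ρ = 0`. -/
lemma sc_eq_zero (hI : IsOpen I) (hρ₀ : 0 < ρ₀) (hf : ContDiffOn ℝ ∞ f (dom I ρ₀))
    (h : ∀ q ∈ dom I ρ₀, 0 < q.2.1 → f q = 0) {p : ℝ × E} (hp : p ∈ sdom I) : sc f p = 0 := by
  refine ((jet_line hI hρ₀ hf hp).eq_zero ?_).1
  filter_upwards [(eventually_mem_dom hρ₀ hp).filter_mono nhdsWithin_le_nhds,
    self_mem_nhdsWithin] with t ht ht' using h _ ht ht'

lemma dd_eq_zero (hI : IsOpen I) (h : ∀ q ∈ dom I ρ₀, 0 < q.2.1 → f q = 0) (v : X) :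
    ∀ q ∈ dom I ρ₀, 0 < q.2.1 → dd v f q = 0 := by
  intro q hq hq'
  have ho : IsOpen (dom I ρ₀ ∩ {q : X | 0 < q.2.1}) :=
    (isOpen_dom hI ρ₀).inter (isOpen_lt continuous_const continuous_snd.fst)
  rw [dd_congr (g := fun _ => 0) ho (fun q hq => h q hq.1 hq.2) ⟨hq, hq'⟩, dd_const]

end Coefficients

/-! ### Algebraic constraints on the metric coefficients and their Taylor coefficients -/

/-- Derivatives of the normal component of a tangential vector field at a point whose position
vector is the pole. -/
lemma tan_pole {F : Type*} [NormedAddCommGroup F] [NormedSpace ℝ F] {O : Set F} (hO : IsOpen O)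
    {v : Fin 3 → F → ℝ} (hv : ∀ j, ContDiffOn ℝ ∞ (v j) O) (y : Fin 3 → F →L[ℝ] ℝ)
    (h : ∀ q ∈ O, ∑ j, v j q * y j q = 0) {q : F} (hq : q ∈ O) (hy : ∀ j, y j q = e3 j) :
    v 2 q = 0 ∧ (∀ e, dd e (v 2) q = -∑ j, v j q * y j e) ∧
    ∀ e e', dd e (dd e' (v 2)) q = -∑ j, (dd e (v j) q * y j e' + dd e' (v j) q * y j e) := by
  have d0 : ∀ j, ∀ q ∈ O, DifferentiableAt ℝ (v j) q := fun j q hq => smooth_differentiableAt hO (hv j) hq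
  have d1 : ∀ e j, ∀ q ∈ O, DifferentiableAt ℝ (dd e (v j)) q := fun e j q hq =>
    smooth_differentiableAt hO (smooth_dd hO (hv j) e) hq
  have dy : ∀ j q, DifferentiableAt ℝ (fun q => y j q) q := fun j q => (y j).differentiableAt
  have first : ∀ e, ∀ q ∈ O, ∑ j, (dd e (v j) q * y j q + v j q * y j e) = 0 := by
    intro e q hq
    have h1 := dd_congr hO h hq e
    have hds : ∀ j ∈ Finset.univ, DifferentiableAt ℝ (fun q => v j q * y j q) q :=
      fun j _ => (d0 j q hq).mul (dy j q)
    rw [dd_const, dd_sum hds] at h1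
    rw [← h1]
    refine Finset.sum_congr rfl fun j _ => ?_
    rw [dd_mul (d0 j q hq) (dy j q), dd_clm]
  have second : ∀ e e', ∑ j, (dd e (dd e' (v j)) q * y j q + dd e' (v j) q * y j e +
      dd e (v j) q * y j e') = 0 := by
    intro e e'
    have h1 := dd_congr hO (first e') hq e
    have hds : ∀ j ∈ Finset.univ,
        DifferentiableAt ℝ (fun q => dd e' (v j) q * y j q + v j q * y j e') q :=
      fun j _ => ((d1 e' j q hq).mul (dy j q)).add ((d0 j q hq).mul_const _)
    rw [dd_const, dd_sum hds] at h1
    rw [← h1]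
    refine Finset.sum_congr rfl fun j _ => ?_
    rw [dd_add (f := fun q => dd e' (v j) q * y j q) ((d1 e' j q hq).mul (dy j q))
      ((d0 j q hq).mul_const _), dd_mul (d1 e' j q hq) (dy j q),
      dd_clm, dd_mul (d0 j q hq) (differentiableAt_const _), dd_const]
    ring
  have h0 := h q hq
  have h1 := fun e => first e q hq
  simp only [hy, Fin.sum_univ_three, PiLp.single_apply] at h0 h1 second ⊢
  simp at h0 h1 second
  refine ⟨h0, fun e => ?_, fun e e' => ?_⟩
  · linarith [h1 e]
  · linarith [second e e']

/-- The Cartesian coordinates of the last factor of `X`. -/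
def yX (j : Fin 3) : X →L[ℝ] ℝ :=
  (EuclideanSpace.proj j : E →L[ℝ] ℝ).comp ((ContinuousLinearMap.snd ℝ ℝ E).comp
    (ContinuousLinearMap.snd ℝ ℝ (ℝ × E)))

@[simp] lemma yX_apply (j : Fin 3) (q : X) : yX j q = q.2.2 j := rfl

/-- The Cartesian coordinates of the last factor of `ℝ × E`. -/
def yS (j : Fin 3) : ℝ × E →L[ℝ] ℝ :=
  (EuclideanSpace.proj j : E →L[ℝ] ℝ).comp (ContinuousLinearMap.snd ℝ ℝ E)

@[simp] lemma yS_apply (j : Fin 3) (p : ℝ × E) : yS j p = p.2 j := rfl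

/-- The part `ρ > 0` of the domain. -/
def domp (I : Set ℝ) (ρ₀ : ℝ) : Set X := dom I ρ₀ ∩ {q | 0 < q.2.1}

lemma isOpen_domp {I : Set ℝ} (hI : IsOpen I) (ρ₀ : ℝ) : IsOpen (domp I ρ₀) :=
  (isOpen_dom hI ρ₀).inter (isOpen_lt continuous_const continuous_snd.fst)

/-- There is a rotation or reflection that takes the pole to a given point of the sphere. -/
lemma exists_isometry {x : E} (hx : x ∈ S2) : ∃ Q : E ≃ₗᵢ[ℝ] E, Q e3 = x :=
  ⟨(ℝ ∙ (e3 - x))ᗮ.reflection, Submodule.reflection_sub (by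
    rw [norm_of_mem_S2 hx, norm_of_mem_S2 e3_mem])⟩

section Coefficients

variable {I : Set ℝ} {ρ₀ : ℝ} {f g : X → ℝ}

lemma sc_mul (p : ℝ × E) : sc (fun q => f q * g q) p = sc f p * sc g p := rfl

lemma dd_er_mul (hI : IsOpen I) (hf : ContDiffOn ℝ ∞ f (dom I ρ₀))
    (hg : ContDiffOn ℝ ∞ g (dom I ρ₀)) {q : X} (hq : q ∈ dom I ρ₀) :
    dd er (fun q => f q * g q) q = dd er f q * g q + f q * dd er g q :=
  dd_mul (smooth_differentiableAt (isOpen_dom hI ρ₀) hf hq)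
    (smooth_differentiableAt (isOpen_dom hI ρ₀) hg hq)

lemma c1_mul (hI : IsOpen I) (hρ₀ : 0 < ρ₀) (hf : ContDiffOn ℝ ∞ f (dom I ρ₀))
    (hg : ContDiffOn ℝ ∞ g (dom I ρ₀)) {p : ℝ × E} (hp : p ∈ sdom I) :
    c1 (fun q => f q * g q) p = c1 f p * sc g p + sc f p * c1 g p :=
  dd_er_mul hI hf hg (zero_mem_dom hρ₀ hp)

lemma c2_mul (hI : IsOpen I) (hρ₀ : 0 < ρ₀) (hf : ContDiffOn ℝ ∞ f (dom I ρ₀))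
    (hg : ContDiffOn ℝ ∞ g (dom I ρ₀)) {p : ℝ × E} (hp : p ∈ sdom I) :
    c2 (fun q => f q * g q) p = c2 f p * sc g p + c1 f p * c1 g p + sc f p * c2 g p := by
  have hd := isOpen_dom hI ρ₀
  have hq := zero_mem_dom hρ₀ hp
  have hf1 := smooth_dd hd hf er
  have hg1 := smooth_dd hd hg er
  simp only [c2, c1, sc]
  rw [dd_congr hd (fun q hq => dd_er_mul hI hf hg hq) hq,
    dd_add (smooth_differentiableAt hd (hf1.mul hg) hq) (smooth_differentiableAt hd (hf.mul hg1) hq),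
    dd_er_mul hI hf1 hg hq, dd_er_mul hI hf hg1 hq]
  ring

lemma c1_sub (hI : IsOpen I) (hρ₀ : 0 < ρ₀) (hf : ContDiffOn ℝ ∞ f (dom I ρ₀))
    (hg : ContDiffOn ℝ ∞ g (dom I ρ₀)) {p : ℝ × E} (hp : p ∈ sdom I) :
    c1 (fun q => f q - g q) p = c1 f p - c1 g p :=
  dd_sub (smooth_differentiableAt (isOpen_dom hI ρ₀) hf (zero_mem_dom hρ₀ hp))
    (smooth_differentiableAt (isOpen_dom hI ρ₀) hg (zero_mem_dom hρ₀ hp))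

lemma c2_sub (hI : IsOpen I) (hρ₀ : 0 < ρ₀) (hf : ContDiffOn ℝ ∞ f (dom I ρ₀))
    (hg : ContDiffOn ℝ ∞ g (dom I ρ₀)) {p : ℝ × E} (hp : p ∈ sdom I) :
    c2 (fun q => f q - g q) p = c2 f p - c2 g p := by
  have hd := isOpen_dom hI ρ₀
  have hq := zero_mem_dom hρ₀ hp
  have hf1 := smooth_dd hd hf er
  have hg1 := smooth_dd hd hg er
  simp only [c2, sc]
  rw [dd_congr hd (fun q hq => dd_sub (smooth_differentiableAt hd hf hq)
    (smooth_differentiableAt hd hg hq)) hq,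
    dd_sub (smooth_differentiableAt hd hf1 hq) (smooth_differentiableAt hd hg1 hq)]
  ring

lemma c1_sum {ι : Type*} {s : Finset ι} {f : ι → X → ℝ} (hI : IsOpen I) (hρ₀ : 0 < ρ₀)
    (hf : ∀ i ∈ s, ContDiffOn ℝ ∞ (f i) (dom I ρ₀)) {p : ℝ × E} (hp : p ∈ sdom I) :
    c1 (fun q => ∑ i ∈ s, f i q) p = ∑ i ∈ s, c1 (f i) p :=
  dd_sum fun i hi => smooth_differentiableAt (isOpen_dom hI ρ₀) (hf i hi) (zero_mem_dom hρ₀ hp)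

lemma c2_sum {ι : Type*} {s : Finset ι} {f : ι → X → ℝ} (hI : IsOpen I) (hρ₀ : 0 < ρ₀)
    (hf : ∀ i ∈ s, ContDiffOn ℝ ∞ (f i) (dom I ρ₀)) {p : ℝ × E} (hp : p ∈ sdom I) :
    c2 (fun q => ∑ i ∈ s, f i q) p = ∑ i ∈ s, c2 (f i) p := by
  have hd := isOpen_dom hI ρ₀
  have hq := zero_mem_dom hρ₀ hp
  simp only [c2, sc]
  rw [dd_congr hd (fun q hq => dd_sum fun i hi => smooth_differentiableAt hd (hf i hi) hq) hq,
    dd_sum fun i hi => smooth_differentiableAt hd (smooth_dd hd (hf i hi) er) hq, Finset.mul_sum]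

/-- Taylor coefficients in `ρ` of a linear relation with coefficients depending on `x` only. -/
lemma coeff_tan (hI : IsOpen I) (hρ₀ : 0 < ρ₀) {v : Fin 3 → X → ℝ}
    (hv : ∀ j, ContDiffOn ℝ ∞ (v j) (dom I ρ₀))
    (h : ∀ q ∈ dom I ρ₀, 0 < q.2.1 → ∑ j, v j q * q.2.2 j = 0) {p : ℝ × E} (hp : p ∈ sdom I) :
    ∑ j, sc (v j) p * p.2 j = 0 ∧ ∑ j, c1 (v j) p * p.2 j = 0 ∧ ∑ j, c2 (v j) p * p.2 j = 0 := by
  have hd := isOpen_dom hI ρ₀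
  have hy : ∀ j, ContDiffOn ℝ ∞ (fun q : X => q.2.2 j) (dom I ρ₀) := fun j =>
    (yX j).contDiff.contDiffOn
  have z := fun j => dd_clm (v := er) (q := ((p.1, 0, p.2) : X)) (yX j)
  have z1 : ∀ j, c1 (fun q : X => q.2.2 j) p = 0 := fun j => (z j).trans (by simp [er])
  have z2 : ∀ j, c2 (fun q : X => q.2.2 j) p = 0 := by
    intro j
    have e : dd er (fun q : X => q.2.2 j) = fun _ => 0 := by
      ext q; exact (dd_clm (yX j)).trans (by simp [er])
    simp only [c2, sc, e, dd_const, mul_zero]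
  have hm : ∀ j ∈ Finset.univ, ContDiffOn ℝ ∞ (fun q : X => v j q * q.2.2 j) (dom I ρ₀) :=
    fun j _ => (hv j).mul (hy j)
  have hsm' := ContDiffOn.sum hm
  have h1 := dd_eq_zero hI h er
  have h2 := dd_eq_zero hI h1 er
  have k0 := sc_eq_zero hI hρ₀ hsm' h hp
  have k1 := sc_eq_zero hI hρ₀ (smooth_dd hd hsm' er) h1 hp
  have k2 := sc_eq_zero hI hρ₀ (smooth_dd hd (smooth_dd hd hsm' er) er) h2 hp
  refine ⟨k0, ?_, ?_⟩
  · change c1 (fun q : X => ∑ j, v j q * q.2.2 j) p = 0 at k1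
    rw [c1_sum hI hρ₀ hm hp] at k1
    rw [← k1]
    refine Finset.sum_congr rfl fun j _ => ?_
    rw [c1_mul hI hρ₀ (hv j) (hy j) hp, z1, mul_zero, add_zero]; rfl
  · have k2' : c2 (fun q : X => ∑ j, v j q * q.2.2 j) p = 0 := by
      change 1 / 2 * _ = _; rw [k2, mul_zero]
    rw [c2_sum hI hρ₀ hm hp] at k2'
    rw [← k2']
    refine Finset.sum_congr rfl fun j _ => ?_
    rw [c2_mul hI hρ₀ (hv j) (hy j) hp, z1, z2, mul_zero, mul_zero, add_zero, add_zero]; rfl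

end Coefficients

namespace BondiSachsMetric

variable {I : Set ℝ} {ρ₀ : ℝ} {g : BondiSachsMetric I ρ₀} {w : Fin 3 → X → ℝ}

lemma unit_apply_mul_norm {y : E} (hy : y ≠ 0) (j : Fin 3) : y j = ‖y‖ * unit y j := by
  conv_lhs => rw [← norm_smul_unit hy]
  simp

variable (g) in
lemma hh_tan {q : X} (hq : q ∈ domp I ρ₀) (i : Fin 3) : ∑ j, g.hh i j q * q.2.2 j = 0 := by
  have h := g.h_tangent _ hq.1.1 _ ⟨hq.2, hq.1.2.1.2⟩ _ (unit_mem hq.1.2.2) i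
  have : ∀ j, g.hh i j q * q.2.2 j = ‖q.2.2‖ * (g.h q.1 q.2.1 (unit q.2.2) i j * unit q.2.2 j) := by
    intro j
    conv_lhs => rw [unit_apply_mul_norm hq.1.2.2 j]
    simp only [hh]; ring
  rw [Finset.sum_congr rfl fun j _ => this j, ← Finset.mul_sum, h, mul_zero]

variable (g) in
lemma hh_symm {q : X} (hq : q ∈ domp I ρ₀) (i j : Fin 3) : g.hh i j q = g.hh j i q :=
  g.h_symm _ hq.1.1 _ ⟨hq.2, hq.1.2.1.2⟩ _ (unit_mem hq.1.2.2) i j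

lemma IsShift.tan (hw : g.IsShift w) {q : X} (hq : q ∈ domp I ρ₀) : ∑ j, w j q * q.2.2 j = 0 := by
  have h := g.W_tangent _ hq.1.1 _ ⟨hq.2, hq.1.2.1.2⟩ _ (unit_mem hq.1.2.2)
  have hρ : q.2.1 ≠ 0 := ne_of_gt hq.2
  have : ∀ j, w j q * q.2.2 j = ‖q.2.2‖ * q.2.1⁻¹ * (g.W q.1 q.2.1 (unit q.2.2) j * unit q.2.2 j) := by
    intro j
    have h2 : g.W q.1 q.2.1 (unit q.2.2) j = q.2.1 * w j q := hw.eq j q hq.1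
    rw [h2]
    conv_lhs => rw [unit_apply_mul_norm hq.1.2.2 j]
    field_simp
  rw [Finset.sum_congr rfl fun j _ => this j, ← Finset.mul_sum, h, mul_zero]

lemma sum_isometry (Q : E ≃ₗᵢ[ℝ] E) (a b : Fin 3) :
    ∑ i, Q (bv a) i * Q (bv b) i = if a = b then 1 else 0 := by
  have h : inner ℝ (Q (bv a)) (Q (bv b)) = inner ℝ (bv a) (bv b) := Q.inner_map_map _ _
  simp only [PiLp.inner_apply, RCLike.inner_apply, conj_trivial] at h
  rw [show ∑ i, Q (bv a) i * Q (bv b) i = ∑ i, Q (bv b) i * Q (bv a) i from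
    Finset.sum_congr rfl fun i _ => mul_comm _ _, h]
  simp [eq_comm]

/-- The determinant condition in ambient form: `(tr h)² - tr h² = 2`. -/
lemma trace_identity (g : BondiSachsMetric I ρ₀) {q : X} (hq : q ∈ domp I ρ₀) :
    (∑ i, g.hh i i q) * (∑ i, g.hh i i q) - ∑ i, ∑ j, g.hh i j q * g.hh i j q - 2 = 0 := by
  obtain ⟨Q, hQ⟩ := exists_isometry (unit_mem hq.1.2.2)
  set M : Matrix (Fin 3) (Fin 3) ℝ := Matrix.of fun i a => Q (bv a) i with hM
  have hMM : M.transpose * M = 1 := by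
    ext a b
    simp only [Matrix.mul_apply, Matrix.transpose_apply, hM, Matrix.of_apply, sum_isometry,
      Matrix.one_apply]
  have hMM' : M * M.transpose = 1 := mul_eq_one_comm.1 hMM
  set h : Matrix (Fin 3) (Fin 3) ℝ := Matrix.of fun i j => g.hh i j q with hh'
  set A := M.transpose * h * M with hA
  have hAe : ∀ a b, A a b = ∑ i, ∑ j, g.hh i j q * Q (bv a) i * Q (bv b) j := by
    intro a b
    simp only [hA, Matrix.mul_apply, Matrix.transpose_apply, hM, hh', Matrix.of_apply, Finset.sum_mul]
    rw [Finset.sum_comm]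
    exact Finset.sum_congr rfl fun i _ => Finset.sum_congr rfl fun j _ => by ring
  have hA2 : ∀ a, A a 2 = 0 := by
    intro a
    rw [hAe]
    refine Finset.sum_eq_zero fun i _ => ?_
    have h2 := g.h_tangent _ hq.1.1 _ ⟨hq.2, hq.1.2.1.2⟩ _ (unit_mem hq.1.2.2) i
    have h3 : ∀ j, g.hh i j q * Q (bv a) i * Q (bv 2) j =
        Q (bv a) i * (g.h q.1 q.2.1 (unit q.2.2) i j * unit q.2.2 j) := fun j => by
      rw [hQ]; simp only [hh]; ring
    rw [Finset.sum_congr rfl fun j _ => h3 j, ← Finset.mul_sum, h2, mul_zero]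
  have hAs : ∀ a b, A a b = A b a := by
    intro a b
    rw [hAe, hAe, Finset.sum_comm]
    exact Finset.sum_congr rfl fun i _ => Finset.sum_congr rfl fun j _ => by
      rw [g.hh_symm hq]; ring
  have hdet := g.h_det _ hq.1.1 _ ⟨hq.2, hq.1.2.1.2⟩ _ (unit_mem hq.1.2.2) (Q (bv 0)) (Q (bv 1)) (by
    rw [← hQ]
    have h0 : Orthonormal ℝ ![e3, bv 0, bv 1] := by
      rw [orthonormal_iff_ite]
      intro i j
      fin_cases i <;> fin_cases j <;> simp [PiLp.inner_apply]
    have := h0.comp_linearIsometryEquiv Q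
    convert this using 1
    ext i; fin_cases i <;> rfl)
  have d1 : A 0 0 * A 1 1 - A 0 1 ^ 2 = 1 := by rw [hAe, hAe, hAe]; exact hdet
  have t1 : A.trace = h.trace := by
    rw [hA, Matrix.trace_mul_comm, ← Matrix.mul_assoc, hMM', Matrix.one_mul]
  have t2 : (A * A).trace = (h * h).trace := by
    have : A * A = M.transpose * (h * h) * M := by
      rw [hA]
      calc _ = M.transpose * h * (M * M.transpose) * h * M := by simp only [Matrix.mul_assoc]
        _ = _ := by rw [hMM', Matrix.mul_one]; simp only [Matrix.mul_assoc]
    rw [this, Matrix.trace_mul_comm, ← Matrix.mul_assoc, hMM', Matrix.one_mul]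
  have t3 : (h * h).trace = ∑ i, ∑ j, g.hh i j q * g.hh i j q := by
    simp only [Matrix.trace, Matrix.diag, Matrix.mul_apply, hh', Matrix.of_apply]
    exact Finset.sum_congr rfl fun i _ => Finset.sum_congr rfl fun j _ => by rw [g.hh_symm hq j i]
  have t4 : h.trace = ∑ i, g.hh i i q := rfl
  rw [← t3, ← t4, ← t1, ← t2]
  simp only [Matrix.trace, Matrix.diag, Matrix.mul_apply, Fin.sum_univ_three, hA2, hAs 2, hAs 1 0]
  linear_combination 2 * d1

lemma sc_hh {p : ℝ × E} (hp : p ∈ sdom I) (i j : Fin 3) :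
    sc (g.hh i j) p = proj (unit p.2) i j := by
  simp [sc, hh, g.h_zero _ hp.1 _ (unit_mem hp.2)]

lemma sc_Uh {p : ℝ × E} (hp : p ∈ sdom I) : sc g.Uh p = 1 := g.U_zero _ hp.1 _ (unit_mem hp.2)

lemma sc_Vh {p : ℝ × E} (hp : p ∈ sdom I) : sc g.Vh p = 1 := g.V_zero _ hp.1 _ (unit_mem hp.2)

lemma c1_eq_deriv (hI : IsOpen I) (hρ₀ : 0 < ρ₀) {f : X → ℝ} (hf : ContDiffOn ℝ ∞ f (dom I ρ₀))
    {p : ℝ × E} (hp : p ∈ sdom I) : c1 f p = deriv (fun ρ => f (p.1, ρ, p.2)) 0 :=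
  (hasDerivAt_line hI hf (zero_mem_dom hρ₀ hp)).deriv.symm

lemma c1_Uh (hI : IsOpen I) (hρ₀ : 0 < ρ₀) {p : ℝ × E} (hp : p ∈ sdom I) : c1 g.Uh p = 0 := by
  rw [c1_eq_deriv hI hρ₀ g.smooth_Uh hp]; exact g.U_one _ hp.1 _ (unit_mem hp.2)

lemma smooth_rho : ContDiffOn ℝ ∞ (fun q : X => q.2.1) (dom I ρ₀) := by fun_prop

lemma dd_er_rho (q : X) : dd er (fun q : X => q.2.1) q = 1 :=
  (dd_clm ((ContinuousLinearMap.fst ℝ ℝ E).comp (ContinuousLinearMap.snd ℝ ℝ (ℝ × E)))).trans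
    (by simp [er])

lemma c1_rho (p : ℝ × E) : c1 (fun q : X => q.2.1) p = 1 := dd_er_rho _

lemma IsShift.c1_Wh (hI : IsOpen I) (hρ₀ : 0 < ρ₀) (hw : g.IsShift w) {p : ℝ × E} (hp : p ∈ sdom I)
    (i : Fin 3) : c1 (g.Wh i) p = sc (w i) p := by
  have h : c1 (g.Wh i) p = c1 (fun q => q.2.1 * w i q) p :=
    dd_congr (isOpen_dom hI ρ₀) (hw.eq i) (zero_mem_dom hρ₀ hp) _
  rw [h, c1_mul hI hρ₀ smooth_rho (hw.smooth i) hp, c1_rho]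
  simp [sc]

lemma IsShift.sc_eq (hI : IsOpen I) (hρ₀ : 0 < ρ₀) (hw : g.IsShift w) {p : ℝ × E} (hp : p ∈ sdom I)
    (i : Fin 3) : sc (w i) p = 0 := by
  rw [← hw.c1_Wh hI hρ₀ hp, c1_eq_deriv hI hρ₀ (g.smooth_Wh i) hp]
  exact g.W_one _ hp.1 _ (unit_mem hp.2) i

/-- Tangency of the Taylor coefficients of `h`. -/
lemma coeff_hh_tan (hI : IsOpen I) (hρ₀ : 0 < ρ₀) {p : ℝ × E} (hp : p ∈ sdom I) (i : Fin 3) :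
    ∑ j, c1 (g.hh i j) p * p.2 j = 0 ∧ ∑ j, c2 (g.hh i j) p * p.2 j = 0 :=
  (coeff_tan hI hρ₀ (fun j => g.smooth_hh i j) (fun _ hq hq' => g.hh_tan ⟨hq, hq'⟩ i) hp).2

lemma IsShift.coeff_tan (hI : IsOpen I) (hρ₀ : 0 < ρ₀) (hw : g.IsShift w) {p : ℝ × E}
    (hp : p ∈ sdom I) : ∑ j, c1 (w j) p * p.2 j = 0 ∧ ∑ j, c2 (w j) p * p.2 j = 0 :=
  (BondiSachs.coeff_tan hI hρ₀ hw.smooth (fun _ hq hq' => hw.tan ⟨hq, hq'⟩) hp).2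

lemma coeff_hh_symm (hI : IsOpen I) (hρ₀ : 0 < ρ₀) {p : ℝ × E} (hp : p ∈ sdom I) (i j : Fin 3) :
    c1 (g.hh i j) p = c1 (g.hh j i) p ∧ c2 (g.hh i j) p = c2 (g.hh j i) p := by
  have hd := isOpen_dom hI ρ₀
  have hs := (g.smooth_hh i j).sub (g.smooth_hh j i)
  have h0 : ∀ q ∈ dom I ρ₀, 0 < q.2.1 → g.hh i j q - g.hh j i q = 0 := fun q hq hq' =>
    sub_eq_zero.2 (g.hh_symm ⟨hq, hq'⟩ i j)
  have h1 := dd_eq_zero hI h0 er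
  have h2 := dd_eq_zero hI h1 er
  have k1 : c1 (fun q => g.hh i j q - g.hh j i q) p = 0 := sc_eq_zero hI hρ₀ (smooth_dd hd hs er) h1 hp
  have k2 : c2 (fun q => g.hh i j q - g.hh j i q) p = 0 := by
    have := sc_eq_zero hI hρ₀ (smooth_dd hd (smooth_dd hd hs er) er) h2 hp
    change 1 / 2 * _ = _; rw [this, mul_zero]
  rw [c1_sub hI hρ₀ (g.smooth_hh i j) (g.smooth_hh j i) hp] at k1
  rw [c2_sub hI hρ₀ (g.smooth_hh i j) (g.smooth_hh j i) hp] at k2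
  exact ⟨by linarith, by linarith⟩

/-- `C` is trace-free and the trace of the next coefficient of `h` is `|C|²/2`. -/
lemma coeff_hh_trace (hI : IsOpen I) (hρ₀ : 0 < ρ₀) {p : ℝ × E} (hp : p ∈ sdom I) :
    ∑ i, c1 (g.hh i i) p = 0 ∧
    ∑ i, c2 (g.hh i i) p = 1 / 2 * ∑ i, ∑ j, c1 (g.hh i j) p * c1 (g.hh i j) p := by
  have hd := isOpen_dom hI ρ₀
  have hT : ContDiffOn ℝ ∞ (fun q => ∑ i, g.hh i i q) (dom I ρ₀) :=
    ContDiffOn.sum fun i _ => g.smooth_hh i i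
  have hN1 : ∀ i, ContDiffOn ℝ ∞ (fun q => ∑ j, g.hh i j q * g.hh i j q) (dom I ρ₀) := fun i =>
    ContDiffOn.sum fun j _ => (g.smooth_hh i j).mul (g.smooth_hh i j)
  have hN : ContDiffOn ℝ ∞ (fun q => ∑ i, ∑ j, g.hh i j q * g.hh i j q) (dom I ρ₀) :=
    ContDiffOn.sum fun i _ => hN1 i
  have hP := (hT.mul hT).sub hN
  have hP2 := hP.sub (contDiffOn_const (c := (2 : ℝ)))
  have h0 : ∀ q ∈ dom I ρ₀, 0 < q.2.1 → _ := fun q hq hq' => g.trace_identity (q := q) ⟨hq, hq'⟩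
  have h1 := dd_eq_zero hI h0 er
  have h2 := dd_eq_zero hI h1 er
  have z1 : c1 (fun _ : X => (2 : ℝ)) p = 0 := by simp [c1, sc]
  have z2 : c2 (fun _ : X => (2 : ℝ)) p = 0 := by
    have : dd er (fun _ : X => (2 : ℝ)) = fun _ => 0 := by ext q; simp
    simp [c2, sc, this]
  have k1 := sc_eq_zero hI hρ₀ (smooth_dd hd hP2 er) h1 hp
  have k2 := sc_eq_zero hI hρ₀ (smooth_dd hd (smooth_dd hd hP2 er) er) h2 hp
  have k1' : c1 (fun q => (∑ i, g.hh i i q) * (∑ i, g.hh i i q)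
    - ∑ i, ∑ j, g.hh i j q * g.hh i j q - 2) p = 0 := k1
  have k2' : c2 (fun q => (∑ i, g.hh i i q) * (∑ i, g.hh i i q)
      - ∑ i, ∑ j, g.hh i j q * g.hh i j q - 2) p = 0 := by
    change 1 / 2 * _ = _; rw [k2, mul_zero]
  have hij : ∀ i, ∀ j ∈ Finset.univ, ContDiffOn ℝ ∞ (fun q => g.hh i j q * g.hh i j q) (dom I ρ₀) :=
    fun i j _ => (g.smooth_hh i j).mul (g.smooth_hh i j)
  rw [c1_sub hI hρ₀ hP contDiffOn_const hp, c1_sub hI hρ₀ (hT.mul hT) hN hp, c1_mul hI hρ₀ hT hT hp,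
    c1_sum hI hρ₀ (fun i _ => g.smooth_hh i i) hp, c1_sum hI hρ₀ (fun i _ => hN1 i) hp] at k1'
  rw [c2_sub hI hρ₀ hP contDiffOn_const hp, c2_sub hI hρ₀ (hT.mul hT) hN hp, c2_mul hI hρ₀ hT hT hp,
    c1_sum hI hρ₀ (fun i _ => g.smooth_hh i i) hp, c2_sum hI hρ₀ (fun i _ => g.smooth_hh i i) hp,
    c2_sum hI hρ₀ (fun i _ => hN1 i) hp] at k2'
  have e1 : ∀ i, c1 (fun q => ∑ j, g.hh i j q * g.hh i j q) p =
      ∑ j, 2 * (proj (unit p.2) i j * c1 (g.hh i j) p) := fun i => by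
    rw [c1_sum hI hρ₀ (hij i) hp]
    exact Finset.sum_congr rfl fun j _ => by
      rw [c1_mul hI hρ₀ (g.smooth_hh i j) (g.smooth_hh i j) hp, sc_hh hp]; ring
  have e2 : ∀ i, c2 (fun q => ∑ j, g.hh i j q * g.hh i j q) p =
      ∑ j, (2 * (proj (unit p.2) i j * c2 (g.hh i j) p) + c1 (g.hh i j) p * c1 (g.hh i j) p) := fun i => by
    rw [c2_sum hI hρ₀ (hij i) hp]
    exact Finset.sum_congr rfl fun j _ => by
      rw [c2_mul hI hρ₀ (g.smooth_hh i j) (g.smooth_hh i j) hp, sc_hh hp]; ring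
  have hsT : sc (fun q => ∑ i, g.hh i i q) p = 2 := by
    have : sc (fun q => ∑ i, g.hh i i q) p = ∑ i, proj (unit p.2) i i :=
      Finset.sum_congr rfl fun i _ => sc_hh hp i i
    rw [this]
    have := sum_sq_of_mem (unit_mem hp.2)
    simp only [proj, Fin.sum_univ_three, if_true]
    linear_combination -this
  have t1 : ∀ i, ∑ j, c1 (g.hh i j) p * unit p.2 j = 0 := fun i => by
    have := (coeff_hh_tan (g := g) hI hρ₀ hp i).1
    have e : ∀ j, c1 (g.hh i j) p * unit p.2 j = ‖p.2‖⁻¹ * (c1 (g.hh i j) p * p.2 j) := fun j => by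
      simp [unit]; ring
    rw [Finset.sum_congr rfl fun j _ => e j, ← Finset.mul_sum, this, mul_zero]
  have t2 : ∀ i, ∑ j, c2 (g.hh i j) p * unit p.2 j = 0 := fun i => by
    have := (coeff_hh_tan (g := g) hI hρ₀ hp i).2
    have e : ∀ j, c2 (g.hh i j) p * unit p.2 j = ‖p.2‖⁻¹ * (c2 (g.hh i j) p * p.2 j) := fun j => by
      simp [unit]; ring
    rw [Finset.sum_congr rfl fun j _ => e j, ← Finset.mul_sum, this, mul_zero]
  have p1 : ∀ i, ∑ j, proj (unit p.2) i j * c1 (g.hh i j) p = c1 (g.hh i i) p := fun i => by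
    have e : ∀ j, proj (unit p.2) i j * c1 (g.hh i j) p = (if i = j then c1 (g.hh i j) p else 0) -
      unit p.2 i * (c1 (g.hh i j) p * unit p.2 j) := fun j => by simp [proj]; split_ifs <;> ring
    rw [Finset.sum_congr rfl fun j _ => e j, Finset.sum_sub_distrib, ← Finset.mul_sum, t1]
    simp
  have p2 : ∀ i, ∑ j, proj (unit p.2) i j * c2 (g.hh i j) p = c2 (g.hh i i) p := fun i => by
    have e : ∀ j, proj (unit p.2) i j * c2 (g.hh i j) p = (if i = j then c2 (g.hh i j) p else 0) -
      unit p.2 i * (c2 (g.hh i j) p * unit p.2 j) := fun j => by simp [proj]; split_ifs <;> ring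
    rw [Finset.sum_congr rfl fun j _ => e j, Finset.sum_sub_distrib, ← Finset.mul_sum, t2]
    simp
  simp only [e1, e2, hsT, z1, z2, ← Finset.mul_sum, Finset.sum_add_distrib, p1, p2] at k1' k2'
  have r1 : ∑ i, c1 (g.hh i i) p = 0 := by linarith
  refine ⟨r1, ?_⟩
  rw [r1] at k2'
  linarith

/-- Taylor coefficients of `G_{0i}`. The normal part at leading order comes from the term `du dr`. -/
lemma IsShift.coeff_Bh (hI : IsOpen I) (hρ₀ : 0 < ρ₀) (hw : g.IsShift w) {p : ℝ × E}
    (hp : p ∈ sdom I) (i : Fin 3) :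
    sc (g.Bh w i) p = -unit p.2 i ∧ c1 (g.Bh w i) p = c1 (w i) p ∧
    c2 (g.Bh w i) p = c2 (w i) p + ∑ k, c1 (g.hh i k) p * c1 (w k) p - c2 g.Uh p * unit p.2 i := by
  have hd := isOpen_dom hI ρ₀
  have hw0 := fun k => hw.sc_eq hI hρ₀ hp k
  have hx : sc (xh i) p = unit p.2 i := rfl
  have hxr : ∀ q ∈ dom I ρ₀, dd er (xh i) q = 0 := by
    rintro ⟨u, ρ, y⟩ hq
    exact (hasDerivAt_line hI (smooth_xh i) hq).unique (hasDerivAt_const ρ (unit y i))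
  have hx1 : c1 (xh i) p = 0 := hxr _ (zero_mem_dom hρ₀ hp)
  have hx2 : c2 (xh i) p = 0 := by
    simp only [c2, sc]
    rw [dd_congr (g := fun _ => 0) hd hxr (zero_mem_dom hρ₀ hp), dd_const, mul_zero]
  have hs : ∀ k ∈ Finset.univ, ContDiffOn ℝ ∞ (fun q => g.hh i k q * w k q) (dom I ρ₀) :=
    fun k _ => (g.smooth_hh i k).mul (hw.smooth k)
  have hpr : ∀ c : Fin 3 → ℝ, ∑ j, c j * p.2 j = 0 → ∑ k, proj (unit p.2) i k * c k = c i := by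
    intro c hc
    have e : ∀ k, proj (unit p.2) i k * c k = (if i = k then c k else 0) -
        unit p.2 i * ‖p.2‖⁻¹ * (c k * p.2 k) := fun k => by
      simp only [proj]; conv_lhs => rw [show unit p.2 k = ‖p.2‖⁻¹ * p.2 k by simp [unit]]
      split_ifs <;> ring
    rw [Finset.sum_congr rfl fun k _ => e k, Finset.sum_sub_distrib, ← Finset.mul_sum, hc]
    simp
  obtain ⟨q1, q2⟩ := hw.coeff_tan hI hρ₀ hp
  refine ⟨?_, ?_, ?_⟩
  · have : sc (g.Bh w i) p = ∑ k, sc (g.hh i k) p * sc (w k) p - sc g.Uh p * sc (xh i) p := rfl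
    rw [this]; simp [hw0, sc_Uh hp, hx]
  · have : c1 (g.Bh w i) p = c1 (fun q => ∑ k, g.hh i k q * w k q - g.Uh q * xh i q) p := rfl
    rw [this, c1_sub hI hρ₀ (ContDiffOn.sum hs) (g.smooth_Uh.mul (smooth_xh i)) hp,
      c1_sum hI hρ₀ hs hp, c1_mul hI hρ₀ g.smooth_Uh (smooth_xh i) hp, c1_Uh hI hρ₀ hp, hx1]
    simp only [c1_mul hI hρ₀ (g.smooth_hh _ _) (hw.smooth _) hp, hw0, sc_hh hp, mul_zero, zero_add,
      zero_mul, sub_zero]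
    exact hpr _ q1
  · have : c2 (g.Bh w i) p = c2 (fun q => ∑ k, g.hh i k q * w k q - g.Uh q * xh i q) p := rfl
    rw [this, c2_sub hI hρ₀ (ContDiffOn.sum hs) (g.smooth_Uh.mul (smooth_xh i)) hp,
      c2_sum hI hρ₀ hs hp, c2_mul hI hρ₀ g.smooth_Uh (smooth_xh i) hp, c1_Uh hI hρ₀ hp, hx1, hx2, hx]
    simp only [c2_mul hI hρ₀ (g.smooth_hh _ _) (hw.smooth _) hp, hw0, sc_hh hp, mul_zero, zero_add,
      add_zero, Finset.sum_add_distrib]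
    rw [hpr _ q2]; ring

/-- Taylor coefficients of `G_00`; the coefficient of order one is twice the mass aspect. -/
lemma IsShift.coeff_Sh (hI : IsOpen I) (hρ₀ : 0 < ρ₀) (hw : g.IsShift w) {p : ℝ × E}
    (hp : p ∈ sdom I) : sc (g.Sh w) p = -1 ∧ c1 (g.Sh w) p = -c1 g.Vh p := by
  have hw0 := fun k => hw.sc_eq hI hρ₀ hp k
  have hww : ∀ k l, ContDiffOn ℝ ∞ (fun q => w k q * w l q) (dom I ρ₀) := fun k l =>
    (hw.smooth k).mul (hw.smooth l)
  have hs : ∀ k, ∀ l ∈ Finset.univ, ContDiffOn ℝ ∞ (fun q => g.hh k l q * (w k q * w l q)) (dom I ρ₀) :=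
    fun k l _ => (g.smooth_hh k l).mul (hww k l)
  have hs' : ∀ k ∈ Finset.univ, ContDiffOn ℝ ∞ (fun q => ∑ l, g.hh k l q * (w k q * w l q)) (dom I ρ₀) :=
    fun k _ => ContDiffOn.sum (hs k)
  constructor
  · have : sc (g.Sh w) p = ∑ k, ∑ l, sc (g.hh k l) p * (sc (w k) p * sc (w l) p)
      - sc g.Uh p * sc g.Vh p := rfl
    rw [this]; simp [hw0, sc_Uh hp, sc_Vh hp]
  · have : c1 (g.Sh w) p = c1 (fun q => ∑ k, ∑ l, g.hh k l q * (w k q * w l q) - g.Uh q * g.Vh q) p := rfl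
    rw [this, c1_sub hI hρ₀ (ContDiffOn.sum hs') (g.smooth_Uh.mul g.smooth_Vh) hp,
      c1_sum hI hρ₀ hs' hp, c1_mul hI hρ₀ g.smooth_Uh g.smooth_Vh hp, c1_Uh hI hρ₀ hp, sc_Uh hp]
    have e : ∀ k, c1 (fun q => ∑ l, g.hh k l q * (w k q * w l q)) p = 0 := by
      intro k
      rw [c1_sum hI hρ₀ (hs k) hp]
      refine Finset.sum_eq_zero fun l _ => ?_
      rw [c1_mul hI hρ₀ (g.smooth_hh k l) (hww k l) hp, c1_mul hI hρ₀ (hw.smooth k) (hw.smooth l) hp,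
        sc_mul, hw0, hw0]
      ring
    simp [e]

end BondiSachsMetric

/-! ### The metric and its derivatives at the pole -/

/-- Full contraction of two 2-tensors. -/
def con (H X : Fin 4 → Fin 4 → ℝ) : ℝ := ∑ k, ∑ l, H k l * X k l

/-- The quadratic part of the Ricci tensor with one of the two Christoffel symbols, contracted with a
fixed vector, given separately as `Θ`. -/
def conQuad (H : Fin 4 → Fin 4 → ℝ) (Γ : Fin 4 → Fin 4 → Fin 4 → ℝ) (Θ : Fin 4 → Fin 4 → ℝ)
    (j : Fin 4) : ℝ :=
  con H fun k l => con H fun b c => Γ b j l * Θ c k - Γ b k l * Θ c j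

lemma ricQuad_eq (H : Fin 4 → Fin 4 → ℝ) (Γ : Fin 4 → Fin 4 → Fin 4 → ℝ) (i j : Fin 4) :
    ricQuad H Γ i j = conQuad H Γ (fun c k => Γ c i k) j := by
  simp only [ricQuad, conQuad, con, Finset.mul_sum]
  refine Finset.sum_congr rfl fun k _ => Finset.sum_congr rfl fun l _ =>
    Finset.sum_congr rfl fun b _ => Finset.sum_congr rfl fun c _ => ?_
  ring

lemma ricLin_eq (H : Fin 4 → Fin 4 → ℝ) (g₂ : Fin 4 → Fin 4 → Fin 4 → Fin 4 → ℝ) (i j : Fin 4) :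
    ricLin H g₂ i j = 1 / 2 * con H fun k l => g₂ k i l j + g₂ l j i k - g₂ k l i j - g₂ i j k l := rfl

/-- The Leibniz rule for a contraction. -/
lemma Jet.con {H X : ℝ → Fin 4 → Fin 4 → ℝ} {H₀ H₁ X₀ X₁ : Fin 4 → Fin 4 → ℝ}
    (hH : ∀ k l, Jet (fun t => H t k l) (H₀ k l) (H₁ k l))
    (hX : ∀ k l, Jet (fun t => X t k l) (X₀ k l) (X₁ k l)) :
    Jet (fun t => con (H t) (X t)) (con H₀ X₀) (con H₁ X₀ + con H₀ X₁) := by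
  refine (Jet.sum (s := Finset.univ) fun k _ => Jet.sum (s := Finset.univ) fun l _ =>
    (hH k l).mul (hX k l)).eq rfl ?_
  simp only [BondiSachs.con, Finset.sum_add_distrib]

lemma Jet.conQuad {H : ℝ → Fin 4 → Fin 4 → ℝ} {H₀ H₁ : Fin 4 → Fin 4 → ℝ}
    {Γ : ℝ → Fin 4 → Fin 4 → Fin 4 → ℝ} {Γ₀ Γ₁ : Fin 4 → Fin 4 → Fin 4 → ℝ}
    {Θ : ℝ → Fin 4 → Fin 4 → ℝ} {Θ₀ Θ₁ : Fin 4 → Fin 4 → ℝ}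
    (hH : ∀ k l, Jet (fun t => H t k l) (H₀ k l) (H₁ k l))
    (hΓ : ∀ b k l, Jet (fun t => Γ t b k l) (Γ₀ b k l) (Γ₁ b k l))
    (hΘ : ∀ c k, Jet (fun t => Θ t c k) (Θ₀ c k) (Θ₁ c k)) (j : Fin 4) :
    Jet (fun t => conQuad (H t) (Γ t) (Θ t) j) (conQuad H₀ Γ₀ Θ₀ j)
      ((BondiSachs.con H₁ fun k l => BondiSachs.con H₀ fun b c => Γ₀ b j l * Θ₀ c k - Γ₀ b k l * Θ₀ c j) +
        (BondiSachs.con H₀ fun k l =>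
          (BondiSachs.con H₁ fun b c => Γ₀ b j l * Θ₀ c k - Γ₀ b k l * Θ₀ c j) +
          (BondiSachs.con H₀ fun b c => Γ₁ b j l * Θ₀ c k + Γ₀ b j l * Θ₁ c k
            - (Γ₁ b k l * Θ₀ c j + Γ₀ b k l * Θ₁ c j)))) :=
  Jet.con hH fun k l => Jet.con hH fun b c =>
    ((hΓ b j l).mul (hΘ c k)).sub ((hΓ b k l).mul (hΘ c j))

namespace BondiSachsMetric

variable {I : Set ℝ} {ρ₀ : ℝ} {g : BondiSachsMetric I ρ₀} {w : Fin 3 → X → ℝ}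

variable (g) in
/-- The components of `h`, with the symmetry of `h` built in. -/
def hs (i j : Fin 3) : X → ℝ := g.hh (min i j) (max i j)

variable (g) in
/-- The Cartesian components of the metric, with the symmetry of `h` built in. -/
def gs (w : Fin 3 → X → ℝ) (μ ν : Fin 4) : X → ℝ :=
  ![![g.Sh w, g.Bh w 0, g.Bh w 1, g.Bh w 2],
    ![g.Bh w 0, g.hs 0 0, g.hs 0 1, g.hs 0 2],
    ![g.Bh w 1, g.hs 0 1, g.hs 1 1, g.hs 1 2],
    ![g.Bh w 2, g.hs 0 2, g.hs 1 2, g.hs 2 2]] μ ν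

lemma gs_eq {q : X} (hq : q ∈ domp I ρ₀) (μ ν : Fin 4) : g.gtab w μ ν q = g.gs w μ ν q := by
  fin_cases μ <;> fin_cases ν <;> first | rfl | exact g.hh_symm hq _ _

lemma hs_eq {q : X} (hq : q ∈ domp I ρ₀) (i j : Fin 3) : g.hs i j q = g.hh i j q := by
  rcases le_total i j with h | h
  · simp [hs, h]
  · simp only [hs, h, min_eq_right, max_eq_left]; exact g.hh_symm hq _ _

lemma d1_congr (hI : IsOpen I) {f f' : X → ℝ} (h : ∀ q ∈ domp I ρ₀, f q = f' q) {q : X}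
    (hq : q ∈ domp I ρ₀) (k : Fin 4) : d1 f q k = d1 f' q k := by
  have e := fun v => dd_congr (isOpen_domp hI ρ₀) h hq v
  simp only [d1, e]

lemma d2_congr (hI : IsOpen I) {f f' : X → ℝ} (h : ∀ q ∈ domp I ρ₀, f q = f' q) {q : X}
    (hq : q ∈ domp I ρ₀) (k l : Fin 4) : d2 f q k l = d2 f' q k l := by
  have e := fun v => dd_congr (isOpen_domp hI ρ₀) h hq v
  have e2 := fun v v' => dd_congr (isOpen_domp hI ρ₀)
    (fun q hq => dd_congr (isOpen_domp hI ρ₀) h hq v) hq v'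
  simp only [d2, e, e2]

variable (g) in
/-- The inverse of the metric at the pole. -/
def invG (w : Fin 3 → X → ℝ) (q : X) : Fin 4 → Fin 4 → ℝ :=
  ![![0, 0, 0, -(g.Uh q)⁻¹],
    ![0, g.hs 1 1 q, -g.hs 0 1 q, w 0 q * (g.Uh q)⁻¹],
    ![0, -g.hs 0 1 q, g.hs 0 0 q, w 1 q * (g.Uh q)⁻¹],
    ![-(g.Uh q)⁻¹, w 0 q * (g.Uh q)⁻¹, w 1 q * (g.Uh q)⁻¹, g.Vh q * (g.Uh q)⁻¹]]

lemma pole_mem_domp {u t : ℝ} (hu : u ∈ I) (ht : t ∈ Ioo 0 ρ₀) : ((u, t, e3) : X) ∈ domp I ρ₀ :=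
  ⟨pole_mem_dom hu ⟨by linarith [ht.1, ht.2], ht.2⟩, ht.1⟩

lemma smooth_hs (i j : Fin 3) : ContDiffOn ℝ ∞ (g.hs i j) (dom I ρ₀) := g.smooth_hh _ _

/-- The components `h_{i3}` and their derivatives at the pole. -/
lemma hs_pole (hI : IsOpen I) {u t : ℝ} (hu : u ∈ I) (ht : t ∈ Ioo 0 ρ₀) (i : Fin 3) :
    g.hs i 2 (u, t, e3) = 0 ∧
    (∀ e : X, dd e (g.hs i 2) (u, t, e3) = -∑ j, g.hs i j (u, t, e3) * e.2.2 j) ∧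
    ∀ e e' : X, dd e (dd e' (g.hs i 2)) (u, t, e3) =
      -∑ j, (dd e (g.hs i j) (u, t, e3) * e'.2.2 j + dd e' (g.hs i j) (u, t, e3) * e.2.2 j) :=
  tan_pole (isOpen_domp hI ρ₀) (v := g.hs i) (fun j => (g.smooth_hh _ _).mono inter_subset_left)
    yX (fun q hq => by
      rw [← g.hh_tan hq i]
      exact Finset.sum_congr rfl fun j _ => by rw [hs_eq hq, yX_apply])
    (pole_mem_domp hu ht) (fun j => rfl)

lemma IsShift.pole (hI : IsOpen I) (hw : g.IsShift w) {u t : ℝ} (hu : u ∈ I) (ht : t ∈ Ioo 0 ρ₀) :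
    w 2 (u, t, e3) = 0 :=
  (tan_pole (isOpen_domp hI ρ₀) (fun j => (hw.smooth j).mono inter_subset_left)
    yX (fun _ hq => hw.tan hq) (pole_mem_domp hu ht) (fun _ => rfl)).1

lemma det_pole (hI : IsOpen I) {u t : ℝ} (hu : u ∈ I) (ht : t ∈ Ioo 0 ρ₀) :
    g.hs 0 0 (u, t, e3) * g.hs 1 1 (u, t, e3) - g.hs 0 1 (u, t, e3) ^ 2 = 1 := by
  have hq := pole_mem_domp hu ht
  have h := g.trace_identity hq
  have h0 := (hs_pole (g := g) hI hu ht 0).1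
  have h1 := (hs_pole (g := g) hI hu ht 1).1
  have h2 := (hs_pole (g := g) hI hu ht 2).1
  have e : ∀ i j, g.hh i j (u, t, e3) = g.hs i j (u, t, e3) := fun i j => (hs_eq hq i j).symm
  have s : ∀ i j, g.hs i j = g.hs j i := fun i j => by simp [hs, min_comm, max_comm]
  simp only [e, Fin.sum_univ_three, s 1 0, s 2 0, s 2 1, h0, h1, h2] at h
  linarith

lemma Uh_ne_zero {u t : ℝ} (hu : u ∈ I) (ht : t ∈ Ioo 0 ρ₀) : g.Uh (u, t, e3) ≠ 0 :=
  (g.U_pos u hu t ht _ (by simp)).ne'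

/-- On the polar axis the inverse metric is a polynomial in the components, `U` and `1/U`, because the
angular block has determinant one. -/
lemma IsShift.gs_mul_invG (hI : IsOpen I) (hw : g.IsShift w) {u t : ℝ} (hu : u ∈ I)
    (ht : t ∈ Ioo 0 ρ₀) :
    (Matrix.of fun μ ν => g.gs w μ ν (u, t, e3)) * Matrix.of (g.invG w (u, t, e3)) = 1 := by
  have hq := pole_mem_domp hu ht
  have hU := Uh_ne_zero (g := g) hu ht
  have h0 := (hs_pole (g := g) hI hu ht 0).1
  have h1 := (hs_pole (g := g) hI hu ht 1).1
  have h2 := (hs_pole (g := g) hI hu ht 2).1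
  have hw2 := hw.pole hI hu ht
  have hd := det_pole (g := g) hI hu ht
  have e : ∀ i j, g.hh i j (u, t, e3) = g.hs i j (u, t, e3) := fun i j => (hs_eq hq i j).symm
  have s : ∀ i j, g.hs i j = g.hs j i := fun i j => by simp [hs, min_comm, max_comm]
  have x0 : xh 0 (u, t, e3) = 0 := by simp [xh]
  have x1 : xh 1 (u, t, e3) = 0 := by simp [xh]
  have x2 : xh 2 (u, t, e3) = 1 := by simp [xh]
  have b0 : g.Bh w 0 (u, t, e3) = g.hs 0 0 (u, t, e3) * w 0 (u, t, e3) +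
      g.hs 0 1 (u, t, e3) * w 1 (u, t, e3) := by
    simp only [Bh, e, Fin.sum_univ_three, hw2, x0]; ring
  have b1 : g.Bh w 1 (u, t, e3) = g.hs 0 1 (u, t, e3) * w 0 (u, t, e3) +
      g.hs 1 1 (u, t, e3) * w 1 (u, t, e3) := by
    simp only [Bh, e, Fin.sum_univ_three, hw2, x1, s 1 0]; ring
  have b2 : g.Bh w 2 (u, t, e3) = -g.Uh (u, t, e3) := by
    simp only [Bh, e, Fin.sum_univ_three, hw2, x2, s 2 0, s 2 1, h0, h1]; ring
  have b3 : g.Sh w (u, t, e3) = g.hs 0 0 (u, t, e3) * w 0 (u, t, e3) ^ 2 +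
      2 * g.hs 0 1 (u, t, e3) * w 0 (u, t, e3) * w 1 (u, t, e3) +
      g.hs 1 1 (u, t, e3) * w 1 (u, t, e3) ^ 2 - g.Uh (u, t, e3) * g.Vh (u, t, e3) := by
    simp only [Sh, e, Fin.sum_univ_three, hw2, s 1 0]; ring
  ext i j
  rw [Matrix.mul_apply, Fin.sum_univ_four]
  fin_cases i <;> fin_cases j <;>
    simp [gs, invG, h0, h1, h2, b0, b1, b2, b3, hU] <;> first
    | linear_combination hd
    | (field_simp; ring1)
    | (field_simp; linear_combination w 0 (u, t, e3) * hd)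
    | (field_simp; linear_combination w 1 (u, t, e3) * hd)

/-- The Ricci tensor on the polar axis. -/
lemma IsShift.ricci_pole_eq (hI : IsOpen I) (hw : g.IsShift w) {u t : ℝ} (hu : u ∈ I)
    (ht : t ∈ Ioo 0 ρ₀) (i j : Fin 4) :
    ricci g.metric i j (polePoint u t) =
      ricLin (g.invG w (u, t, e3)) (fun k l a b => d2 (g.gs w a b) (u, t, e3) k l) i j +
      ricQuad (g.invG w (u, t, e3)) (gam fun k a b => d1 (g.gs w a b) (u, t, e3) k) i j := by
  have hq := pole_mem_domp hu ht
  have e1 : ∀ k a b, d1 (g.gtab w a b) (u, t, e3) k = d1 (g.gs w a b) (u, t, e3) k := fun k a b =>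
    d1_congr hI (fun q hq => gs_eq hq a b) hq k
  have e2 : ∀ k l a b, d2 (g.gtab w a b) (u, t, e3) k l = d2 (g.gs w a b) (u, t, e3) k l :=
    fun k l a b => d2_congr hI (fun q hq => gs_eq hq a b) hq k l
  refine (hw.ricci_pole hI hu ht (H := Matrix.of (g.invG w (u, t, e3))) ?_ i j).trans ?_
  · rw [← hw.gs_mul_invG hI hu ht]
    congr 1; ext μ ν; exact gs_eq hq μ ν
  · simp only [e1, e2]; rfl

end BondiSachsMetric

/-! ### Expansion of the curvature at null infinity -/

section JetTables

variable {I : Set ℝ} {ρ₀ : ℝ} {f : X → ℝ}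

/-- The pole of the section `u` of null infinity. -/
abbrev pol (u : ℝ) : ℝ × E := (u, e3)

lemma pol_mem {u : ℝ} (hu : u ∈ I) : pol u ∈ sdom I := ⟨hu, e3_ne⟩

lemma c1_er (p : ℝ × E) : c1 (dd er f) p = 2 * c2 f p := by
  simp only [c2, c1]; ring

lemma sc_eu (hI : IsOpen I) (hρ₀ : 0 < ρ₀) (hf : ContDiffOn ℝ ∞ f (dom I ρ₀)) {p : ℝ × E}
    (hp : p ∈ sdom I) : sc (dd eu f) p = dd su (sc f) p := (dd_sc hI hρ₀ hf hp su).symm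

lemma sc_es (hI : IsOpen I) (hρ₀ : 0 < ρ₀) (hf : ContDiffOn ℝ ∞ f (dom I ρ₀)) {p : ℝ × E}
    (hp : p ∈ sdom I) (k : Fin 3) : sc (dd (es k) f) p = dd (ss k) (sc f) p :=
  (dd_sc hI hρ₀ hf hp (ss k)).symm

lemma c1_eu (hI : IsOpen I) (hρ₀ : 0 < ρ₀) (hf : ContDiffOn ℝ ∞ f (dom I ρ₀)) {p : ℝ × E}
    (hp : p ∈ sdom I) : c1 (dd eu f) p = dd su (c1 f) p := c1_dd hI hρ₀ hf hp su

lemma c1_es (hI : IsOpen I) (hρ₀ : 0 < ρ₀) (hf : ContDiffOn ℝ ∞ f (dom I ρ₀)) {p : ℝ × E}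
    (hp : p ∈ sdom I) (k : Fin 3) : c1 (dd (es k) f) p = dd (ss k) (c1 f) p :=
  c1_dd hI hρ₀ hf hp (ss k)

lemma c2_eu (hI : IsOpen I) (hρ₀ : 0 < ρ₀) (hf : ContDiffOn ℝ ∞ f (dom I ρ₀)) {p : ℝ × E}
    (hp : p ∈ sdom I) : c2 (dd eu f) p = dd su (c2 f) p := c2_dd hI hρ₀ hf hp su

lemma c2_es (hI : IsOpen I) (hρ₀ : 0 < ρ₀) (hf : ContDiffOn ℝ ∞ f (dom I ρ₀)) {p : ℝ × E}
    (hp : p ∈ sdom I) (k : Fin 3) : c2 (dd (es k) f) p = dd (ss k) (c2 f) p :=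
  c2_dd hI hρ₀ hf hp (ss k)

/-- Leading coefficients of the array of first derivatives, divided by `ρ`. -/
def V1 (f : X → ℝ) (p : ℝ × E) : Fin 4 → ℝ :=
  ![dd su (c1 f) p, dd (ss 0) (sc f) p, dd (ss 1) (sc f) p, 0]

/-- Subleading coefficients of the array of first derivatives, divided by `ρ`. -/
def S1 (f : X → ℝ) (p : ℝ × E) : Fin 4 → ℝ :=
  ![dd su (c2 f) p, dd (ss 0) (c1 f) p, dd (ss 1) (c1 f) p, -c1 f p]

/-- The array of second derivatives without its `∂_u²` entry. -/
def d2z (f : X → ℝ) (q : X) (k l : Fin 4) : ℝ := if k = 0 ∧ l = 0 then 0 else d2 f q k l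

/-- Leading coefficients of the array of second derivatives, divided by `ρ²`. -/
def V2 (f : X → ℝ) (p : ℝ × E) : Fin 4 → Fin 4 → ℝ :=
  ![![0, dd su (dd (ss 0) (c1 f)) p, dd su (dd (ss 1) (c1 f)) p, -dd su (c1 f) p],
    ![dd su (dd (ss 0) (c1 f)) p, dd (ss 0) (dd (ss 0) (sc f)) p, dd (ss 0) (dd (ss 1) (sc f)) p,
      -dd (ss 0) (sc f) p],
    ![dd su (dd (ss 1) (c1 f)) p, dd (ss 0) (dd (ss 1) (sc f)) p, dd (ss 1) (dd (ss 1) (sc f)) p,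
      -dd (ss 1) (sc f) p],
    ![-dd su (c1 f) p, -dd (ss 0) (sc f) p, -dd (ss 1) (sc f) p, 0]]

/-- Subleading coefficients of the array of second derivatives, divided by `ρ²`. -/
def S2' (f : X → ℝ) (p : ℝ × E) : Fin 4 → Fin 4 → ℝ :=
  ![![0, dd su (dd (ss 0) (c2 f)) p, dd su (dd (ss 1) (c2 f)) p, -(2 * dd su (c2 f) p)],
    ![dd su (dd (ss 0) (c2 f)) p, dd (ss 0) (dd (ss 0) (c1 f)) p - c1 f p,
      dd (ss 0) (dd (ss 1) (c1 f)) p, -(2 * dd (ss 0) (c1 f) p)],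
    ![dd su (dd (ss 1) (c2 f)) p, dd (ss 0) (dd (ss 1) (c1 f)) p,
      dd (ss 1) (dd (ss 1) (c1 f)) p - c1 f p, -(2 * dd (ss 1) (c1 f) p)],
    ![-(2 * dd su (c2 f) p), -(2 * dd (ss 0) (c1 f) p), -(2 * dd (ss 1) (c1 f) p), 2 * c1 f p]]

variable (hI : IsOpen I) (hρ₀ : 0 < ρ₀) (hf : ContDiffOn ℝ ∞ f (dom I ρ₀)) {u : ℝ} (hu : u ∈ I)

include hI hρ₀ hf hu

lemma jet_er : Jet (fun t => dd er f (u, t, e3)) (c1 f (pol u)) (2 * c2 f (pol u)) :=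
  (jet_line hI hρ₀ (smooth_dd (isOpen_dom hI ρ₀) hf er) (pol_mem hu)).eq rfl (c1_er _)

lemma jet_erer : Jet (fun t => dd er (dd er f) (u, t, e3)) (2 * c2 f (pol u))
    (c1 (dd er (dd er f)) (pol u)) :=
  (jet_line hI hρ₀ (smooth_dd (isOpen_dom hI ρ₀) (smooth_dd (isOpen_dom hI ρ₀) hf er) er)
    (pol_mem hu)).eq (c1_er _) rfl

lemma jet_es (k : Fin 3) : Jet (fun t => dd (es k) f (u, t, e3)) (dd (ss k) (sc f) (pol u))
    (dd (ss k) (c1 f) (pol u)) :=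
  (jet_line hI hρ₀ (smooth_dd (isOpen_dom hI ρ₀) hf _) (pol_mem hu)).eq
    (sc_es hI hρ₀ hf (pol_mem hu) k) (c1_es hI hρ₀ hf (pol_mem hu) k)

lemma jet_es_er (k : Fin 3) : Jet (fun t => dd er (dd (es k) f) (u, t, e3))
    (dd (ss k) (c1 f) (pol u)) (2 * dd (ss k) (c2 f) (pol u)) :=
  (jet_er hI hρ₀ (smooth_dd (isOpen_dom hI ρ₀) hf _) hu).eq (c1_es hI hρ₀ hf (pol_mem hu) k)
    (by rw [c2_es hI hρ₀ hf (pol_mem hu) k])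

lemma jet_es_div (k : Fin 3) (h0 : dd (ss k) (sc f) (pol u) = 0) :
    Jet (fun t => dd (es k) f (u, t, e3) / t) (dd (ss k) (c1 f) (pol u))
    (dd (ss k) (c2 f) (pol u)) :=
  (jet_line_div hI hρ₀ (smooth_dd (isOpen_dom hI ρ₀) hf _) (pol_mem hu)
    ((sc_es hI hρ₀ hf (pol_mem hu) k).trans h0)).eq
    (c1_es hI hρ₀ hf (pol_mem hu) k) (c2_es hI hρ₀ hf (pol_mem hu) k)

/-- The first derivatives of a component that is constant in `u` at null infinity are divisible by `ρ`. -/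
lemma jet_d1 (h0 : ∀ p ∈ sdom I, dd su (sc f) p = 0) (k : Fin 4) :
    Jet (fun t => d1 f (u, t, e3) k / t) (V1 f (pol u) k) (S1 f (pol u) k) := by
  have hd := isOpen_dom hI ρ₀
  have hp := pol_mem hu
  fin_cases k
  · exact (jet_line_div hI hρ₀ (smooth_dd hd hf eu) hp ((sc_eu hI hρ₀ hf hp).trans (h0 _ hp))).eq
      (c1_eu hI hρ₀ hf hp) (c2_eu hI hρ₀ hf hp)
  · refine (jet_es hI hρ₀ hf hu 0).congr ?_
    filter_upwards [Jet.ne] with t ht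
    simp [d1]; field_simp
  · refine (jet_es hI hρ₀ hf hu 1).congr ?_
    filter_upwards [Jet.ne] with t ht
    simp [d1]; field_simp
  · refine (((Jet.id.mul (jet_er hI hρ₀ hf hu)).neg).congr ?_).eq
      (c := V1 f (pol u) 3) (d := S1 f (pol u) 3) ?_ ?_
    · filter_upwards [Jet.ne] with t ht
      simp [d1]; field_simp
    · simp [V1]
    · simp [S1]

/-- Apart from `∂_u²`, the second derivatives of a component that is constant in `u` at null infinity are
divisible by `ρ²`. -/
lemma jet_d2z (h0 : ∀ p ∈ sdom I, dd su (sc f) p = 0) (k l : Fin 4) :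
    Jet (fun t => d2z f (u, t, e3) k l / t ^ 2) (V2 f (pol u) k l) (S2' f (pol u) k l) := by
  have hd := isOpen_dom hI ρ₀
  have hp := pol_mem hu
  have hs := isOpen_sdom hI
  have j0 (k : Fin 3) : Jet (fun t => dd eu (dd (es k) f) (u, t, e3) / t)
      (dd su (dd (ss k) (c1 f)) (pol u)) (dd su (dd (ss k) (c2 f)) (pol u)) := by
    have hk := smooth_dd hd hf (es k)
    refine (jet_line_div hI hρ₀ (smooth_dd hd hk eu) hp ?_).eq ?_ ?_
    · rw [sc_eu hI hρ₀ hk hp, dd_congr hs (fun p hp => sc_es hI hρ₀ hf hp k) hp,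
        dd_comm hs (smooth_sc hρ₀ hf) hp, dd_congr (g := fun _ => 0) hs h0 hp, dd_const]
    · rw [c1_eu hI hρ₀ hk hp, dd_congr hs (fun p hp => c1_es hI hρ₀ hf hp k) hp]
    · rw [c2_eu hI hρ₀ hk hp, dd_congr hs (fun p hp => c2_es hI hρ₀ hf hp k) hp]
  have j3 : Jet (fun t => dd eu (dd er f) (u, t, e3))
      (dd su (c1 f) (pol u)) (2 * dd su (c2 f) (pol u)) := by
    have hk := smooth_dd hd hf er
    refine (jet_line hI hρ₀ (smooth_dd hd hk eu) hp).eq (sc_eu hI hρ₀ hk hp) ?_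
    rw [c1_eu hI hρ₀ hk hp, ← dd_const_mul (smooth_differentiableAt hs (smooth_c2 hI hρ₀ hf) hp)]
    exact dd_congr hs (fun p _ => c1_er p) hp _
  have jss (k l : Fin 3) : Jet (fun t => dd (es k) (dd (es l) f) (u, t, e3))
      (dd (ss k) (dd (ss l) (sc f)) (pol u)) (dd (ss k) (dd (ss l) (c1 f)) (pol u)) := by
    refine (jet_es hI hρ₀ (smooth_dd hd hf (es l)) hu k).eq ?_ ?_
    · exact dd_congr hs (fun p hp => sc_es hI hρ₀ hf hp l) hp _
    · exact dd_congr hs (fun p hp => c1_es hI hρ₀ hf hp l) hp _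
  have jkk (k : Fin 3) : Jet (fun t => dd (es k) (dd (es k) f) (u, t, e3) - t * dd er f (u, t, e3))
      (dd (ss k) (dd (ss k) (sc f)) (pol u)) (dd (ss k) (dd (ss k) (c1 f)) (pol u) - c1 f (pol u)) :=
    ((jss k k).sub (Jet.id.mul (jet_er hI hρ₀ hf hu))).eq (by ring) (by ring)
  have jk3 (k : Fin 3) : Jet (fun t => -dd (es k) f (u, t, e3) - t * dd er (dd (es k) f) (u, t, e3))
      (-dd (ss k) (sc f) (pol u)) (-(2 * dd (ss k) (c1 f) (pol u))) :=
    ((jet_es hI hρ₀ hf hu k).neg.sub (Jet.id.mul (jet_es_er hI hρ₀ hf hu k))).eq (by ring) (by ring)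
  have j33 : Jet (fun t => t * (t * dd er (dd er f) (u, t, e3)) + 2 * (t * dd er f (u, t, e3)))
      0 (2 * c1 f (pol u)) :=
    ((Jet.id.mul (Jet.id.mul (jet_erer hI hρ₀ hf hu))).add
      ((Jet.id.mul (jet_er hI hρ₀ hf hu)).const_mul 2)).eq (by ring) (by ring)
  fin_cases k <;> fin_cases l
  · simpa [d2z, V2, S2'] using Jet.const 0
  · refine (j0 0).congr ?_; filter_upwards [Jet.ne] with t ht; simp [d2z, d2]; field_simp
  · refine (j0 1).congr ?_; filter_upwards [Jet.ne] with t ht; simp [d2z, d2]; field_simp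
  · refine j3.neg.congr ?_; filter_upwards [Jet.ne] with t ht; simp [d2z, d2]; field_simp
  · refine (j0 0).congr ?_; filter_upwards [Jet.ne] with t ht; simp [d2z, d2]; field_simp
  · refine (jkk 0).congr ?_; filter_upwards [Jet.ne] with t ht; simp [d2z, d2]; field_simp
  · refine (jss 0 1).congr ?_; filter_upwards [Jet.ne] with t ht; simp [d2z, d2]; field_simp
  · refine (jk3 0).congr ?_; filter_upwards [Jet.ne] with t ht; simp [d2z, d2]; field_simp
  · refine (j0 1).congr ?_; filter_upwards [Jet.ne] with t ht; simp [d2z, d2]; field_simp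
  · refine (jss 0 1).congr ?_; filter_upwards [Jet.ne] with t ht; simp [d2z, d2]; field_simp
  · refine (jkk 1).congr ?_; filter_upwards [Jet.ne] with t ht; simp [d2z, d2]; field_simp
  · refine (jk3 1).congr ?_; filter_upwards [Jet.ne] with t ht; simp [d2z, d2]; field_simp
  · refine j3.neg.congr ?_; filter_upwards [Jet.ne] with t ht; simp [d2z, d2]; field_simp
  · refine (jk3 0).congr ?_; filter_upwards [Jet.ne] with t ht; simp [d2z, d2]; field_simp
  · refine (jk3 1).congr ?_; filter_upwards [Jet.ne] with t ht; simp [d2z, d2]; field_simp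
  · refine j33.congr ?_; filter_upwards [Jet.ne] with t ht; simp [d2z, d2]; field_simp

end JetTables

/-! ### Taylor coefficients of the metric components at the pole -/

/-- The components of `x` on null infinity. -/
def xs (i : Fin 3) (p : ℝ × E) : ℝ := unit p.2 i

lemma smooth_xs {I : Set ℝ} (i : Fin 3) : ContDiffOn ℝ ∞ (xs i) (sdom I) := by
  have h : ContDiffOn ℝ ∞ (fun p : ℝ × E => unit p.2) (sdom I) :=
    smooth_unit.comp contDiff_snd.contDiffOn fun q hq => hq.2
  exact (contDiffOn_euclidean.1 h) i

lemma dd_xs {I : Set ℝ} {p : ℝ × E} (hp : p ∈ sdom I) (v : ℝ × E) (i : Fin 3) :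
    dd v (xs i) p = ‖p.2‖⁻¹ * (v.2 i - xs i p * ∑ j, xs j p * v.2 j) := by
  have hu : DifferentiableAt ℝ unit p.2 := (smooth_unit.contDiffAt (isOpen_ne0.mem_nhds hp.2)).differentiableAt
    (by simp)
  have h : HasFDerivAt (fun p : ℝ × E => unit p.2) ((fderiv ℝ unit p.2).comp (ContinuousLinearMap.snd ℝ ℝ E)) p :=
    HasFDerivAt.comp p (f := Prod.snd) hu.hasFDerivAt hasFDerivAt_snd
  have h2 := (EuclideanSpace.proj i : E →L[ℝ] ℝ).hasFDerivAt.comp p h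
  have : dd v (xs i) p = fderiv ℝ unit p.2 v.2 i := by
    change fderiv ℝ (xs i) p v = _
    rw [show fderiv ℝ (xs i) p = _ from h2.fderiv]; simp
  rw [this, fderiv_unit hp.2]; rfl

lemma dd_su_xs {I : Set ℝ} {p : ℝ × E} (hp : p ∈ sdom I) (i : Fin 3) :
    dd su (xs i) p = 0 := by rw [dd_xs hp]; simp [su]

lemma xs_pole (u : ℝ) (i : Fin 3) : xs i (pol u) = e3 i := by simp [xs]

lemma dd_xs_pole (u : ℝ) (a i : Fin 3) :
    dd (ss a) (xs i) (pol u) = (if i = a then 1 else 0) - e3 i * e3 a := by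
  rw [dd_xs (pol_mem (mem_univ u))]
  simp [xs, ss]

lemma dd_mul_add_mul {F : Type*} [NormedAddCommGroup F] [NormedSpace ℝ F] {a b c d : F → ℝ} {q v : F}
    (ha : DifferentiableAt ℝ a q) (hb : DifferentiableAt ℝ b q) (hc : DifferentiableAt ℝ c q)
    (hd : DifferentiableAt ℝ d q) : dd v (fun p => a p * b p + c p * d p) q =
      dd v a q * b q + a q * dd v b q + (dd v c q * d q + c q * dd v d q) := by
  rw [dd_add (f := fun p => a p * b p) (g := fun p => c p * d p) (ha.mul hb) (hc.mul hd),
    dd_mul ha hb, dd_mul hc hd]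

lemma dd_norm_inv (u : ℝ) (a : Fin 3) : dd (ss a) (fun p => ‖p.2‖⁻¹) (pol u) = -e3 a := by
  have hn : DifferentiableAt ℝ (fun y : E => ‖y‖) e3 :=
    (contDiffAt_norm ℝ (n := 1) e3_ne).differentiableAt (by simp)
  have h : HasFDerivAt (fun p : ℝ × E => ‖p.2‖) ((fderiv ℝ (fun y : E => ‖y‖) e3).comp
      (ContinuousLinearMap.snd ℝ ℝ E)) (pol u) :=
    HasFDerivAt.comp (pol u) (f := Prod.snd) hn.hasFDerivAt hasFDerivAt_snd
  have h2 := (hasDerivAt_inv (x := ‖(pol u).2‖) (by simp)).comp_hasFDerivAt (pol u) h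
  have h3 : fderiv ℝ (fun p : ℝ × E => ‖p.2‖⁻¹) (pol u) = _ := h2.fderiv
  rw [dd, h3]
  simp only [_root_.smul_apply, ContinuousLinearMap.comp_apply, ss,
    ContinuousLinearMap.coe_snd', hasFDerivAt_norm e3_ne]
  simp only [PiLp.single_apply]
  split_ifs <;> simp_all

lemma dd_dd_xs_pole (u : ℝ) {a b : Fin 3} (ha : a ≠ 2) (hb : b ≠ 2) (i : Fin 3) :
    dd (ss b) (dd (ss a) (xs i)) (pol u) = -(e3 i * if a = b then 1 else 0) := by
  have ho := isOpen_sdom isOpen_univ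
  have hp := pol_mem (mem_univ u)
  have hx : ∀ i, DifferentiableAt ℝ (xs i) (pol u) := fun i =>
    smooth_differentiableAt ho (smooth_xs i) hp
  have hn : DifferentiableAt ℝ (fun p : ℝ × E => ‖p.2‖⁻¹) (pol u) := by
    have hs : ContDiffAt ℝ 1 (fun p : ℝ × E => ‖p.2‖⁻¹) (pol u) :=
      (contDiffAt_snd.norm ℝ e3_ne).inv (by simp)
    exact hs.differentiableAt (by simp)
  have e : ∀ p ∈ sdom univ, dd (ss a) (xs i) p = ‖p.2‖⁻¹ * ((bv a) i - xs i p * xs a p) := by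
    intro p hp
    rw [dd_xs hp]
    simp [ss]
  have e3a : ∀ c : Fin 3, c ≠ 2 → e3 c = 0 := fun c hc => by simp [hc]
  rw [dd_congr ho e hp, dd_mul (g := fun p => bv a i - xs i p * xs a p) hn (((hx i).mul (hx a)).const_sub _),
    dd_sub (f := fun _ => bv a i) (g := fun p => xs i p * xs a p) (differentiableAt_const _)
      ((hx i).mul (hx a)), dd_const, dd_mul (hx i) (hx a), dd_norm_inv, dd_xs_pole, dd_xs_pole,
    xs_pole, xs_pole, e3a a ha, e3a b hb]
  simp

section ScriCoefficients

variable {I : Set ℝ} (hI : IsOpen I) {u : ℝ} (hu : u ∈ I)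

include hI

include hu in
lemma dd_ss_proj {f : ℝ × E → ℝ} {i j : Fin 3} (h : ∀ p ∈ sdom I, f p = proj (unit p.2) i j)
    {a : Fin 3} (ha : a ≠ 2) : dd (ss a) f (pol u) =
      -((if i = a then 1 else 0) * e3 j + e3 i * if j = a then 1 else 0) := by
  have ho := isOpen_sdom hI
  have hp := pol_mem hu
  have hx : ∀ i, DifferentiableAt ℝ (xs i) (pol u) := fun i =>
    smooth_differentiableAt ho (smooth_xs i) hp
  have e3a : e3 a = 0 := by simp [ha]
  rw [dd_congr (g := fun p => (if i = j then 1 else 0) - xs i p * xs j p) ho h hp,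
    dd_sub (f := fun _ => if i = j then (1 : ℝ) else 0) (g := fun p => xs i p * xs j p)
      (differentiableAt_const _) ((hx i).mul (hx j)), dd_const, dd_mul (hx i) (hx j), dd_xs_pole,
    dd_xs_pole, xs_pole, xs_pole, e3a]
  ring

lemma dd_su_proj {f : ℝ × E → ℝ} {i j : Fin 3} (h : ∀ p ∈ sdom I, f p = proj (unit p.2) i j) :
    ∀ p ∈ sdom I, dd su f p = 0 := by
  intro p hp
  have ho := isOpen_sdom hI
  have hx : ∀ i, DifferentiableAt ℝ (xs i) p := fun i =>
    smooth_differentiableAt ho (smooth_xs i) hp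
  rw [dd_congr (g := fun p => (if i = j then 1 else 0) - xs i p * xs j p) ho h hp,
    dd_sub (f := fun _ => if i = j then (1 : ℝ) else 0) (g := fun p => xs i p * xs j p)
      (differentiableAt_const _) ((hx i).mul (hx j)), dd_const, dd_mul (hx i) (hx j),
    dd_su_xs hp, dd_su_xs hp]
  ring

include hu in
lemma dd_dd_proj {f : ℝ × E → ℝ} {i j : Fin 3} (h : ∀ p ∈ sdom I, f p = proj (unit p.2) i j)
    {a b : Fin 3} (ha : a ≠ 2) (hb : b ≠ 2) : dd (ss a) (dd (ss b) f) (pol u) =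
      2 * (e3 i * e3 j * if a = b then 1 else 0) -
      ((if i = a then 1 else 0) * (if j = b then 1 else 0) +
      (if i = b then 1 else 0) * if j = a then 1 else 0) := by
  have ho := isOpen_sdom hI
  have hp := pol_mem hu
  have hx : ∀ i, ∀ p ∈ sdom I, DifferentiableAt ℝ (xs i) p := fun i p hp =>
    smooth_differentiableAt ho (smooth_xs i) hp
  have hdx : ∀ i, DifferentiableAt ℝ (dd (ss b) (xs i)) (pol u) := fun i =>
    smooth_differentiableAt ho (smooth_dd ho (smooth_xs i) _) hp
  have e : ∀ p ∈ sdom I, dd (ss b) f p =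
      0 - (dd (ss b) (xs i) p * xs j p + xs i p * dd (ss b) (xs j) p) := by
    intro p hp
    rw [dd_congr (g := fun p => (if i = j then 1 else 0) - xs i p * xs j p) ho h hp,
      dd_sub (f := fun _ => if i = j then (1 : ℝ) else 0) (g := fun p => xs i p * xs j p)
        (differentiableAt_const _) ((hx i p hp).mul (hx j p hp)), dd_const,
      dd_mul (hx i p hp) (hx j p hp)]
  have m1 := (hdx i).mul (hx j _ hp)
  have m2 := (hx i _ hp).mul (hdx j)
  have e3a : ∀ c : Fin 3, c ≠ 2 → e3 c = 0 := fun c hc => by simp [hc]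
  rw [dd_congr ho e hp, dd_sub (f := fun _ => (0 : ℝ))
      (g := fun p => dd (ss b) (xs i) p * xs j p + xs i p * dd (ss b) (xs j) p)
      (differentiableAt_const _) (m1.add m2), dd_const,
    dd_mul_add_mul (hdx i) (hx j _ hp) (hx i _ hp) (hdx j), dd_dd_xs_pole u hb ha, dd_dd_xs_pole u hb ha]
  simp only [dd_xs_pole, xs_pole, e3a a ha, e3a b hb, mul_zero, sub_zero, eq_comm (a := b) (b := a)]
  ring

include hu in
lemma dd_ss_neg_unit {f : ℝ × E → ℝ} {i : Fin 3} (h : ∀ p ∈ sdom I, f p = -unit p.2 i)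
    {a : Fin 3} (ha : a ≠ 2) : dd (ss a) f (pol u) = -(if i = a then 1 else 0) := by
  have ho := isOpen_sdom hI
  have hp := pol_mem hu
  have e3a : e3 a = 0 := by simp [ha]
  rw [dd_congr (g := fun p => -1 * xs i p) ho (fun p hp => by rw [h p hp, xs]; ring) hp,
    dd_const_mul (smooth_differentiableAt ho (smooth_xs i) hp), dd_xs_pole, e3a]
  ring

lemma dd_su_neg_unit {f : ℝ × E → ℝ} {i : Fin 3} (h : ∀ p ∈ sdom I, f p = -unit p.2 i) :
    ∀ p ∈ sdom I, dd su f p = 0 := by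
  intro p hp
  have ho := isOpen_sdom hI
  rw [dd_congr (g := fun p => -1 * xs i p) ho (fun p hp => by rw [h p hp, xs]; ring) hp,
    dd_const_mul (smooth_differentiableAt ho (smooth_xs i) hp), dd_su_xs hp, mul_zero]

include hu in
lemma dd_dd_neg_unit {f : ℝ × E → ℝ} {i : Fin 3} (h : ∀ p ∈ sdom I, f p = -unit p.2 i)
    {a b : Fin 3} (ha : a ≠ 2) (hb : b ≠ 2) :
    dd (ss a) (dd (ss b) f) (pol u) = e3 i * if a = b then 1 else 0 := by
  have ho := isOpen_sdom hI
  have hp := pol_mem hu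
  have hx : ∀ p ∈ sdom I, DifferentiableAt ℝ (xs i) p := fun p hp =>
    smooth_differentiableAt ho (smooth_xs i) hp
  have e : ∀ p ∈ sdom I, dd (ss b) f p = -1 * dd (ss b) (xs i) p := fun p hp => by
    rw [dd_congr (g := fun p => -1 * xs i p) ho (fun p hp => by rw [h p hp, xs]; ring) hp,
      dd_const_mul (hx p hp)]
  rw [dd_congr ho e hp, dd_const_mul (smooth_differentiableAt ho (smooth_dd ho (smooth_xs i) _) hp),
    dd_dd_xs_pole u hb ha]
  simp only [eq_comm (a := b) (b := a)]; ring

end ScriCoefficients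

namespace BondiSachsMetric

variable {I : Set ℝ} {ρ₀ : ℝ} {g : BondiSachsMetric I ρ₀} {w : Fin 3 → X → ℝ}

lemma coeff_hs (hI : IsOpen I) (hρ₀ : 0 < ρ₀) {p : ℝ × E} (hp : p ∈ sdom I) (i j : Fin 3) :
    c1 (g.hs i j) p = c1 (g.hh i j) p ∧ c2 (g.hs i j) p = c2 (g.hh i j) p := by
  rcases le_total i j with h | h
  · simp [hs, h]
  · simp only [hs, h, min_eq_right, max_eq_left]; exact coeff_hh_symm hI hρ₀ hp j i

/-- The normal components of the Taylor coefficients of `h` at the pole. -/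
lemma coeff_hs_pole (hI : IsOpen I) (hρ₀ : 0 < ρ₀) {u : ℝ} (hu : u ∈ I) (i : Fin 3) :
    (c1 (g.hs i 2) (pol u) = 0 ∧
    (∀ e, dd e (c1 (g.hs i 2)) (pol u) = -∑ j, c1 (g.hs i j) (pol u) * yS j e) ∧
    ∀ e e', dd e (dd e' (c1 (g.hs i 2))) (pol u) =
      -∑ j, (dd e (c1 (g.hs i j)) (pol u) * yS j e' + dd e' (c1 (g.hs i j)) (pol u) * yS j e)) ∧
    c2 (g.hs i 2) (pol u) = 0 ∧
    (∀ e, dd e (c2 (g.hs i 2)) (pol u) = -∑ j, c2 (g.hs i j) (pol u) * yS j e) ∧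
    ∀ e e', dd e (dd e' (c2 (g.hs i 2))) (pol u) =
      -∑ j, (dd e (c2 (g.hs i j)) (pol u) * yS j e' + dd e' (c2 (g.hs i j)) (pol u) * yS j e) := by
  refine ⟨tan_pole (isOpen_sdom hI) (v := fun j => c1 (g.hs i j))
    (fun j => smooth_c1 hI hρ₀ (smooth_hs i j)) yS (fun p hp => ?_) (pol_mem hu) (fun _ => rfl),
    tan_pole (isOpen_sdom hI) (v := fun j => c2 (g.hs i j))
    (fun j => smooth_c2 hI hρ₀ (smooth_hs i j)) yS (fun p hp => ?_) (pol_mem hu) (fun _ => rfl)⟩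
  · rw [← (coeff_hh_tan (g := g) hI hρ₀ hp i).1]
    exact Finset.sum_congr rfl fun j _ => by rw [(coeff_hs hI hρ₀ hp i j).1, yS_apply]
  · rw [← (coeff_hh_tan (g := g) hI hρ₀ hp i).2]
    exact Finset.sum_congr rfl fun j _ => by rw [(coeff_hs hI hρ₀ hp i j).2, yS_apply]

/-- The normal component of the coefficient of order one of `G_{0i}` at the pole. -/
lemma IsShift.c1_Bh_pole (hI : IsOpen I) (hρ₀ : 0 < ρ₀) (hw : g.IsShift w) {u : ℝ} (hu : u ∈ I) :
    c1 (g.Bh w 2) (pol u) = 0 ∧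
    (∀ e, dd e (c1 (g.Bh w 2)) (pol u) = -∑ j, c1 (g.Bh w j) (pol u) * yS j e) ∧
    ∀ e e', dd e (dd e' (c1 (g.Bh w 2))) (pol u) =
      -∑ j, (dd e (c1 (g.Bh w j)) (pol u) * yS j e' + dd e' (c1 (g.Bh w j)) (pol u) * yS j e) :=
  tan_pole (isOpen_sdom hI) (v := fun j => c1 (g.Bh w j))
    (fun j => smooth_c1 hI hρ₀ (hw.smooth_Bh j)) yS (fun p hp => by
      rw [← (hw.coeff_tan hI hρ₀ hp).1]
      exact Finset.sum_congr rfl fun j _ => by rw [(hw.coeff_Bh hI hρ₀ hp j).2.1, yS_apply])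
    (pol_mem hu) (fun _ => rfl)

/-- The normal component of the coefficient of order two of `G_{0i}` at the pole. -/
lemma IsShift.c2_Bh_pole (hI : IsOpen I) (hρ₀ : 0 < ρ₀) (hw : g.IsShift w) {u : ℝ} (hu : u ∈ I) :
    c2 (g.Bh w 2) (pol u) = -c2 g.Uh (pol u) ∧
    (∀ a : Fin 3, a ≠ 2 → dd (ss a) (c2 (g.Bh w 2)) (pol u) =
      -c2 (g.Bh w a) (pol u) - dd (ss a) (c2 g.Uh) (pol u)) ∧
    dd su (c2 (g.Bh w 2)) (pol u) = -dd su (c2 g.Uh) (pol u) ∧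
    ∀ a : Fin 3, a ≠ 2 → dd su (dd (ss a) (c2 (g.Bh w 2))) (pol u) =
      -dd su (c2 (g.Bh w a)) (pol u) - dd su (dd (ss a) (c2 g.Uh)) (pol u) := by
  have ho := isOpen_sdom hI
  have hp := pol_mem hu
  have sU := smooth_c2 hI hρ₀ g.smooth_Uh
  have sB := fun j => smooth_c2 hI hρ₀ (hw.smooth_Bh j)
  have sx := fun j => smooth_xs (I := I) j
  have sUx := fun j => sU.mul (sx j)
  have dU := fun p hp => smooth_differentiableAt ho sU (q := p) hp
  have dB := fun j p hp => smooth_differentiableAt ho (sB j) (q := p) hp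
  have dx := fun j p hp => smooth_differentiableAt ho (sx j) (q := p) hp
  have dUx := fun j p hp => smooth_differentiableAt ho (sUx j) (q := p) hp
  obtain ⟨h0, h1, h2⟩ := tan_pole ho (v := fun j p => c2 (g.Bh w j) p + c2 g.Uh p * xs j p)
    (fun j => (sB j).add (sUx j)) yS (fun p hp => by
      have hC := fun k => (coeff_hh_tan (g := g) hI hρ₀ hp k).1
      have e : ∀ j, (c2 (g.Bh w j) p + c2 g.Uh p * xs j p) * yS j p = c2 (w j) p * p.2 j +
          ∑ k, c1 (w k) p * (c1 (g.hh k j) p * p.2 j) := fun j => by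
        rw [(hw.coeff_Bh hI hρ₀ hp j).2.2, yS_apply, xs, sub_add_cancel, add_mul, Finset.sum_mul]
        congr 1
        exact Finset.sum_congr rfl fun k _ => by rw [(coeff_hh_symm hI hρ₀ hp j k).1]; ring
      rw [Finset.sum_congr rfl fun j _ => e j, Finset.sum_add_distrib, (hw.coeff_tan hI hρ₀ hp).2,
        Finset.sum_comm]
      simp only [← Finset.mul_sum, hC, mul_zero, Finset.sum_const_zero, add_zero])
    hp (fun _ => rfl)
  have k1 : ∀ e, ∀ j, ∀ p ∈ sdom I, dd e (fun p => c2 (g.Bh w j) p + c2 g.Uh p * xs j p) p =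
      dd e (c2 (g.Bh w j)) p + (dd e (c2 g.Uh) p * xs j p + c2 g.Uh p * dd e (xs j) p) :=
    fun e j p hp => by rw [dd_add (dB j p hp) (dUx j p hp), dd_mul (dU p hp) (dx j p hp)]
  have z : e3 0 = 0 ∧ e3 1 = 0 ∧ e3 2 = 1 := by simp
  have za : ∀ a : Fin 3, a ≠ 2 → e3 a = 0 := fun a ha => by simp [ha]
  have y1 : ∀ j a, yS j (ss a) = if j = a then 1 else 0 := fun j a => by simp [ss]
  have y2 : ∀ j, yS j su = 0 := fun j => by simp [su]
  simp only [xs_pole, z.2.2, mul_one] at h0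
  refine ⟨by linarith, fun a ha => ?_, ?_, fun a ha => ?_⟩
  · have := h1 (ss a)
    rw [k1 _ _ _ hp] at this
    simp only [y1, xs_pole, dd_xs_pole, za a ha, z.2.2, mul_ite, mul_one, mul_zero,
      Finset.sum_ite_eq', Finset.mem_univ, if_true, Ne.symm ha, if_false] at this
    linarith
  · have := h1 su
    rw [k1 _ _ _ hp] at this
    simp only [y2, xs_pole, dd_su_xs hp, z.2.2, mul_one, mul_zero, Finset.sum_const_zero] at this
    linarith
  · have := h2 su (ss a)
    rw [dd_congr ho (k1 (ss a) 2) hp] at this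
    have d1 : DifferentiableAt ℝ (dd (ss a) (c2 (g.Bh w 2))) (pol u) :=
      smooth_differentiableAt ho (smooth_dd ho (sB 2) _) hp
    have d2 : DifferentiableAt ℝ (dd (ss a) (c2 g.Uh)) (pol u) :=
      smooth_differentiableAt ho (smooth_dd ho sU _) hp
    have d3 : DifferentiableAt ℝ (dd (ss a) (xs 2)) (pol u) :=
      smooth_differentiableAt ho (smooth_dd ho (sx 2) _) hp
    rw [dd_add (g := fun p => dd (ss a) (c2 g.Uh) p * xs 2 p + c2 g.Uh p * dd (ss a) (xs 2) p) d1
        ((d2.mul (dx 2 _ hp)).add ((dU _ hp).mul d3)),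
      dd_mul_add_mul d2 (dx 2 _ hp) (dU _ hp) d3, dd_comm ho (sx 2) hp,
      dd_congr (g := fun _ => 0) ho (fun p hp => dd_su_xs hp 2) hp] at this
    simp only [k1 _ _ _ hp, y1, y2, xs_pole, dd_xs_pole, dd_su_xs hp, za a ha, z.2.2, dd_const,
      mul_ite, mul_one, mul_zero, add_zero,
      Finset.sum_ite_eq', Finset.mem_univ, if_true, Ne.symm ha, if_false, sub_zero] at this
    linarith

/-- At null infinity the metric components do not depend on `u`. -/
lemma IsShift.gs_const (hI : IsOpen I) (hw : g.IsShift w) (hρ₀ : 0 < ρ₀) (μ ν : Fin 4) :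
    ∀ p ∈ sdom I, dd su (sc (g.gs w μ ν)) p = 0 := by
  have hh : ∀ i j, ∀ p ∈ sdom I, dd su (sc (g.hs i j)) p = 0 := fun i j =>
    dd_su_proj hI fun p hp => sc_hh hp _ _
  have hB : ∀ i, ∀ p ∈ sdom I, dd su (sc (g.Bh w i)) p = 0 := fun i =>
    dd_su_neg_unit hI fun p hp => (hw.coeff_Bh hI hρ₀ hp i).1
  have hS : ∀ p ∈ sdom I, dd su (sc (g.Sh w)) p = 0 := fun p hp => by
    rw [dd_congr (g := fun _ => -1) (isOpen_sdom hI) (fun p hp => (hw.coeff_Sh hI hρ₀ hp).1) hp, dd_const]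
  fin_cases μ <;> fin_cases ν <;> first | exact hS | exact hB _ | exact hh _ _

lemma IsShift.smooth_gs (hw : g.IsShift w) (μ ν : Fin 4) : ContDiffOn ℝ ∞ (g.gs w μ ν) (dom I ρ₀) := by
  fin_cases μ <;> fin_cases ν <;>
    first | exact hw.smooth_Sh | exact hw.smooth_Bh _ | exact smooth_hs _ _

end BondiSachsMetric

set_option linter.unusedSimpArgs false

/-! ### The Einstein equations at null infinity -/

namespace BondiSachsMetric

variable {I : Set ℝ} {ρ₀ : ℝ} {g : BondiSachsMetric I ρ₀} {w : Fin 3 → X → ℝ}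

lemma con_invG (w : Fin 3 → X → ℝ) (q : X) (X : Fin 4 → Fin 4 → ℝ) : con (g.invG w q) X =
    g.hs 1 1 q * X 1 1 - g.hs 0 1 q * (X 1 2 + X 2 1) + g.hs 0 0 q * X 2 2 +
    (g.Uh q)⁻¹ * (g.Vh q * X 3 3 - X 0 3 - X 3 0 + w 0 q * (X 1 3 + X 3 1)
      + w 1 q * (X 2 3 + X 3 2)) := by
  simp [con, invG, Fin.sum_univ_four]; ring

/-- The inverse metric at null infinity. -/
def invG0 : Fin 4 → Fin 4 → ℝ :=
  ![![0, 0, 0, -1], ![0, 1, 0, 0], ![0, 0, 1, 0], ![-1, 0, 0, 1]]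

lemma con_invG0 (X : Fin 4 → Fin 4 → ℝ) : con invG0 X = X 1 1 + X 2 2 + X 3 3 - X 0 3 - X 3 0 := by
  simp [con, invG0, Fin.sum_univ_four]; ring

variable (g) in
/-- The first-order correction to the inverse metric at null infinity. -/
def invG1 (w : Fin 3 → X → ℝ) (p : ℝ × E) : Fin 4 → Fin 4 → ℝ :=
  ![![0, 0, 0, 0],
    ![0, c1 (g.hs 1 1) p, -c1 (g.hs 0 1) p, c1 (g.Bh w 0) p],
    ![0, -c1 (g.hs 0 1) p, c1 (g.hs 0 0) p, c1 (g.Bh w 1) p],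
    ![0, c1 (g.Bh w 0) p, c1 (g.Bh w 1) p, c1 g.Vh p]]

lemma con_invG1 (w : Fin 3 → X → ℝ) (p : ℝ × E) (X : Fin 4 → Fin 4 → ℝ) : con (g.invG1 w p) X =
    c1 (g.hs 1 1) p * X 1 1 - c1 (g.hs 0 1) p * (X 1 2 + X 2 1) + c1 (g.hs 0 0) p * X 2 2 +
    c1 (g.Bh w 0) p * (X 1 3 + X 3 1) + c1 (g.Bh w 1) p * (X 2 3 + X 3 2) + c1 g.Vh p * X 3 3 := by
  simp [con, invG1, Fin.sum_univ_four]; ring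

variable (hI : IsOpen I) (hρ₀ : 0 < ρ₀) (hw : g.IsShift w) {u : ℝ} (hu : u ∈ I)

include hI hρ₀ hu

include hw in
/-- The one-sided jet of the inverse metric at null infinity. -/
lemma IsShift.jet_invG (k l : Fin 4) :
    Jet (fun t => g.invG w (u, t, e3) k l) (invG0 k l) (g.invG1 w (pol u) k l) := by
  have hp := pol_mem hu
  have jh (i j : Fin 3) : Jet (fun t => g.hs i j (u, t, e3)) (proj e3 (min i j) (max i j))
      (c1 (g.hs i j) (pol u)) :=
    (jet_line hI hρ₀ (smooth_hs i j) hp).eq (by simp [hs, sc_hh hp]) rfl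
  have jU : Jet (fun t => (g.Uh (u, t, e3))⁻¹) 1 0 :=
    ((jet_line hI hρ₀ g.smooth_Uh hp).inv (by simp [sc_Uh hp])).eq (by simp [sc_Uh hp])
      (by simp [c1_Uh hI hρ₀ hp])
  have jV : Jet (fun t => g.Vh (u, t, e3)) 1 (c1 g.Vh (pol u)) :=
    (jet_line hI hρ₀ g.smooth_Vh hp).eq (sc_Vh hp) rfl
  have jw (i : Fin 3) : Jet (fun t => w i (u, t, e3)) 0 (c1 (g.Bh w i) (pol u)) :=
    (jet_line hI hρ₀ (hw.smooth i) hp).eq (hw.sc_eq hI hρ₀ hp i) (hw.coeff_Bh hI hρ₀ hp i).2.1.symm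
  have j0 := Jet.const 0
  have p00 : proj e3 (min 0 0) (max 0 0) = 1 := by simp [proj]
  have p01 : proj e3 (min 0 1) (max 0 1) = 0 := by simp [proj]
  have p11 : proj e3 (min 1 1) (max 1 1) = 1 := by simp [proj]
  have a1 := (jh 0 0).eq p00 rfl
  have a2 := (jh 0 1).neg.eq (by rw [p01, neg_zero]) rfl
  have a3 := (jh 1 1).eq p11 rfl
  have a4 : Jet (fun t => w 0 (u, t, e3) * (g.Uh (u, t, e3))⁻¹) 0 (c1 (g.Bh w 0) (pol u)) :=
    ((jw 0).mul jU).eq (by ring) (by ring)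
  have a5 : Jet (fun t => w 1 (u, t, e3) * (g.Uh (u, t, e3))⁻¹) 0 (c1 (g.Bh w 1) (pol u)) :=
    ((jw 1).mul jU).eq (by ring) (by ring)
  have a6 : Jet (fun t => -(g.Uh (u, t, e3))⁻¹) (-1) 0 := jU.neg.eq rfl (by simp)
  have a7 : Jet (fun t => g.Vh (u, t, e3) * (g.Uh (u, t, e3))⁻¹) 1 (c1 g.Vh (pol u)) :=
    (jV.mul jU).eq (by ring) (by ring)
  fin_cases k <;> fin_cases l
  · exact j0
  · exact j0
  · exact j0
  · exact a6
  · exact j0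
  · exact a3
  · exact a2
  · exact a4
  · exact j0
  · exact a2
  · exact a1
  · exact a5
  · exact a6
  · exact a4
  · exact a5
  · exact a7

include hw in
/-- All Christoffel symbols on the polar axis are `O(ρ)`. -/
lemma IsShift.jet_gam (c k l : Fin 4) :
    Jet (fun t => gam (fun k a b => d1 (g.gs w a b) (u, t, e3) k) c k l / t)
      (gam (fun k a b => V1 (g.gs w a b) (pol u) k) c k l)
      (gam (fun k a b => S1 (g.gs w a b) (pol u) k) c k l) := by
  have h (a b k : Fin 4) := jet_d1 hI hρ₀ (hw.smooth_gs a b) hu (hw.gs_const hI hρ₀ a b) k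
  refine ((((h l c k).add (h k c l)).sub (h k l c)).const_mul (1 / 2)).congr ?_
  filter_upwards with t
  simp only [gam]; ring

omit hI hρ₀ hu in
lemma eventually_Ioo (hρ₀ : 0 < ρ₀) : ∀ᶠ t in 𝓝[>] (0 : ℝ), t ∈ Ioo 0 ρ₀ := Ioo_mem_nhdsGT hρ₀

include hw in
omit hρ₀ in
/-- The vacuum equation on the polar axis, with the quadratic part as a contraction with `Γ_{c,ik}`. -/
lemma IsShift.ricci_pole_zero (hvac : g.IsVacuum) {t : ℝ} (ht : t ∈ Ioo 0 ρ₀) (i j : Fin 4) :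
    ricLin (g.invG w (u, t, e3)) (fun k l a b => d2 (g.gs w a b) (u, t, e3) k l) i j +
      conQuad (g.invG w (u, t, e3)) (gam fun k a b => d1 (g.gs w a b) (u, t, e3) k)
        (fun c k => gam (fun k a b => d1 (g.gs w a b) (u, t, e3) k) c i k) j = 0 := by
  have hp := polePoint_mem hu ht
  have h := hvac _ hp.1 hp.2 i j
  rw [hw.ricci_pole_eq hI hu ht] at h
  rw [← h]
  congr 1
  exact (ricQuad_eq _ _ _ _).symm

omit hI hρ₀ hu in
/-- Homogeneity of the quadratic part of the Ricci tensor. -/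
lemma conQuad_div {H : Fin 4 → Fin 4 → ℝ} {Γ : Fin 4 → Fin 4 → Fin 4 → ℝ} {Θ : Fin 4 → Fin 4 → ℝ}
    {j : Fin 4} (r s : ℝ) : conQuad H (fun b k l => Γ b k l / r) (fun c k => Θ c k / s) j =
      conQuad H Γ Θ j / (r * s) := by
  simp only [conQuad, con, Finset.sum_div, Finset.mul_sum]
  refine Finset.sum_congr rfl fun k _ => Finset.sum_congr rfl fun l _ =>
    Finset.sum_congr rfl fun b _ => Finset.sum_congr rfl fun c _ => ?_
  rw [mul_div_assoc, mul_div_assoc, sub_div, mul_div_mul_comm, mul_div_mul_comm]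

omit hI hρ₀ hu in
/-- Homogeneity of the linear part of the Ricci tensor. -/
lemma ricLin_div (H : Fin 4 → Fin 4 → ℝ) (g₂ : Fin 4 → Fin 4 → Fin 4 → Fin 4 → ℝ) (i j : Fin 4)
    (r : ℝ) : (1 / 2 * con H fun k l => g₂ k i l j / r + g₂ l j i k / r - g₂ k l i j / r - g₂ i j k l / r) =
      ricLin H g₂ i j / r := by
  simp only [ricLin_eq, con, Finset.mul_sum, Finset.sum_div]
  refine Finset.sum_congr rfl fun k _ => Finset.sum_congr rfl fun l _ => ?_
  ring

include hw in
/-- The expansion of the components `R_{uA}` of the Einstein equation. -/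
lemma IsShift.ricci_zero_coeff (hvac : g.IsVacuum) (j : Fin 4) (hj : j = 1 ∨ j = 2) :
    let V := fun k l a b => V2 (g.gs w a b) (pol u) k l
    let S := fun k l a b => S2' (g.gs w a b) (pol u) k l
    let Γ₀ := gam fun k a b => V1 (g.gs w a b) (pol u) k
    let Γ₁ := gam fun k a b => S1 (g.gs w a b) (pol u) k
    1 / 2 * (con (g.invG1 w (pol u)) (fun k l => V k 0 l j + V l j 0 k - V k l 0 j - V 0 j k l) +
        con invG0 fun k l => S k 0 l j + S l j 0 k - S k l 0 j - S 0 j k l) +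
      ((con (g.invG1 w (pol u)) fun k l =>
          con invG0 fun b c => Γ₀ b j l * Γ₀ c 0 k - Γ₀ b k l * Γ₀ c 0 j) +
        (con invG0 fun k l =>
          (con (g.invG1 w (pol u)) fun b c => Γ₀ b j l * Γ₀ c 0 k - Γ₀ b k l * Γ₀ c 0 j) +
          (con invG0 fun b c => Γ₁ b j l * Γ₀ c 0 k + Γ₀ b j l * Γ₁ c 0 k
            - (Γ₁ b k l * Γ₀ c 0 j + Γ₀ b k l * Γ₁ c 0 j)))) = 0 := by
  intro V S Γ₀ Γ₁
  have hH := hw.jet_invG hI hρ₀ hu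
  have hΓ := hw.jet_gam hI hρ₀ hu
  have h2 (a b k l : Fin 4) := jet_d2z hI hρ₀ (hw.smooth_gs a b) hu (hw.gs_const hI hρ₀ a b) k l
  have h := (((Jet.con hH fun k l => (((h2 l j k 0).add (h2 0 k l j)).sub (h2 0 j k l)).sub
    (h2 k l 0 j)).const_mul (1 / 2)).add (Jet.conQuad hH hΓ (fun c k => hΓ c 0 k) j)).eq_zero
  refine (h ?_).2
  filter_upwards [eventually_Ioo hρ₀] with t ht
  have hR := hw.ricci_pole_zero hI hu hvac ht 0 j
  have h3 := (hs_pole (g := g) hI hu ht 0).2.2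
  have h3' := (hs_pole (g := g) hI hu ht 1).2.2
  -- the entries `∂_u²` of second derivatives do not contribute
  have e : ricLin (g.invG w (u, t, e3)) (fun k l a b => d2z (g.gs w a b) (u, t, e3) k l) 0 j =
      ricLin (g.invG w (u, t, e3)) (fun k l a b => d2 (g.gs w a b) (u, t, e3) k l) 0 j := by
    simp only [ricLin_eq, con_invG]
    rcases hj with rfl | rfl <;> simp [d2z, d2, gs, h3, h3', eu]
  have k1 := ricLin_div (g.invG w (u, t, e3)) (fun k l a b => d2z (g.gs w a b) (u, t, e3) k l) 0 j (t ^ 2)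
  have k2 := conQuad_div (H := g.invG w (u, t, e3)) (j := j)
    (Γ := gam fun k a b => d1 (g.gs w a b) (u, t, e3) k)
    (Θ := fun c k => gam (fun k a b => d1 (g.gs w a b) (u, t, e3) k) c 0 k) t t
  rw [k1, k2, e, ← pow_two, ← add_div, hR, zero_div]

omit hI hρ₀ hu in
variable (g) in
/-- The Christoffel symbols `Γ_{c,rk}` on the polar axis, divided by `ρ²`. -/
def th (w : Fin 3 → X → ℝ) (q : X) : Fin 4 → Fin 4 → ℝ :=
  ![![-(1 / 2) * dd er (g.Sh w) q,
      1 / 2 * (-dd er (g.Bh w 0) q + dd (es 0) (g.Bh w 2) q / q.2.1),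
      1 / 2 * (-dd er (g.Bh w 1) q + dd (es 1) (g.Bh w 2) q / q.2.1), -dd er (g.Bh w 2) q],
    ![1 / 2 * (-dd er (g.Bh w 0) q - dd (es 0) (g.Bh w 2) q / q.2.1),
      -(1 / 2) * dd er (g.hs 0 0) q, -(1 / 2) * dd er (g.hs 0 1) q, 0],
    ![1 / 2 * (-dd er (g.Bh w 1) q - dd (es 1) (g.Bh w 2) q / q.2.1),
      -(1 / 2) * dd er (g.hs 0 1) q, -(1 / 2) * dd er (g.hs 1 1) q, 0],
    ![0, 0, 0, 0]]

variable (g) in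
/-- Leading coefficients of the Christoffel symbols `Γ_{c,rk}` divided by `ρ²`. -/
def th0 (w : Fin 3 → X → ℝ) (p : ℝ × E) : Fin 4 → Fin 4 → ℝ :=
  ![![-(1 / 2) * c1 (g.Sh w) p,
      1 / 2 * (-c1 (g.Bh w 0) p + dd (ss 0) (c1 (g.Bh w 2)) p),
      1 / 2 * (-c1 (g.Bh w 1) p + dd (ss 1) (c1 (g.Bh w 2)) p), -c1 (g.Bh w 2) p],
    ![1 / 2 * (-c1 (g.Bh w 0) p - dd (ss 0) (c1 (g.Bh w 2)) p),
      -(1 / 2) * c1 (g.hs 0 0) p, -(1 / 2) * c1 (g.hs 0 1) p, 0],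
    ![1 / 2 * (-c1 (g.Bh w 1) p - dd (ss 1) (c1 (g.Bh w 2)) p),
      -(1 / 2) * c1 (g.hs 0 1) p, -(1 / 2) * c1 (g.hs 1 1) p, 0],
    ![0, 0, 0, 0]]

variable (g) in
/-- Subleading coefficients of the Christoffel symbols `Γ_{c,rk}` divided by `ρ²`. -/
def th1 (w : Fin 3 → X → ℝ) (p : ℝ × E) : Fin 4 → Fin 4 → ℝ :=
  ![![-(1 / 2) * (2 * c2 (g.Sh w) p),
      1 / 2 * (-(2 * c2 (g.Bh w 0) p) + dd (ss 0) (c2 (g.Bh w 2)) p),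
      1 / 2 * (-(2 * c2 (g.Bh w 1) p) + dd (ss 1) (c2 (g.Bh w 2)) p), -(2 * c2 (g.Bh w 2) p)],
    ![1 / 2 * (-(2 * c2 (g.Bh w 0) p) - dd (ss 0) (c2 (g.Bh w 2)) p),
      -(1 / 2) * (2 * c2 (g.hs 0 0) p), -(1 / 2) * (2 * c2 (g.hs 0 1) p), 0],
    ![1 / 2 * (-(2 * c2 (g.Bh w 1) p) - dd (ss 1) (c2 (g.Bh w 2)) p),
      -(1 / 2) * (2 * c2 (g.hs 0 1) p), -(1 / 2) * (2 * c2 (g.hs 1 1) p), 0],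
    ![0, 0, 0, 0]]

include hw in
lemma IsShift.dd_sc_Bh_two {a : Fin 3} (ha : a ≠ 2) : dd (ss a) (sc (g.Bh w 2)) (pol u) = 0 := by
  rw [dd_ss_neg_unit hI hu (fun p hp => (hw.coeff_Bh hI hρ₀ hp 2).1) ha]
  simp [Ne.symm ha]

include hw in
/-- The one-sided jet of the Christoffel symbols with a radial index. -/
lemma IsShift.jet_th (c k : Fin 4) :
    Jet (fun t => g.th w (u, t, e3) c k) (g.th0 w (pol u) c k) (g.th1 w (pol u) c k) := by
  have j0 := Jet.const 0
  have jh (i j : Fin 3) := (jet_er hI hρ₀ (smooth_hs (g := g) i j) hu).const_mul (-(1 / 2))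
  have jB (i : Fin 3) := jet_er hI hρ₀ (hw.smooth_Bh i) hu
  have jB2 (a : Fin 3) (ha : a ≠ 2) := jet_es_div hI hρ₀ (hw.smooth_Bh 2) hu a
    (hw.dd_sc_Bh_two hI hρ₀ hu ha)
  have b0 := (((jB 0).neg.add (jB2 0 (by decide))).const_mul (1 / 2))
  have b1 := (((jB 1).neg.add (jB2 1 (by decide))).const_mul (1 / 2))
  have d0 := (((jB 0).neg.sub (jB2 0 (by decide))).const_mul (1 / 2))
  have d1 := (((jB 1).neg.sub (jB2 1 (by decide))).const_mul (1 / 2))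
  fin_cases c <;> fin_cases k
  · exact (jet_er hI hρ₀ hw.smooth_Sh hu).const_mul (-(1 / 2))
  · exact b0
  · exact b1
  · exact (jB 2).neg
  · exact d0
  · exact jh 0 0
  · exact jh 0 1
  · exact j0
  · exact d1
  · exact jh 0 1
  · exact jh 1 1
  · exact j0
  all_goals exact j0

omit hρ₀ in
/-- The Christoffel symbols `Γ_{c,3k}` are `O(ρ²)`, one order better than the others, as the direction 3
is radial on the axis. -/
lemma gam_three {t : ℝ} (ht : t ∈ Ioo 0 ρ₀) (c k : Fin 4) :
    gam (fun k a b => d1 (g.gs w a b) (u, t, e3) k) c 3 k / t ^ 2 = g.th w (u, t, e3) c k := by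
  have ht0 := ht.1.ne'
  have h (i : Fin 3) := (hs_pole (g := g) hI hu ht i).2.1
  have h0 (i : Fin 3) := (hs_pole (g := g) hI hu ht i).1
  have s20 : g.hs 2 0 = g.hs 0 2 := rfl
  have s21 : g.hs 2 1 = g.hs 1 2 := rfl
  have s10 : g.hs 1 0 = g.hs 0 1 := rfl
  fin_cases c <;> fin_cases k <;>
    simp [gam, d1, gs, th, h, h0, eu, er, es, Fin.sum_univ_three, s20, s21, s10] <;> field_simp <;> ring

variable (g) in
/-- The second derivatives of the metric that enter `R_{rA}`, divided by `ρ³`. -/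
def lin (w : Fin 3 → X → ℝ) (a : Fin 3) (q : X) : Fin 4 → Fin 4 → ℝ :=
  let D := fun i j k => dd er (dd (es k) (g.hs i j)) q
  ![![0, 0, 0, 0],
    ![0, D 0 0 a - D 0 a 0, D 0 1 a - D 1 a 0, 0],
    ![0, D 0 1 a - D 0 a 1, D 1 1 a - D 1 a 1, 0],
    ![q.2.1 * dd er (dd er (g.Bh w a)) q + 2 * dd er (g.Bh w a) q + dd (es a) (g.Bh w 2) q / q.2.1 +
      dd er (dd (es a) (g.Bh w 2)) q, q.2.1 * dd er (dd er (g.hs 0 a)) q,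
      q.2.1 * dd er (dd er (g.hs 1 a)) q, 0]]

variable (g) in
/-- Leading coefficients of the second derivatives of the metric in `R_{rA}`. -/
def lin0 (w : Fin 3 → X → ℝ) (a : Fin 3) (p : ℝ × E) : Fin 4 → Fin 4 → ℝ :=
  let D := fun i j k => dd (ss k) (c1 (g.hs i j)) p
  ![![0, 0, 0, 0],
    ![0, D 0 0 a - D 0 a 0, D 0 1 a - D 1 a 0, 0],
    ![0, D 0 1 a - D 0 a 1, D 1 1 a - D 1 a 1, 0],
    ![2 * c1 (g.Bh w a) p + 2 * dd (ss a) (c1 (g.Bh w 2)) p, 0, 0, 0]]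

variable (g) in
/-- Subleading coefficients of the second derivatives of the metric in `R_{rA}`. -/
def lin1 (w : Fin 3 → X → ℝ) (a : Fin 3) (p : ℝ × E) : Fin 4 → Fin 4 → ℝ :=
  let D := fun i j k => 2 * dd (ss k) (c2 (g.hs i j)) p
  ![![0, 0, 0, 0],
    ![0, D 0 0 a - D 0 a 0, D 0 1 a - D 1 a 0, 0],
    ![0, D 0 1 a - D 0 a 1, D 1 1 a - D 1 a 1, 0],
    ![6 * c2 (g.Bh w a) p + 3 * dd (ss a) (c2 (g.Bh w 2)) p, 2 * c2 (g.hs 0 a) p, 2 * c2 (g.hs 1 a) p, 0]]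

include hw in
/-- The one-sided jet of the second derivatives of the metric in `R_{rA}`. -/
lemma IsShift.jet_lin {a : Fin 3} (ha : a ≠ 2) (k l : Fin 4) :
    Jet (fun t => g.lin w a (u, t, e3) k l) (g.lin0 w a (pol u) k l) (g.lin1 w a (pol u) k l) := by
  have j0 := Jet.const 0
  have jD (i j k : Fin 3) := jet_es_er hI hρ₀ (smooth_hs (g := g) i j) hu k
  have jh (i j : Fin 3) : Jet (fun t => t * dd er (dd er (g.hs i j)) (u, t, e3)) 0
      (2 * c2 (g.hs i j) (pol u)) :=
    (Jet.id.mul (jet_erer hI hρ₀ (smooth_hs (g := g) i j) hu)).eq (by ring) (by ring)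
  have jB : Jet (fun t => t * dd er (dd er (g.Bh w a)) (u, t, e3) + 2 * dd er (g.Bh w a) (u, t, e3) +
      dd (es a) (g.Bh w 2) (u, t, e3) / t + dd er (dd (es a) (g.Bh w 2)) (u, t, e3))
      (2 * c1 (g.Bh w a) (pol u) + 2 * dd (ss a) (c1 (g.Bh w 2)) (pol u))
      (6 * c2 (g.Bh w a) (pol u) + 3 * dd (ss a) (c2 (g.Bh w 2)) (pol u)) :=
    ((((Jet.id.mul (jet_erer hI hρ₀ (hw.smooth_Bh a) hu)).add
      ((jet_er hI hρ₀ (hw.smooth_Bh a) hu).const_mul 2)).add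
      (jet_es_div hI hρ₀ (hw.smooth_Bh 2) hu a (hw.dd_sc_Bh_two hI hρ₀ hu ha))).add
      (jet_es_er hI hρ₀ (hw.smooth_Bh 2) hu a)).eq (by ring) (by ring)
  fin_cases k <;> fin_cases l
  · exact j0
  · exact j0
  · exact j0
  · exact j0
  · exact j0
  · exact (jD 0 0 a).sub (jD 0 a 0)
  · exact (jD 0 1 a).sub (jD 1 a 0)
  · exact j0
  · exact j0
  · exact (jD 0 1 a).sub (jD 0 a 1)
  · exact (jD 1 1 a).sub (jD 1 a 1)
  · exact j0
  · exact jB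
  · exact jh 0 a
  · exact jh 1 a
  · exact j0

omit hρ₀ in
/-- The linear part of `R_{rA}` is `O(ρ³)`. -/
lemma ricLin_three {t : ℝ} (ht : t ∈ Ioo 0 ρ₀) {a : Fin 3} (ha : a = 0 ∨ a = 1) :
    ricLin (g.invG w (u, t, e3)) (fun k l a b => d2 (g.gs w a b) (u, t, e3) k l) 3 a.succ /
      t ^ 3 = 1 / 2 * con (g.invG w (u, t, e3)) (g.lin w a (u, t, e3)) := by
  have ht0 := ht.1.ne'
  have h (i : Fin 3) := (hs_pole (g := g) hI hu ht i).2.1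
  have h' (i : Fin 3) := (hs_pole (g := g) hI hu ht i).2.2
  have h0 (i : Fin 3) := (hs_pole (g := g) hI hu ht i).1
  have s20 : g.hs 2 0 = g.hs 0 2 := rfl
  have s21 : g.hs 2 1 = g.hs 1 2 := rfl
  have s10 : g.hs 1 0 = g.hs 0 1 := rfl
  rw [ricLin_eq, con_invG, con_invG]
  rcases ha with rfl | rfl
  · simp [d2, gs, lin, h, h', h0, eu, er, es, Fin.sum_univ_three, s20, s21, s10]
    field_simp
    ring
  · simp [d2, gs, lin, h, h', h0, eu, er, es, Fin.sum_univ_three, s20, s21, s10]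
    field_simp
    ring

end BondiSachsMetric

namespace BondiSachsMetric

variable {I : Set ℝ} {ρ₀ : ℝ} {g : BondiSachsMetric I ρ₀} {w : Fin 3 → X → ℝ}

variable (hI : IsOpen I) (hρ₀ : 0 < ρ₀) (hw : g.IsShift w) {u : ℝ} (hu : u ∈ I)

include hI hρ₀ hu hw

/-- The expansion of the components `R_{rA}` of the Einstein equation. -/
lemma IsShift.ricci_three_coeff (hvac : g.IsVacuum) {a : Fin 3} (ha : a = 0 ∨ a = 1) :
    let Γ₀ := gam fun k a b => V1 (g.gs w a b) (pol u) k
    let Γ₁ := gam fun k a b => S1 (g.gs w a b) (pol u) k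
    let Θ₀ := g.th0 w (pol u)
    let Θ₁ := g.th1 w (pol u)
    1 / 2 * con invG0 (g.lin0 w a (pol u)) + conQuad invG0 Γ₀ Θ₀ a.succ = 0 ∧
    1 / 2 * (con (g.invG1 w (pol u)) (g.lin0 w a (pol u)) + con invG0 (g.lin1 w a (pol u))) +
      ((con (g.invG1 w (pol u)) fun k l =>
          con invG0 fun b c => Γ₀ b a.succ l * Θ₀ c k - Γ₀ b k l * Θ₀ c a.succ) +
        (con invG0 fun k l =>
          (con (g.invG1 w (pol u)) fun b c => Γ₀ b a.succ l * Θ₀ c k - Γ₀ b k l * Θ₀ c a.succ) +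
          (con invG0 fun b c => Γ₁ b a.succ l * Θ₀ c k + Γ₀ b a.succ l * Θ₁ c k
            - (Γ₁ b k l * Θ₀ c a.succ + Γ₀ b k l * Θ₁ c a.succ)))) = 0 := by
  intro Γ₀ Γ₁ Θ₀ Θ₁
  have hH := hw.jet_invG hI hρ₀ hu
  have hΓ := hw.jet_gam hI hρ₀ hu
  have hL := hw.jet_lin hI hρ₀ hu (a := a) (by rcases ha with rfl | rfl <;> decide)
  have h := (((Jet.con hH hL).const_mul (1 / 2)).add
    (Jet.conQuad hH hΓ (hw.jet_th hI hρ₀ hu) a.succ)).eq_zero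
  refine h ?_
  filter_upwards [eventually_Ioo hρ₀] with t ht
  have hR := hw.ricci_pole_zero hI hu hvac ht 3 a.succ
  have k2 := conQuad_div (H := g.invG w (u, t, e3)) (j := a.succ)
    (Γ := gam fun k a b => d1 (g.gs w a b) (u, t, e3) k)
    (Θ := fun c k => gam (fun k a b => d1 (g.gs w a b) (u, t, e3) k) c 3 k) t (t ^ 2)
  simp only [gam_three hI hu ht] at k2
  have k3 : (fun c k => g.th w (u, t, e3) c k) = g.th w (u, t, e3) := rfl
  rw [k3] at k2
  rw [k2, ← ricLin_three hI hu ht ha, ← pow_succ', ← add_div, hR, zero_div]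

/-- The expansion of the component `R_{rr}` of the Einstein equation. -/
lemma IsShift.ricci_rr (hvac : g.IsVacuum) :
    c2 g.Uh (pol u) = -(1 / 16) * (c1 (g.hs 0 0) (pol u) ^ 2 + 2 * c1 (g.hs 0 1) (pol u) ^ 2 +
      c1 (g.hs 1 1) (pol u) ^ 2) := by
  have hp := pol_mem hu
  have hd := isOpen_dom hI ρ₀
  have hH := hw.jet_invG hI hρ₀ hu
  have hΓ := hw.jet_gam hI hρ₀ hu
  have hΘ := hw.jet_th hI hρ₀ hu
  have j0 := Jet.const 0
  have jh (i j : Fin 3) := (jet_erer hI hρ₀ (smooth_hs (g := g) i j) hu).neg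
  have hL (k l : Fin 4) : Jet (fun t => (![![0, 0, 0, 0],
      ![0, -dd er (dd er (g.hs 0 0)) (u, t, e3), -dd er (dd er (g.hs 0 1)) (u, t, e3), 0],
      ![0, -dd er (dd er (g.hs 0 1)) (u, t, e3), -dd er (dd er (g.hs 1 1)) (u, t, e3), 0],
      ![0, 0, 0, 0]] : Fin 4 → Fin 4 → ℝ) k l)
      ((![![0, 0, 0, 0], ![0, -(2 * c2 (g.hs 0 0) (pol u)), -(2 * c2 (g.hs 0 1) (pol u)), 0],
      ![0, -(2 * c2 (g.hs 0 1) (pol u)), -(2 * c2 (g.hs 1 1) (pol u)), 0],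
      ![0, 0, 0, 0]] : Fin 4 → Fin 4 → ℝ) k l)
      ((![![0, 0, 0, 0], ![0, -c1 (dd er (dd er (g.hs 0 0))) (pol u), -c1 (dd er (dd er (g.hs 0 1))) (pol u), 0],
      ![0, -c1 (dd er (dd er (g.hs 0 1))) (pol u), -c1 (dd er (dd er (g.hs 1 1))) (pol u), 0],
      ![0, 0, 0, 0]] : Fin 4 → Fin 4 → ℝ) k l) := by
    fin_cases k <;> fin_cases l
    · exact j0
    · exact j0
    · exact j0
    · exact j0
    · exact j0
    · exact jh 0 0
    · exact jh 0 1
    · exact j0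
    · exact j0
    · exact jh 0 1
    · exact jh 1 1
    · exact j0
    · exact j0
    · exact j0
    · exact j0
    · exact j0
  have hB : Jet (fun t => -(dd er (g.Bh w 2) (u, t, e3) / t)) (-(2 * c2 (g.Bh w 2) (pol u)))
      (-c2 (dd er (g.Bh w 2)) (pol u)) :=
    ((jet_line_div hI hρ₀ (smooth_dd hd (hw.smooth_Bh 2) er) hp
      (hw.c1_Bh_pole hI hρ₀ hu).1).eq (c1_er _) rfl).neg
  have hT (c : Fin 4) : Jet (fun t => (![-(dd er (g.Bh w 2) (u, t, e3) / t), 0, 0, 0] : Fin 4 → ℝ) c)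
      ((![-(2 * c2 (g.Bh w 2) (pol u)), 0, 0, 0] : Fin 4 → ℝ) c)
      ((![-c2 (dd er (g.Bh w 2)) (pol u), 0, 0, 0] : Fin 4 → ℝ) c) := by
    fin_cases c
    · exact hB
    · exact j0
    · exact j0
    · exact j0
  have h := (((Jet.con hH hL).const_mul (1 / 2)).add (Jet.con hH fun k l => Jet.con hH fun b c =>
    ((hΘ b l).mul (hΘ c k)).sub ((hΓ b k l).mul (hT c)))).eq_zero ?_
  · have H := h.1
    obtain ⟨⟨a1, a2, a3⟩, a4, a5, a6⟩ := coeff_hs_pole (g := g) hI hρ₀ hu 0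
    obtain ⟨⟨b1, b2, b3⟩, b4, b5, b6⟩ := coeff_hs_pole (g := g) hI hρ₀ hu 1
    obtain ⟨⟨d1, d2, d3⟩, d4, d5, d6⟩ := coeff_hs_pole (g := g) hI hρ₀ hu 2
    obtain ⟨e1, e2, e3⟩ := hw.c1_Bh_pole hI hρ₀ hu
    obtain ⟨f1, f2, f3, f4⟩ := hw.c2_Bh_pole hI hρ₀ hu
    obtain ⟨-, tr⟩ := coeff_hh_trace (g := g) hI hρ₀ hp
    simp only [← (coeff_hs hI hρ₀ hp _ _).1, ← (coeff_hs hI hρ₀ hp _ _).2] at tr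
    have p1 := fun i j a ha => dd_ss_proj hI hu (a := a) (f := sc (g.hs i j))
      (fun p hp => sc_hh hp _ _) ha
    have q1 := fun i a ha => dd_ss_neg_unit hI hu (a := a) (f := sc (g.Bh w i))
      (fun p hp => (hw.coeff_Bh hI hρ₀ hp i).1) ha
    have y2 : ∀ j, yS j su = 0 := fun j => by simp [su]
    have s20 : g.hs 2 0 = g.hs 0 2 := rfl
    have s21 : g.hs 2 1 = g.hs 1 2 := rfl
    have s10 : g.hs 1 0 = g.hs 0 1 := rfl
    simp only [con_invG0] at H
    simp [gam, V1, gs, th0, a1, a2, a4, b1, b2, b4, d1, d2, d4, e1, e2, f1, y2, p1, q1, s20, s21, s10,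
      Fin.sum_univ_three] at H tr
    linarith
  · filter_upwards [eventually_Ioo hρ₀] with t ht
    have ht0 := ht.1.ne'
    have hR := hw.ricci_pole_zero hI hu hvac ht 3 3
    have k1 : ricLin (g.invG w (u, t, e3)) (fun k l a b => d2 (g.gs w a b) (u, t, e3) k l) 3 3 / t ^ 4 =
        1 / 2 * con (g.invG w (u, t, e3)) ![![0, 0, 0, 0],
        ![0, -dd er (dd er (g.hs 0 0)) (u, t, e3), -dd er (dd er (g.hs 0 1)) (u, t, e3), 0],
        ![0, -dd er (dd er (g.hs 0 1)) (u, t, e3), -dd er (dd er (g.hs 1 1)) (u, t, e3), 0],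
        ![0, 0, 0, 0]] := by
      have h (i : Fin 3) := (hs_pole (g := g) hI hu ht i).2.1
      have h' (i : Fin 3) := (hs_pole (g := g) hI hu ht i).2.2
      have h0 (i : Fin 3) := (hs_pole (g := g) hI hu ht i).1
      have s20 : g.hs 2 0 = g.hs 0 2 := rfl
      have s21 : g.hs 2 1 = g.hs 1 2 := rfl
      have s10 : g.hs 1 0 = g.hs 0 1 := rfl
      rw [ricLin_eq, con_invG, con_invG]
      simp [d2, gs, h, h', h0, eu, er, es, Fin.sum_univ_three, s20, s21, s10]
      field_simp
      ring
    have k2 : conQuad (g.invG w (u, t, e3)) (gam fun k a b => d1 (g.gs w a b) (u, t, e3) k)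
        (fun c k => gam (fun k a b => d1 (g.gs w a b) (u, t, e3) k) c 3 k) 3 / t ^ 4 =
        con (g.invG w (u, t, e3)) fun k l => con (g.invG w (u, t, e3)) fun b c =>
        g.th w (u, t, e3) b l * g.th w (u, t, e3) c k -
          gam (fun k a b => d1 (g.gs w a b) (u, t, e3) k) b k l / t *
          (![-(dd er (g.Bh w 2) (u, t, e3) / t), 0, 0, 0] : Fin 4 → ℝ) c := by
      have hc (c : Fin 4) : (![-(dd er (g.Bh w 2) (u, t, e3) / t), 0, 0, 0] : Fin 4 → ℝ) c =
          gam (fun k a b => d1 (g.gs w a b) (u, t, e3) k) c 3 3 / t ^ 2 / t := by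
        rw [gam_three hI hu ht]
        fin_cases c <;> simp [th] <;> ring
      simp only [← gam_three hI hu ht, hc, conQuad, con, Finset.sum_div, Finset.mul_sum]
      refine Finset.sum_congr rfl fun k _ => Finset.sum_congr rfl fun l _ =>
        Finset.sum_congr rfl fun b _ => Finset.sum_congr rfl fun c _ => ?_
      field_simp
    rw [← k1, ← k2, ← add_div, hR, zero_div]

/-- The Einstein equations `R_{rA} = 0` at leading and subleading order, and `R_{uA} = 0` at
subleading order, at the pole. -/
lemma IsShift.ricci_coeff (hvac : g.IsVacuum) {a b : Fin 3} (hab : a = 0 ∧ b = 1 ∨ a = 1 ∧ b = 0) :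
    c1 (g.Bh w a) (pol u) =
      1 / 2 * (dd (ss b) (c1 (g.hs a b)) (pol u) - dd (ss a) (c1 (g.hs b b)) (pol u)) ∧
    1 / 4 * dd (ss a) (c1 (g.hs b b)) (pol u) * (c1 (g.hs a a) (pol u) - c1 (g.hs b b) (pol u)) +
      1 / 2 * c1 (g.Bh w a) (pol u) * (c1 (g.hs a a) (pol u) + c1 (g.hs b b) (pol u)) -
      1 / 2 * c1 (g.hs a b) (pol u) * dd (ss a) (c1 (g.hs a b)) (pol u) +
      1 / 4 * c1 (g.hs a b) (pol u) *
        (dd (ss b) (c1 (g.hs a a)) (pol u) + dd (ss b) (c1 (g.hs b b)) (pol u)) +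
      dd (ss a) (c2 (g.hs b b)) (pol u) - dd (ss b) (c2 (g.hs a b)) (pol u) +
      2 * dd (ss a) (c2 g.Uh) (pol u) = 0 ∧
    -(c1 (g.hs a b) (pol u) * dd su (dd (ss b) (c1 (g.hs a a))) (pol u)) +
      c1 (g.hs a b) (pol u) * dd su (dd (ss a) (c1 (g.hs a b))) (pol u) +
      c1 (g.hs a b) (pol u) * dd su (c1 (g.Bh w b)) (pol u) +
      c1 (g.hs a a) (pol u) * dd su (dd (ss b) (c1 (g.hs a b))) (pol u) -
      c1 (g.hs a a) (pol u) * dd su (dd (ss a) (c1 (g.hs b b))) (pol u) +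
      c1 (g.hs a a) (pol u) * dd su (c1 (g.Bh w a)) (pol u) +
      dd su (dd (ss b) (c2 (g.hs a b))) (pol u) + dd (ss a) (dd (ss b) (c1 (g.Bh w b))) (pol u) -
      dd (ss b) (dd (ss b) (c1 (g.Bh w a))) (pol u) + c1 (g.Bh w a) (pol u) +
      c1 (g.Bh w a) (pol u) * dd su (c1 (g.hs a a)) (pol u) -
      dd su (dd (ss a) (c2 (g.hs b b))) (pol u) + dd (ss a) (c1 (g.Sh w)) (pol u) -
      3 * dd su (c2 (g.Bh w a)) (pol u) - dd su (dd (ss a) (c2 g.Uh)) (pol u) -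
      dd su (c1 (g.hs a a)) (pol u) * dd (ss b) (c1 (g.hs a b)) (pol u) +
      1 / 2 * dd su (c1 (g.hs a a)) (pol u) * dd (ss a) (c1 (g.hs b b)) (pol u) +
      c1 (g.Bh w b) (pol u) * dd su (c1 (g.hs a b)) (pol u) +
      1 / 2 * dd su (c1 (g.hs a b)) (pol u) * dd (ss b) (c1 (g.hs a a)) (pol u) -
      1 / 2 * dd su (c1 (g.hs a b)) (pol u) * dd (ss b) (c1 (g.hs b b)) (pol u) +
      1 / 2 * dd (ss a) (c1 (g.hs b b)) (pol u) * dd su (c1 (g.hs b b)) (pol u) = 0 := by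
  have hp := pol_mem hu
  obtain ⟨⟨a1, a2, a3⟩, a4, a5, a6⟩ := coeff_hs_pole (g := g) hI hρ₀ hu 0
  obtain ⟨⟨b1, b2, b3⟩, b4, b5, b6⟩ := coeff_hs_pole (g := g) hI hρ₀ hu 1
  obtain ⟨⟨d1, d2, d3⟩, d4, d5, d6⟩ := coeff_hs_pole (g := g) hI hρ₀ hu 2
  obtain ⟨e1, e2, e3⟩ := hw.c1_Bh_pole hI hρ₀ hu
  obtain ⟨f1, f2, f3, f4⟩ := hw.c2_Bh_pole hI hρ₀ hu
  have y1 : ∀ j a, yS j (ss a) = if j = a then 1 else 0 := fun j a => by simp [ss]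
  have y2 : ∀ j, yS j su = 0 := fun j => by simp [su]
  have s20 : g.hs 2 0 = g.hs 0 2 := rfl
  have s21 : g.hs 2 1 = g.hs 1 2 := rfl
  have s10 : g.hs 1 0 = g.hs 0 1 := rfl
  have s1 : (0 : Fin 3).succ = (1 : Fin 4) := rfl
  have s2 : (1 : Fin 3).succ = (2 : Fin 4) := rfl
  have p1 := fun i j a ha => dd_ss_proj hI hu (a := a) (f := sc (g.hs i j))
    (fun p hp => sc_hh hp _ _) ha
  have p2 := fun i j a b ha hb => dd_dd_proj hI hu (a := a) (b := b) (f := sc (g.hs i j))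
    (fun p hp => sc_hh hp _ _) ha hb
  have q1 := fun i a ha => dd_ss_neg_unit hI hu (a := a) (f := sc (g.Bh w i))
    (fun p hp => (hw.coeff_Bh hI hρ₀ hp i).1) ha
  have q2 := fun i a b ha hb => dd_dd_neg_unit hI hu (a := a) (b := b) (f := sc (g.Bh w i))
    (fun p hp => (hw.coeff_Bh hI hρ₀ hp i).1) ha hb
  have t0 : ∀ v, ∀ p ∈ sdom I, dd v (sc (g.Sh w)) p = 0 := fun v p hp => by
    rw [dd_congr (g := fun _ => -1) (isOpen_sdom hI) (fun p hp => (hw.coeff_Sh hI hρ₀ hp).1) hp,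
      dd_const]
  have t1 : ∀ v v', dd v (dd v' (sc (g.Sh w))) (pol u) = 0 := fun v v' => by
    rw [dd_congr (g := fun _ => 0) (isOpen_sdom hI) (t0 v') hp, dd_const]
  have t2 := fun v => t0 v _ hp
  have c10 := dd_comm (isOpen_sdom hI) (smooth_c1 hI hρ₀ (hw.smooth_Bh 0)) hp (ss 0) (ss 1)
  rcases hab with ⟨rfl, rfl⟩ | ⟨rfl, rfl⟩
  · obtain ⟨H1, H2⟩ := hw.ricci_three_coeff hI hρ₀ hu hvac (Or.inl rfl)
    have H3 := hw.ricci_zero_coeff hI hρ₀ hu hvac 1 (Or.inl rfl)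
    simp only [conQuad, con_invG0, con_invG1] at H1 H2 H3
    simp [s1, s2, gam, V1, S1, V2, S2', gs, th0, th1, lin0, lin1, a1, a2, a3, a4, a5, a6, b1, b2, b3, b4,
    b5, b6, d1, d2, d3, d4, d5, d6, e1, e2, e3, f1, f2, f3, f4, y1, y2, Fin.sum_univ_three, s20, s21,
    s10, p1, p2, q1, q2, t1, t2] at H1 H2 H3
    exact ⟨by linear_combination H1, by linear_combination H2, by linear_combination 2 * H3⟩
  · obtain ⟨H1, H2⟩ := hw.ricci_three_coeff hI hρ₀ hu hvac (Or.inr rfl)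
    have H3 := hw.ricci_zero_coeff hI hρ₀ hu hvac 2 (Or.inr rfl)
    simp only [conQuad, con_invG0, con_invG1] at H1 H2 H3
    simp [s1, s2, gam, V1, S1, V2, S2', gs, th0, th1, lin0, lin1, a1, a2, a3, a4, a5, a6, b1, b2, b3, b4,
    b5, b6, d1, d2, d3, d4, d5, d6, e1, e2, e3, f1, f2, f3, f4, y1, y2, Fin.sum_univ_three, s20, s21,
    s10, p1, p2, q1, q2, t1, t2] at H1 H2 H3
    simp only [s10]
    exact ⟨by linear_combination H1, by linear_combination H2, by linear_combination 2 * H3 - c10⟩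

end BondiSachsMetric

/-! ### Equivariance of the Ricci tensor under linear isometries -/

section Multilinear

variable {n : ℕ}

/-- The function is linear. -/
def Lin (f : (Fin n → ℝ) → ℝ) : Prop := ∃ L : (Fin n → ℝ) →ₗ[ℝ] ℝ, ∀ v, f v = L v

namespace Lin

variable {f g : (Fin n → ℝ) → ℝ}

lemma add (hf : Lin f) (hg : Lin g) : Lin fun v => f v + g v := by
  obtain ⟨L, hL⟩ := hf; obtain ⟨L', hL'⟩ := hg
  exact ⟨L + L', fun v => by simp [hL, hL']⟩

lemma sub (hf : Lin f) (hg : Lin g) : Lin fun v => f v - g v := by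
  obtain ⟨L, hL⟩ := hf; obtain ⟨L', hL'⟩ := hg
  exact ⟨L - L', fun v => by simp [hL, hL']⟩

lemma const_mul (c : ℝ) (hf : Lin f) : Lin fun v => c * f v := by
  obtain ⟨L, hL⟩ := hf
  exact ⟨c • L, fun v => by simp [hL]⟩

lemma mul_const (hf : Lin f) (c : ℝ) : Lin fun v => f v * c := by
  obtain ⟨L, hL⟩ := hf
  exact ⟨c • L, fun v => by simp [hL, mul_comm]⟩

lemma sum {ι : Type*} {s : Finset ι} {f : ι → (Fin n → ℝ) → ℝ} (h : ∀ i, Lin (f i)) :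
    Lin fun v => ∑ i ∈ s, f i v := by
  choose L hL using h
  exact ⟨∑ i ∈ s, L i, fun v => by simp [hL]⟩

lemma eq_sum (hf : Lin f) (v : Fin n → ℝ) : f v = ∑ k, v k * f (Pi.single k 1) := by
  obtain ⟨L, hL⟩ := hf
  rw [hL]
  conv_lhs => rw [← Finset.univ_sum_single v, map_sum]
  refine Finset.sum_congr rfl fun k _ => ?_
  rw [hL, ← smul_eq_mul, ← map_smul, ← Pi.single_smul', smul_eq_mul, mul_one]

end Lin

/-- Transformation of a 2-tensor. -/
def pull2 (M H : Matrix (Fin n) (Fin n) ℝ) : Matrix (Fin n) (Fin n) ℝ := M.transpose * H * M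

/-- The contraction of a 2-tensor with a bilinear form does not depend on the orthonormal basis. -/
lemma sum_pull2 {M : Matrix (Fin n) (Fin n) ℝ} (hM : M * M.transpose = 1)
    (H : Matrix (Fin n) (Fin n) ℝ) {B : (Fin n → ℝ) → (Fin n → ℝ) → ℝ} (h1 : ∀ w, Lin fun v => B v w)
    (h2 : ∀ v, Lin (B v)) :
    ∑ k, ∑ l, pull2 M H k l * B (fun a => M a k) (fun a => M a l) =
      ∑ k, ∑ l, H k l * B (Pi.single k 1) (Pi.single l 1) := by
  set X : Matrix (Fin n) (Fin n) ℝ := Matrix.of fun k l => B (Pi.single k 1) (Pi.single l 1) with hX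
  have e : ∀ k l, B (fun a => M a k) (fun a => M a l) = pull2 M X k l := by
    intro k l
    rw [(h1 _).eq_sum]
    simp only [pull2, Matrix.mul_apply, Matrix.transpose_apply, Finset.sum_mul, hX, Matrix.of_apply]
    rw [Finset.sum_comm]
    refine Finset.sum_congr rfl fun a _ => ?_
    rw [(h2 _).eq_sum, Finset.mul_sum]
    exact Finset.sum_congr rfl fun b _ => by ring
  have tr : ∀ A B : Matrix (Fin n) (Fin n) ℝ, ∑ k, ∑ l, A k l * B k l = (A.transpose * B).trace := by
    intro A B
    simp only [Matrix.trace, Matrix.diag, Matrix.mul_apply, Matrix.transpose_apply]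
    exact Finset.sum_comm
  simp only [e]
  change _ = ∑ k, ∑ l, H k l * X k l
  rw [tr, tr]
  simp only [pull2, Matrix.transpose_mul, Matrix.transpose_transpose]
  calc (M.transpose * (H.transpose * M) * (M.transpose * X * M)).trace
      = (M.transpose * (H.transpose * (M * M.transpose) * X * M)).trace := by
        simp only [Matrix.mul_assoc]
    _ = (H.transpose * X * (M * M.transpose)).trace := by
        rw [hM, Matrix.trace_mul_comm]; simp only [Matrix.mul_assoc, hM, Matrix.mul_one]
    _ = _ := by rw [hM, Matrix.mul_one]

end Multilinear

section Equivariance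

variable {K : (Fin 4 → ℝ) → (Fin 4 → ℝ) → (Fin 4 → ℝ) → (Fin 4 → ℝ) → ℝ}
  {D : (Fin 4 → ℝ) → (Fin 4 → ℝ) → (Fin 4 → ℝ) → ℝ} {M : Matrix (Fin 4) (Fin 4) ℝ}

/-- The Ricci tensor built from the second jet of a metric transforms as a 2-tensor. -/
lemma ric_pull (hM : M * M.transpose = 1) (H : Matrix (Fin 4) (Fin 4) ℝ)
    (K1 : ∀ w x y, Lin fun v => K v w x y) (K2 : ∀ v x y, Lin fun w => K v w x y)
    (K3 : ∀ v w y, Lin fun x => K v w x y) (K4 : ∀ v w x, Lin fun y => K v w x y)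
    (D1 : ∀ w x, Lin fun v => D v w x) (D2 : ∀ v x, Lin fun w => D v w x)
    (D3 : ∀ v w, Lin fun x => D v w x)
    (h : ∀ i j, ricLin H (fun k l a b => K (cv k) (cv l) (cv a) (cv b)) i j +
      ricQuad H (gam fun k a b => D (cv k) (cv a) (cv b)) i j = 0) (i j : Fin 4) :
    let m : Fin 4 → Fin 4 → ℝ := fun k a => M a k
    ricLin (pull2 M H) (fun k l a b => K (m k) (m l) (m a) (m b)) i j +
      ricQuad (pull2 M H) (gam fun k a b => D (m k) (m a) (m b)) i j = 0 := by
  intro m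
  set Γ : (Fin 4 → ℝ) → (Fin 4 → ℝ) → (Fin 4 → ℝ) → ℝ := fun x v w =>
    1 / 2 * (D v w x + D w v x - D x v w) with hΓ
  have Γ1 : ∀ v w, Lin fun x => Γ x v w := fun v w =>
    (((D3 _ _).add (D3 _ _)).sub (D1 _ _)).const_mul _
  have Γ2 : ∀ x w, Lin fun v => Γ x v w := fun x w =>
    (((D1 _ _).add (D2 _ _)).sub (D2 _ _)).const_mul _
  have Γ3 : ∀ x v, Lin fun w => Γ x v w := fun x v =>
    (((D2 _ _).add (D1 _ _)).sub (D3 _ _)).const_mul _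
  -- the Ricci form of two vectors
  set R : (Fin 4 → ℝ) → (Fin 4 → ℝ) → ℝ := fun v w =>
    1 / 2 * (∑ k, ∑ l, H k l * (K (cv k) v (cv l) w + K (cv l) w v (cv k) - K (cv k) (cv l) v w
      - K v w (cv k) (cv l))) +
    ∑ k, ∑ l, H k l * ∑ b, ∑ c, H b c *
      (Γ (cv b) w (cv l) * Γ (cv c) v (cv k) - Γ (cv b) (cv k) (cv l) * Γ (cv c) v w) with hR
  have R1 : ∀ w, Lin fun v => R v w := fun w =>
    ((Lin.sum fun k => Lin.sum fun l => Lin.const_mul _ ((((K2 _ _ _).add (K3 _ _ _)).sub (K3 _ _ _)).sub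
      (K1 _ _ _))).const_mul _).add (Lin.sum fun k => Lin.sum fun l => Lin.const_mul _
        (Lin.sum fun b => Lin.sum fun c => Lin.const_mul _
          ((Lin.const_mul _ (Γ2 _ _)).sub (Lin.const_mul _ (Γ2 _ _)))))
  have R2 : ∀ v, Lin fun w => R v w := fun v =>
    ((Lin.sum fun k => Lin.sum fun l => Lin.const_mul _ ((((K4 _ _ _).add (K2 _ _ _)).sub (K4 _ _ _)).sub
      (K2 _ _ _))).const_mul _).add (Lin.sum fun k => Lin.sum fun l => Lin.const_mul _
        (Lin.sum fun b => Lin.sum fun c => Lin.const_mul _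
          (((Γ2 _ _).mul_const _).sub (Lin.const_mul _ (Γ3 _ _)))))
  have hR0 : ∀ i j, R (cv i) (cv j) = 0 := by
    intro i j
    exact (congrArg₂ (· + ·) rfl (ricQuad_eq H (gam fun k a b => D (cv k) (cv a) (cv b)) i j).symm).trans
      (h i j)
  have hz : ∀ v w, R v w = 0 := by
    intro v w
    rw [(R1 w).eq_sum]
    refine Finset.sum_eq_zero fun k _ => ?_
    rw [(R2 _).eq_sum, Finset.sum_eq_zero fun l _ => by rw [hR0, mul_zero], mul_zero]
  refine Eq.trans ?_ (hz (m i) (m j))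
  refine congrArg₂ (· + ·) (congrArg (fun t : ℝ => 1 / 2 * t) ?_)
    ((ricQuad_eq (pull2 M H) (gam fun k a b => D (m k) (m a) (m b)) i j).trans ?_)
  · exact sum_pull2 hM H (B := fun v w => K v (m i) w (m j) + K w (m j) (m i) v - K v w (m i) (m j)
      - K (m i) (m j) v w)
      (fun w => (((K1 _ _ _).add (K4 _ _ _)).sub (K1 _ _ _)).sub (K3 _ _ _))
      (fun v => (((K3 _ _ _).add (K1 _ _ _)).sub (K2 _ _ _)).sub (K4 _ _ _))
  · have inner : ∀ k l, (∑ b, ∑ c, pull2 M H b c * (Γ (m b) (m j) (m l) * Γ (m c) (m i) (m k) -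
        Γ (m b) (m k) (m l) * Γ (m c) (m i) (m j))) =
        ∑ b, ∑ c, H b c * (Γ (cv b) (m j) (m l) * Γ (cv c) (m i) (m k) -
        Γ (cv b) (m k) (m l) * Γ (cv c) (m i) (m j)) := fun k l =>
      sum_pull2 hM H (B := fun x y => Γ x (m j) (m l) * Γ y (m i) (m k) -
        Γ x (m k) (m l) * Γ y (m i) (m j))
        (fun w => ((Γ1 _ _).mul_const _).sub ((Γ1 _ _).mul_const _))
        (fun v => (Lin.const_mul _ (Γ1 _ _)).sub (Lin.const_mul _ (Γ1 _ _)))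
    change ∑ k, ∑ l, pull2 M H k l * (∑ b, ∑ c, pull2 M H b c *
      (Γ (m b) (m j) (m l) * Γ (m c) (m i) (m k) - Γ (m b) (m k) (m l) * Γ (m c) (m i) (m j))) = _
    refine Eq.trans (Finset.sum_congr rfl fun k _ => Finset.sum_congr rfl fun l _ =>
      congrArg (fun t : ℝ => pull2 M H k l * t) (inner k l)) ?_
    exact sum_pull2 hM H (B := fun v w => ∑ b, ∑ c, H b c * (Γ (cv b) (m j) w * Γ (cv c) (m i) v -
        Γ (cv b) v w * Γ (cv c) (m i) (m j)))
      (fun w => Lin.sum fun b => Lin.sum fun c => Lin.const_mul _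
        ((Lin.const_mul _ (Γ3 _ _)).sub ((Γ2 _ _).mul_const _)))
      (fun w => Lin.sum fun b => Lin.sum fun c => Lin.const_mul _
        (((Γ3 _ _).mul_const _).sub ((Γ3 _ _).mul_const _)))

variable {G : (Fin 4 → ℝ) → Matrix (Fin 4) (Fin 4) ℝ} {O : Set (Fin 4 → ℝ)}

/-- The Ricci tensor of a pulled back metric vanishes where that of the metric does. -/
lemma ricci_pull (hM : M * M.transpose = 1) (hO : IsOpen O)
    (hG : ∀ i j, ContDiffOn ℝ ∞ (fun q => G q i j) O)
    (hsymm : ∀ q ∈ O, ∀ i j, G q i j = G q j i) {p : Fin 4 → ℝ} (hp : M.mulVec p ∈ O)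
    {H : Matrix (Fin 4) (Fin 4) ℝ} (hH : G (M.mulVec p) * H = 1)
    (h : ∀ i j, ricci G i j (M.mulVec p) = 0) (i j : Fin 4) :
    ricci (fun q => pull2 M (G (M.mulVec q))) i j p = 0 := by
  set L : (Fin 4 → ℝ) →L[ℝ] (Fin 4 → ℝ) := LinearMap.toContinuousLinearMap M.mulVecLin with hL
  have hLa : ∀ q, L q = M.mulVec q := fun q => rfl
  have hO' : IsOpen (L ⁻¹' O) := hO.preimage L.continuous
  have hGc : ∀ x y : Fin 4 → ℝ, ContDiffOn ℝ ∞ (fun q => ∑ a, ∑ b, x a * y b * G q a b) O := fun x y =>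
    ContDiffOn.sum fun a _ => ContDiffOn.sum fun b _ => contDiffOn_const.mul (hG a b)
  have hpull : ∀ q i j, pull2 M (G (M.mulVec q)) i j = ∑ a, ∑ b, M a i * M b j * G (L q) a b := by
    intro q i j
    simp only [pull2, Matrix.mul_apply, Matrix.transpose_apply, Finset.sum_mul, hLa]
    rw [Finset.sum_comm]
    exact Finset.sum_congr rfl fun a _ => Finset.sum_congr rfl fun b _ => by ring
  have chain : ∀ {f : (Fin 4 → ℝ) → ℝ} (_ : ContDiffOn ℝ ∞ f O) (v : Fin 4 → ℝ), ∀ q ∈ L ⁻¹' O,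
      dd v (fun q => f (L q)) q = dd (L v) f (L q) := by
    intro f hf v q hq
    have := (smooth_differentiableAt hO hf hq).hasFDerivAt.comp q L.hasFDerivAt
    rw [dd, show fderiv ℝ (fun q => f (L q)) q = _ from this.fderiv]; rfl
  have hcol : ∀ k : Fin 4, L (cv k) = fun a => M a k := fun k => by
    rw [hLa, Matrix.mulVec_single_one]; rfl
  have hM' : M.transpose * M = 1 := mul_eq_one_comm.1 hM
  have hH' : pull2 M (G (M.mulVec p)) * pull2 M H = 1 := by
    simp only [pull2]
    calc _ = M.transpose * (G (M.mulVec p) * ((M * M.transpose) * H)) * M := by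
          simp only [Matrix.mul_assoc]
      _ = 1 := by rw [hM, Matrix.one_mul, hH, Matrix.mul_one, hM']
  have hsm : ∀ i j, ContDiffOn ℝ ∞ (fun q => pull2 M (G (M.mulVec q)) i j) (L ⁻¹' O) := fun i j =>
    ((hGc (fun a => M a i) (fun b => M b j)).comp (L.contDiff.contDiffOn) fun q hq => hq).congr
      fun q _ => hpull q i j
  have hsy : ∀ q ∈ L ⁻¹' O, ∀ i j, pull2 M (G (M.mulVec q)) i j = pull2 M (G (M.mulVec q)) j i := by
    intro q hq i j
    rw [hpull, hpull, Finset.sum_comm]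
    exact Finset.sum_congr rfl fun a _ => Finset.sum_congr rfl fun b _ => by
      rw [hsymm _ hq b a]; ring
  rw [ricci_eq hO' hsm hsy hp hH']
  set D : (Fin 4 → ℝ) → (Fin 4 → ℝ) → (Fin 4 → ℝ) → ℝ := fun v x y =>
    dd v (fun q => ∑ a, ∑ b, x a * y b * G q a b) (L p) with hD
  set K : (Fin 4 → ℝ) → (Fin 4 → ℝ) → (Fin 4 → ℝ) → (Fin 4 → ℝ) → ℝ := fun v w x y =>
    dd v (dd w fun q => ∑ a, ∑ b, x a * y b * G q a b) (L p) with hK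
  have eD : ∀ k a b, dd (cv k) (fun q => pull2 M (G (M.mulVec q)) a b) p =
      D (fun c => M c k) (fun c => M c a) (fun c => M c b) := fun k a b => by
    rw [dd_congr hO' (fun q _ => hpull q a b) hp, chain (hGc _ _) _ _ hp, hcol]
  have eK : ∀ k l a b, dd (cv k) (dd (cv l) fun q => pull2 M (G (M.mulVec q)) a b) p =
      K (fun c => M c k) (fun c => M c l) (fun c => M c a) (fun c => M c b) := fun k l a b => by
    rw [dd_congr hO' (fun q hq => (dd_congr hO' (fun q _ => hpull q a b) hq _).trans
      (chain (hGc _ _) (cv l) q hq)) hp, hcol, chain (smooth_dd hO (hGc _ _) _) _ _ hp, hcol]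
  simp only [eD, eK]
  have dG : ∀ a b, ∀ q ∈ O, DifferentiableAt ℝ (fun q => G q a b) q := fun a b q hq =>
    smooth_differentiableAt hO (hG a b) hq
  have dG1 : ∀ a b w, ∀ q ∈ O, DifferentiableAt ℝ (dd w fun q => G q a b) q := fun a b w q hq =>
    smooth_differentiableAt hO (smooth_dd hO (hG a b) w) hq
  have first : ∀ w x y : Fin 4 → ℝ, ∀ q ∈ O, dd w (fun q => ∑ a, ∑ b, x a * y b * G q a b) q =
      ∑ a, ∑ b, x a * y b * dd w (fun q => G q a b) q := by
    intro w x y q hq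
    have h1 : ∀ a, ∀ b ∈ Finset.univ, DifferentiableAt ℝ (fun q => x a * y b * G q a b) q := fun a b _ =>
      (dG a b q hq).const_mul _
    have h2 : ∀ a ∈ Finset.univ, DifferentiableAt ℝ (fun q => ∑ b, x a * y b * G q a b) q := fun a _ =>
      DifferentiableAt.fun_sum (h1 a)
    rw [dd_sum h2]
    refine Finset.sum_congr rfl fun a _ => ?_
    rw [dd_sum (h1 a)]
    exact Finset.sum_congr rfl fun b _ => dd_const_mul (dG a b q hq) _
  have second : ∀ v w x y : Fin 4 → ℝ, K v w x y =
      ∑ a, ∑ b, x a * y b * dd v (dd w fun q => G q a b) (L p) := by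
    intro v w x y
    have h1 : ∀ a, ∀ b ∈ Finset.univ,
        DifferentiableAt ℝ (fun q => x a * y b * dd w (fun q => G q a b) q) (L p) := fun a b _ =>
      (dG1 a b w _ hp).const_mul _
    have h2 : ∀ a ∈ Finset.univ,
        DifferentiableAt ℝ (fun q => ∑ b, x a * y b * dd w (fun q => G q a b) q) (L p) := fun a _ =>
      DifferentiableAt.fun_sum (h1 a)
    rw [hK]
    change dd v (dd w fun q => ∑ a, ∑ b, x a * y b * G q a b) (L p) = _
    have hpL : L p ∈ O := hp
    rw [dd_congr hO (first w x y) hpL, dd_sum h2]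
    refine Finset.sum_congr rfl fun a _ => ?_
    rw [dd_sum (h1 a)]
    exact Finset.sum_congr rfl fun b _ => dd_const_mul (dG1 a b w _ hp) _
  have linDir : ∀ f : (Fin 4 → ℝ) → ℝ, Lin fun v => dd v f (L p) := fun f =>
    ⟨(fderiv ℝ f (L p)).toLinearMap, fun v => rfl⟩
  have linDir2 : ∀ a b v, Lin fun w => dd v (dd w fun q => G q a b) (L p) := fun a b v =>
    (linDir (dd v fun q => G q a b)).elim fun T hT =>
      ⟨T, fun w => (dd_comm hO (hG a b) hp v w).trans (hT w)⟩
  have coord : ∀ a : Fin 4, Lin fun x : Fin 4 → ℝ => x a := fun a => ⟨LinearMap.proj a, fun v => rfl⟩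
  have hDe : ∀ v x y, D v x y = ∑ a, ∑ b, x a * y b * dd v (fun q => G q a b) (L p) := fun v x y =>
    first v x y _ hp
  refine ric_pull hM H (K := K) (D := D) (fun w x y => linDir _) (fun v x y => ?_) (fun v w y => ?_)
    (fun v w x => ?_) (fun w x => linDir _) (fun v x => ?_) (fun v w => ?_) (fun i j => ?_) i j
  · simp only [second]
    exact Lin.sum fun a => Lin.sum fun b => (linDir2 a b v).const_mul _
  · simp only [second]
    exact Lin.sum fun a => Lin.sum fun b => ((coord a).mul_const _).mul_const _
  · simp only [second]
    exact Lin.sum fun a => Lin.sum fun b => ((coord b).const_mul _).mul_const _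
  · simp only [hDe]
    exact Lin.sum fun a => Lin.sum fun b => ((coord a).mul_const _).mul_const _
  · simp only [hDe]
    exact Lin.sum fun a => Lin.sum fun b => ((coord b).const_mul _).mul_const _
  · rw [← h i j, ricci_eq hO hG hsymm hp hH]
    have e1 : ∀ k a b, D (cv k) (cv a) (cv b) = dd (cv k) (fun q => G q a b) (L p) := fun k a b => by
      rw [hDe]; simp [Pi.single_apply]
    have e2 : ∀ k l a b, K (cv k) (cv l) (cv a) (cv b) = dd (cv k) (dd (cv l) fun q => G q a b) (L p) :=
      fun k l a b => by rw [second]; simp [Pi.single_apply]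
    simp only [e1, e2]; rfl

end Equivariance

/-! ### Rotating a Bondi–Sachs metric -/

/-- The matrix of a linear isometry of `ℝ³`. -/
def mat (Q : E ≃ₗᵢ[ℝ] E) : Matrix (Fin 3) (Fin 3) ℝ := Matrix.of fun i j => Q (bv j) i

lemma mat_transpose_mul (Q : E ≃ₗᵢ[ℝ] E) : (mat Q).transpose * mat Q = 1 := by
  ext a b
  simp only [Matrix.mul_apply, Matrix.transpose_apply, mat, Matrix.of_apply, BondiSachsMetric.sum_isometry,
    Matrix.one_apply]

lemma mat_mul_transpose (Q : E ≃ₗᵢ[ℝ] E) : mat Q * (mat Q).transpose = 1 :=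
  mul_eq_one_comm.1 (mat_transpose_mul Q)

lemma isometry_apply (Q : E ≃ₗᵢ[ℝ] E) (y : E) (i : Fin 3) : Q y i = ∑ j, mat Q i j * y j := by
  conv_lhs => rw [← sum_smul_bv y]
  simp [mat, map_sum, map_smul, mul_comm]

lemma sum_mat_mul (Q : E ≃ₗᵢ[ℝ] E) (y : E) (j : Fin 3) : ∑ i, mat Q i j * Q y i = y j := by
  have h := congrFun (congrArg (fun A : Matrix (Fin 3) (Fin 3) ℝ => A.mulVec y.ofLp)
    (mat_transpose_mul Q)) j
  rw [Matrix.one_mulVec, ← Matrix.mulVec_mulVec] at h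
  rw [← h]
  simp only [Matrix.mulVec, dotProduct, Matrix.transpose_apply, isometry_apply]

lemma unit_isometry (Q : E ≃ₗᵢ[ℝ] E) (y : E) : unit (Q y) = Q (unit y) := by
  simp [unit, Q.norm_map, map_smul]

lemma isometry_mem {x : E} (Q : E ≃ₗᵢ[ℝ] E) (hx : x ∈ S2) : Q x ∈ S2 := by
  rw [mem_sphere_zero_iff_norm, Q.norm_map]; exact norm_of_mem_S2 hx

lemma isometry_ne_zero {y : E} (Q : E ≃ₗᵢ[ℝ] E) (hy : y ≠ 0) : Q y ≠ 0 := by simpa using hy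

lemma sum_mat_mat' (Q : E ≃ₗᵢ[ℝ] E) (i j : Fin 3) :
    ∑ k, mat Q i k * mat Q j k = if i = j then 1 else 0 := by
  have h := congrFun (congrFun (mat_mul_transpose Q) i) j
  simpa only [Matrix.mul_apply, Matrix.transpose_apply, Matrix.one_apply] using h

/-- The isometry acting on the last factor of `X`. -/
def rotX (Q : E ≃ₗᵢ[ℝ] E) (q : X) : X := (q.1, q.2.1, Q q.2.2)

lemma contDiff_rotX (Q : E ≃ₗᵢ[ℝ] E) : ContDiff ℝ ∞ (rotX Q) :=
  contDiff_fst.prodMk (contDiff_snd.fst.prodMk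
    (Q.toContinuousLinearEquiv.contDiff.comp contDiff_snd.snd))

lemma rotX_mem {I : Set ℝ} {ρ₀ : ℝ} (Q : E ≃ₗᵢ[ℝ] E) {q : X} (hq : q ∈ dom I ρ₀) :
    rotX Q q ∈ dom I ρ₀ := ⟨hq.1, hq.2.1, isometry_ne_zero Q hq.2.2⟩

lemma smooth_comp_rotX {I : Set ℝ} {ρ₀ : ℝ} (Q : E ≃ₗᵢ[ℝ] E) {f : X → ℝ}
    (hf : ContDiffOn ℝ ∞ f (dom I ρ₀)) : ContDiffOn ℝ ∞ (fun q => f (rotX Q q)) (dom I ρ₀) :=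
  hf.comp (contDiff_rotX Q).contDiffOn fun _ hq => rotX_mem Q hq

lemma SmoothCoeff.rotate {I : Set ℝ} {ρ₀ : ℝ} {F : ℝ → ℝ → E → ℝ} (hF : SmoothCoeff I ρ₀ F)
    (Q : E ≃ₗᵢ[ℝ] E) : SmoothCoeff I ρ₀ fun u ρ x => F u ρ (Q x) := by
  refine (smooth_comp_rotX Q hF).congr fun q _ => ?_
  simp only [rotX, unit_isometry]

lemma sum_pull2_mul (Q : E ≃ₗᵢ[ℝ] E) (h : Matrix (Fin 3) (Fin 3) ℝ) (v w : E) :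
    ∑ i, ∑ j, pull2 (mat Q) h i j * v i * w j = ∑ i, ∑ j, h i j * Q v i * Q w j := by
  have e1 : ∀ (A : Matrix (Fin 3) (Fin 3) ℝ) (v w : E),
      ∑ i, ∑ j, A i j * v i * w j = dotProduct v.ofLp (A.mulVec w.ofLp) := by
    intro A v w
    simp only [dotProduct, Matrix.mulVec, Finset.mul_sum]
    exact Finset.sum_congr rfl fun i _ => Finset.sum_congr rfl fun j _ => by ring
  have e2 : ∀ v, (Q v).ofLp = (mat Q).mulVec v.ofLp := fun v => funext fun i => isometry_apply Q v i
  rw [e1, e1, e2, e2, pull2, ← Matrix.mulVec_mulVec, ← Matrix.mulVec_mulVec,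
    Matrix.dotProduct_mulVec, Matrix.vecMul_transpose]

lemma pull2_apply {n : ℕ} (M H : Matrix (Fin n) (Fin n) ℝ) (i j : Fin n) :
    pull2 M H i j = ∑ k, ∑ l, M k i * M l j * H k l := by
  simp only [pull2, Matrix.mul_apply, Matrix.transpose_apply, Finset.sum_mul]
  rw [Finset.sum_comm]
  exact Finset.sum_congr rfl fun a _ => Finset.sum_congr rfl fun b _ => by ring

lemma pull2_proj (Q : E ≃ₗᵢ[ℝ] E) (x : E) : pull2 (mat Q) (proj (Q x)) = proj x := by
  have e : ∀ y : E, proj y = 1 - Matrix.vecMulVec y.ofLp y.ofLp := by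
    intro y; ext i j; simp [proj, Matrix.one_apply, Matrix.vecMulVec_apply]
  rw [e, e, pull2, Matrix.mul_sub, Matrix.sub_mul, Matrix.mul_one, mat_transpose_mul]
  congr 1
  rw [Matrix.mul_vecMulVec, Matrix.vecMulVec_mul]
  have h : (mat Q).transpose.mulVec (Q x).ofLp = x.ofLp := funext fun j => by
    simpa only [Matrix.mulVec, dotProduct, Matrix.transpose_apply] using sum_mat_mul Q x j
  rw [← Matrix.mulVec_transpose, h]

namespace BondiSachsMetric

variable {I : Set ℝ} {ρ₀ : ℝ} (g : BondiSachsMetric I ρ₀)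

/-- The Bondi–Sachs metric pulled back by a linear isometry of `ℝ³`. -/
def rotate (hI : IsOpen I) (hρ₀ : 0 < ρ₀) (Q : E ≃ₗᵢ[ℝ] E) : BondiSachsMetric I ρ₀ where
  U u ρ x := g.U u ρ (Q x)
  V u ρ x := g.V u ρ (Q x)
  W u ρ x := WithLp.toLp 2 fun i => ∑ k, mat Q k i * g.W u ρ (Q x) k
  h u ρ x := pull2 (mat Q) (g.h u ρ (Q x))
  smooth_U := g.smooth_U.rotate Q
  smooth_V := g.smooth_V.rotate Q
  smooth_W i := by
    have h := fun k => (g.smooth_W k).rotate Q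
    simp only [SmoothCoeff] at h ⊢
    exact ContDiffOn.sum fun k _ => contDiffOn_const.mul (h k)
  smooth_h i j := by
    simp only [pull2_apply]
    exact ContDiffOn.sum fun k _ => ContDiffOn.sum fun l _ =>
      contDiffOn_const.mul ((g.smooth_h k l).rotate Q)
  U_pos u hu ρ hρ x hx := g.U_pos u hu ρ hρ _ (isometry_mem Q hx)
  W_tangent u hu ρ hρ x hx := by
    rw [← g.W_tangent u hu ρ hρ _ (isometry_mem Q hx)]
    simp only [isometry_apply, Finset.sum_mul, Finset.mul_sum]
    rw [Finset.sum_comm]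
    exact Finset.sum_congr rfl fun a _ => Finset.sum_congr rfl fun b _ => by ring
  h_symm u hu ρ hρ x hx i j := by
    rw [pull2_apply, pull2_apply, Finset.sum_comm]
    refine Finset.sum_congr rfl fun a _ => Finset.sum_congr rfl fun b _ => ?_
    rw [g.h_symm u hu ρ hρ _ (isometry_mem Q hx) b a]; ring
  h_tangent u hu ρ hρ x hx i := by
    have h : ∀ k, ∑ l, g.h u ρ (Q x) k l * Q x l = 0 := g.h_tangent u hu ρ hρ _ (isometry_mem Q hx)
    simp only [isometry_apply, Finset.mul_sum] at h
    simp only [pull2_apply, Finset.sum_mul]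
    rw [Finset.sum_comm]
    refine Finset.sum_eq_zero fun k _ => ?_
    rw [Finset.sum_comm]
    calc _ = mat Q k i * ∑ l, ∑ j, g.h u ρ (Q x) k l * (mat Q l j * x j) := by
          simp only [Finset.mul_sum]
          exact Finset.sum_congr rfl fun a _ => Finset.sum_congr rfl fun b _ => by ring
      _ = 0 := by rw [h, mul_zero]
  h_det u hu ρ hρ x hx v w ho := by
    have := g.h_det u hu ρ hρ _ (isometry_mem Q hx) (Q v) (Q w) (by
      have h := ho.comp_linearIsometry Q.toLinearIsometry
      convert h using 1
      ext i; fin_cases i <;> rfl)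
    simpa only [sum_pull2_mul] using this
  U_zero u hu x hx := g.U_zero u hu _ (isometry_mem Q hx)
  U_one u hu x hx := g.U_one u hu _ (isometry_mem Q hx)
  V_zero u hu x hx := g.V_zero u hu _ (isometry_mem Q hx)
  W_zero u hu x hx := by
    ext i; simp [g.W_zero u hu _ (isometry_mem Q hx)]
  W_one u hu x hx i := by
    have hx' := isometry_mem Q hx
    have hd : ∀ k, DifferentiableAt ℝ (fun ρ => g.W u ρ (Q x) k) 0 := fun k => by
      have := (hasDerivAt_line hI (g.smooth_W k) (zero_mem_dom (p := (u, Q x)) hρ₀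
        ⟨hu, ne_zero_of_mem_S2 hx'⟩)).differentiableAt
      simpa only [unit_of_mem hx'] using this
    have e : ∀ k ∈ Finset.univ, DifferentiableAt ℝ (fun ρ => mat Q k i * g.W u ρ (Q x) k) 0 :=
      fun k _ => (hd k).const_mul _
    change deriv (fun ρ => ∑ k, mat Q k i * g.W u ρ (Q x) k) 0 = 0
    rw [deriv_fun_sum e]
    refine Finset.sum_eq_zero fun k _ => ?_
    rw [deriv_const_mul _ (hd k), g.W_one u hu _ hx', mul_zero]
  h_zero u hu x hx := by
    rw [g.h_zero u hu _ (isometry_mem Q hx), pull2_proj]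

/-- The isometry acting on the coordinates `(u, y)` of `ℝ⁴`. -/
def mat4 (Q : E ≃ₗᵢ[ℝ] E) : Matrix (Fin 4) (Fin 4) ℝ :=
  Matrix.of (Fin.cons (Fin.cons 1 0) fun i => Fin.cons 0 (mat Q i))

lemma mat4_mul_transpose (Q : E ≃ₗᵢ[ℝ] E) : mat4 Q * (mat4 Q).transpose = 1 := by
  ext i j
  refine Fin.cases (Fin.cases ?_ (fun j => ?_) j) (fun i => Fin.cases ?_ (fun j => ?_) j) i <;>
    simp [Matrix.mul_apply, mat4, Fin.sum_univ_succ (n := 3), Matrix.one_apply]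
  · simpa using fun h => absurd h (Fin.succ_ne_zero j).symm
  · simpa [Fin.sum_univ_three] using sum_mat_mat' Q i j

variable {g}

lemma mulVec_mat4 (Q : E ≃ₗᵢ[ℝ] E) (p : Fin 4 → ℝ) :
    (mat4 Q).mulVec p 0 = p 0 ∧ spatial ((mat4 Q).mulVec p) = Q (spatial p) := by
  constructor
  · simp [Matrix.mulVec, dotProduct, mat4, Fin.sum_univ_succ (n := 3)]
  · ext i
    rw [isometry_apply]
    simp [spatial, Matrix.mulVec, dotProduct, mat4, Fin.sum_univ_succ (n := 3)]

lemma sum_mat4 (Q : E ≃ₗᵢ[ℝ] E) (v : Fin 4 → ℝ) (j : Fin 4) : ∑ i, mat4 Q i j * v i =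
    (Fin.cons (v 0) fun j => ∑ i, mat Q i j * v (Fin.succ i) : Fin 4 → ℝ) j := by
  rw [Fin.sum_univ_succ]
  refine Fin.cases ?_ (fun j => ?_) j <;> simp [mat4]

variable (g) in
/-- The rotated Bondi–Sachs metric is the pullback of the original one by the isometry of `ℝ⁴` that fixes
`u`. -/
lemma metric_rotate (hI : IsOpen I) (hρ₀ : 0 < ρ₀) (Q : E ≃ₗᵢ[ℝ] E) (p : Fin 4 → ℝ) :
    (g.rotate hI hρ₀ Q).metric p = pull2 (mat4 Q) (g.metric ((mat4 Q).mulVec p)) := by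
  obtain ⟨h0, h1⟩ := mulVec_mat4 Q p
  ext μ ν
  have hu : ∀ μ, ∑ a, mat4 Q a μ * duCo a = duCo μ := fun μ => by
    rw [sum_mat4]; refine Fin.cases ?_ (fun j => ?_) μ <;> simp [duCo]
  have hr : ∀ μ, ∑ a, mat4 Q a μ * drCo ((mat4 Q).mulVec p) a = drCo p μ := fun μ => by
    rw [sum_mat4]
    refine Fin.cases ?_ (fun j => ?_) μ
    · simp [drCo]
    · simp [drCo, h1, unit_isometry, sum_mat_mul]
  have hx : ∀ k μ, ∑ a, mat4 Q a μ * dxCo ((mat4 Q).mulVec p) k a = ∑ j, mat Q k j * dxCo p j μ := by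
    intro k μ
    rw [sum_mat4]
    refine Fin.cases ?_ (fun j => ?_) μ
    · simp [dxCo]
    · have h2 : ∑ i, mat Q i j * proj (Q (unit (spatial p))) k i =
          ∑ i, mat Q k i * proj (unit (spatial p)) i j := by
        simp only [proj, mul_sub, Finset.sum_sub_distrib]
        congr 1
        · simp
        · calc _ = Q (unit (spatial p)) k * ∑ i, mat Q i j * Q (unit (spatial p)) i := by
                rw [Finset.mul_sum]; exact Finset.sum_congr rfl fun _ _ => by ring
            _ = _ := by
                rw [sum_mat_mul, isometry_apply, Finset.sum_mul]
                exact Finset.sum_congr rfl fun _ _ => by ring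
      simp only [dxCo, Fin.cons_succ, h1, unit_isometry, Q.norm_map]
      simp only [mul_left_comm _ (‖spatial p‖⁻¹), ← Finset.mul_sum, h2]
  -- the pullback is linear in the metric
  set P : (Fin 4 → Fin 4 → ℝ) →ₗ[ℝ] ℝ :=
    { toFun := fun F => ∑ a, ∑ b, mat4 Q a μ * mat4 Q b ν * F a b
      map_add' := fun F G => by simp [mul_add, Finset.sum_add_distrib]
      map_smul' := fun c F => by
        simp only [Pi.smul_apply, smul_eq_mul, Finset.mul_sum, RingHom.id_apply]
        exact Finset.sum_congr rfl fun i _ => Finset.sum_congr rfl fun j _ => by ring } with hP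
  have hPm : ∀ v w : Fin 4 → ℝ, P (fun a b => v a * w b) =
      (∑ a, mat4 Q a μ * v a) * ∑ b, mat4 Q b ν * w b := fun v w => by
    change ∑ a, ∑ b, mat4 Q a μ * mat4 Q b ν * (v a * w b) = _
    rw [Finset.sum_mul_sum]
    exact Finset.sum_congr rfl fun i _ => Finset.sum_congr rfl fun j _ => by ring
  set q := (mat4 Q).mulVec p with hq
  set u := p 0
  set x := unit (spatial p) with hxd
  set ρ := ‖spatial p‖⁻¹ with hρ
  set θ : Fin 3 → Fin 4 → ℝ := fun k μ => dxCo q k μ + g.W u ρ (Q x) k * duCo μ with hθ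
  set θ' : Fin 3 → Fin 4 → ℝ := fun k μ =>
    dxCo p k μ + (∑ j, mat Q j k * g.W u ρ (Q x) j) * duCo μ with hθ'
  have hθe : ∀ k μ, ∑ a, mat4 Q a μ * θ k a = ∑ j, mat Q k j * θ' j μ := by
    intro k μ
    simp only [hθ, hθ', mul_add, Finset.sum_add_distrib, hx]
    congr 1
    calc _ = g.W u ρ (Q x) k * ∑ a, mat4 Q a μ * duCo a := by
          rw [Finset.mul_sum]; exact Finset.sum_congr rfl fun _ _ => by ring
      _ = ∑ l, (∑ j, mat Q k j * mat Q l j) * (g.W u ρ (Q x) l * duCo μ) := by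
          simp [hu, sum_mat_mat']
      _ = _ := by
          simp only [Finset.sum_mul, Finset.mul_sum]
          rw [Finset.sum_comm]
          exact Finset.sum_congr rfl fun _ _ => Finset.sum_congr rfl fun _ _ => by ring
  have hmet : g.metric q = ‖spatial p‖ ^ 2 • (∑ k, ∑ l, g.h u ρ (Q x) k l • fun a b => θ k a * θ l b)
      - (g.U u ρ (Q x) * g.V u ρ (Q x)) • (fun a b => duCo a * duCo b)
      - g.U u ρ (Q x) • ((fun a b => duCo a * drCo q b) + fun a b => drCo q a * duCo b) := by
    ext a b
    simp [metric, h0, h1, unit_isometry, Q.norm_map, Finset.sum_apply, ← hxd, ← hρ, hθ, mul_add]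
  have hmet' : pull2 (mat4 Q) (g.metric q) μ ν = P (g.metric q) := pull2_apply _ _ _ _
  rw [hmet', hmet]
  simp only [map_sub, map_smul, map_sum, map_add, hPm, hu, hr, hθe, smul_eq_mul]
  simp only [metric, rotate, ← hxd, ← hρ]
  congr 3
  have key := sum_pull2_mul Q (g.h u ρ (Q x)) (WithLp.toLp 2 fun j => θ' j μ)
    (WithLp.toLp 2 fun j => θ' j ν)
  simp only [isometry_apply] at key
  refine Eq.trans ?_ (key.trans ?_)
  · exact Finset.sum_congr rfl fun i _ => Finset.sum_congr rfl fun j _ => by ring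
  · exact Finset.sum_congr rfl fun i _ => Finset.sum_congr rfl fun j _ => by ring

variable (g) in
lemma smooth_metric (hI : IsOpen I) (hρ₀ : 0 < ρ₀) (μ ν : Fin 4) :
    ContDiffOn ℝ ∞ (fun p => g.metric p μ ν) (region I ρ₀) := by
  obtain ⟨w, hw⟩ := g.exists_isShift hI
  refine ContDiffOn.congr ?_ fun p hp => metric_eq hρ₀ hw hp one_pos μ ν
  refine (hw.smooth_gtab μ ν).comp (fun p hp => ContDiffAt.contDiffWithinAt ?_)
    fun p hp => kap_mem hρ₀ one_pos hp
  have hs : ContDiff ℝ ∞ spatial := spatialL.contDiff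
  have hy := spatial_ne_zero hρ₀ hp
  have hn : ContDiffAt ℝ ∞ (fun p => ‖spatial p‖) p := hs.contDiffAt.norm ℝ hy
  exact (contDiff_apply ℝ ℝ 0).contDiffAt.prodMk
    ((hn.inv (norm_ne_zero_iff.2 hy)).prodMk (hs.contDiffAt.const_smul 1))

variable (g) in
/-- Nondegeneracy holds at every point because, after a rotation, the point lies on the polar axis, where
the inverse metric is explicit. -/
lemma metric_nondegenerate (hI : IsOpen I) (hρ₀ : 0 < ρ₀) {p : Fin 4 → ℝ} (hp : p ∈ region I ρ₀) :
    ∃ H, g.metric p * H = 1 := by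
  have hy := spatial_ne_zero hρ₀ hp
  have hr := kap_mem_pos hρ₀ hp
  obtain ⟨Q, hQ⟩ := exists_isometry (unit_mem hy)
  obtain ⟨w, hw⟩ := (g.rotate hI hρ₀ Q).exists_isShift hI
  set t := ‖spatial p‖⁻¹ with ht
  have h1 := hw.gs_mul_invG hI hp.1 hr
  have hpp : (mat4 Q).mulVec (polePoint (p 0) t) = p := by
    obtain ⟨e0, e1⟩ := mulVec_mat4 Q (polePoint (p 0) t)
    rw [spatial_polePoint, map_smul, hQ, ht, inv_inv, norm_smul_unit hy] at e1
    ext i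
    refine Fin.cases (by simpa [polePoint] using e0) (fun i => ?_) i
    exact congrFun (congrArg WithLp.ofLp e1) i
  have h2 : (g.rotate hI hρ₀ Q).metric (polePoint (p 0) t) *
      Matrix.of ((g.rotate hI hρ₀ Q).invG w (p 0, t, e3)) = 1 := by
    rw [← h1]; congr 1; ext μ ν
    rw [metric_eq hρ₀ hw (polePoint_mem hp.1 hr) hr.1, kap_polePoint hr.1,
      gs_eq (pole_mem_domp hp.1 hr)]
    rfl
  rw [metric_rotate g, hpp] at h2
  have hdet : (g.metric p).det ≠ 0 := by
    intro h
    have := congrArg Matrix.det h2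
    simp [pull2, h] at this
  exact ⟨_, Matrix.mul_nonsing_inv _ (isUnit_iff_ne_zero.2 hdet)⟩

/-- A rotated vacuum metric is vacuum. -/
lemma IsVacuum.rotate (hvac : g.IsVacuum) (hI : IsOpen I) (hρ₀ : 0 < ρ₀) (Q : E ≃ₗᵢ[ℝ] E) :
    (g.rotate hI hρ₀ Q).IsVacuum := by
  intro p hp hp' i j
  obtain ⟨e0, e1⟩ := mulVec_mat4 Q p
  have hm : (mat4 Q).mulVec p ∈ region I ρ₀ := ⟨by rw [e0]; exact hp, by rw [e1, Q.norm_map]; exact hp'⟩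
  obtain ⟨H, hH⟩ := g.metric_nondegenerate hI hρ₀ hm
  obtain ⟨w, hw⟩ := g.exists_isShift hI
  have := ricci_pull (mat4_mul_transpose Q) (isOpen_region hI ρ₀) (g.smooth_metric hI hρ₀)
    (fun q hq => hw.gtab_symm hρ₀ one_pos hq) hm hH (fun i j => hvac _ hm.1 hm.2 i j) i j
  rwa [← funext (g.metric_rotate hI hρ₀ Q)] at this

end BondiSachsMetric

/-! ### Calculus on null infinity -/

/-- Smoothness of a function of `u` and a point of the sphere. -/
def SmoothScri (I : Set ℝ) (F : ℝ → E → ℝ) : Prop :=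
  ContDiffOn ℝ ∞ (fun p : ℝ × E => F p.1 (unit p.2)) (sdom I)

/-- The function on the sphere has derivative `v` at `x` in the coordinate direction `k`. -/
def HasGrad (f : E → ℝ) (x : E) (k : Fin 3) (v : ℝ) : Prop :=
  HasDerivAt (fun t : ℝ => f (unit (x + t • bv k))) v 0

section Grad

variable {f g : E → ℝ} {x : E} {k : Fin 3} {v w : ℝ}

namespace HasGrad

lemma add (hf : HasGrad f x k v) (hg : HasGrad g x k w) : HasGrad (fun y => f y + g y) x k (v + w) :=
  HasDerivAt.fun_add hf hg

lemma sub (hf : HasGrad f x k v) (hg : HasGrad g x k w) : HasGrad (fun y => f y - g y) x k (v - w) :=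
  HasDerivAt.fun_sub hf hg

lemma const_mul (c : ℝ) (hf : HasGrad f x k v) : HasGrad (fun y => c * f y) x k (c * v) :=
  HasDerivAt.const_mul c hf

lemma const (c : ℝ) : HasGrad (fun _ => c) x k 0 := hasDerivAt_const _ _

lemma mul (hx : x ∈ S2) (hf : HasGrad f x k v) (hg : HasGrad g x k w) :
    HasGrad (fun y => f y * g y) x k (v * g x + f x * w) := by
  have := HasDerivAt.fun_mul hf hg
  simp only [zero_smul, add_zero, unit_of_mem hx] at this
  exact this

lemma sum {ι : Type*} {s : Finset ι} {f : ι → E → ℝ} {v : ι → ℝ} (h : ∀ i ∈ s, HasGrad (f i) x k (v i)) :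
    HasGrad (fun y => ∑ i ∈ s, f i y) x k (∑ i ∈ s, v i) := HasDerivAt.fun_sum h

lemma congr (hx : x ∈ S2) (hf : HasGrad f x k v) (h : ∀ y ∈ S2, f y = g y) : HasGrad g x k v := by
  refine HasDerivAt.congr_of_eventuallyEq hf ?_
  have hc : ContinuousAt (fun t : ℝ => x + t • bv k) 0 := by fun_prop
  have h0 : x + (0 : ℝ) • bv k ≠ 0 := by simpa using ne_zero_of_mem_S2 hx
  filter_upwards [hc.eventually (isOpen_ne0.mem_nhds h0)] with t ht
  exact (h _ (unit_mem ht)).symm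

lemma unique (hf : HasGrad f x k v) (hg : HasGrad f x k w) : v = w := HasDerivAt.unique hf hg

end HasGrad

lemma hasGrad_of_differentiableAt (h : DifferentiableAt ℝ (fun y => f (unit y)) x) (k : Fin 3) :
    HasGrad f x k (grad f x k) := by
  have hl : HasDerivAt (fun t : ℝ => x + t • bv k) (bv k) 0 := by
    simpa using ((hasDerivAt_id (0 : ℝ)).smul_const (bv k)).const_add x
  exact hasDerivAt_dd h _ hl (by simp)

lemma grad_congr (h : ∀ y ∈ S2, f y = g y) (hx : x ≠ 0) (k : Fin 3) : grad f x k = grad g x k :=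
  dd_congr isOpen_ne0 (fun _ hy => h _ (unit_mem hy)) hx _

lemma grad_smul {c : ℝ} (hc : 0 < c) (f : E → ℝ) (x : E) (k : Fin 3) :
    grad f (c • x) k = c⁻¹ * grad f x k := by
  have h : (fun y => f (unit y)) = fun y => f (unit (c • y)) := funext fun y => by rw [unit_smul hc]
  have h2 := fderiv_comp_smul c (f := fun y => f (unit y)) (x := x)
  rw [grad, grad]
  conv_rhs => rw [h, h2]
  simp [hc.ne']

end Grad

namespace SmoothScri

variable {I : Set ℝ} {F G : ℝ → E → ℝ} {u : ℝ} {x : E}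

lemma add (hF : SmoothScri I F) (hG : SmoothScri I G) : SmoothScri I fun u x => F u x + G u x :=
  ContDiffOn.add hF hG

lemma sub (hF : SmoothScri I F) (hG : SmoothScri I G) : SmoothScri I fun u x => F u x - G u x :=
  ContDiffOn.sub hF hG

lemma mul (hF : SmoothScri I F) (hG : SmoothScri I G) : SmoothScri I fun u x => F u x * G u x :=
  ContDiffOn.mul hF hG

lemma const (c : ℝ) : SmoothScri I fun _ _ => c := contDiffOn_const

lemma sum {ι : Type*} {s : Finset ι} {F : ι → ℝ → E → ℝ} (h : ∀ i, SmoothScri I (F i)) :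
    SmoothScri I fun u x => ∑ i ∈ s, F i u x := ContDiffOn.sum fun i _ => h i

lemma coord (i : Fin 3) : SmoothScri I fun _ x => x i := smooth_xs i

lemma congr (hF : SmoothScri I F) (h : ∀ u ∈ I, ∀ x ∈ S2, F u x = G u x) : SmoothScri I G :=
  ContDiffOn.congr hF fun _ hp => (h _ hp.1 _ (unit_mem hp.2)).symm

lemma proj (i j : Fin 3) : SmoothScri I fun _ x => proj x i j :=
  (const _).sub ((coord i).mul (coord j))

lemma differentiableAt (hI : IsOpen I) (hF : SmoothScri I F) (hu : u ∈ I) (hx : x ∈ S2) :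
    DifferentiableAt ℝ (fun y => F u (unit y)) x := by
  have h := smooth_differentiableAt (isOpen_sdom hI) hF (q := (u, x)) ⟨hu, ne_zero_of_mem_S2 hx⟩
  exact h.comp (f := fun y : E => (u, y)) x (by fun_prop)

lemma hasGrad (hI : IsOpen I) (hF : SmoothScri I F) (hu : u ∈ I) (hx : x ∈ S2) (k : Fin 3) :
    HasGrad (F u) x k (BondiSachs.grad (F u) x k) :=
  hasGrad_of_differentiableAt (hF.differentiableAt hI hu hx) k

lemma grad_eq_dd (hI : IsOpen I) (hF : SmoothScri I F) {p : ℝ × E} (hp : p ∈ sdom I) (k : Fin 3) :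
    BondiSachs.grad (F p.1) p.2 k = dd (ss k) (fun p : ℝ × E => F p.1 (unit p.2)) p := by
  have h := smooth_differentiableAt (isOpen_sdom hI) hF hp
  have h2 : HasFDerivAt (fun y : E => (p.1, y)) (ContinuousLinearMap.inr ℝ ℝ E) p.2 :=
    hasFDerivAt_prodMk_right p.1 p.2
  have h3 := (h.hasFDerivAt (x := (p.1, p.2))).comp (f := fun y : E => (p.1, y)) p.2 h2
  rw [BondiSachs.grad, show fderiv ℝ (fun y => F p.1 (unit y)) p.2 = _ from h3.fderiv]
  rfl

/-- The gradient at `p/|p|` of a ray-constant function, in terms of the derivative at `p`. -/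
lemma grad_hat (hI : IsOpen I) (hF : SmoothScri I F) {p : ℝ × E} (hp : p ∈ sdom I) (k : Fin 3) :
    BondiSachs.grad (F p.1) (unit p.2) k =
      ‖p.2‖ * dd (ss k) (fun p : ℝ × E => F p.1 (unit p.2)) p := by
  rw [← hF.grad_eq_dd hI hp, unit, grad_smul (inv_pos.2 (norm_pos_of_mem hp.2)), inv_inv]

lemma grad (hI : IsOpen I) (hF : SmoothScri I F) (k : Fin 3) :
    SmoothScri I fun u x => BondiSachs.grad (F u) x k := by
  have h : ContDiffOn ℝ ∞ (fun p : ℝ × E => ‖p.2‖) (sdom I) :=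
    smooth_norm.comp contDiff_snd.contDiffOn fun q hq => hq.2
  exact (h.mul (smooth_dd (isOpen_sdom hI) hF (ss k))).congr fun p hp => hF.grad_hat hI hp k

lemma deriv_eq_dd (hI : IsOpen I) (hF : SmoothScri I F) {p : ℝ × E} (hp : p ∈ sdom I) :
    HasDerivAt (fun s => F s (unit p.2)) (dd su (fun p : ℝ × E => F p.1 (unit p.2)) p) p.1 := by
  have h := smooth_differentiableAt (isOpen_sdom hI) hF hp
  have hl : HasDerivAt (fun s : ℝ => (s, p.2)) su p.1 := (hasDerivAt_id p.1).prodMk (hasDerivAt_const _ _)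
  exact hasDerivAt_dd (q := p) h _ hl rfl

lemma du (hI : IsOpen I) (hF : SmoothScri I F) : SmoothScri I fun u x => deriv (fun s => F s x) u :=
  (smooth_dd (isOpen_sdom hI) hF su).congr fun _ hp => (hF.deriv_eq_dd hI hp).deriv

lemma hasDerivAt (hI : IsOpen I) (hF : SmoothScri I F) (hu : u ∈ I) (hx : x ∈ S2) :
    HasDerivAt (fun s => F s x) (deriv (fun s => F s x) u) u := by
  have := hF.deriv_eq_dd hI (p := (u, x)) ⟨hu, ne_zero_of_mem_S2 hx⟩
  simp only [unit_of_mem hx] at this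
  exact this.deriv.symm ▸ this

/-- Derivatives along the sphere commute with `∂_u`. -/
lemma deriv_grad (hI : IsOpen I) (hF : SmoothScri I F) (hu : u ∈ I) (hx : x ∈ S2) (k : Fin 3) :
    deriv (fun s => BondiSachs.grad (F s) x k) u =
      BondiSachs.grad (fun y => deriv (fun s => F s y) u) x k := by
  have hp : ((u, x) : ℝ × E) ∈ sdom I := ⟨hu, ne_zero_of_mem_S2 hx⟩
  have ho := isOpen_sdom hI
  have h1 := ((hF.grad hI k).deriv_eq_dd hI hp).deriv
  simp only [unit_of_mem hx] at h1
  rw [h1, (hF.du hI).grad_eq_dd hI hp,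
    dd_congr ho (fun p hp => hF.grad_hat hI hp k) hp,
    dd_congr ho (fun p hp => (hF.deriv_eq_dd hI hp).deriv) hp, dd_comm ho hF hp]
  have hn : ContDiffOn ℝ ∞ (fun p : ℝ × E => ‖p.2‖) (sdom I) :=
    smooth_norm.comp contDiff_snd.contDiffOn fun q hq => hq.2
  have hs := smooth_dd ho hF (ss k)
  rw [dd_mul (smooth_differentiableAt ho hn hp) (smooth_differentiableAt ho hs hp)]
  have h0 : dd su (fun p : ℝ × E => ‖p.2‖) (u, x) = 0 := by
    have hl : HasDerivAt (fun s : ℝ => (s, x)) su u := (hasDerivAt_id u).prodMk (hasDerivAt_const _ _)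
    exact (hasDerivAt_dd (smooth_differentiableAt ho hn hp) _ hl rfl).unique
      (hasDerivAt_const u ‖x‖)
  rw [h0, norm_of_mem_S2 hx]; ring

end SmoothScri

lemma hasGrad_coord {x : E} (hx : x ∈ S2) (k i : Fin 3) : HasGrad (fun y => y i) x k (proj x i k) := by
  have h := (SmoothScri.coord (I := univ) i).hasGrad isOpen_univ (mem_univ 0) hx k
  convert h using 1
  rw [grad]
  have hu : DifferentiableAt ℝ unit x :=
    (smooth_unit.contDiffAt (isOpen_ne0.mem_nhds (ne_zero_of_mem_S2 hx))).differentiableAt (by simp)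
  have h2 := ((EuclideanSpace.proj i : E →L[ℝ] ℝ).hasFDerivAt.comp x hu.hasFDerivAt).fderiv
  rw [show fderiv ℝ (fun y => unit y i) x = _ from h2]
  change _ = (fderiv ℝ unit x (bv k)) i
  rw [fderiv_unit (ne_zero_of_mem_S2 hx)]
  simp [norm_of_mem_S2 hx, unit_of_mem hx, proj]

lemma hasGrad_proj {x : E} (hx : x ∈ S2) (k i j : Fin 3) :
    HasGrad (fun y => proj y i j) x k (-(proj x i k * x j + x i * proj x j k)) := by
  have := (HasGrad.const (x := x) (k := k) (if i = j then 1 else 0)).sub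
    ((hasGrad_coord hx k i).mul hx (hasGrad_coord hx k j))
  rwa [zero_sub] at this

/-- The gradient of a function on the sphere is tangential. -/
lemma sum_mul_grad {f : E → ℝ} {x : E} (h : DifferentiableAt ℝ (fun y => f (unit y)) x) :
    ∑ k, x k * grad f x k = 0 := by
  have hl : HasDerivAt (fun t : ℝ => x + t • x) x 0 := by
    simpa using ((hasDerivAt_id (0 : ℝ)).smul_const x).const_add x
  have h1 := hasDerivAt_dd h _ hl (by simp)
  have h2 : (fun t : ℝ => f (unit (x + t • x))) =ᶠ[𝓝 0] fun _ => f (unit x) := by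
    filter_upwards [Ioi_mem_nhds (show (-1 : ℝ) < 0 by norm_num)] with t ht
    rw [show x + t • x = (1 + t) • x by rw [add_smul, one_smul], unit_smul (by linarith [mem_Ioi.1 ht])]
  have h3 := h1.unique ((hasDerivAt_const (0 : ℝ) (f (unit x))).congr_of_eventuallyEq h2)
  rw [← h3, dd]
  have e := congrArg (fderiv ℝ (fun y => f (unit y)) x) (sum_smul_bv x)
  rw [← e, map_sum]
  exact Finset.sum_congr rfl fun k _ => by rw [map_smul]; rfl

/-! ### The Bondi data and the momentum constraint at the pole -/

section

variable {I : Set ℝ} {ρ₀ : ℝ}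

/-- `F` is the restriction to the sphere of the ray-constant function `f`. -/
structure Hat (I : Set ℝ) (f : ℝ × E → ℝ) (F : ℝ → E → ℝ) : Prop where
  smooth : ContDiffOn ℝ ∞ f (sdom I)
  eq : ∀ p ∈ sdom I, F p.1 (unit p.2) = f p

namespace Hat

variable {f : ℝ × E → ℝ} {F : ℝ → E → ℝ} {u : ℝ}

lemma smoothScri (h : Hat I f F) : SmoothScri I F := h.smooth.congr h.eq

lemma pole (h : Hat I f F) (hu : u ∈ I) : f (pol u) = F u e3 := by
  rw [← h.eq _ (pol_mem hu), unit_e3]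

lemma dd_ss (hI : IsOpen I) (h : Hat I f F) (hu : u ∈ I) (k : Fin 3) :
    dd (ss k) f (pol u) = grad (F u) e3 k := by
  rw [h.smoothScri.grad_eq_dd hI (pol_mem hu)]
  exact (dd_congr (isOpen_sdom hI) h.eq (pol_mem hu) _).symm

lemma dd_su (hI : IsOpen I) (h : Hat I f F) (hu : u ∈ I) :
    dd su f (pol u) = deriv (fun s => F s e3) u := by
  have h1 := (h.smoothScri.deriv_eq_dd hI (pol_mem hu)).deriv
  rw [dd_congr (isOpen_sdom hI) h.eq (pol_mem hu), unit_e3] at h1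
  exact h1.symm

lemma norm_mul_dd (hI : IsOpen I) (h : Hat I f F) (k : Fin 3) :
    Hat I (fun p => ‖p.2‖ * dd (ss k) f p) (fun u x => grad (F u) x k) where
  smooth := (smooth_norm.comp contDiff_snd.contDiffOn fun q hq => hq.2).mul
    (smooth_dd (isOpen_sdom hI) h.smooth _)
  eq p hp := by rw [h.smoothScri.grad_hat hI hp, dd_congr (isOpen_sdom hI) h.eq hp]

lemma dd_norm (v : ℝ × E) : dd v (fun p : ℝ × E => ‖p.2‖) (pol u) = v.2 2 := by
  have hn : DifferentiableAt ℝ (fun y : E => ‖y‖) e3 :=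
    (contDiffAt_norm ℝ (n := 1) e3_ne).differentiableAt (by simp)
  have h : HasFDerivAt (fun p : ℝ × E => ‖p.2‖) ((fderiv ℝ (fun y : E => ‖y‖) e3).comp
      (ContinuousLinearMap.snd ℝ ℝ E)) (pol u) :=
    HasFDerivAt.comp (pol u) (f := Prod.snd) hn.hasFDerivAt hasFDerivAt_snd
  rw [dd, h.fderiv]
  simp [hasFDerivAt_norm e3_ne]

lemma dd_dd (hI : IsOpen I) (h : Hat I f F) (hu : u ∈ I) {v : ℝ × E} (hv : v.2 2 = 0) (k : Fin 3) :
    dd v (fun p => ‖p.2‖ * dd (ss k) f p) (pol u) = dd v (dd (ss k) f) (pol u) := by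
  have ho := isOpen_sdom hI
  have hp := pol_mem hu
  have hn : ContDiffOn ℝ ∞ (fun p : ℝ × E => ‖p.2‖) (sdom I) :=
    smooth_norm.comp contDiff_snd.contDiffOn fun q hq => hq.2
  rw [dd_mul (smooth_differentiableAt ho hn hp)
    (smooth_differentiableAt ho (smooth_dd ho h.smooth (ss k)) hp), dd_norm, hv]
  simp

lemma dd_ss_ss (hI : IsOpen I) (h : Hat I f F) (hu : u ∈ I) {a : Fin 3} (ha : a ≠ 2) (k : Fin 3) :
    dd (ss a) (dd (ss k) f) (pol u) = grad (fun y => grad (F u) y k) e3 a := by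
  rw [← h.dd_dd hI hu (by simpa [ss] using ha.symm), (h.norm_mul_dd hI k).dd_ss hI hu]

lemma dd_su_ss (hI : IsOpen I) (h : Hat I f F) (hu : u ∈ I) (k : Fin 3) :
    dd su (dd (ss k) f) (pol u) = deriv (fun s => grad (F s) e3 k) u := by
  rw [← h.dd_dd hI hu (by simp [su]), (h.norm_mul_dd hI k).dd_su hI hu]

end Hat

/-- Derivative along the polar generator of null infinity. -/
lemma hasDerivAt_pol (hI : IsOpen I) {f : ℝ × E → ℝ} (hf : ContDiffOn ℝ ∞ f (sdom I)) {u : ℝ}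
    (hu : u ∈ I) : HasDerivAt (fun s => f (pol s)) (dd su f (pol u)) u := by
  have hl : HasDerivAt (fun s : ℝ => pol s) su u := (hasDerivAt_id u).prodMk (hasDerivAt_const _ _)
  exact hasDerivAt_dd (smooth_differentiableAt (isOpen_sdom hI) hf (pol_mem hu)) _ hl rfl

end

namespace BondiSachsMetric

variable {I : Set ℝ} {ρ₀ : ℝ} {g : BondiSachsMetric I ρ₀} {w : Fin 3 → X → ℝ}

/-- The `∂_r`-part of the momentum constraint, differentiated in `u` and added to the `∂_u`-part. -/
lemma IsShift.momentum_dd (hI : IsOpen I) (hρ₀ : 0 < ρ₀) (hw : g.IsShift w) (hvac : g.IsVacuum) {u : ℝ}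
    (hu : u ∈ I) {a b : Fin 3} (hab : a = 0 ∧ b = 1 ∨ a = 1 ∧ b = 0) :
    let c : Fin 3 → Fin 3 → ℝ := fun i j => c1 (g.hs i j) (pol u)
    let n : Fin 3 → Fin 3 → ℝ := fun i j => dd su (c1 (g.hs i j)) (pol u)
    let D : Fin 3 → Fin 3 → Fin 3 → ℝ := fun k i j => dd (ss k) (c1 (g.hs i j)) (pol u)
    let Dn : Fin 3 → Fin 3 → Fin 3 → ℝ := fun k i j => dd su (dd (ss k) (c1 (g.hs i j))) (pol u)
    let B : Fin 3 → ℝ := fun i => c1 (g.Bh w i) (pol u)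
    let Bu : Fin 3 → ℝ := fun i => dd su (c1 (g.Bh w i)) (pol u)
    c a b * Dn a a b - c a b * Dn b a a + c a b * Bu b + c a a * Dn b a b - c a a * Dn a b b +
      c a a * Bu a + dd (ss a) (dd (ss b) (c1 (g.Bh w b))) (pol u) -
      dd (ss b) (dd (ss b) (c1 (g.Bh w a))) (pol u) + B a + B a * n a a +
      dd (ss a) (c1 (g.Sh w)) (pol u) - 3 * dd su (c2 (g.Bh w a)) (pol u) +
      dd su (dd (ss a) (c2 g.Uh)) (pol u) - n a a * D b a b + 1 / 2 * n a a * D a b b + B b * n a b +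
      1 / 2 * n a b * D b a a - 1 / 2 * n a b * D b b b + 1 / 2 * D a b b * n b b +
      (1 / 4 * (Dn a b b * (c a a - c b b) + D a b b * (n a a - n b b)) +
        1 / 2 * (Bu a * (c a a + c b b) + B a * (n a a + n b b)) -
        1 / 2 * (n a b * D a a b + c a b * Dn a a b) +
        1 / 4 * (n a b * (D b a a + D b b b) + c a b * (Dn b a a + Dn b b b))) = 0 := by
  intro c n D Dn B Bu
  have h := (hw.ricci_coeff hI hρ₀ hu hvac hab).2.2
  have ho := isOpen_sdom hI
  have sc := fun i j => smooth_c1 hI hρ₀ (smooth_hs (g := g) i j)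
  have sc2 := fun i j => smooth_c2 hI hρ₀ (smooth_hs (g := g) i j)
  have hc := fun i j => hasDerivAt_pol hI (sc i j) hu
  have hD := fun k i j => hasDerivAt_pol hI (smooth_dd ho (sc i j) (ss k)) hu
  have hD2 := fun k i j => hasDerivAt_pol hI (smooth_dd ho (sc2 i j) (ss k)) hu
  have hU := fun k => hasDerivAt_pol hI (smooth_dd ho (smooth_c2 hI hρ₀ g.smooth_Uh) (ss k)) hu
  have hB := fun i => hasDerivAt_pol hI (smooth_c1 hI hρ₀ (hw.smooth_Bh i)) hu
  have hder := ((((((((hD a b b).const_mul (1 / 4)).fun_mul ((hc a a).fun_sub (hc b b))).fun_add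
    (((hB a).const_mul (1 / 2)).fun_mul ((hc a a).fun_add (hc b b)))).fun_sub
    (((hc a b).const_mul (1 / 2)).fun_mul (hD a a b))).fun_add
    (((hc a b).const_mul (1 / 4)).fun_mul ((hD b a a).fun_add (hD b b b)))).fun_add (hD2 a b b)).fun_sub
    (hD2 b a b)).fun_add ((hU a).const_mul 2)
  have h0 := hder.unique ((hasDerivAt_const u (0 : ℝ)).congr_of_eventuallyEq (by
    filter_upwards [hI.mem_nhds hu] with s hs
    exact (hw.ricci_coeff hI hρ₀ hs hvac hab).2.1))
  simp only [c, n, D, Dn, B, Bu]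
  linear_combination h + h0

section Data

variable (g) in
lemma hat_C (hI : IsOpen I) (hρ₀ : 0 < ρ₀) (i j : Fin 3) :
    Hat I (c1 (g.hh i j)) (fun u x => g.C u x i j) where
  smooth := smooth_c1 hI hρ₀ (g.smooth_hh i j)
  eq _ hp := (c1_eq_deriv hI hρ₀ (g.smooth_hh i j) hp).symm

lemma hat_C' (hI : IsOpen I) (hρ₀ : 0 < ρ₀) (i j : Fin 3) :
    Hat I (c1 (g.hs i j)) (fun u x => g.C u x i j) where
  smooth := smooth_c1 hI hρ₀ (smooth_hs i j)
  eq p hp := by rw [(coeff_hs hI hρ₀ hp i j).1, (g.hat_C hI hρ₀ i j).eq p hp]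

variable (g) in
lemma hat_m (hI : IsOpen I) (hρ₀ : 0 < ρ₀) : Hat I (fun p => -(1 / 2) * c1 g.Vh p) g.m where
  smooth := contDiffOn_const.mul (smooth_c1 hI hρ₀ g.smooth_Vh)
  eq p hp := by rw [c1_eq_deriv hI hρ₀ g.smooth_Vh hp]; rfl

/-- Iterated derivatives in `ρ` as iterated directional derivatives. -/
lemma iteratedDeriv_line (hI : IsOpen I) (hρ₀ : 0 < ρ₀) (n : ℕ) {f : X → ℝ}
    (hf : ContDiffOn ℝ ∞ f (dom I ρ₀)) {p : ℝ × E} (hp : p ∈ sdom I) :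
    iteratedDeriv n (fun ρ => f (p.1, ρ, p.2)) 0 = sc ((dd er)^[n] f) p := by
  have h : ∀ n, ContDiffOn ℝ ∞ ((dd er)^[n] f) (dom I ρ₀) ∧ ∀ ρ ∈ Ioo (-ρ₀) ρ₀,
      iteratedDeriv n (fun ρ => f (p.1, ρ, p.2)) ρ = (dd er)^[n] f (p.1, ρ, p.2) := by
    intro n
    induction n with
    | zero => exact ⟨hf, fun ρ _ => by simp⟩
    | succ n ih =>
      rw [Function.iterate_succ_apply']
      refine ⟨smooth_dd (isOpen_dom hI ρ₀) ih.1 _, fun ρ hρ => ?_⟩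
      rw [iteratedDeriv_succ]
      refine HasDerivAt.deriv ((hasDerivAt_line hI ih.1 ⟨hp.1, hρ, hp.2⟩).congr_of_eventuallyEq ?_)
      filter_upwards [Ioo_mem_nhds hρ.1 hρ.2] with s hs using ih.2 s hs
  exact (h n).2 0 ⟨by simpa using hρ₀, hρ₀⟩

variable (g) in
lemma hat_U2 (hI : IsOpen I) (hρ₀ : 0 < ρ₀) : Hat I (c2 g.Uh) g.U2 where
  smooth := smooth_c2 hI hρ₀ g.smooth_Uh
  eq p hp := by
    have := iteratedDeriv_line hI hρ₀ 2 g.smooth_Uh hp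
    simp only [U2, c2]
    rw [show (dd er (dd er g.Uh)) = (dd er)^[2] g.Uh from rfl, ← this]; rfl

/-- Derivatives of `W` of positive order are, up to a factor, derivatives of `w = W/ρ`. -/
lemma IsShift.iterate_dd (hI : IsOpen I) (hw : g.IsShift w) (i : Fin 3) (n : ℕ) :
    ∀ q ∈ dom I ρ₀, (dd er)^[n + 1] (g.Wh i) q =
      (n + 1) * (dd er)^[n] (w i) q + q.2.1 * (dd er)^[n + 1] (w i) q := by
  have ho := isOpen_dom hI ρ₀
  have hs : ∀ n, ContDiffOn ℝ ∞ ((dd er)^[n] (w i)) (dom I ρ₀) := by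
    intro n
    induction n with
    | zero => exact hw.smooth i
    | succ n ih => rw [Function.iterate_succ_apply']; exact smooth_dd ho ih _
  have hprod : ∀ n, ∀ q ∈ dom I ρ₀, dd er (fun q => q.2.1 * (dd er)^[n] (w i) q) q =
      (dd er)^[n] (w i) q + q.2.1 * (dd er)^[n + 1] (w i) q := by
    intro n q hq
    rw [dd_mul (smooth_differentiableAt ho smooth_rho hq) (smooth_differentiableAt ho (hs n) hq),
      dd_er_rho, one_mul, Function.iterate_succ_apply']
  induction n with
  | zero =>
    intro q hq
    rw [Function.iterate_succ_apply', Function.iterate_zero_apply, dd_congr ho (hw.eq i) hq]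
    simpa using hprod 0 q hq
  | succ n ih =>
    intro q hq
    rw [Function.iterate_succ_apply', dd_congr ho ih hq,
      dd_add (f := fun q => ((n : ℝ) + 1) * (dd er)^[n] (w i) q)
        (g := fun q => q.2.1 * (dd er)^[n + 1] (w i) q)
        ((smooth_differentiableAt ho (hs n) hq).const_mul _)
        ((smooth_differentiableAt ho smooth_rho hq).mul (smooth_differentiableAt ho (hs (n + 1)) hq)),
      dd_const_mul (smooth_differentiableAt ho (hs n) hq), hprod (n + 1) q hq,
      Function.iterate_succ_apply' (dd er) n]
    push_cast; ring

/-- The leading coefficient of `G_{0i}` is the coefficient of `r⁻²` in `W`. -/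
lemma IsShift.hat_W2 (hI : IsOpen I) (hρ₀ : 0 < ρ₀) (hw : g.IsShift w) (i : Fin 3) :
    Hat I (c1 (g.Bh w i)) (fun u x => g.W2 u x i) where
  smooth := smooth_c1 hI hρ₀ (hw.smooth_Bh i)
  eq p hp := by
    have h1 := iteratedDeriv_line hI hρ₀ 2 (g.smooth_Wh i) hp
    rw [sc, hw.iterate_dd hI i 1 _ (zero_mem_dom hρ₀ hp)] at h1
    rw [(hw.coeff_Bh hI hρ₀ hp i).2.1]
    change 1 / 2 * iteratedDeriv 2 (fun ρ => g.Wh i (p.1, ρ, p.2)) 0 = _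
    rw [h1]; simp [c1, sc]; ring

lemma IsShift.W3_eq (hI : IsOpen I) (hρ₀ : 0 < ρ₀) (hw : g.IsShift w) (i : Fin 3) {p : ℝ × E}
    (hp : p ∈ sdom I) : g.W3 p.1 (unit p.2) i = c2 (w i) p := by
  have h1 := iteratedDeriv_line hI hρ₀ 3 (g.smooth_Wh i) hp
  rw [sc, hw.iterate_dd hI i 2 _ (zero_mem_dom hρ₀ hp)] at h1
  change 1 / 6 * iteratedDeriv 3 (fun ρ => g.Wh i (p.1, ρ, p.2)) 0 = _
  rw [h1]; simp [c2, sc]; ring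

/-- The subleading coefficient of the component `G_{0i}` in terms of the angular momentum aspect. -/
lemma IsShift.hat_N (hI : IsOpen I) (hρ₀ : 0 < ρ₀) (hw : g.IsShift w) (i : Fin 3) :
    Hat I (c2 (g.Bh w i)) (fun u x => 2 / 3 * g.N u x i - g.U2 u x * x i + grad (g.U2 u) x i) where
  smooth := smooth_c2 hI hρ₀ (hw.smooth_Bh i)
  eq p hp := by
    rw [(hw.coeff_Bh hI hρ₀ hp i).2.2, N, hw.W3_eq hI hρ₀ i hp, ← (g.hat_U2 hI hρ₀).eq p hp]
    have h : ∀ k, g.C p.1 (unit p.2) i k * g.W2 p.1 (unit p.2) k = c1 (g.hh i k) p * c1 (w k) p := by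
      intro k
      rw [(g.hat_C hI hρ₀ i k).eq p hp, (hw.hat_W2 hI hρ₀ k).eq p hp, (hw.coeff_Bh hI hρ₀ hp k).2.1]
    simp only [h]; ring

/-- The leading coefficient of `G_00 + 1` is twice the mass aspect. -/
lemma IsShift.hat_Sh (hI : IsOpen I) (hρ₀ : 0 < ρ₀) (hw : g.IsShift w) :
    Hat I (c1 (g.Sh w)) (fun u x => 2 * g.m u x) where
  smooth := smooth_c1 hI hρ₀ hw.smooth_Sh
  eq p hp := by
    rw [(g.hat_m hI hρ₀).eq p hp, (hw.coeff_Sh hI hρ₀ hp).2]; ring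

end Data

end BondiSachsMetric

/-! ### Equivariance of the tensor calculus on the sphere -/

section Equivariance

/-- The pullback of a vector field by a linear isometry. -/
def rotV (Q : E ≃ₗᵢ[ℝ] E) (X : E → E) (y : E) : E :=
  WithLp.toLp 2 (Matrix.vecMul (X (Q y)).ofLp (mat Q))

/-- The pullback of a 2-tensor by a linear isometry. -/
def rotT (Q : E ≃ₗᵢ[ℝ] E) (T : E → Matrix (Fin 3) (Fin 3) ℝ) (y : E) : Matrix (Fin 3) (Fin 3) ℝ :=
  pull2 (mat Q) (T (Q y))

/-- Differentiability at `x` of a function on the sphere. -/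
abbrev DiffAt (f : E → ℝ) (x : E) : Prop := DifferentiableAt ℝ (fun y => f (unit y)) x

lemma pull2_mul (Q : E ≃ₗᵢ[ℝ] E) (A B : Matrix (Fin 3) (Fin 3) ℝ) :
    pull2 (mat Q) (A * B) = pull2 (mat Q) A * pull2 (mat Q) B := by
  simp only [pull2]
  calc _ = (mat Q).transpose * A * 1 * B * mat Q := by simp only [Matrix.mul_one, Matrix.mul_assoc]
    _ = _ := by rw [← mat_mul_transpose Q]; simp only [Matrix.mul_assoc]

lemma pull2_transpose {n : ℕ} (M A : Matrix (Fin n) (Fin n) ℝ) :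
    pull2 M A.transpose = (pull2 M A).transpose := by
  simp [pull2, Matrix.transpose_mul, Matrix.mul_assoc]

lemma pull2_add {n : ℕ} (M A B : Matrix (Fin n) (Fin n) ℝ) : pull2 M (A + B) = pull2 M A + pull2 M B := by
  simp [pull2, Matrix.mul_add, Matrix.add_mul]

lemma pull2_sub {n : ℕ} (M A B : Matrix (Fin n) (Fin n) ℝ) : pull2 M (A - B) = pull2 M A - pull2 M B := by
  simp [pull2, Matrix.mul_sub, Matrix.sub_mul]

lemma pull2_smul {n : ℕ} (M A : Matrix (Fin n) (Fin n) ℝ) (c : ℝ) : pull2 M (c • A) = c • pull2 M A := by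
  simp [pull2]

lemma pull2_sum {n : ℕ} (M : Matrix (Fin n) (Fin n) ℝ) {ι : Type*} (s : Finset ι)
    (A : ι → Matrix (Fin n) (Fin n) ℝ) : pull2 M (∑ i ∈ s, A i) = ∑ i ∈ s, pull2 M (A i) := by
  simp [pull2, Matrix.mul_sum, Matrix.sum_mul]

lemma trace_pull2 (Q : E ≃ₗᵢ[ℝ] E) (A : Matrix (Fin 3) (Fin 3) ℝ) :
    (pull2 (mat Q) A).trace = A.trace := by
  rw [pull2, Matrix.trace_mul_comm, ← Matrix.mul_assoc, mat_mul_transpose, Matrix.one_mul]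

lemma vecMul_pull2 (Q : E ≃ₗᵢ[ℝ] E) (v : Fin 3 → ℝ) (A : Matrix (Fin 3) (Fin 3) ℝ) :
    Matrix.vecMul (Matrix.vecMul v (mat Q)) (pull2 (mat Q) A) =
      Matrix.vecMul (Matrix.vecMul v A) (mat Q) := by
  rw [pull2, Matrix.vecMul_vecMul, Matrix.vecMul_vecMul, Matrix.mul_assoc, ← Matrix.mul_assoc (mat Q),
    mat_mul_transpose, Matrix.one_mul]

lemma pull2_mulVec (Q : E ≃ₗᵢ[ℝ] E) (v : Fin 3 → ℝ) (A : Matrix (Fin 3) (Fin 3) ℝ) :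
    (pull2 (mat Q) A).mulVec (Matrix.vecMul v (mat Q)) = Matrix.vecMul (A.mulVec v) (mat Q) := by
  rw [← Matrix.vecMul_transpose, ← pull2_transpose, vecMul_pull2, Matrix.vecMul_transpose]

lemma dotProduct_vecMul_mat (Q : E ≃ₗᵢ[ℝ] E) (v w : Fin 3 → ℝ) :
    dotProduct (Matrix.vecMul v (mat Q)) (Matrix.vecMul w (mat Q)) = dotProduct v w := by
  rw [← Matrix.mulVec_transpose (mat Q) w, Matrix.dotProduct_mulVec, Matrix.vecMul_vecMul,
    mat_mul_transpose, Matrix.vecMul_one]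

/-- Full contraction of two matrices. -/
def contract (A B : Matrix (Fin 3) (Fin 3) ℝ) : ℝ := ∑ i, ∑ j, A i j * B i j

lemma contract_eq (A B : Matrix (Fin 3) (Fin 3) ℝ) : contract A B = (A.transpose * B).trace := by
  simp only [contract, Matrix.trace, Matrix.diag, Matrix.mul_apply, Matrix.transpose_apply]
  exact Finset.sum_comm

lemma contract_pull2 (Q : E ≃ₗᵢ[ℝ] E) (A B : Matrix (Fin 3) (Fin 3) ℝ) :
    contract (pull2 (mat Q) A) (pull2 (mat Q) B) = contract A B := by
  rw [contract_eq, contract_eq, ← pull2_transpose, ← pull2_mul, trace_pull2]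

variable {x : E} (Q : E ≃ₗᵢ[ℝ] E)

lemma diffAt_comp {f : E → ℝ} (h : DiffAt f (Q x)) : DiffAt (fun y => f (Q y)) x := by
  have e : (fun y => f (Q (unit y))) = (fun y => f (unit y)) ∘ Q := funext fun y => by
    simp [unit_isometry]
  rw [DiffAt, e]
  exact h.comp x Q.differentiable.differentiableAt

lemma grad_comp (f : E → ℝ) (x : E) (k : Fin 3) :
    grad (fun y => f (Q y)) x k = ∑ j, mat Q j k * grad f (Q x) j := by
  have e : (fun y => f (Q (unit y))) = (fun y => f (unit y)) ∘ Q.toContinuousLinearEquiv :=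
    funext fun y => by simp [unit_isometry]
  rw [grad, e, ContinuousLinearEquiv.comp_right_fderiv]
  change fderiv ℝ (fun y => f (unit y)) (Q x) (Q (bv k)) = _
  conv_lhs => rw [← sum_smul_bv (Q (bv k)), map_sum]
  exact Finset.sum_congr rfl fun j _ => by rw [map_smul]; rfl

lemma hasGrad_comp {f : E → ℝ} (h : DiffAt f (Q x)) (k : Fin 3) :
    HasGrad (fun y => f (Q y)) x k (∑ j, mat Q j k * grad f (Q x) j) := by
  rw [← grad_comp]; exact hasGrad_of_differentiableAt (diffAt_comp Q h) k

lemma HasGrad.grad_eq {f : E → ℝ} {k : Fin 3} {v : ℝ} (h : HasGrad f x k v) (hd : DiffAt f x) :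
    grad f x k = v := (hasGrad_of_differentiableAt hd k).unique h

lemma diffAt_rotV {X : E → E} (h : ∀ b, DiffAt (fun y => X y b) (Q x)) (b : Fin 3) :
    DiffAt (fun y => rotV Q X y b) x := by
  have : ∀ c ∈ Finset.univ, DifferentiableAt ℝ (fun y => X (Q (unit y)) c * mat Q c b) x := fun c _ =>
    (diffAt_comp Q (h c)).mul_const _
  exact DifferentiableAt.fun_sum this

lemma diffAt_rotT {T : E → Matrix (Fin 3) (Fin 3) ℝ} (h : ∀ b c, DiffAt (fun y => T y b c) (Q x))
    (b c : Fin 3) : DiffAt (fun y => rotT Q T y b c) x := by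
  simp only [rotT, pull2_apply, DiffAt]
  have : ∀ k l, l ∈ Finset.univ → DifferentiableAt ℝ
      (fun y => mat Q k b * mat Q l c * T (Q (unit y)) k l) x := fun k l _ =>
    (diffAt_comp Q (h k l)).const_mul _
  exact DifferentiableAt.fun_sum fun k _ => DifferentiableAt.fun_sum (this k)

/-- The matrix of the ambient derivatives `∂_k X_b`. -/
def jac (X : E → E) (x : E) : Matrix (Fin 3) (Fin 3) ℝ := Matrix.of fun k b => grad (fun y => X y b) x k

/-- The matrix of the ambient derivatives `∂_k T_bc`, for fixed `k`. -/
def jac2 (T : E → Matrix (Fin 3) (Fin 3) ℝ) (x : E) (k : Fin 3) : Matrix (Fin 3) (Fin 3) ℝ :=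
  Matrix.of fun b c => grad (fun y => T y b c) x k

lemma jac_rotV {X : E → E} (h : ∀ b, DiffAt (fun y => X y b) (Q x)) :
    jac (rotV Q X) x = pull2 (mat Q) (jac X (Q x)) := by
  ext k b
  have h1 : HasGrad (fun y => ∑ c, mat Q c b * X (Q y) c) x k
      (∑ c, mat Q c b * ∑ j, mat Q j k * grad (fun y => X y c) (Q x) j) :=
    HasGrad.sum fun c _ => (hasGrad_comp Q (h c) k).const_mul _
  have h2 : (fun y => rotV Q X y b) = fun y => ∑ c, mat Q c b * X (Q y) c := funext fun y => by
    simp [rotV, Matrix.vecMul, dotProduct, mul_comm]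
  have h3 := diffAt_rotV Q h b
  rw [jac, Matrix.of_apply]
  rw [h2] at h3 ⊢
  rw [h1.grad_eq h3, pull2_apply]
  simp only [Finset.mul_sum]
  rw [Finset.sum_comm]
  exact Finset.sum_congr rfl fun j _ => Finset.sum_congr rfl fun c _ => by
    simp only [jac, Matrix.of_apply]; ring

lemma jac2_rotT {T : E → Matrix (Fin 3) (Fin 3) ℝ} (h : ∀ b c, DiffAt (fun y => T y b c) (Q x))
    (k : Fin 3) : jac2 (rotT Q T) x k = ∑ a, mat Q a k • pull2 (mat Q) (jac2 T (Q x) a) := by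
  ext b c
  have h1 : HasGrad (fun y => ∑ d, ∑ e, mat Q d b * mat Q e c * T (Q y) d e) x k
      (∑ d, ∑ e, mat Q d b * mat Q e c * ∑ a, mat Q a k * grad (fun y => T y d e) (Q x) a) :=
    HasGrad.sum fun d _ => HasGrad.sum fun e _ => (hasGrad_comp Q (h d e) k).const_mul _
  have h2 : (fun y => rotT Q T y b c) = fun y => ∑ d, ∑ e, mat Q d b * mat Q e c * T (Q y) d e :=
    funext fun y => by simp [rotT, pull2_apply]
  have h3 := diffAt_rotT Q h b c
  rw [jac2, Matrix.of_apply]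
  rw [h2] at h3 ⊢
  rw [h1.grad_eq h3]
  simp only [Matrix.sum_apply, Matrix.smul_apply, pull2_apply, smul_eq_mul, Finset.mul_sum, jac2,
    Matrix.of_apply]
  calc _ = ∑ d, ∑ a, ∑ e, mat Q d b * mat Q e c * (mat Q a k * grad (fun y => T y d e) (Q x) a) :=
        Finset.sum_congr rfl fun d _ => Finset.sum_comm
    _ = ∑ a, ∑ d, ∑ e, mat Q d b * mat Q e c * (mat Q a k * grad (fun y => T y d e) (Q x) a) :=
        Finset.sum_comm
    _ = _ := Finset.sum_congr rfl fun _ _ => Finset.sum_congr rfl fun _ _ =>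
        Finset.sum_congr rfl fun _ _ => by ring

lemma proj_symm (x : E) (i j : Fin 3) : proj x i j = proj x j i := by
  simp [proj, eq_comm, mul_comm]

lemma cov1_eq (X : E → E) (x : E) : Matrix.of (cov1 X x) = jac X x * proj x := by
  ext k i
  simp only [Matrix.of_apply, cov1, Matrix.mul_apply, jac]
  exact Finset.sum_congr rfl fun b _ => by rw [proj_symm x i b, mul_comm]

lemma cov2_eq (T : E → Matrix (Fin 3) (Fin 3) ℝ) (x : E) (k : Fin 3) :
    Matrix.of (cov2 T x k) = proj x * jac2 T x k * proj x := by
  ext i j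
  simp only [Matrix.of_apply, cov2, Matrix.mul_apply, jac2, Finset.sum_mul]
  rw [Finset.sum_comm]
  refine Finset.sum_congr rfl fun b _ => Finset.sum_congr rfl fun c _ => ?_
  rw [proj_symm x j b]; ring

/-- Equivariance of the Levi-Civita derivative of vector fields. -/
lemma cov1_rotV {X : E → E} (h : ∀ b, DiffAt (fun y => X y b) (Q x)) :
    Matrix.of (cov1 (rotV Q X) x) = pull2 (mat Q) (Matrix.of (cov1 X (Q x))) := by
  rw [cov1_eq, cov1_eq, jac_rotV Q h, pull2_mul, pull2_proj]

/-- Equivariance of the Levi-Civita derivative of 2-tensors. -/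
lemma cov2_rotT {T : E → Matrix (Fin 3) (Fin 3) ℝ} (h : ∀ b c, DiffAt (fun y => T y b c) (Q x))
    (k : Fin 3) : Matrix.of (cov2 (rotT Q T) x k) =
      ∑ a, mat Q a k • pull2 (mat Q) (Matrix.of (cov2 T (Q x) a)) := by
  rw [cov2_eq, jac2_rotT Q h, Matrix.mul_sum, Matrix.sum_mul]
  refine Finset.sum_congr rfl fun a _ => ?_
  rw [cov2_eq, pull2_mul, pull2_mul, pull2_proj, Matrix.mul_smul, Matrix.smul_mul]

/-- Equivariance of the divergence. -/
lemma div2_rotT {T : E → Matrix (Fin 3) (Fin 3) ℝ} (h : ∀ b c, DiffAt (fun y => T y b c) (Q x)) :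
    div2 (rotT Q T) x = rotV Q (div2 T) x := by
  ext i
  have h1 : ∀ k, cov2 (rotT Q T) x k k i = ∑ a, ∑ m, mat Q a k * mat Q m k *
      ∑ n, cov2 T (Q x) a m n * mat Q n i := fun k => by
    have := congrFun (congrFun (cov2_rotT Q h k) k) i
    rw [Matrix.of_apply] at this
    rw [this]
    simp only [Matrix.sum_apply, Matrix.smul_apply, smul_eq_mul, pull2_apply, Finset.mul_sum,
      Matrix.of_apply]
    exact Finset.sum_congr rfl fun _ _ => Finset.sum_congr rfl fun _ _ =>
      Finset.sum_congr rfl fun _ _ => by ring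
  simp only [div2, rotV, h1]
  rw [Finset.sum_comm]
  calc _ = ∑ a, ∑ m, (∑ k, mat Q a k * mat Q m k) * ∑ n, cov2 T (Q x) a m n * mat Q n i := by
        refine Finset.sum_congr rfl fun a _ => ?_
        rw [Finset.sum_comm]
        simp only [Finset.sum_mul]
    _ = _ := by
        simp only [sum_mat_mat', ite_mul, one_mul, zero_mul, Finset.sum_ite_eq, Finset.mem_univ,
          if_true, Matrix.vecMul, dotProduct, Finset.sum_mul]
        exact Finset.sum_comm

lemma lie2_eq (Y : E → E) (T : E → Matrix (Fin 3) (Fin 3) ℝ) (x : E) :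
    Matrix.of (lie2 Y T x) = ∑ k, Y x k • Matrix.of (cov2 T x k) + Matrix.of (cov1 Y x) * T x +
      T x * (Matrix.of (cov1 Y x)).transpose := by
  ext i j
  simp only [Matrix.of_apply, lie2, Matrix.add_apply, Matrix.sum_apply, Matrix.smul_apply,
    Matrix.mul_apply, Matrix.transpose_apply, smul_eq_mul, Finset.sum_add_distrib]
  congr 1
  exact Finset.sum_congr rfl fun _ _ => mul_comm _ _

/-- Equivariance of the Lie derivative. -/
lemma lie2_rot {Y : E → E} {T : E → Matrix (Fin 3) (Fin 3) ℝ} (hY : ∀ b, DiffAt (fun y => Y y b) (Q x))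
    (h : ∀ b c, DiffAt (fun y => T y b c) (Q x)) : Matrix.of (lie2 (rotV Q Y) (rotT Q T) x) =
      pull2 (mat Q) (Matrix.of (lie2 Y T (Q x))) := by
  rw [lie2_eq, lie2_eq, pull2_add, pull2_add, pull2_mul, pull2_mul, pull2_transpose, pull2_sum]
  rw [cov1_rotV Q hY]
  congr 2
  simp only [cov2_rotT Q h, Finset.smul_sum, pull2_smul]
  rw [Finset.sum_comm]
  refine Finset.sum_congr rfl fun a _ => ?_
  simp only [smul_smul, ← Finset.sum_smul]
  congr 1
  have : rotV Q Y x = Q.symm (Y (Q x)) := by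
    apply Q.injective
    rw [Q.apply_symm_apply]
    ext i
    rw [isometry_apply]
    have e := congrFun (congrArg (fun A : Matrix (Fin 3) (Fin 3) ℝ => A.mulVec (Y (Q x)).ofLp)
      (mat_mul_transpose Q)) i
    rw [Matrix.one_mulVec, ← Matrix.mulVec_mulVec, Matrix.mulVec_transpose] at e
    exact e
  rw [this]
  have e := isometry_apply Q (Q.symm (Y (Q x))) a
  rw [Q.apply_symm_apply] at e
  rw [e]
  exact Finset.sum_congr rfl fun _ _ => mul_comm _ _

end Equivariance

/-! ### Equivariance of the Bondi data -/

namespace BondiSachsMetric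

variable {I : Set ℝ} {ρ₀ : ℝ} (g : BondiSachsMetric I ρ₀) (hI : IsOpen I) (hρ₀ : 0 < ρ₀)
  (Q : E ≃ₗᵢ[ℝ] E) {u : ℝ} {x : E}

include hI hρ₀ in
lemma contDiffAt_line {F : ℝ → ℝ → E → ℝ} (hF : SmoothCoeff I ρ₀ F) (hu : u ∈ I) (hx : x ∈ S2) (n : ℕ) :
    ContDiffAt ℝ n (fun ρ => F u ρ x) 0 := by
  have h := (hF.contDiffAt ((isOpen_dom hI ρ₀).mem_nhds (zero_mem_dom (p := (u, x)) hρ₀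
    ⟨hu, ne_zero_of_mem_S2 hx⟩))).comp (0 : ℝ) (f := fun ρ : ℝ => ((u, ρ, x) : X)) (by fun_prop)
  have e : (fun ρ => F u ρ x) = fun ρ : ℝ => F u ρ (unit x) := by rw [unit_of_mem hx]
  rw [e]
  exact h.of_le (by exact_mod_cast le_top)

lemma C_rotate (hu : u ∈ I) (hx : x ∈ S2) :
    (g.rotate hI hρ₀ Q).C u x = pull2 (mat Q) (g.C u (Q x)) := by
  have hx' := isometry_mem Q hx
  have hd : ∀ k l, DifferentiableAt ℝ (fun ρ => g.h u ρ (Q x) k l) 0 := fun k l =>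
    (contDiffAt_line hI hρ₀ (g.smooth_h k l) hu hx' 1).differentiableAt (by simp)
  ext i j
  rw [pull2_apply]
  change deriv (fun ρ => pull2 (mat Q) (g.h u ρ (Q x)) i j) 0 = _
  simp only [pull2_apply]
  exact (HasDerivAt.fun_sum fun k _ => HasDerivAt.fun_sum fun l _ =>
    (hd k l).hasDerivAt.const_mul _).deriv

lemma news_rotate (hu : u ∈ I) (hx : x ∈ S2) :
    (g.rotate hI hρ₀ Q).news u x = pull2 (mat Q) (g.news u (Q x)) := by
  have hx' := isometry_mem Q hx
  have hd := fun i j => (g.hat_C hI hρ₀ i j).smoothScri.hasDerivAt hI hu hx'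
  ext i j
  have h2 : (fun s => (g.rotate hI hρ₀ Q).C s x i j) =ᶠ[𝓝 u] fun s =>
      ∑ k, ∑ l, mat Q k i * mat Q l j * g.C s (Q x) k l := by
    filter_upwards [hI.mem_nhds hu] with s hs
    rw [C_rotate g hI hρ₀ Q hs hx, pull2_apply]
  rw [pull2_apply]
  exact ((HasDerivAt.fun_sum fun k _ => HasDerivAt.fun_sum fun l _ =>
    (hd k l).const_mul _).congr_of_eventuallyEq h2).deriv

lemma iteratedDeriv_W_rotate (hu : u ∈ I) (hx : x ∈ S2) (i : Fin 3) (n : ℕ) :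
    iteratedDeriv n (fun ρ => (g.rotate hI hρ₀ Q).W u ρ x i) 0 =
      ∑ k, mat Q k i * iteratedDeriv n (fun ρ => g.W u ρ (Q x) k) 0 := by
  have h := fun k => contDiffAt_line hI hρ₀ (g.smooth_W k) hu (isometry_mem Q hx) n
  change iteratedDeriv n (fun ρ => ∑ k, mat Q k i * g.W u ρ (Q x) k) 0 = _
  simp only [Fin.sum_univ_three]
  rw [iteratedDeriv_fun_add ((contDiffAt_const.mul (h 0)).add (contDiffAt_const.mul (h 1)))
    (contDiffAt_const.mul (h 2)), iteratedDeriv_fun_add (contDiffAt_const.mul (h 0))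
    (contDiffAt_const.mul (h 1))]
  simp only [iteratedDeriv_const_mul_field]

lemma W2_rotate (hu : u ∈ I) (hx : x ∈ S2) :
    (g.rotate hI hρ₀ Q).W2 u x = Matrix.vecMul (g.W2 u (Q x)) (mat Q) := by
  ext i
  rw [W2, iteratedDeriv_W_rotate g hI hρ₀ Q hu hx, Finset.mul_sum]
  change _ = ∑ k, g.W2 u (Q x) k * mat Q k i
  exact Finset.sum_congr rfl fun k _ => by rw [W2]; ring

lemma W3_rotate (hu : u ∈ I) (hx : x ∈ S2) :
    (g.rotate hI hρ₀ Q).W3 u x = Matrix.vecMul (g.W3 u (Q x)) (mat Q) := by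
  ext i
  rw [W3, iteratedDeriv_W_rotate g hI hρ₀ Q hu hx, Finset.mul_sum]
  change _ = ∑ k, g.W3 u (Q x) k * mat Q k i
  exact Finset.sum_congr rfl fun k _ => by rw [W3]; ring

lemma N_eq (u : ℝ) (x : E) : g.N u x = (3 / 2 : ℝ) •
    (g.W3 u x + (g.C u x).mulVec (g.W2 u x) - fun i => grad (g.U2 u) x i) := by
  ext i; simp [N, Matrix.mulVec, dotProduct]

lemma N_rotate (hu : u ∈ I) (hx : x ∈ S2) :
    (g.rotate hI hρ₀ Q).N u x = Matrix.vecMul (g.N u (Q x)) (mat Q) := by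
  rw [N_eq, N_eq, W3_rotate g hI hρ₀ Q hu hx, W2_rotate g hI hρ₀ Q hu hx, C_rotate g hI hρ₀ Q hu hx,
    pull2_mulVec, Matrix.smul_vecMul, Matrix.sub_vecMul, Matrix.add_vecMul]
  congr 2
  ext i
  change grad (fun y => g.U2 u (Q y)) x i = _
  rw [grad_comp]
  exact Finset.sum_congr rfl fun _ _ => mul_comm _ _

variable {g}

include hI hρ₀ in
lemma diffAt_C (hu : u ∈ I) (hx : x ∈ S2) (i j : Fin 3) : DiffAt (fun y => g.C u y i j) x :=
  (g.hat_C hI hρ₀ i j).smoothScri.differentiableAt hI hu hx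

lemma cov1_congr {X X' : E → E} {x : E} (hx : x ∈ S2) (h : ∀ y ∈ S2, X y = X' y) : cov1 X x = cov1 X' x := by
  ext k i
  exact Finset.sum_congr rfl fun b _ => by
    rw [grad_congr (fun y hy => by rw [h y hy]) (ne_zero_of_mem_S2 hx)]

lemma cov2_congr {T T' : E → Matrix (Fin 3) (Fin 3) ℝ} {x : E} (hx : x ∈ S2) (h : ∀ y ∈ S2, T y = T' y) :
    cov2 T x = cov2 T' x := by
  ext k i j
  exact Finset.sum_congr rfl fun b _ => Finset.sum_congr rfl fun c _ => by
    rw [grad_congr (fun y hy => by rw [h y hy]) (ne_zero_of_mem_S2 hx)]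

lemma div2_congr {T T' : E → Matrix (Fin 3) (Fin 3) ℝ} {x : E} (hx : x ∈ S2) (h : ∀ y ∈ S2, T y = T' y) :
    div2 T x = div2 T' x := by
  simp only [div2, cov2_congr hx h]

lemma lie2_congr {Y Y' : E → E} {T T' : E → Matrix (Fin 3) (Fin 3) ℝ} {x : E} (hx : x ∈ S2)
    (hY : ∀ y ∈ S2, Y y = Y' y) (h : ∀ y ∈ S2, T y = T' y) : lie2 Y T x = lie2 Y' T' x := by
  ext i j
  simp only [lie2, cov2_congr hx h, cov1_congr hx hY, h x hx, hY x hx]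

lemma div2_C_rotate (hu : u ∈ I) (hx : x ∈ S2) :
    div2 ((g.rotate hI hρ₀ Q).C u) x = rotV Q (div2 (g.C u)) x := by
  rw [div2_congr hx (T' := rotT Q (g.C u)) fun y hy => C_rotate g hI hρ₀ Q hu hy,
    div2_rotT Q fun b c => diffAt_C hI hρ₀ hu (isometry_mem Q hx) b c]

include hI hρ₀ in
lemma C_symm (hu : u ∈ I) (hx : x ∈ S2) (i j : Fin 3) : g.C u x i j = g.C u x j i := by
  have hp : ((u, x) : ℝ × E) ∈ sdom I := ⟨hu, ne_zero_of_mem_S2 hx⟩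
  have h1 := (g.hat_C hI hρ₀ i j).eq _ hp
  have h2 := (g.hat_C hI hρ₀ j i).eq _ hp
  simp only [unit_of_mem hx] at h1 h2
  rw [h1, h2, (coeff_hh_symm hI hρ₀ hp i j).1]

include hI hρ₀ in
lemma C_tangent (hu : u ∈ I) (hx : x ∈ S2) (i : Fin 3) : ∑ j, g.C u x i j * x j = 0 := by
  have hp : ((u, x) : ℝ × E) ∈ sdom I := ⟨hu, ne_zero_of_mem_S2 hx⟩
  rw [← (coeff_hh_tan (g := g) hI hρ₀ hp i).1]
  refine Finset.sum_congr rfl fun j _ => ?_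
  have h1 := (g.hat_C hI hρ₀ i j).eq _ hp
  simp only [unit_of_mem hx] at h1
  rw [h1]

include hI hρ₀ in
lemma C_trace (hu : u ∈ I) (hx : x ∈ S2) : ∑ i, g.C u x i i = 0 := by
  have hp : ((u, x) : ℝ × E) ∈ sdom I := ⟨hu, ne_zero_of_mem_S2 hx⟩
  rw [← (coeff_hh_trace (g := g) hI hρ₀ hp).1]
  refine Finset.sum_congr rfl fun i _ => ?_
  have h1 := (g.hat_C hI hρ₀ i i).eq _ hp
  simp only [unit_of_mem hx] at h1
  rw [h1]

include hI hρ₀ in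
lemma W2_tangent (hu : u ∈ I) (hx : x ∈ S2) : ∑ i, g.W2 u x i * x i = 0 := by
  have hp : ((u, x) : ℝ × E) ∈ sdom I := ⟨hu, ne_zero_of_mem_S2 hx⟩
  obtain ⟨w, hw⟩ := g.exists_isShift hI
  rw [← (hw.coeff_tan hI hρ₀ hp).1]
  refine Finset.sum_congr rfl fun i _ => ?_
  have h1 := (hw.hat_W2 hI hρ₀ i).eq _ hp
  simp only [unit_of_mem hx] at h1
  rw [h1, (hw.coeff_Bh hI hρ₀ hp i).2.1]

lemma proj_e3 (i j : Fin 3) : proj e3 i j = if i = j then (if i = 2 then 0 else 1) else 0 := by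
  fin_cases i <;> fin_cases j <;> simp [proj]

include hI hρ₀ in
/-- Tangency of `C`, differentiated at the pole. -/
lemma grad_C_pole (hu : u ∈ I) (k i : Fin 3) :
    grad (fun y => g.C u y i 2) e3 k = if k = 2 then 0 else -g.C u e3 i k := by
  have hg := fun j => (g.hat_C hI hρ₀ i j).smoothScri.hasGrad hI hu e3_mem k
  have h1 : HasGrad (fun y => ∑ j, g.C u y i j * y j) e3 k _ :=
    HasGrad.sum fun j _ => (hg j).mul e3_mem (hasGrad_coord e3_mem k j)
  have h2 := h1.unique ((HasGrad.const 0).congr e3_mem fun y hy => (C_tangent hI hρ₀ hu hy i).symm)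
  simp only [Fin.sum_univ_three, proj_e3] at h2
  fin_cases k <;> simp at h2 ⊢ <;> linarith

include hI hρ₀ in
lemma grad_C_trace (hu : u ∈ I) (hx : x ∈ S2) (k : Fin 3) : ∑ i, grad (fun y => g.C u y i i) x k = 0 := by
  have hg := fun i => (g.hat_C hI hρ₀ i i).smoothScri.hasGrad hI hu hx k
  exact (HasGrad.sum fun i _ => hg i).unique
    ((HasGrad.const 0).congr hx fun y hy => (C_trace hI hρ₀ hu hy).symm)

include hI hρ₀ in
/-- The vacuum equation `R_{rA} = 0` at leading order, at the pole. -/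
lemma W2_pole (hvac : g.IsVacuum) (hu : u ∈ I) (i : Fin 3) : g.W2 u e3 i = 1 / 2 * div2 (g.C u) e3 i := by
  obtain ⟨w, hw⟩ := g.exists_isShift hI
  have hs : grad (fun y => g.C u y 1 0) e3 = grad (fun y => g.C u y 0 1) e3 := funext fun k =>
    grad_congr (fun y hy => C_symm hI hρ₀ hu hy 1 0) e3_ne k
  have h0 := (hw.ricci_coeff hI hρ₀ hu hvac (a := 0) (b := 1) (by simp)).1
  have h1 := (hw.ricci_coeff hI hρ₀ hu hvac (a := 1) (b := 0) (by simp)).1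
  have t0 := grad_C_trace hI hρ₀ hu e3_mem (g := g) 0
  have t1 := grad_C_trace hI hρ₀ hu e3_mem (g := g) 1
  have n0 := grad_C_pole hI hρ₀ hu (g := g) 0 2
  have n1 := grad_C_pole hI hρ₀ hu (g := g) 1 2
  have c0 := C_tangent hI hρ₀ hu e3_mem (g := g) 0
  have c1 := C_tangent hI hρ₀ hu e3_mem (g := g) 1
  have s0 := C_symm hI hρ₀ hu e3_mem (g := g) 2 0
  have s1 := C_symm hI hρ₀ hu e3_mem (g := g) 2 1
  have w2 := W2_tangent hI hρ₀ hu e3_mem (g := g)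
  simp only [(hat_C' (g := g) hI hρ₀ _ _).dd_ss hI hu, (hw.hat_W2 hI hρ₀ _).pole hu] at h0 h1
  simp [Fin.sum_univ_three] at t0 t1 n0 n1 c0 c1 w2
  simp only [div2, cov2, proj_e3, Fin.sum_univ_three]
  fin_cases i <;> simp [w2]
  · rw [h0, hs]; linarith
  · rw [h1, hs]; linarith

include hI hρ₀ in
/-- The coefficient of `r⁻²` in the shift is half the divergence of the shear. -/
lemma div2_C (hvac : g.IsVacuum) (hu : u ∈ I) (hx : x ∈ S2) (i : Fin 3) :
    div2 (g.C u) x i = 2 * g.W2 u x i := by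
  obtain ⟨Q, rfl⟩ := exists_isometry hx
  have h : (g.rotate hI hρ₀ Q).W2 u e3 = (1 / 2 : ℝ) • (rotV Q (div2 (g.C u)) e3).ofLp := by
    ext i
    rw [W2_pole hI hρ₀ (hvac.rotate hI hρ₀ Q) hu, div2_C_rotate hI hρ₀ Q hu e3_mem]; rfl
  rw [W2_rotate g hI hρ₀ Q hu e3_mem, rotV, ← Matrix.smul_vecMul] at h
  have h2 := congrArg (fun v => Matrix.vecMul v (mat Q).transpose) h
  simp only [Matrix.vecMul_vecMul, mat_mul_transpose, Matrix.vecMul_one] at h2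
  rw [h2]; simp

include hI hρ₀ in
/-- The coefficient of `r⁻²` in `U` is `-|C|²/16`. -/
lemma U2_eq (hvac : g.IsVacuum) (hu : u ∈ I) (hx : x ∈ S2) :
    g.U2 u x = -(1 / 16) * contract (g.C u x) (g.C u x) := by
  obtain ⟨Q, rfl⟩ := exists_isometry hx
  obtain ⟨w, hw⟩ := (g.rotate hI hρ₀ Q).exists_isShift hI
  have h := hw.ricci_rr hI hρ₀ hu (hvac.rotate hI hρ₀ Q)
  rw [← contract_pull2 Q, ← C_rotate g hI hρ₀ Q hu e3_mem]
  set g' := g.rotate hI hρ₀ Q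
  simp only [(hat_C' (g := g') hI hρ₀ _ _).pole hu, (g'.hat_U2 hI hρ₀).pole hu] at h
  have h2 : g.U2 u (Q e3) = g'.U2 u e3 := rfl
  have s := C_symm hI hρ₀ hu e3_mem (g := g')
  have c : ∀ i, g'.C u e3 i 2 = 0 := fun i => by
    simpa [Fin.sum_univ_three] using C_tangent hI hρ₀ hu e3_mem (g := g') i
  rw [h2, h]
  simp only [contract, Fin.sum_univ_three, c, s 2 0, s 2 1, s 1 0]
  ring

end BondiSachsMetric

/-! ### The balance law at the pole -/

/-- The restriction to the sphere of a linear vector field. -/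
def linField (A : Matrix (Fin 3) (Fin 3) ℝ) (x : E) : E := WithLp.toLp 2 fun i => ∑ k, A i k * x k

lemma linField_apply (A : Matrix (Fin 3) (Fin 3) ℝ) (x : E) (i : Fin 3) :
    linField A x i = ∑ k, A i k * x k := rfl

lemma smoothScri_linField {I : Set ℝ} (A : Matrix (Fin 3) (Fin 3) ℝ) (i : Fin 3) :
    SmoothScri I fun _ x => linField A x i :=
  SmoothScri.sum (s := Finset.univ) fun k => (SmoothScri.const (A i k)).mul (SmoothScri.coord k)

lemma hasGrad_linField (A : Matrix (Fin 3) (Fin 3) ℝ) {x : E} (hx : x ∈ S2) (k i : Fin 3) :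
    HasGrad (fun y => linField A y i) x k (∑ j, A i j * proj x j k) :=
  HasGrad.sum (s := Finset.univ) fun j _ => (hasGrad_coord hx k j).const_mul (A i j)

lemma cov1_linField (A : Matrix (Fin 3) (Fin 3) ℝ) {x : E} (hx : x ∈ S2) (k i : Fin 3) :
    cov1 (linField A) x k i = ∑ b, proj x i b * ∑ j, A b j * proj x j k := by
  refine Finset.sum_congr rfl fun b _ => ?_
  rw [(hasGrad_linField A hx k b).grad_eq
    ((smoothScri_linField (I := univ) A b).differentiableAt isOpen_univ (mem_univ 0) hx)]

lemma grad_e3_two {f : E → ℝ} (h : DiffAt f e3) : grad f e3 2 = 0 := by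
  simpa [Fin.sum_univ_three] using sum_mul_grad h

namespace SmoothScri

variable {I : Set ℝ} {F : ℝ → E → ℝ} {u : ℝ}

/-- The tangency of the gradient, differentiated at the pole. -/
lemma grad_grad_two (hI : IsOpen I) (hF : SmoothScri I F) (hu : u ∈ I) {k : Fin 3} (hk : k ≠ 2) :
    BondiSachs.grad (fun y => BondiSachs.grad (F u) y 2) e3 k = -BondiSachs.grad (F u) e3 k := by
  have hg := fun j => (hF.grad hI j).hasGrad hI hu e3_mem k
  have h1 : HasGrad (fun y => ∑ j, y j * BondiSachs.grad (F u) y j) e3 k _ :=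
    HasGrad.sum fun j _ => (hasGrad_coord e3_mem k j).mul e3_mem (hg j)
  have h2 := h1.unique ((HasGrad.const 0).congr e3_mem fun y hy =>
    (sum_mul_grad (hF.differentiableAt hI hu hy)).symm)
  simp only [Fin.sum_univ_three, BondiSachsMetric.proj_e3] at h2
  fin_cases k <;> simp at h2 hk ⊢ <;> linarith

lemma grad_comm (hI : IsOpen I) (hF : SmoothScri I F) (hu : u ∈ I) {a b : Fin 3} (ha : a ≠ 2) (hb : b ≠ 2) :
    BondiSachs.grad (fun y => BondiSachs.grad (F u) y a) e3 b =
      BondiSachs.grad (fun y => BondiSachs.grad (F u) y b) e3 a := by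
  have hH : Hat I (fun p : ℝ × E => F p.1 (unit p.2)) F := ⟨hF, fun _ _ => rfl⟩
  rw [← hH.dd_ss_ss hI hu ha, ← hH.dd_ss_ss hI hu hb, dd_comm (isOpen_sdom hI) hF (pol_mem hu)]

end SmoothScri

namespace BondiSachsMetric

variable {I : Set ℝ} {ρ₀ : ℝ} (g : BondiSachsMetric I ρ₀) (hI : IsOpen I) (hρ₀ : 0 < ρ₀) {u : ℝ} {x : E}

include hI hρ₀

lemma smooth_C (i j : Fin 3) : SmoothScri I fun u x => g.C u x i j := (g.hat_C hI hρ₀ i j).smoothScri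

lemma smooth_news (i j : Fin 3) : SmoothScri I fun u x => g.news u x i j := (g.smooth_C hI hρ₀ i j).du hI

lemma smooth_m : SmoothScri I g.m := (g.hat_m hI hρ₀).smoothScri

lemma smooth_U2 : SmoothScri I g.U2 := (g.hat_U2 hI hρ₀).smoothScri

lemma smooth_W2 (i : Fin 3) : SmoothScri I fun u x => g.W2 u x i := by
  obtain ⟨w, hw⟩ := g.exists_isShift hI
  exact (hw.hat_W2 hI hρ₀ i).smoothScri

lemma smooth_N (i : Fin 3) : SmoothScri I fun u x => g.N u x i := by
  obtain ⟨w, hw⟩ := g.exists_isShift hI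
  refine (((SmoothScri.const (3 / 2)).mul ((hw.hat_N hI hρ₀ i).smoothScri)).add
    ((SmoothScri.const (3 / 2)).mul (((g.smooth_U2 hI hρ₀).mul (SmoothScri.coord i)).sub
      ((g.smooth_U2 hI hρ₀).grad hI i)))).congr fun u _ x _ => ?_
  ring

variable {g}

lemma W2_pole_two (hu : u ∈ I) : g.W2 u e3 2 = 0 := by
  simpa [Fin.sum_univ_three] using W2_tangent hI hρ₀ hu e3_mem (g := g)

lemma grad_W2_pole (hu : u ∈ I) {k : Fin 3} (hk : k ≠ 2) :
    grad (fun y => g.W2 u y 2) e3 k = -g.W2 u e3 k := by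
  have hg := fun j => (g.smooth_W2 hI hρ₀ j).hasGrad hI hu e3_mem k
  have h1 : HasGrad (fun y => ∑ j, g.W2 u y j * y j) e3 k _ :=
    HasGrad.sum fun j _ => (hg j).mul e3_mem (hasGrad_coord e3_mem k j)
  have h2 := h1.unique ((HasGrad.const 0).congr e3_mem fun y hy => (W2_tangent hI hρ₀ hu hy).symm)
  simp only [Fin.sum_univ_three, proj_e3] at h2
  fin_cases k <;> simp at h2 hk ⊢ <;> linarith

lemma news_symm (hu : u ∈ I) (hx : x ∈ S2) (i j : Fin 3) : g.news u x i j = g.news u x j i := by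
  refine Filter.EventuallyEq.deriv_eq ?_
  filter_upwards [hI.mem_nhds hu] with s hs using C_symm hI hρ₀ hs hx i j

lemma news_tangent (hu : u ∈ I) (hx : x ∈ S2) (i : Fin 3) : ∑ j, g.news u x i j * x j = 0 := by
  have h1 : HasDerivAt (fun s => ∑ j, g.C s x i j * x j) (∑ j, g.news u x i j * x j) u :=
    HasDerivAt.fun_sum fun j _ => ((g.smooth_C hI hρ₀ i j).hasDerivAt hI hu hx).mul_const _
  refine h1.unique ((hasDerivAt_const u (0 : ℝ)).congr_of_eventuallyEq ?_)
  filter_upwards [hI.mem_nhds hu] with s hs using C_tangent hI hρ₀ hs hx i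

lemma news_trace (hu : u ∈ I) (hx : x ∈ S2) : ∑ i, g.news u x i i = 0 := by
  have h1 : HasDerivAt (fun s => ∑ j, g.C s x j j) (∑ j, g.news u x j j) u :=
    HasDerivAt.fun_sum fun j _ => (g.smooth_C hI hρ₀ j j).hasDerivAt hI hu hx
  refine h1.unique ((hasDerivAt_const u (0 : ℝ)).congr_of_eventuallyEq ?_)
  filter_upwards [hI.mem_nhds hu] with s hs using C_trace hI hρ₀ hs hx

lemma grad_news (hu : u ∈ I) (k i j : Fin 3) : deriv (fun s => grad (fun y => g.C s y i j) e3 k) u =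
    grad (fun y => g.news u y i j) e3 k := (g.smooth_C hI hρ₀ i j).deriv_grad hI hu e3_mem k

lemma grad_news_pole (hu : u ∈ I) (k i : Fin 3) :
    grad (fun y => g.news u y i 2) e3 k = if k = 2 then 0 else -g.news u e3 i k := by
  have hg := fun j => (g.smooth_news hI hρ₀ i j).hasGrad hI hu e3_mem k
  have h1 : HasGrad (fun y => ∑ j, g.news u y i j * y j) e3 k _ :=
    HasGrad.sum fun j _ => (hg j).mul e3_mem (hasGrad_coord e3_mem k j)
  have h2 := h1.unique ((HasGrad.const 0).congr e3_mem fun y hy => (news_tangent hI hρ₀ hu hy i).symm)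
  simp only [Fin.sum_univ_three, proj_e3] at h2
  fin_cases k <;> simp at h2 ⊢ <;> linarith

lemma grad_news_trace (hu : u ∈ I) (hx : x ∈ S2) (k : Fin 3) :
    ∑ i, grad (fun y => g.news u y i i) x k = 0 := by
  have hg := fun i => (g.smooth_news hI hρ₀ i i).hasGrad hI hu hx k
  exact (HasGrad.sum fun i _ => hg i).unique
    ((HasGrad.const 0).congr hx fun y hy => (news_trace hI hρ₀ hu hy).symm)

/-- The momentum constraint at the pole, in terms of the Bondi data. -/
lemma momentum_pole (hvac : g.IsVacuum) (hu : u ∈ I) {a b : Fin 3} (hab : a = 0 ∧ b = 1 ∨ a = 1 ∧ b = 0) :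
    let c : Fin 3 → Fin 3 → ℝ := fun i j => g.C u e3 i j
    let n : Fin 3 → Fin 3 → ℝ := fun i j => g.news u e3 i j
    let D : Fin 3 → Fin 3 → Fin 3 → ℝ := fun k i j => grad (fun y => g.C u y i j) e3 k
    let Dn : Fin 3 → Fin 3 → Fin 3 → ℝ := fun k i j => grad (fun y => g.news u y i j) e3 k
    let B : Fin 3 → ℝ := fun i => g.W2 u e3 i
    let Bu : Fin 3 → ℝ := fun i => deriv (fun s => g.W2 s e3 i) u
    c a b * Dn a a b - c a b * Dn b a a + c a b * Bu b + c a a * Dn b a b - c a a * Dn a b b +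
      c a a * Bu a + grad (fun y => grad (fun z => g.W2 u z b) y b) e3 a -
      grad (fun y => grad (fun z => g.W2 u z a) y b) e3 b + B a + B a * n a a +
      2 * grad (g.m u) e3 a - 2 * deriv (fun s => g.N s e3 a) u -
      2 * deriv (fun s => grad (g.U2 s) e3 a) u - n a a * D b a b + 1 / 2 * n a a * D a b b + B b * n a b +
      1 / 2 * n a b * D b a a - 1 / 2 * n a b * D b b b + 1 / 2 * D a b b * n b b +
      (1 / 4 * (Dn a b b * (c a a - c b b) + D a b b * (n a a - n b b)) +
        1 / 2 * (Bu a * (c a a + c b b) + B a * (n a a + n b b)) -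
        1 / 2 * (n a b * D a a b + c a b * Dn a a b) +
        1 / 4 * (n a b * (D b a a + D b b b) + c a b * (Dn b a a + Dn b b b))) = 0 := by
  intro c n D Dn B Bu
  obtain ⟨w, hw⟩ := g.exists_isShift hI
  have h := hw.momentum_dd hI hρ₀ hvac hu hab
  have ha2 : a ≠ 2 := by rcases hab with ⟨rfl, rfl⟩ | ⟨rfl, rfl⟩ <;> decide
  have hb2 : b ≠ 2 := by rcases hab with ⟨rfl, rfl⟩ | ⟨rfl, rfl⟩ <;> decide
  have hC := fun i j => hat_C' (g := g) hI hρ₀ i j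
  have hB := fun i => hw.hat_W2 hI hρ₀ i
  have hm : grad (fun y => 2 * g.m u y) e3 a = 2 * grad (g.m u) e3 a :=
    (((g.smooth_m hI hρ₀).hasGrad hI hu e3_mem a).const_mul 2).grad_eq
      (((g.smooth_m hI hρ₀).differentiableAt hI hu e3_mem).const_mul 2)
  have hN : deriv (fun s => 2 / 3 * g.N s e3 a - g.U2 s e3 * e3 a + grad (g.U2 s) e3 a) u =
      2 / 3 * deriv (fun s => g.N s e3 a) u + deriv (fun s => grad (g.U2 s) e3 a) u := by
    have e : e3 a = 0 := by simpa using ha2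
    have h1 := ((((g.smooth_N hI hρ₀ a).hasDerivAt hI hu e3_mem).const_mul (2 / 3)).fun_sub
      (((g.smooth_U2 hI hρ₀).hasDerivAt hI hu e3_mem).mul_const (e3 a))).fun_add
      (((g.smooth_U2 hI hρ₀).grad hI a).hasDerivAt hI hu e3_mem)
    rw [h1.deriv, e]; ring
  have e1 := fun i j => (hC i j).pole hu
  have e2 := fun i j => (hC i j).dd_su hI hu
  have e3 := fun i j k => (hC i j).dd_ss hI hu k
  have e4 := fun i j k => (hC i j).dd_su_ss hI hu k
  have e5 := fun i => (hB i).pole hu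
  have e6 := fun i => (hB i).dd_su hI hu
  have e7 := fun i k => (hB i).dd_ss_ss hI hu ha2 k
  have e8 := fun i k => (hB i).dd_ss_ss hI hu hb2 k
  simp only [e1, e2, e3, e4, e5, e6, e7, e8, (hw.hat_Sh hI hρ₀).dd_ss hI hu, hm,
    (hw.hat_N hI hρ₀ a).dd_su hI hu, hN, (g.hat_U2 hI hρ₀).dd_su_ss hI hu, grad_news hI hρ₀ hu] at h
  have e9 : ∀ i j, deriv (fun s => g.C s BondiSachs.e3 i j) u = g.news u BondiSachs.e3 i j := fun _ _ => rfl
  simp only [e9] at h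
  simp only [c, n, D, Dn, B, Bu]
  linear_combination h

end BondiSachsMetric

namespace SmoothScri

variable {I : Set ℝ} {X : ℝ → E → E} {T : ℝ → E → Matrix (Fin 3) (Fin 3) ℝ}

lemma cov1 (hI : IsOpen I) (hX : ∀ b, SmoothScri I fun u x => X u x b) (k i : Fin 3) :
    SmoothScri I fun u x => BondiSachs.cov1 (X u) x k i :=
  SmoothScri.sum (s := Finset.univ) fun b => (SmoothScri.proj i b).mul ((hX b).grad hI k)

lemma cov2 (hI : IsOpen I) (hT : ∀ b c, SmoothScri I fun u x => T u x b c) (k i j : Fin 3) :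
    SmoothScri I fun u x => BondiSachs.cov2 (T u) x k i j :=
  SmoothScri.sum (s := Finset.univ) fun b => SmoothScri.sum (s := Finset.univ) fun c =>
    ((SmoothScri.proj i b).mul (SmoothScri.proj j c)).mul ((hT b c).grad hI k)

lemma div2 (hI : IsOpen I) (hT : ∀ b c, SmoothScri I fun u x => T u x b c) (i : Fin 3) :
    SmoothScri I fun u x => BondiSachs.div2 (T u) x i :=
  SmoothScri.sum (s := Finset.univ) fun k => SmoothScri.cov2 hI hT k k i

end SmoothScri

namespace BondiSachsMetric

variable {I : Set ℝ} {ρ₀ : ℝ} (g : BondiSachsMetric I ρ₀) (hI : IsOpen I) (hρ₀ : 0 < ρ₀) {u : ℝ} {x : E}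
  (A : Matrix (Fin 3) (Fin 3) ℝ)

include hI hρ₀

lemma smooth_div2 (i : Fin 3) : SmoothScri I fun u x => div2 (g.C u) x i :=
  SmoothScri.div2 hI (g.smooth_C hI hρ₀) i

lemma smooth_density : SmoothScri I (g.density (linField A)) :=
  SmoothScri.sum (s := Finset.univ) fun i => (smoothScri_linField A i).mul
    ((g.smooth_N hI hρ₀ i).sub ((SmoothScri.const (1 / 4)).mul
      (SmoothScri.sum (s := Finset.univ) fun j => (g.smooth_C hI hρ₀ i j).mul (g.smooth_div2 hI hρ₀ j))))

lemma smooth_P (b a : Fin 3) : SmoothScri I fun u x => g.P u x b a :=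
  (SmoothScri.cov1 hI (g.smooth_div2 hI hρ₀) b a).sub (SmoothScri.cov1 hI (g.smooth_div2 hI hρ₀) a b)

lemma smooth_fluxVec (d : Fin 3) : SmoothScri I fun u x => g.fluxVec (linField A) u x d := by
  have hY := smoothScri_linField (I := I) A
  have hC := g.smooth_C hI hρ₀
  have hs := fun (c : ℝ) (F : Fin 3 → ℝ → E → ℝ) (h : ∀ i, SmoothScri I (F i)) =>
    (SmoothScri.const (I := I) c).mul (SmoothScri.sum (s := Finset.univ) h)
  exact (((((hY d).mul (g.smooth_m hI hρ₀)).add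
    (hs _ _ fun i => SmoothScri.sum (s := Finset.univ) fun j =>
      ((hY i).mul (hC i j)).mul (g.smooth_news hI hρ₀ j d))).sub
    (hs _ _ fun i => (hY i).mul (g.smooth_P hI hρ₀ d i))).add
    (hs _ _ fun i => (SmoothScri.cov1 hI hY d i).mul (g.smooth_div2 hI hρ₀ i))).add
    (hs _ _ fun i => (hY i).mul (hC d i))

variable {g}

/-- The `u`-derivative of the charge density at the pole. -/
lemma hasDerivAt_density (hvac : g.IsVacuum) (hu : u ∈ I) (Y : E → E) :
    HasDerivAt (fun s => g.density Y s e3) (∑ i, Y e3 i * (deriv (fun s => g.N s e3 i) u - 1 / 2 *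
      ∑ j, (g.news u e3 i j * g.W2 u e3 j + g.C u e3 i j * deriv (fun s => g.W2 s e3 j) u))) u := by
  have h1 : HasDerivAt (fun s => ∑ i, Y e3 i * (g.N s e3 i - 1 / 2 * ∑ j, g.C s e3 i j * g.W2 s e3 j))
    _ u := HasDerivAt.fun_sum fun i _ => (((g.smooth_N hI hρ₀ i).hasDerivAt hI hu e3_mem).fun_sub
      ((HasDerivAt.fun_sum fun j _ => ((g.smooth_C hI hρ₀ i j).hasDerivAt hI hu e3_mem).fun_mul
        ((g.smooth_W2 hI hρ₀ j).hasDerivAt hI hu e3_mem)).const_mul (1 / 2))).const_mul (Y e3 i)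
  refine h1.congr_of_eventuallyEq ?_
  filter_upwards [hI.mem_nhds hu] with s hs
  simp only [density, div2_C hI hρ₀ hvac hs e3_mem, Finset.mul_sum]
  refine Finset.sum_congr rfl fun i _ => congrArg _ (congrArg _ ?_)
  exact Finset.sum_congr rfl fun j _ => by ring

/-- The derivatives of the flux vector field. -/
lemma hasGrad_fluxVec (hvac : g.IsVacuum) (hu : u ∈ I) (d k : Fin 3) :
    let x := e3
    let Y : Fin 3 → ℝ := fun i => linField A x i
    let DY : Fin 3 → ℝ := fun i => ∑ j, A i j * proj x j k
    let c : Fin 3 → Fin 3 → ℝ := fun i j => g.C u x i j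
    let n : Fin 3 → Fin 3 → ℝ := fun i j => g.news u x i j
    let Dc : Fin 3 → Fin 3 → ℝ := fun i j => grad (fun y => g.C u y i j) x k
    let Dn : Fin 3 → Fin 3 → ℝ := fun i j => grad (fun y => g.news u y i j) x k
    let B : Fin 3 → ℝ := fun i => g.W2 u x i
    let DB : Fin 3 → Fin 3 → ℝ := fun l i => grad (fun y => g.W2 u y i) x l
    let DDB : Fin 3 → Fin 3 → ℝ := fun l i => grad (fun y => grad (fun z => g.W2 u z i) y l) x k
    let Dp : Fin 3 → Fin 3 → ℝ := fun i j => -(proj x i k * x j + x i * proj x j k)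
    let cB : Fin 3 → Fin 3 → ℝ := fun l i => ∑ b, proj x i b * DB l b
    let DcB : Fin 3 → Fin 3 → ℝ := fun l i => ∑ b, (Dp i b * DB l b + proj x i b * DDB l b)
    let cY : Fin 3 → Fin 3 → ℝ := fun l i => ∑ b, proj x i b * ∑ j, A b j * proj x j l
    let DcY : Fin 3 → Fin 3 → ℝ := fun l i => ∑ b, (Dp i b * (∑ j, A b j * proj x j l) +
      proj x i b * ∑ j, A b j * Dp j l)
    HasGrad (fun y => g.fluxVec (linField A) u y d) x k
      (DY d * g.m u x + Y d * grad (g.m u) x k +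
        1 / 2 * ∑ i, ∑ j, ((DY i * c i j + Y i * Dc i j) * n j d + Y i * c i j * Dn j d) -
        1 / 2 * ∑ i, (DY i * (cB d i - cB i d) + Y i * (DcB d i - DcB i d)) +
        ∑ i, (DcY d i * B i + cY d i * DB k i) +
        1 / 2 * ∑ i, (DY i * c d i + Y i * Dc d i)) := by
  intro x Y DY c n Dc Dn B DB DDB Dp cB DcB cY DcY
  have hx : x ∈ S2 := e3_mem
  have hY := fun i => hasGrad_linField A hx k i
  have hC := fun i j => (g.smooth_C hI hρ₀ i j).hasGrad hI hu hx k
  have hn := fun i j => (g.smooth_news hI hρ₀ i j).hasGrad hI hu hx k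
  have hm := (g.smooth_m hI hρ₀).hasGrad hI hu hx k
  have hB := fun i => (g.smooth_W2 hI hρ₀ i).hasGrad hI hu hx k
  have hDB := fun l i => ((g.smooth_W2 hI hρ₀ i).grad hI l).hasGrad hI hu hx k
  have hcB : ∀ l i, HasGrad (fun y => ∑ b, proj y i b * grad (fun z => g.W2 u z b) y l) x k (DcB l i) :=
    fun l i => HasGrad.sum fun b _ => (hasGrad_proj hx k i b).mul hx (hDB l b)
  have hcY : ∀ l i, HasGrad (fun y => ∑ b, proj y i b * ∑ j, A b j * proj y j l) x k (DcY l i) :=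
    fun l i => HasGrad.sum fun b _ => (hasGrad_proj hx k i b).mul hx
      (HasGrad.sum fun j _ => (hasGrad_proj hx k j l).const_mul (A b j))
  have key := ((((((hY d).mul hx hm).add ((HasGrad.sum (s := Finset.univ) fun i _ =>
    HasGrad.sum (s := Finset.univ) fun j _ => ((hY i).mul hx (hC i j)).mul hx (hn j d)).const_mul
    (1 / 2))).sub ((HasGrad.sum (s := Finset.univ) fun i _ => (hY i).mul hx
      ((hcB d i).sub (hcB i d))).const_mul (1 / 2))).add
    (HasGrad.sum (s := Finset.univ) fun i _ => (hcY d i).mul hx (hB i))).add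
    ((HasGrad.sum (s := Finset.univ) fun i _ => (hY i).mul hx (hC d i)).const_mul (1 / 2)))
  refine key.congr hx fun y hy => ?_
  have e1 : ∀ k i, cov1 (div2 (g.C u)) y k i =
      2 * ∑ b, proj y i b * grad (fun z => g.W2 u z b) y k := by
    intro k i
    rw [cov1, Finset.mul_sum]
    refine Finset.sum_congr rfl fun b _ => ?_
    rw [grad_congr (fun z hz => div2_C hI hρ₀ hvac hu hz b) (ne_zero_of_mem_S2 hy),
      (((g.smooth_W2 hI hρ₀ b).hasGrad hI hu hy k).const_mul 2).grad_eq
        (((g.smooth_W2 hI hρ₀ b).differentiableAt hI hu hy).const_mul 2)]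
    ring
  simp only [fluxVec, P, e1, div2_C hI hρ₀ hvac hu hy, cov1_linField A hy]
  congr 1
  congr 1
  · congr 1
    rw [Finset.mul_sum, Finset.mul_sum]
    exact Finset.sum_congr rfl fun i _ => by ring
  · rw [Finset.mul_sum]
    exact Finset.sum_congr rfl fun i _ => by ring

end BondiSachsMetric

namespace BondiSachsMetric

variable {I : Set ℝ} {ρ₀ : ℝ} {g : BondiSachsMetric I ρ₀} (hI : IsOpen I) (hρ₀ : 0 < ρ₀) {u : ℝ} {x : E}
  {A : Matrix (Fin 3) (Fin 3) ℝ}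

include hI hρ₀

/-- The `u`-derivative of the gradient of `-|C|²/16` at the pole. -/
lemma du_grad_U2 (hvac : g.IsVacuum) (hu : u ∈ I) (k : Fin 3) :
    deriv (fun s => grad (g.U2 s) e3 k) u = -(1 / 8) * ∑ i, ∑ j,
      (grad (fun y => g.C u y i j) e3 k * g.news u e3 i j +
        g.C u e3 i j * grad (fun y => g.news u y i j) e3 k) := by
  have hC := fun i j => g.smooth_C hI hρ₀ i j
  have h1 : ∀ s ∈ I, grad (g.U2 s) e3 k = -(1 / 16) * ∑ i, ∑ j,
      (grad (fun y => g.C s y i j) e3 k * g.C s e3 i j + g.C s e3 i j * grad (fun y => g.C s y i j) e3 k) := by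
    intro s hs
    have h2 : HasGrad (fun y => -(1 / 16) * ∑ i, ∑ j, g.C s y i j * g.C s y i j) e3 k _ :=
      (HasGrad.sum fun i _ => HasGrad.sum fun j _ => ((hC i j).hasGrad hI hs e3_mem k).mul e3_mem
        ((hC i j).hasGrad hI hs e3_mem k)).const_mul _
    exact (h2.congr e3_mem fun y hy => (U2_eq hI hρ₀ hvac hs hy).symm).grad_eq
      ((g.smooth_U2 hI hρ₀).differentiableAt hI hs e3_mem)
  have hD := fun i j => ((hC i j).grad hI k).hasDerivAt hI hu e3_mem
  have hc := fun i j => (hC i j).hasDerivAt hI hu e3_mem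
  have h3 := (HasDerivAt.fun_sum (u := Finset.univ) fun i _ => HasDerivAt.fun_sum (u := Finset.univ)
    fun j _ => ((hD i j).fun_mul (hc i j)).fun_add ((hc i j).fun_mul (hD i j))).const_mul (-(1 / 16 : ℝ))
  rw [(h3.congr_of_eventuallyEq (by filter_upwards [hI.mem_nhds hu] with s hs using h1 s hs)).deriv]
  have h4 : ∀ i j, deriv (fun s => grad (fun y => g.C s y i j) e3 k) u =
      grad (fun y => g.news u y i j) e3 k := fun i j => grad_news hI hρ₀ hu k i j
  have h5 : ∀ i j, deriv (fun s => g.C s e3 i j) u = g.news u e3 i j := fun _ _ => rfl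
  simp only [h4, h5, Finset.mul_sum]
  exact Finset.sum_congr rfl fun i _ => Finset.sum_congr rfl fun j _ => by ring

/-- The divergence of the symmetric trace-free tensor `C` at the pole, in terms of two of its components. -/
lemma W2_pole_eq (hvac : g.IsVacuum) (hu : u ∈ I) :
    g.W2 u e3 0 = 1 / 2 * (grad (fun y => g.C u y 0 0) e3 0 + grad (fun y => g.C u y 0 1) e3 1) ∧
    g.W2 u e3 1 = 1 / 2 * (grad (fun y => g.C u y 0 1) e3 0 - grad (fun y => g.C u y 0 0) e3 1) := by
  have ct : ∀ i, g.C u e3 i 2 = 0 := fun i => by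
    simpa [Fin.sum_univ_three] using C_tangent hI hρ₀ hu e3_mem (g := g) i
  have cs := C_symm hI hρ₀ hu e3_mem (g := g)
  have Ds : ∀ k, grad (fun y => g.C u y 1 0) e3 k = grad (fun y => g.C u y 0 1) e3 k := fun k =>
    grad_congr (fun y hy => C_symm hI hρ₀ hu hy 1 0) e3_ne k
  have Dtr : grad (fun y => g.C u y 1 1) e3 1 = -grad (fun y => g.C u y 0 0) e3 1 := by
    have := grad_C_trace hI hρ₀ hu e3_mem (g := g) 1
    simp only [Fin.sum_univ_three, grad_C_pole hI hρ₀ hu (g := g), cs 2, ct] at this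
    split_ifs at this <;> linarith
  rw [W2_pole hI hρ₀ hvac hu, W2_pole hI hρ₀ hvac hu]
  simp [div2, cov2, proj_e3, Fin.sum_univ_three, Ds, Dtr]
  ring

lemma du_W2_pole (hvac : g.IsVacuum) (hu : u ∈ I) :
    deriv (fun s => g.W2 s e3 0) u =
      1 / 2 * (grad (fun y => g.news u y 0 0) e3 0 + grad (fun y => g.news u y 0 1) e3 1) ∧
    deriv (fun s => g.W2 s e3 1) u =
      1 / 2 * (grad (fun y => g.news u y 0 1) e3 0 - grad (fun y => g.news u y 0 0) e3 1) := by
  have hD := fun k i j => (((g.smooth_C hI hρ₀ i j).grad hI k).hasDerivAt hI hu e3_mem).congr_deriv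
    (grad_news hI hρ₀ hu k i j)
  constructor
  · refine ((((hD 0 0 0).fun_add (hD 1 0 1)).const_mul (1 / 2)).congr_of_eventuallyEq ?_).deriv
    filter_upwards [hI.mem_nhds hu] with s hs using (W2_pole_eq hI hρ₀ hvac hs).1
  · refine ((((hD 0 0 1).fun_sub (hD 1 0 0)).const_mul (1 / 2)).congr_of_eventuallyEq ?_).deriv
    filter_upwards [hI.mem_nhds hu] with s hs using (W2_pole_eq hI hρ₀ hvac hs).2

/-- The balance law at the pole. -/
lemma balance_pole (hvac : g.IsVacuum) (hA : ∀ i j, A i j = -A j i) (hu : u ∈ I) :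
    deriv (fun s => g.density (linField A) s e3) u =
      ∑ k, grad (fun y => g.fluxVec (linField A) u y k) e3 k - 1 / 4 * g.newsLie (linField A) u e3 := by
  rw [(hasDerivAt_density hI hρ₀ hvac hu (linField A)).deriv]
  have hV := fun k => (hasGrad_fluxVec hI hρ₀ A hvac hu k k).grad_eq
    ((g.smooth_fluxVec hI hρ₀ A k).differentiableAt hI hu e3_mem)
  have hV2 : grad (fun y => g.fluxVec (linField A) u y 2) e3 2 = 0 :=
    grad_e3_two ((g.smooth_fluxVec hI hρ₀ A 2).differentiableAt hI hu e3_mem)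
  rw [Fin.sum_univ_three (f := fun k => grad (fun y => g.fluxVec (linField A) u y k) e3 k), hV2,
    hV 0, hV 1]
  have m0 := momentum_pole hI hρ₀ hvac hu (a := 0) (b := 1) (by simp)
  have m1 := momentum_pole hI hρ₀ hvac hu (a := 1) (b := 0) (by simp)
  -- symmetries of the data at the pole
  have cs := C_symm hI hρ₀ hu e3_mem (g := g)
  have ns := news_symm hI hρ₀ hu e3_mem (g := g)
  have ct : ∀ i, g.C u e3 i 2 = 0 := fun i => by
    simpa [Fin.sum_univ_three] using C_tangent hI hρ₀ hu e3_mem (g := g) i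
  have nt : ∀ i, g.news u e3 i 2 = 0 := fun i => by
    simpa [Fin.sum_univ_three] using news_tangent hI hρ₀ hu e3_mem (g := g) i
  have ctr : g.C u e3 1 1 = -g.C u e3 0 0 := by
    have := C_trace hI hρ₀ hu e3_mem (g := g)
    simp only [Fin.sum_univ_three, ct] at this; linarith
  have ntr : g.news u e3 1 1 = -g.news u e3 0 0 := by
    have := news_trace hI hρ₀ hu e3_mem (g := g)
    simp only [Fin.sum_univ_three, nt] at this; linarith
  have Ds : ∀ k i j, grad (fun y => g.C u y i j) e3 k = grad (fun y => g.C u y j i) e3 k := fun k i j =>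
    grad_congr (fun y hy => C_symm hI hρ₀ hu hy i j) e3_ne k
  have Dns : ∀ k i j, grad (fun y => g.news u y i j) e3 k = grad (fun y => g.news u y j i) e3 k :=
    fun k i j => grad_congr (fun y hy => news_symm hI hρ₀ hu hy i j) e3_ne k
  have Dt := grad_C_pole hI hρ₀ hu (g := g)
  have Dnt := grad_news_pole hI hρ₀ hu (g := g)
  have Dtr : ∀ k, grad (fun y => g.C u y 1 1) e3 k = -grad (fun y => g.C u y 0 0) e3 k := fun k => by
    have := grad_C_trace hI hρ₀ hu e3_mem (g := g) k
    simp only [Fin.sum_univ_three, Dt, cs 2, ct] at this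
    split_ifs at this <;> linarith
  have Dntr : ∀ k, grad (fun y => g.news u y 1 1) e3 k = -grad (fun y => g.news u y 0 0) e3 k := fun k => by
    have := grad_news_trace hI hρ₀ hu e3_mem (g := g) k
    simp only [Fin.sum_univ_three, Dnt, ns 2, nt] at this
    split_ifs at this <;> linarith
  have hdiff : ∀ i j, DiffAt (fun y => g.C u y i j) e3 := fun i j => diffAt_C hI hρ₀ hu e3_mem i j
  have D2 : ∀ i j, grad (fun y => g.C u y i j) e3 2 = 0 := fun i j => grad_e3_two (hdiff i j)
  have U2u := du_grad_U2 hI hρ₀ hvac hu (g := g)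
  -- the shift is half the divergence of the shear
  obtain ⟨W0, W1⟩ := W2_pole_eq hI hρ₀ hvac hu (g := g)
  obtain ⟨Wu0, Wu1⟩ := du_W2_pole hI hρ₀ hvac hu (g := g)
  have W2 := W2_pole_two hI hρ₀ hu (g := g)
  have DW := fun k hk => grad_W2_pole hI hρ₀ hu (g := g) (k := k) hk
  have DDW := fun i k hk => (g.smooth_W2 hI hρ₀ i).grad_grad_two hI hu (k := k) hk
  have DWc := fun i => (g.smooth_W2 hI hρ₀ i).grad_comm hI hu (a := 1) (b := 0) (by decide) (by decide)
  have DW2 : ∀ i, grad (fun y => g.W2 u y i) e3 2 = 0 := fun i =>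
    grad_e3_two ((g.smooth_W2 hI hρ₀ i).differentiableAt hI hu e3_mem)
  have A0 : ∀ i, A i i = 0 := fun i => by linarith [hA i i]
  have a1 := hA 1 0
  have a2 := hA 2 0
  have a3 := hA 2 1
  simp only [newsLie, lie2, cov2, cov1_linField A e3_mem, Fin.sum_univ_three, linField_apply, proj_e3]
  simp [Fin.sum_univ_three] at U2u m0 m1 ⊢
  simp [ct, nt, ctr, ntr, cs 1 0, cs 2 0, cs 2 1, ns 1 0, ns 2 0, ns 2 1, Ds _ 1 0, Ds _ 2 0, Ds _ 2 1,
    Dns _ 1 0, Dns _ 2 0, Dns _ 2 1, Dt, Dnt, Dtr, Dntr, D2, U2u, W0, W1, Wu0, Wu1, W2, DW, DDW, DWc, DW2,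
    A0, a1, a2, a3] at m0 m1 ⊢
  linear_combination -1 / 2 * A 0 2 * m0 - 1 / 2 * A 1 2 * m1

end BondiSachsMetric

/-! ### The balance law on the sphere -/

lemma rotV_linField (Q : E ≃ₗᵢ[ℝ] E) (A : Matrix (Fin 3) (Fin 3) ℝ) :
    rotV Q (linField A) = linField (pull2 (mat Q) A) := by
  ext y i
  change ∑ k, (∑ l, A k l * Q y l) * mat Q k i = ∑ j, pull2 (mat Q) A i j * y j
  simp only [isometry_apply, pull2_apply, Finset.sum_mul, Finset.mul_sum]
  rw [Finset.sum_comm' (s := Finset.univ) (t := fun _ => Finset.univ) (t' := Finset.univ)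
    (s' := fun _ => Finset.univ) (by simp)]
  calc _ = ∑ l, ∑ j, ∑ k, A k l * (mat Q l j * y j) * mat Q k i :=
        Finset.sum_congr rfl fun l _ => Finset.sum_comm
    _ = ∑ j, ∑ l, ∑ k, A k l * (mat Q l j * y j) * mat Q k i := Finset.sum_comm
    _ = _ := Finset.sum_congr rfl fun j _ => by
        rw [Finset.sum_comm]
        exact Finset.sum_congr rfl fun k _ => Finset.sum_congr rfl fun l _ => by ring

namespace BondiSachsMetric

variable {I : Set ℝ} {ρ₀ : ℝ} (g : BondiSachsMetric I ρ₀) (hI : IsOpen I) (hρ₀ : 0 < ρ₀)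
  (Q : E ≃ₗᵢ[ℝ] E) {u : ℝ} {x : E} {A : Matrix (Fin 3) (Fin 3) ℝ}

lemma density_eq (Y : E → E) (u : ℝ) (x : E) : g.density Y u x =
    dotProduct (Y x).ofLp (g.N u x - (1 / 4 : ℝ) • (g.C u x).mulVec (div2 (g.C u) x).ofLp) := by
  simp [density, dotProduct, Matrix.mulVec]

lemma fluxVec_eq (Y : E → E) (u : ℝ) (x : E) : (g.fluxVec Y u x).ofLp =
    g.m u x • (Y x).ofLp + (1 / 2 : ℝ) • Matrix.vecMul (Matrix.vecMul (Y x).ofLp (g.C u x)) (g.news u x)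
      - (1 / 4 : ℝ) • (Matrix.of (g.P u x)).mulVec (Y x).ofLp
      + (1 / 2 : ℝ) • (Matrix.of (cov1 Y x)).mulVec (div2 (g.C u) x).ofLp
      + (1 / 2 : ℝ) • (g.C u x).mulVec (Y x).ofLp := by
  ext d
  have h : ∑ i, ∑ j, Y x i * g.C u x i j * g.news u x j d =
      ∑ j, (∑ i, Y x i * g.C u x i j) * g.news u x j d := by
    rw [Finset.sum_comm]; simp only [Finset.sum_mul]
  simp only [fluxVec, h]
  simp only [Matrix.mulVec, Matrix.vecMul, dotProduct, Pi.add_apply, Pi.sub_apply, Pi.smul_apply,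
    smul_eq_mul, Matrix.of_apply, mul_comm (Y x _) (g.P u x d _), mul_comm (Y x _) (g.C u x d _),
    mul_comm (Y x d)]

/-- The charge density is equivariant. -/
lemma density_rotate (Y : E → E) (hu : u ∈ I) (hx : x ∈ S2) :
    (g.rotate hI hρ₀ Q).density (rotV Q Y) u x = g.density Y u (Q x) := by
  rw [density_eq, density_eq, N_rotate g hI hρ₀ Q hu hx, C_rotate g hI hρ₀ Q hu hx,
    div2_C_rotate hI hρ₀ Q hu hx]
  simp only [rotV]
  rw [pull2_mulVec, ← Matrix.smul_vecMul, ← Matrix.sub_vecMul, dotProduct_vecMul_mat]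

lemma P_rotate (hu : u ∈ I) (hx : x ∈ S2) :
    Matrix.of ((g.rotate hI hρ₀ Q).P u x) = pull2 (mat Q) (Matrix.of (g.P u (Q x))) := by
  have e : ∀ g : BondiSachsMetric I ρ₀, ∀ x, Matrix.of (g.P u x) =
      Matrix.of (cov1 (div2 (g.C u)) x) - (Matrix.of (cov1 (div2 (g.C u)) x)).transpose :=
    fun g x => rfl
  have h : cov1 (div2 ((g.rotate hI hρ₀ Q).C u)) x = cov1 (rotV Q (div2 (g.C u))) x :=
    cov1_congr hx fun y hy => div2_C_rotate hI hρ₀ Q hu hy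
  rw [e, e, h, cov1_rotV Q fun b => (g.smooth_div2 hI hρ₀ b).differentiableAt hI hu (isometry_mem Q hx),
    pull2_sub, pull2_transpose]

/-- The flux vector is equivariant. -/
lemma fluxVec_rotate (hu : u ∈ I) (hx : x ∈ S2) :
    (g.rotate hI hρ₀ Q).fluxVec (rotV Q (linField A)) u x = rotV Q (g.fluxVec (linField A) u) x := by
  have hx' := isometry_mem Q hx
  have hY : ∀ b, DiffAt (fun y => linField A y b) (Q x) := fun b =>
    (smoothScri_linField (I := I) A b).differentiableAt hI hu hx'
  refine WithLp.ofLp_injective 2 ?_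
  rw [fluxVec_eq, C_rotate g hI hρ₀ Q hu hx, news_rotate g hI hρ₀ Q hu hx, P_rotate g hI hρ₀ Q hu hx,
    div2_C_rotate hI hρ₀ Q hu hx, cov1_rotV Q hY]
  simp only [rotV]
  rw [fluxVec_eq, vecMul_pull2, vecMul_pull2, pull2_mulVec, pull2_mulVec, pull2_mulVec]
  simp only [Matrix.add_vecMul, Matrix.sub_vecMul, Matrix.smul_vecMul]
  rfl

/-- The flux density is equivariant. -/
lemma newsLie_rotate (hu : u ∈ I) (hx : x ∈ S2) :
    (g.rotate hI hρ₀ Q).newsLie (rotV Q (linField A)) u x = g.newsLie (linField A) u (Q x) := by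
  have hx' := isometry_mem Q hx
  have e : ∀ g : BondiSachsMetric I ρ₀, ∀ Y x, g.newsLie Y u x =
    contract (g.news u x) (Matrix.of (lie2 Y (g.C u) x)) := fun _ _ _ => rfl
  rw [e, e, lie2_congr hx (Y' := rotV Q (linField A)) (T' := rotT Q (g.C u)) (fun _ _ => rfl)
    (fun y hy => C_rotate g hI hρ₀ Q hu hy), lie2_rot Q
    (fun b => (smoothScri_linField (I := I) A b).differentiableAt hI hu hx')
    (fun b c => diffAt_C hI hρ₀ hu hx' b c), news_rotate g hI hρ₀ Q hu hx, contract_pull2]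

variable {g}

include hI hρ₀ in
/-- The balance law: the charge density changes by the divergence of the flux vector and the
contraction of the news with the Lie derivative of the shear. -/
theorem balance (hvac : g.IsVacuum) (hA : ∀ i j, A i j = -A j i) (hu : u ∈ I) (hx : x ∈ S2) :
    deriv (fun s => g.density (linField A) s x) u =
      ∑ k, grad (fun y => g.fluxVec (linField A) u y k) x k - 1 / 4 * g.newsLie (linField A) u x := by
  obtain ⟨Q, rfl⟩ := exists_isometry hx
  have hA' : ∀ i j, pull2 (mat Q) A i j = -pull2 (mat Q) A j i := by
    have : A.transpose = -A := by ext i j; exact hA j i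
    intro i j
    have h2 := congrFun (congrFun (pull2_transpose (mat Q) A) j) i
    rw [this, show -A = (-1 : ℝ) • A by simp, pull2_smul] at h2
    simpa using h2.symm
  have h := balance_pole hI hρ₀ (hvac.rotate hI hρ₀ Q) hA' hu
  rw [← rotV_linField, newsLie_rotate g hI hρ₀ Q hu e3_mem] at h
  have h1 : (fun s => (g.rotate hI hρ₀ Q).density (rotV Q (linField A)) s e3) =ᶠ[𝓝 u]
      fun s => g.density (linField A) s (Q e3) := by
    filter_upwards [hI.mem_nhds hu] with s hs using density_rotate g hI hρ₀ Q _ hs e3_mem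
  have h2 : ∑ k, grad (fun y => (g.rotate hI hρ₀ Q).fluxVec (rotV Q (linField A)) u y k) e3 k =
      ∑ k, grad (fun y => g.fluxVec (linField A) u y k) (Q e3) k := by
    calc _ = (jac (rotV Q (g.fluxVec (linField A) u)) e3).trace :=
          Finset.sum_congr rfl fun k _ =>
            grad_congr (g := fun y => rotV Q (g.fluxVec (linField A) u) y k)
              (fun y hy => by rw [fluxVec_rotate g hI hρ₀ Q hu hy]) e3_ne k
      _ = _ := by
          rw [jac_rotV Q fun b => (g.smooth_fluxVec hI hρ₀ A b).differentiableAt hI hu hx, trace_pull2]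
          rfl
  rw [h1.deriv_eq, h2] at h
  exact h

end BondiSachsMetric

/-! ### The exterior derivative on null infinity -/

lemma wedge_ofSubsingleton_apply (α β : ℝ × E →L[ℝ] ℝ) (v : Fin 2 → ℝ × E) :
    wedge (ContinuousAlternatingMap.ofSubsingleton ℝ (ℝ × E) ℝ (0 : Fin 1) α) β v =
      α (v 0) * β (v 1) - α (v 1) * β (v 0) := by
  simp [wedge, ContinuousAlternatingMap.alternatizeUncurryFin_apply, Fin.sum_univ_two, Fin.removeNth]
  ring

lemma wedge_one_apply (η : (ℝ × E) [⋀^Fin 1]→L[ℝ] ℝ) (β : ℝ × E →L[ℝ] ℝ) (v : Fin 2 → ℝ × E) :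
    wedge η β v = η ![v 0] * β (v 1) - η ![v 1] * β (v 0) := by
  have h0 : Fin.tail v = ![v 1] := funext fun i => by fin_cases i; rfl
  have h1 : Fin.removeNth 1 v = ![v 0] := funext fun i => by fin_cases i; rfl
  simp [wedge, ContinuousAlternatingMap.alternatizeUncurryFin_apply, Fin.sum_univ_two, h0, h1]
  ring

lemma wedge_two_apply (η : (ℝ × E) [⋀^Fin 2]→L[ℝ] ℝ) (β : ℝ × E →L[ℝ] ℝ) (v : Fin 3 → ℝ × E) :
    wedge η β v = η ![v 1, v 2] * β (v 0) - η ![v 0, v 2] * β (v 1) + η ![v 0, v 1] * β (v 2) := by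
  have h0 : Fin.tail v = ![v 1, v 2] := funext fun i => by fin_cases i <;> rfl
  have h1 : Fin.removeNth 1 v = ![v 0, v 2] := funext fun i => by fin_cases i <;> rfl
  have h2 : Fin.removeNth 2 v = ![v 0, v 1] := funext fun i => by fin_cases i <;> rfl
  simp [wedge, ContinuousAlternatingMap.alternatizeUncurryFin_apply, Fin.sum_univ_three, h0, h1, h2]
  ring

lemma areaForm_apply (x : E) (v : Fin 2 → ℝ × E) : areaForm x v =
    ∑ i : Fin 3, x i * ((v 0).2 (i + 1) * (v 1).2 (i + 2) - (v 1).2 (i + 1) * (v 0).2 (i + 2)) := by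
  simp [areaForm, wedge_ofSubsingleton_apply, ContinuousAlternatingMap.sum_apply, dx]

/-- The 2-form `ρ ε - (V ⌟ ε) ∧ du` on null infinity. -/
def scriForm (ρ : ℝ → E → ℝ) (V : ℝ → E → E) (p : ℝ × E) : (ℝ × E) [⋀^Fin 2]→L[ℝ] ℝ :=
  ρ p.1 p.2 • areaForm p.2 - wedge ((areaForm p.2).curryLeft (0, V p.1 p.2)) du

/-- The component `i` of `x × V`. -/
def crossComp (V : E → E) (i : Fin 3) (x : E) : ℝ := x (i + 1) * V x (i + 2) - x (i + 2) * V x (i + 1)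

lemma scriForm_apply (ρ : ℝ → E → ℝ) (V : ℝ → E → E) (p : ℝ × E) (v : Fin 2 → ℝ × E) :
    scriForm ρ V p v =
      ∑ i : Fin 3, ρ p.1 p.2 * p.2 i *
        ((v 0).2 (i + 1) * (v 1).2 (i + 2) - (v 1).2 (i + 1) * (v 0).2 (i + 2)) -
      ∑ i : Fin 3, crossComp (V p.1) i p.2 * ((v 0).2 i * (v 1).1 - (v 1).2 i * (v 0).1) := by
  simp [scriForm, areaForm_apply, wedge_one_apply, crossComp, Fin.sum_univ_three, du]
  ring

/-- The pullback of `scriForm` along the retraction, in Cartesian components. -/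
lemma scriForm_retract (ρ : ℝ → E → ℝ) (V : ℝ → E → E) {p : ℝ × E} (hp : p.2 ≠ 0) :
    (scriForm ρ V (retract p)).compContinuousLinearMap (fderiv ℝ retract p) =
      ∑ i : Fin 3, ((‖p.2‖⁻¹) ^ 2 * (ρ p.1 (unit p.2) * unit p.2 i)) •
        wedge (ContinuousAlternatingMap.ofSubsingleton ℝ (ℝ × E) ℝ (0 : Fin 1) (dx (i + 1))) (dx (i + 2)) -
      ∑ i : Fin 3, ((‖p.2‖⁻¹) ^ 1 * crossComp (V p.1) i (unit p.2)) •
        wedge (ContinuousAlternatingMap.ofSubsingleton ℝ (ℝ × E) ℝ (0 : Fin 1) (dx i)) du := by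
  have hu : DifferentiableAt ℝ unit p.2 :=
    (smooth_unit.contDiffAt (isOpen_ne0.mem_nhds hp)).differentiableAt (by simp)
  have hd : ∀ v : ℝ × E, fderiv ℝ retract p v = (v.1, fderiv ℝ unit p.2 v.2) := fun v => by
    have h : HasFDerivAt retract ((ContinuousLinearMap.fst ℝ ℝ E).prod
        ((fderiv ℝ unit p.2).comp (ContinuousLinearMap.snd ℝ ℝ E))) p :=
      hasFDerivAt_fst.prodMk (hu.hasFDerivAt.comp p hasFDerivAt_snd)
    rw [h.fderiv]; rfl
  have hn : ∀ v i, fderiv ℝ unit p.2 v i = ‖p.2‖⁻¹ * (v i - unit p.2 i * ∑ j, unit p.2 j * v j) :=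
    fderiv_unit hp
  ext v
  rw [ContinuousAlternatingMap.compContinuousLinearMap_apply, scriForm_apply]
  simp only [Function.comp, hd, hn, retract]
  generalize ‖p.2‖⁻¹ = n
  simp only [Fin.sum_univ_three, ContinuousAlternatingMap.sub_apply, ContinuousAlternatingMap.add_apply,
    ContinuousAlternatingMap.smul_apply, wedge_ofSubsingleton_apply, dx, du, crossComp]
  simp
  ring

/-- The derivative at a point of null infinity of an extension homogeneous of degree `-n` in `y`. -/
lemma SmoothScri.hasFDerivAt_scaled {I : Set ℝ} {F : ℝ → E → ℝ} (hI : IsOpen I) (hF : SmoothScri I F)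
    {u : ℝ} (hu : u ∈ I) {x : E} (hx : x ∈ S2) (n : ℕ) :
    HasFDerivAt (fun p : ℝ × E => (‖p.2‖⁻¹) ^ n * F p.1 (unit p.2))
      (deriv (fun s => F s x) u • BondiSachs.du +
        ∑ k, (BondiSachs.grad (F u) x k - n * x k * F u x) • dx k) (u, x) := by
  have hp : ((u, x) : ℝ × E) ∈ sdom I := ⟨hu, ne_zero_of_mem_S2 hx⟩
  have hx0 : x ≠ 0 := ne_zero_of_mem_S2 hx
  have h1 := norm_of_mem_S2 hx
  have hN : DifferentiableAt ℝ (fun y : E => ‖y‖) x := (contDiffAt_norm ℝ hx0 (n := 1)).differentiableAt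
    (by simp)
  have hN2 : HasFDerivAt (fun p : ℝ × E => ‖p.2‖) ((fderiv ℝ (fun y : E => ‖y‖) x).comp
      (ContinuousLinearMap.snd ℝ ℝ E)) (u, x) :=
    (show DifferentiableAt ℝ (fun y : E => ‖y‖) ((u, x) : ℝ × E).2 from hN).hasFDerivAt.comp (u, x)
      hasFDerivAt_snd
  have hF2 := (smooth_differentiableAt (isOpen_sdom hI) hF hp).hasFDerivAt
  have h := (((hasDerivAt_inv (show ‖((u, x) : ℝ × E).2‖ ≠ 0 by simpa using hx0)).comp_hasFDerivAt
    (u, x) hN2).pow n).mul hF2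
  refine h.congr_fderiv ?_
  have hL : fderiv ℝ (fun p : ℝ × E => F p.1 (unit p.2)) (u, x) =
      deriv (fun s => F s x) u • BondiSachs.du + ∑ k, BondiSachs.grad (F u) x k • dx k := by
    ext v
    · have := hF.deriv_eq_dd hI hp
      simp only [unit_of_mem hx] at this
      simp [this.deriv, BondiSachs.du, dx, dd, su]
    · have h2 : ∀ k, BondiSachs.grad (F u) x k = dd (ss k) (fun p : ℝ × E => F p.1 (unit p.2)) (u, x) :=
        fun k => hF.grad_eq_dd hI hp k
      have e : ((0, v) : ℝ × E) = ∑ k, v k • ss k := by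
        refine Prod.ext (by simp [ss, Fin.sum_univ_three]) ?_
        rw [Prod.snd_sum]
        exact (sum_smul_bv v).symm
      change fderiv ℝ (fun p : ℝ × E => F p.1 (unit p.2)) (u, x) (0, v) = _
      rw [e, map_sum]
      simp only [map_smul]
      simp [BondiSachs.du, dx, h2, dd, Fin.sum_univ_three, mul_comm]
  rw [hL]
  ext v
  · simp [dx, BondiSachs.du, h1, unit_of_mem hx]
  · simp [dx, BondiSachs.du, h1, unit_of_mem hx, hasFDerivAt_norm hx0, Fin.sum_univ_three]
    ring

/-- The alternation of a derivative of `a_i dx^(i+1) ∧ dx^(i+2) - b_i dx^i ∧ du` when the divergence of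
`a` vanishes and `∂_u a - curl b = c x`. -/
lemma alternatize_components {a b : Fin 3 → ℝ} {A B : Fin 3 → Fin 3 → ℝ} {c : ℝ} {x : E}
    (h : ∑ i, A i i = 0) (hc : ∀ i, a i - (B (i + 2) (i + 1) - B (i + 1) (i + 2)) = c * x i) :
    ContinuousAlternatingMap.alternatizeUncurryFin
      (∑ i : Fin 3, (a i • du + ∑ k, A i k • dx k).smulRight
          (wedge (ContinuousAlternatingMap.ofSubsingleton ℝ (ℝ × E) ℝ (0 : Fin 1) (dx (i + 1))) (dx (i + 2))) -
        ∑ i : Fin 3, (b i • du + ∑ k, B i k • dx k).smulRight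
          (wedge (ContinuousAlternatingMap.ofSubsingleton ℝ (ℝ × E) ℝ (0 : Fin 1) (dx i)) du)) =
      c • wedge (areaForm x) du := by
  ext v
  have h0 := hc 0
  have h1 := hc 1
  have h2 := hc 2
  rw [ContinuousAlternatingMap.alternatizeUncurryFin_apply, ContinuousAlternatingMap.smul_apply,
    wedge_two_apply]
  rw [Fin.sum_univ_three] at h
  simp [areaForm_apply, Fin.sum_univ_three, wedge_ofSubsingleton_apply, Fin.removeNth, dx,
    Fin.succAbove] at h0 h1 h2 ⊢
  linear_combination
    ((v 0).2 0 * ((v 1).2 1 * (v 2).2 2 - (v 1).2 2 * (v 2).2 1) -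
      (v 0).2 1 * ((v 1).2 0 * (v 2).2 2 - (v 1).2 2 * (v 2).2 0) +
      (v 0).2 2 * ((v 1).2 0 * (v 2).2 1 - (v 1).2 1 * (v 2).2 0)) * h +
    (du (v 0) * ((v 1).2 1 * (v 2).2 2 - (v 1).2 2 * (v 2).2 1) -
      du (v 1) * ((v 0).2 1 * (v 2).2 2 - (v 0).2 2 * (v 2).2 1) +
      du (v 2) * ((v 0).2 1 * (v 1).2 2 - (v 0).2 2 * (v 1).2 1)) * h0 +
    (du (v 0) * ((v 1).2 2 * (v 2).2 0 - (v 1).2 0 * (v 2).2 2) -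
      du (v 1) * ((v 0).2 2 * (v 2).2 0 - (v 0).2 0 * (v 2).2 2) +
      du (v 2) * ((v 0).2 2 * (v 1).2 0 - (v 0).2 0 * (v 1).2 2)) * h1 +
    (du (v 0) * ((v 1).2 0 * (v 2).2 1 - (v 1).2 1 * (v 2).2 0) -
      du (v 1) * ((v 0).2 0 * (v 2).2 1 - (v 0).2 1 * (v 2).2 0) +
      du (v 2) * ((v 0).2 0 * (v 1).2 1 - (v 0).2 1 * (v 1).2 0)) * h2

/-- The exterior derivative of `ρ ε - (V ⌟ ε) ∧ du`. -/
theorem scriExtDeriv_scriForm {I : Set ℝ} (hI : IsOpen I) {ρ : ℝ → E → ℝ} {V : ℝ → E → E}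
    (hρ : SmoothScri I ρ) (hV : ∀ i, SmoothScri I fun u x => V u x i)
    (hVt : ∀ u ∈ I, ∀ x ∈ S2, ∑ i, x i * V u x i = 0) {u : ℝ} (hu : u ∈ I) {x : E} (hx : x ∈ S2) :
    scriExtDeriv (scriForm ρ V) (u, x) =
      (deriv (fun s => ρ s x) u - ∑ k, grad (fun y => V u y k) x k) • wedge (areaForm x) du := by
  have hp : ((u, x) : ℝ × E) ∈ sdom I := ⟨hu, ne_zero_of_mem_S2 hx⟩
  have ha : ∀ i, SmoothScri I fun u x => ρ u x * x i := fun i => hρ.mul (SmoothScri.coord i)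
  have hb : ∀ i, SmoothScri I fun u x => crossComp (V u) i x := fun i =>
    ((SmoothScri.coord _).mul (hV _)).sub ((SmoothScri.coord _).mul (hV _))
  have hev : (fun q => (scriForm ρ V (retract q)).compContinuousLinearMap (fderiv ℝ retract q)) =ᶠ[𝓝 (u, x)]
      fun p => ∑ i : Fin 3, ((‖p.2‖⁻¹) ^ 2 * (ρ p.1 (unit p.2) * unit p.2 i)) •
        wedge (ContinuousAlternatingMap.ofSubsingleton ℝ (ℝ × E) ℝ (0 : Fin 1) (dx (i + 1))) (dx (i + 2)) -
      ∑ i : Fin 3, ((‖p.2‖⁻¹) ^ 1 * crossComp (V p.1) i (unit p.2)) •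
        wedge (ContinuousAlternatingMap.ofSubsingleton ℝ (ℝ × E) ℝ (0 : Fin 1) (dx i)) du := by
    filter_upwards [(isOpen_sdom hI).mem_nhds hp] with p hp using scriForm_retract ρ V hp.2
  have hd := (HasFDerivAt.fun_sum (u := Finset.univ) fun i _ =>
      ((ha i).hasFDerivAt_scaled hI hu hx 2).smul_const (wedge (ContinuousAlternatingMap.ofSubsingleton
        ℝ (ℝ × E) ℝ (0 : Fin 1) (dx (i + 1))) (dx (i + 2)))).fun_sub
    (HasFDerivAt.fun_sum (u := Finset.univ) fun i _ =>
      ((hb i).hasFDerivAt_scaled hI hu hx 1).smul_const (wedge (ContinuousAlternatingMap.ofSubsingleton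
        ℝ (ℝ × E) ℝ (0 : Fin 1) (dx i)) du))
  rw [scriExtDeriv, extDeriv, (hd.congr_of_eventuallyEq hev).fderiv]
  -- the derivatives of the components
  have Dρ := fun k => hρ.hasGrad hI hu hx k
  have DV := fun i k => (hV i).hasGrad hI hu hx k
  have Dx := fun i k => hasGrad_coord hx k i
  have ga : ∀ i k, grad (fun y => ρ u y * y i) x k = grad (ρ u) x k * x i + ρ u x * proj x i k :=
    fun i k => ((ha i).hasGrad hI hu hx k).unique ((Dρ k).mul hx (Dx i k))
  have gb : ∀ i k, grad (fun y => crossComp (V u) i y) x k =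
      (proj x (i + 1) k * V u x (i + 2) + x (i + 1) * grad (fun y => V u y (i + 2)) x k) -
      (proj x (i + 2) k * V u x (i + 1) + x (i + 2) * grad (fun y => V u y (i + 1)) x k) :=
    fun i k => ((hb i).hasGrad hI hu hx k).unique (((Dx _ k).mul hx (DV _ k)).sub ((Dx _ k).mul hx (DV _ k)))
  have da : ∀ i, deriv (fun s => ρ s x * x i) u = deriv (fun s => ρ s x) u * x i := fun i =>
    ((hρ.hasDerivAt hI hu hx).mul_const _).deriv
  have tρ := sum_mul_grad (hρ.differentiableAt hI hu hx)
  have tV := fun i => sum_mul_grad ((hV i).differentiableAt hI hu hx)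
  have hs := sum_sq_of_mem hx
  have hvt := hVt u hu x hx
  rw [Fin.sum_univ_three] at tρ hvt
  refine alternatize_components ?_ fun i => ?_
  · simp only [ga, Fin.sum_univ_three, proj]
    simp
    linear_combination tρ - 3 * ρ u x * hs
  · have tVi := tV i
    rw [Fin.sum_univ_three] at tVi
    simp only [gb, da]
    simp only [crossComp, Fin.sum_univ_three, proj]
    fin_cases i <;> simp at tVi ⊢
    · linear_combination tVi - 2 * V u x 0 * hs + 2 * x 0 * hvt
    · linear_combination tVi - 2 * V u x 1 * hs + 2 * x 1 * hvt
    · linear_combination tVi - 2 * V u x 2 * hs + 2 * x 2 * hvt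

/-- The matrix of the linear map `x ↦ a × x`. -/
def crossMatrix (a : E) : Matrix (Fin 3) (Fin 3) ℝ := !![0, -a 2, a 1; a 2, 0, -a 0; -a 1, a 0, 0]

lemma rotation_eq_linField (a : E) : rotation a = linField (crossMatrix a) := by
  ext x i
  fin_cases i <;> simp [rotation, cross, linField, crossMatrix, cross_apply, Fin.sum_univ_three] <;> ring

lemma crossMatrix_antisymm (a : E) (i j : Fin 3) : crossMatrix a i j = -crossMatrix a j i := by
  fin_cases i <;> fin_cases j <;> simp [crossMatrix]

lemma sum_mul_proj {x : E} (hx : x ∈ S2) (b : Fin 3) : ∑ d, x d * proj x d b = 0 := by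
  have hs := sum_sq_of_mem hx
  fin_cases b <;> simp [Fin.sum_univ_three, proj]
  · linear_combination -x 0 * hs
  · linear_combination -x 1 * hs
  · linear_combination -x 2 * hs

lemma sum_mul_cov1_right {X : E → E} {x : E} (hx : x ∈ S2) (k : Fin 3) : ∑ i, x i * cov1 X x k i = 0 := by
  simp only [cov1, Finset.mul_sum, ← mul_assoc]
  rw [Finset.sum_comm]
  simp only [← Finset.sum_mul, sum_mul_proj hx, zero_mul, Finset.sum_const_zero]

lemma sum_mul_cov1_left {X : E → E} {x : E} (h : ∀ b, DiffAt (fun y => X y b) x) (i : Fin 3) :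
    ∑ k, x k * cov1 X x k i = 0 := by
  simp only [cov1, Finset.mul_sum]
  rw [Finset.sum_comm]
  refine Finset.sum_eq_zero fun b _ => ?_
  calc _ = proj x i b * ∑ k, x k * grad (fun y => X y b) x k := by
        rw [Finset.mul_sum]; exact Finset.sum_congr rfl fun _ _ => by ring
    _ = 0 := by rw [sum_mul_grad (h b), mul_zero]

namespace BondiSachsMetric

variable {I : Set ℝ} {ρ₀ : ℝ} {g : BondiSachsMetric I ρ₀} (hI : IsOpen I) (hρ₀ : 0 < ρ₀) {u : ℝ} {x : E}
  {A : Matrix (Fin 3) (Fin 3) ℝ}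

include hI hρ₀

/-- The flux vector is tangent to the sphere when `Y` is a rotation field. -/
lemma fluxVec_tangent (hA : ∀ i j, A i j = -A j i) (hu : u ∈ I) (hx : x ∈ S2) :
    ∑ d, x d * g.fluxVec (linField A) u x d = 0 := by
  have h1 : ∑ d, x d * linField A x d = 0 := by
    simp only [linField_apply, Fin.sum_univ_three]
    linear_combination x 0 * x 1 * hA 0 1 + x 0 * x 2 * hA 0 2 + x 1 * x 2 * hA 1 2 +
      x 0 ^ 2 / 2 * hA 0 0 + x 1 ^ 2 / 2 * hA 1 1 + x 2 ^ 2 / 2 * hA 2 2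
  have hN := news_tangent hI hρ₀ hu hx (g := g)
  have hD := fun b => (g.smooth_div2 hI hρ₀ b).differentiableAt hI hu hx
  have hY : ∀ b, DiffAt (fun y => linField A y b) x := fun b =>
    (smoothScri_linField (I := I) A b).differentiableAt hI hu hx
  have hP : ∀ i, ∑ d, x d * g.P u x d i = 0 := fun i => by
    simp only [P, mul_sub, Finset.sum_sub_distrib, sum_mul_cov1_left hD, sum_mul_cov1_right hx, sub_zero]
  have hC : ∀ i, ∑ d, x d * g.C u x d i = 0 := fun i => by
    rw [← C_tangent hI hρ₀ hu hx (g := g) i]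
    exact Finset.sum_congr rfl fun d _ => by rw [C_symm hI hρ₀ hu hx i d, mul_comm]
  have hY' := fun i => sum_mul_cov1_left hY i
  simp only [Fin.sum_univ_three] at h1 hN hP hC hY'
  simp only [fluxVec, Fin.sum_univ_three]
  linear_combination g.m u x * h1 +
    1 / 2 * (linField A x 0 * g.C u x 0 0 + linField A x 1 * g.C u x 1 0 + linField A x 2 * g.C u x 2 0) * hN 0 +
    1 / 2 * (linField A x 0 * g.C u x 0 1 + linField A x 1 * g.C u x 1 1 + linField A x 2 * g.C u x 2 1) * hN 1 +
    1 / 2 * (linField A x 0 * g.C u x 0 2 + linField A x 1 * g.C u x 1 2 + linField A x 2 * g.C u x 2 2) * hN 2 +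
    1 / 2 * linField A x 0 * hC 0 +
    1 / 2 * div2 (g.C u) x 0 * hY' 0 +
    (-1 / 4) * linField A x 0 * hP 0 +
    1 / 2 * linField A x 1 * hC 1 +
    1 / 2 * div2 (g.C u) x 1 * hY' 1 +
    (-1 / 4) * linField A x 1 * hP 1 +
    1 / 2 * linField A x 2 * hC 2 +
    1 / 2 * div2 (g.C u) x 2 * hY' 2 +
    (-1 / 4) * linField A x 2 * hP 2

/-- The exterior derivative of `ω` on null infinity. -/
theorem scriExtDeriv_omega (hvac : g.IsVacuum) (hA : ∀ i j, A i j = -A j i) (hu : u ∈ I) (hx : x ∈ S2) :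
    scriExtDeriv (g.omega (linField A)) (u, x) =
      (-(1 / 4) * g.newsLie (linField A) u x) • wedge (areaForm x) du := by
  have h := scriExtDeriv_scriForm hI (g.smooth_density hI hρ₀ A) (g.smooth_fluxVec hI hρ₀ A)
    (fun u hu x hx => fluxVec_tangent hI hρ₀ hA hu hx) hu hx
  rw [balance hI hρ₀ hvac hA hu hx] at h
  refine h.trans ?_
  congr 1
  ring

end BondiSachsMetric

/-! ### The divergence theorem on the sphere -/

/-- Integration in polar coordinates of a product of a radial and an angular function. -/
lemma integral_radial_mul (c : ℝ → ℝ) (G : E → ℝ) :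
    ∫ y : E, c ‖y‖ * G (unit y) =
      (∫ x : S2, G x ∂(volume : Measure E).toSphere) *
        ∫ r : Ioi (0 : ℝ), c r ∂Measure.volumeIoiPow (Module.finrank ℝ E - 1) := by
  have h := (volume : Measure E).measurePreserving_homeomorphUnitSphereProd.integral_comp
    (Homeomorph.measurableEmbedding _) (fun z : S2 × Ioi (0 : ℝ) => G z.1 * c z.2)
  rw [integral_prod_mul (fun x : S2 => G x) (fun r : Ioi (0 : ℝ) => c r)] at h
  calc ∫ y : E, c ‖y‖ * G (unit y)
      = ∫ y : ({0}ᶜ : Set E), c ‖y.1‖ * G (unit y.1) ∂((volume : Measure E).comap (↑)) := by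
        rw [integral_subtype_comap (measurableSet_singleton _).compl fun y : E => c ‖y‖ * G (unit y),
          restrict_compl_singleton]
    _ = _ := integral_congr_ae (Eventually.of_forall fun y => by simp [unit, mul_comm])
    _ = _ := h

/-- A radial cutoff function. -/
def cutoff : ContDiffBump (2 : ℝ) := ⟨1 / 2, 1, by norm_num, by norm_num⟩

lemma tsupport_cutoff : tsupport (fun y : E => cutoff (‖y‖ ^ 2)) ⊆ {0}ᶜ ∩ closedBall 0 2 := by
  have h : tsupport (fun y : E => cutoff (‖y‖ ^ 2)) ⊆ (fun y : E => ‖y‖ ^ 2) ⁻¹' closedBall 2 1 := by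
    refine closure_minimal (fun y hy => ?_) (isClosed_closedBall.preimage (by fun_prop))
    have : ‖y‖ ^ 2 ∈ Function.support cutoff := hy
    rw [cutoff.support_eq] at this
    exact ball_subset_closedBall this
  intro y hy
  have h1 := h hy
  simp only [mem_preimage, mem_closedBall, Real.dist_eq, abs_le] at h1
  refine ⟨fun h0 => ?_, ?_⟩
  · rw [mem_singleton_iff] at h0
    rw [h0] at h1; norm_num at h1
  · rw [mem_closedBall_zero_iff]; nlinarith [norm_nonneg y]

lemma contDiff_cutoff : ContDiff ℝ ∞ (fun y : E => cutoff (‖y‖ ^ 2)) :=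
  cutoff.contDiff.comp (contDiff_norm_sq ℝ)

lemma hasCompactSupport_cutoff : HasCompactSupport (fun y : E => cutoff (‖y‖ ^ 2)) :=
  (isCompact_closedBall (0 : E) 2).of_isClosed_subset (isClosed_tsupport _)
    fun _ hy => (tsupport_cutoff hy).2

/-- Multiplication by a function supported away from zero restores continuity at zero. -/
lemma continuous_cutoff_mul {φ G : E → ℝ} (hφ : Continuous φ)
    (hs : tsupport φ ⊆ tsupport (fun y : E => cutoff (‖y‖ ^ 2))) (hG : ContinuousOn G {0}ᶜ) :
    Continuous fun y => φ y * G y :=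
  ContinuousOn.continuous_of_tsupport_subset (s := {0}ᶜ) (hφ.continuousOn.mul hG) isOpen_ne0
    ((tsupport_mul_subset_left.trans hs).trans fun _ hy => (tsupport_cutoff hy).1)

lemma integrable_cutoff_mul {φ G : E → ℝ} (hφ : Continuous φ)
    (hs : tsupport φ ⊆ tsupport (fun y : E => cutoff (‖y‖ ^ 2))) (hG : ContinuousOn G {0}ᶜ) :
    Integrable (fun y => φ y * G y) :=
  (continuous_cutoff_mul hφ hs hG).integrable_of_hasCompactSupport
    (hasCompactSupport_cutoff.mono' ((subset_tsupport φ).trans hs)).mul_right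

lemma fderiv_cutoff (y v : E) : fderiv ℝ (fun y : E => cutoff (‖y‖ ^ 2)) y v =
    deriv cutoff (‖y‖ ^ 2) * (2 * ∑ i, y i * v i) := by
  have h := ((cutoff.contDiff (n := 1)).differentiable (by simp) (‖y‖ ^ 2)).hasDerivAt.comp_hasFDerivAt y
    (hasStrictFDerivAt_norm_sq y).hasFDerivAt
  have h' : HasFDerivAt (fun y : E => cutoff (‖y‖ ^ 2)) _ y := h
  rw [h'.fderiv]
  simp [PiLp.inner_apply, Fin.sum_univ_three]
  left; ring

/-- The divergence theorem on the sphere. -/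
theorem integral_divergence {X : E → E} (hX : ∀ k, SmoothOnSphere fun y => X y k)
    (ht : ∀ x ∈ S2, ∑ k, x k * X x k = 0) :
    ∫ x : S2, ∑ k, grad (fun y => X y k) x k ∂(volume : Measure E).toSphere = 0 := by
  have hd : ∀ k, ContinuousOn (fun y => grad (fun y => X y k) y k) {0}ᶜ := fun k =>
    ((hX k).continuousOn_fderiv_of_isOpen isOpen_ne0 (by simp)).clm_apply continuousOn_const
  have hφ := contDiff_cutoff
  have hφ' : ∀ k : Fin 3, Continuous fun y : E => fderiv ℝ (fun y : E => cutoff (‖y‖ ^ 2)) y (bv k) :=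
    fun k => (hφ.continuous_fderiv (by simp)).clm_apply continuous_const
  have hs' : ∀ k : Fin 3, tsupport (fun y : E => fderiv ℝ (fun y : E => cutoff (‖y‖ ^ 2)) y (bv k)) ⊆
      tsupport (fun y : E => cutoff (‖y‖ ^ 2)) := fun k => tsupport_fderiv_apply_subset ℝ _
  have i1 := fun k => integrable_cutoff_mul (hφ' k) (hs' k) (hX k).continuousOn
  have i2 := fun k => integrable_cutoff_mul hφ.continuous Subset.rfl (hd k)
  have i3 := fun k => integrable_cutoff_mul hφ.continuous Subset.rfl (hX k).continuousOn
  have parts : ∀ k, ∫ y : E, cutoff (‖y‖ ^ 2) * grad (fun y => X y k) y k =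
      -∫ y : E, fderiv ℝ (fun y : E => cutoff (‖y‖ ^ 2)) y (bv k) * X (unit y) k := fun k =>
    integral_mul_fderiv_eq_neg_fderiv_mul_of_integrable (i1 k) (i2 k) (i3 k)
      (fun y _ => hφ.differentiable (by simp) y)
      fun y hy => smooth_differentiableAt isOpen_ne0 (hX k) (tsupport_cutoff hy).1
  have zero : ∫ y : E, ∑ k, cutoff (‖y‖ ^ 2) * grad (fun y => X y k) y k = 0 := by
    rw [integral_finsetSum _ fun k _ => i2 k]
    simp only [parts]
    rw [Finset.sum_neg_distrib, ← integral_finsetSum _ fun k _ => i1 k, neg_eq_zero]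
    refine integral_eq_zero_of_ae (Eventually.of_forall fun y => ?_)
    -- the gradient of the cutoff is radial
    by_cases hy : y = 0
    · simp [hy, fderiv_cutoff]
    · have e : ∀ k, y k = ‖y‖ * unit y k := fun k => by
        rw [unit, PiLp.smul_apply, smul_eq_mul, mul_inv_cancel_left₀ (norm_ne_zero_iff.2 hy)]
      have h := ht _ (unit_mem hy)
      simp only [Fin.sum_univ_three] at h
      simp [fderiv_cutoff, Fin.sum_univ_three, e]
      linear_combination (2 * deriv cutoff (‖y‖ ^ 2) * ‖y‖) * h
  have polar : ∀ G : E → ℝ, ∫ y : E, (cutoff (‖y‖ ^ 2) * ‖y‖⁻¹) * G (unit y) = _ := fun G =>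
    integral_radial_mul (fun r => cutoff (r ^ 2) * r⁻¹) G
  have hpos : 0 < ∫ y : E, (cutoff (‖y‖ ^ 2) * ‖y‖⁻¹) * 1 := by
    simp only [mul_one]
    have hn : ContinuousOn (fun y : E => ‖y‖⁻¹) {0}ᶜ :=
      continuous_norm.continuousOn.inv₀ fun y hy => norm_ne_zero_iff.2 hy
    refine (continuous_cutoff_mul hφ.continuous Subset.rfl hn).integral_pos_of_hasCompactSupport_nonneg_nonzero
      hasCompactSupport_cutoff.mul_right (fun y => mul_nonneg cutoff.nonneg (by positivity))
      (x := √2 • e3) ?_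
    have h2 : ‖√2 • e3‖ = √2 := by
      rw [norm_smul, norm_of_mem_S2 e3_mem, mul_one, Real.norm_eq_abs, abs_of_pos (by positivity)]
    have h3 : cutoff (2 : ℝ) = 1 := cutoff.one_of_mem_closedBall (by simp [cutoff])
    rw [h2, Real.sq_sqrt (by norm_num), h3]
    positivity
  rw [polar fun _ => 1] at hpos
  have key : ∫ y : E, (cutoff (‖y‖ ^ 2) * ‖y‖⁻¹) * ∑ k, grad (fun y => X y k) (unit y) k = 0 := by
    rw [← zero]
    refine integral_congr_ae (Eventually.of_forall fun y => ?_)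
    by_cases hy : y = 0
    · have h0 : cutoff (0 : ℝ) = 0 := cutoff.zero_of_le_dist (by norm_num [cutoff, Real.dist_eq])
      simp [hy, h0]
    · simp only [Finset.mul_sum, mul_assoc]
      refine Finset.sum_congr rfl fun k _ => ?_
      rw [unit, grad_smul (inv_pos.2 (norm_pos_iff.2 hy)), inv_inv, inv_mul_cancel_left₀]
      exact norm_ne_zero_iff.2 hy
  rw [polar fun x => ∑ k, grad (fun y => X y k) x k] at key
  exact (mul_eq_zero.1 key).resolve_right (right_ne_zero_of_mul hpos.ne')

/-! ### Charges of sections -/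

/-- The integral of `ρ ε - (V ⌟ ε) ∧ du` over the section `u = f(x)`. -/
lemma sectionIntegral_scriForm {f : E → ℝ} (hf : SmoothOnSphere f) {ρ : ℝ → E → ℝ} {V : ℝ → E → E}
    (ht : ∀ x ∈ S2, ∑ k, x k * V (f x) x k = 0) :
    sectionIntegral f (scriForm ρ V) =
      ∫ x : S2, (ρ (f x) x + ∑ k, V (f x) x k * grad f x k) ∂(volume : Measure E).toSphere := by
  refine integral_congr_ae (Eventually.of_forall fun ⟨x, hx⟩ => ?_)
  have hx0 : x ≠ 0 := ne_zero_of_mem_S2 hx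
  have hfd : DifferentiableAt ℝ (fun y => f (unit y)) x := smooth_differentiableAt isOpen_ne0 hf hx0
  have hud : DifferentiableAt ℝ unit x :=
    (smooth_unit.contDiffAt (isOpen_ne0.mem_nhds hx0)).differentiableAt (by simp)
  have hs := sum_sq_of_mem hx
  have hV := ht x hx
  have hd : ∀ w : E, fderiv ℝ (sectionMap f) x w = (∑ k, w k * grad f x k, fderiv ℝ unit x w) := fun w => by
    have h : HasFDerivAt (sectionMap f) _ x := hfd.hasFDerivAt.prodMk hud.hasFDerivAt
    rw [h.fderiv]
    refine Prod.ext ?_ rfl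
    change fderiv ℝ (fun y => f (unit y)) x w = _
    have e := congrArg (fderiv ℝ (fun y => f (unit y)) x) (sum_smul_bv w)
    rw [map_sum] at e
    rw [← e]
    change _ = ∑ k, w k * grad f x k
    exact Finset.sum_congr rfl fun k _ => by rw [map_smul]; rfl
  -- the retraction is the identity on tangent vectors
  have hu : ∀ w : E, ∑ j, x j * w j = 0 → fderiv ℝ unit x w = w := fun w hw => by
    ext i
    rw [fderiv_unit hx0, norm_of_mem_S2 hx, unit_of_mem hx, hw]; simp
  have u1 : ∀ i, fderiv ℝ unit x (WithLp.toLp 2 fun k => proj x k i) = WithLp.toLp 2 fun k => proj x k i :=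
    fun i => hu _ (sum_mul_proj hx i)
  have u2 : ∀ v, fderiv ℝ unit x (cross x v) = cross x v := fun v => hu _ <| by
    simp [cross, cross_apply, Fin.sum_univ_three]; ring
  simp only [ContinuousAlternatingMap.compContinuousLinearMap_apply, scriForm_apply, Function.comp, hd,
    sectionMap, unit_of_mem hx, Matrix.cons_val_zero, Matrix.cons_val_one, u1, u2]
  simp [Fin.sum_univ_three, crossComp, cross, cross_apply, proj] at hV ⊢
  linear_combination (ρ (f x) x + (V (f x) x 0 * grad f x 0 + V (f x) x 1 * grad f x 1 +
    V (f x) x 2 * grad f x 2)) * hs -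
    (x 0 * grad f x 0 + x 1 * grad f x 1 + x 2 * grad f x 2) * hV

lemma SmoothOnSphere.smoothScri {I : Set ℝ} {f : E → ℝ} (hf : SmoothOnSphere f) :
    SmoothScri I fun _ => f :=
  ContDiffOn.comp (g := fun y => f (unit y)) hf contDiff_snd.contDiffOn fun _ hp => hp.2

namespace SmoothScri

variable {I : Set ℝ} {F : ℝ → E → ℝ} {f : E → ℝ} {t : ℝ}

lemma comp_section (hF : SmoothScri I F) (hf : SmoothOnSphere f) (hfI : ∀ x ∈ S2, t * f x ∈ I) :
    SmoothOnSphere fun x => F (t * f x) x :=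
  ContDiffOn.comp (f := fun y : E => (t * f (unit y), y)) hF
    ((contDiffOn_const.mul hf).prodMk contDiffOn_id) fun _ hy => ⟨hfI _ (unit_mem hy), hy⟩

/-- The chain rule along a section `u = t f(x)`. -/
lemma hasGrad_section (hI : IsOpen I) (hF : SmoothScri I F) (hf : SmoothOnSphere f) {x : E} (hx : x ∈ S2)
    (hfI : t * f x ∈ I) (k : Fin 3) : HasGrad (fun y => F (t * f y) y) x k
      (t * BondiSachs.grad f x k * deriv (fun s => F s x) (t * f x) + BondiSachs.grad (F (t * f x)) x k) := by
  have h := hF.hasFDerivAt_scaled hI hfI hx 0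
  simp only [pow_zero, one_mul, Nat.cast_zero, zero_mul, sub_zero] at h
  have hg : HasGrad f x k (BondiSachs.grad f x k) :=
    hasGrad_of_differentiableAt (smooth_differentiableAt isOpen_ne0 hf (ne_zero_of_mem_S2 hx)) k
  have hl : HasDerivAt (fun s : ℝ => x + s • bv k) (bv k) 0 := by
    simpa using ((hasDerivAt_id (0 : ℝ)).smul_const (bv k)).const_add x
  have hc := (HasDerivAt.const_mul t hg).prodMk hl
  have h0 : (t * f (unit (x + (0 : ℝ) • bv k)), x + (0 : ℝ) • bv k) = (t * f x, x) := by
    simp [unit_of_mem hx]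
  have h2 := HasFDerivAt.comp_hasDerivAt (0 : ℝ) (h0.symm ▸ h) hc
  refine HasDerivAt.congr_deriv h2 ?_
  simp [BondiSachs.du, dx, Fin.sum_univ_three]
  fin_cases k <;> simp <;> ring

lemma continuousOn_section (hF : SmoothScri I F) (hf : SmoothOnSphere f)
    (hfI : ∀ t ∈ Icc (0 : ℝ) 1, ∀ x ∈ S2, t * f x ∈ I) :
    ContinuousOn (fun z : S2 × ℝ => F (z.2 * f z.1) z.1) (univ ×ˢ Icc 0 1) := by
  have hfc : Continuous fun x : S2 => f x := by
    have := hf.continuousOn.comp_continuous (f := fun x : S2 => (x : E)) continuous_subtype_val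
      fun x => ne_zero_of_mem_S2 x.2
    refine this.congr fun x => ?_
    simp only [Function.comp, unit_of_mem x.2]
  have := hF.continuousOn.comp (f := fun z : S2 × ℝ => (z.2 * f z.1, (z.1 : E))) (s := univ ×ˢ Icc 0 1)
    ((continuous_snd.mul (hfc.comp continuous_fst)).prodMk
      (continuous_subtype_val.comp continuous_fst)).continuousOn fun z hz => ⟨hfI _ hz.2 _ z.1.2, ne_zero_of_mem_S2 z.1.2⟩
  refine this.congr fun z _ => ?_
  simp only [Function.comp, unit_of_mem z.1.2]

end SmoothScri

/-- The charge of the section `u = f(x)` differs from that of `u = 0` by the flux through the region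
between the sections. Along the family of sections `u = t f(x)` the difference of the two
`t`-derivatives is the divergence of the vector field `f V(t f, ·)`. -/
theorem integral_section {I : Set ℝ} (hI : IsOpen I) {f : E → ℝ} (hf : SmoothOnSphere f)
    (hfI : ∀ t ∈ Icc (0 : ℝ) 1, ∀ x ∈ S2, t * f x ∈ I) {ρ q : ℝ → E → ℝ} {V : ℝ → E → E}
    (hρ : SmoothScri I ρ) (hV : ∀ k, SmoothScri I fun u x => V u x k)
    (hVt : ∀ u ∈ I, ∀ x ∈ S2, ∑ k, x k * V u x k = 0)
    (hq : ∀ u ∈ I, ∀ x ∈ S2, deriv (fun s => ρ s x) u - ∑ k, grad (fun y => V u y k) x k = q u x) :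
    ∫ x : S2, (ρ (f x) x + ∑ k, V (f x) x k * grad f x k) ∂(volume : Measure E).toSphere =
      ∫ x : S2, ρ 0 x ∂(volume : Measure E).toSphere +
        ∫ x : S2, (∫ u in (0 : ℝ)..(f x), q u x) ∂(volume : Measure E).toSphere := by
  have hfs : SmoothScri I fun _ => f := hf.smoothScri
  have h01 : (1 : ℝ) ∈ Icc (0 : ℝ) 1 := ⟨zero_le_one, le_rfl⟩
  have h00 : (0 : ℝ) ∈ Icc (0 : ℝ) 1 := ⟨le_rfl, zero_le_one⟩
  have hqs : SmoothScri I q := ((hρ.du hI).sub (SmoothScri.sum (s := Finset.univ) fun k =>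
    (hV k).grad hI k)).congr hq
  -- the divergence of `f V(t f, ·)`
  set D : ℝ → E → ℝ := fun t x => ∑ k, (grad f x k * V (t * f x) x k + f x *
    (t * grad f x k * deriv (fun s => V s x k) (t * f x) + grad (fun y => V (t * f x) y k) x k)) with hD
  have hDt : ∀ t ∈ Icc (0 : ℝ) 1, ∫ x : S2, D t x ∂(volume : Measure E).toSphere = 0 := by
    intro t ht
    have hs : ∀ k, SmoothOnSphere fun x => V (t * f x) x k := fun k => (hV k).comp_section hf (hfI t ht)
    have hX : ∀ k, SmoothOnSphere fun x => (f x • V (t * f x) x) k := fun k => ContDiffOn.mul hf (hs k)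
    rw [← integral_divergence hX fun x hx => by
      simp only [PiLp.smul_apply, smul_eq_mul, mul_left_comm (x _), ← Finset.mul_sum,
        hVt _ (hfI t ht x hx) x hx, mul_zero]]
    refine integral_congr_ae (Eventually.of_forall fun ⟨x, hx⟩ => Finset.sum_congr rfl fun k _ => ?_)
    have hx0 := ne_zero_of_mem_S2 hx
    have hg : HasGrad f x k (grad f x k) :=
      hasGrad_of_differentiableAt (smooth_differentiableAt isOpen_ne0 hf hx0) k
    exact ((hg.mul hx ((hV k).hasGrad_section hI hf hx (hfI t ht x hx) k)).grad_eq
      (smooth_differentiableAt isOpen_ne0 (hX k) hx0)).symm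
  have cont : ∀ {F : ℝ → E → ℝ}, SmoothScri I F →
      ContinuousOn (fun z : S2 × ℝ => F (z.2 * f z.1) z.1) (univ ×ˢ Icc 0 1) := fun hF =>
    hF.continuousOn_section hf hfI
  have hDc : ContinuousOn (fun z : S2 × ℝ => D z.2 z.1) (univ ×ˢ Icc 0 1) := by
    refine continuousOn_finsetSum _ fun k _ => ?_
    have c1 := cont (hfs.grad hI k)
    exact (c1.mul (cont (hV k))).add ((cont hfs).mul
      (((continuous_snd.continuousOn.mul c1).mul (cont ((hV k).du hI))).add (cont ((hV k).grad hI k))))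
  have hDi : Integrable (Function.uncurry fun (x : S2) (t : ℝ) => D t x)
      ((volume : Measure E).toSphere.prod (volume.restrict (Ioc 0 1))) := by
    have h := hDc.integrableOn_compact (μ := (volume : Measure E).toSphere.prod volume)
      (isCompact_univ.prod isCompact_Icc)
    have h2 := h.mono_set (prod_mono_right (s := univ) Ioc_subset_Icc_self)
    rw [IntegrableOn, ← Measure.prod_restrict, Measure.restrict_univ] at h2
    exact h2
  have hD0 : ∫ x : S2, (∫ t in (0 : ℝ)..1, D t x) ∂(volume : Measure E).toSphere = 0 := by
    simp only [intervalIntegral.integral_of_le (zero_le_one' ℝ)]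
    rw [integral_integral_swap hDi]
    exact setIntegral_eq_zero_of_forall_eq_zero fun t ht => hDt t ⟨ht.1.le, ht.2⟩
  -- the pointwise identity behind the balance
  have hpt : ∀ x : S2, ρ (f x) x + ∑ k, V (f x) x k * grad f x k =
      ρ 0 x + (∫ u in (0 : ℝ)..(f x), q u x) + ∫ t in (0 : ℝ)..1, D t x := by
    rintro ⟨x, hx⟩
    have slice : ∀ {F : S2 × ℝ → ℝ}, ContinuousOn F (univ ×ˢ Icc 0 1) →
        IntervalIntegrable (fun t => F (⟨x, hx⟩, t)) volume 0 1 := fun hF => by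
      refine ContinuousOn.intervalIntegrable ?_
      rw [uIcc_of_le zero_le_one]
      exact hF.comp (f := fun t : ℝ => ((⟨x, hx⟩ : S2), t)) (by fun_prop) fun t ht => ⟨mem_univ _, ht⟩
    have h1 : ∫ u in (0 : ℝ)..(f x), q u x = ∫ t in (0 : ℝ)..1, f x * q (t * f x) x := by
      have := intervalIntegral.mul_integral_comp_mul_right (f := fun u => q u x) (a := 0) (b := 1) (f x)
      rw [zero_mul, one_mul] at this
      rw [← this, intervalIntegral.integral_const_mul]
    have h2 : ∀ t ∈ uIcc (0 : ℝ) 1, HasDerivAt (fun t => ρ (t * f x) x + t * ∑ k, V (t * f x) x k * grad f x k)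
        (f x * q (t * f x) x + D t x) t := by
      intro t ht
      rw [uIcc_of_le zero_le_one] at ht
      have hu := hfI t ht x hx
      have hl : HasDerivAt (fun t : ℝ => t * f x) (f x) t := by simpa using (hasDerivAt_id t).mul_const (f x)
      have e := ((hρ.hasDerivAt hI hu hx).comp t hl).fun_add ((hasDerivAt_id t).fun_mul
        (HasDerivAt.fun_sum (u := Finset.univ) fun k _ => (((hV k).hasDerivAt hI hu hx).comp t hl).mul_const
          (grad f x k)))
      refine HasDerivAt.congr_deriv e ?_
      rw [← hq _ hu x hx]
      simp [hD, Fin.sum_univ_three]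
      ring
    have i1 : IntervalIntegrable (fun t => f x * q (t * f x) x) volume 0 1 :=
      slice ((cont hfs).mul (cont hqs))
    have i2 : IntervalIntegrable (fun t => D t x) volume 0 1 := slice hDc
    have h3 := intervalIntegral.integral_eq_sub_of_hasDerivAt h2 (i1.add i2)
    rw [intervalIntegral.integral_add i1 i2, ← h1] at h3
    simp only [one_mul, zero_mul, add_zero] at h3
    linarith
  have int : ∀ {G : S2 → ℝ} (F : S2 × ℝ → ℝ) (t : ℝ), ContinuousOn F (univ ×ˢ Icc 0 1) → t ∈ Icc (0 : ℝ) 1 →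
      (∀ x, F (x, t) = G x) → Integrable G (volume : Measure E).toSphere := fun {G} F t hF ht hG => by
    have h : Continuous G := (hF.comp_continuous (f := fun x : S2 => (x, t)) (by fun_prop)
      fun x => ⟨mem_univ _, ht⟩).congr hG
    exact h.integrable_of_hasCompactSupport (HasCompactSupport.of_compactSpace _)
  have hρ0 : Integrable (fun x : S2 => ρ 0 x) (volume : Measure E).toSphere :=
    int _ 0 (cont hρ) h00 fun x => by simp
  have hsec : Integrable (fun x : S2 => ρ (f x) x + ∑ k, V (f x) x k * grad f x k)
      (volume : Measure E).toSphere :=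
    int _ 1 ((cont hρ).add (continuousOn_finsetSum Finset.univ fun k _ =>
      (cont (hV k)).mul (cont (hfs.grad hI k)))) h01 fun x => by simp
  have hDint : Integrable (fun x : S2 => ∫ t in (0 : ℝ)..1, D t x) (volume : Measure E).toSphere := by
    simp only [intervalIntegral.integral_of_le (zero_le_one' ℝ)]
    exact hDi.integral_prod_left
  have hqint : Integrable (fun x : S2 => ∫ u in (0 : ℝ)..(f x), q u x) (volume : Measure E).toSphere := by
    refine ((hsec.sub hρ0).sub hDint).congr (Eventually.of_forall fun x => ?_)
    simp only [Pi.sub_apply]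
    linarith [hpt x]
  have hsum : Integrable (fun x : S2 => ρ 0 x + ∫ u in (0 : ℝ)..(f x), q u x)
      (volume : Measure E).toSphere := hρ0.add hqint
  rw [integral_congr_ae (Eventually.of_forall hpt), integral_add hsum hDint, integral_add hρ0 hqint, hD0,
    add_zero]

namespace BondiSachsMetric

variable {I : Set ℝ} {ρ₀ : ℝ} {g : BondiSachsMetric I ρ₀}

/-- The Dray–Streubel angular momentum of a section is the integral of `ω` over it. -/
theorem angMom_eq_sectionIntegral (hI : IsOpen I) (hI' : I.OrdConnected) (h0 : (0 : ℝ) ∈ I) (hρ₀ : 0 < ρ₀)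
    (hvac : g.IsVacuum) {A : Matrix (Fin 3) (Fin 3) ℝ} (hA : ∀ i j, A i j = -A j i) {f : E → ℝ}
    (hf : SmoothOnSphere f) (hfI : ∀ x ∈ S2, f x ∈ I) :
    g.angMom (linField A) f = sectionIntegral f (g.omega (linField A)) := by
  have ht : ∀ u ∈ I, ∀ x ∈ S2, ∑ k, x k * g.fluxVec (linField A) u x k = 0 := fun u hu x hx =>
    fluxVec_tangent hI hρ₀ hA hu hx
  have hconv : Convex ℝ I := hI'.convex
  have h := integral_section hI hf (q := fun u x => -(1 / 4) * g.newsLie (linField A) u x)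
    (fun t ht x hx => hconv.smul_mem_of_zero_mem h0 (hfI x hx) ht)
    (g.smooth_density hI hρ₀ A) (g.smooth_fluxVec hI hρ₀ A) ht fun u hu x hx => by
      rw [balance hI hρ₀ hvac hA hu hx]; ring
  refine Eq.trans ?_ (h.symm.trans (sectionIntegral_scriForm hf fun x hx => ht _ (hfI x hx) x hx).symm)
  simp only [angMom, angMomZero, intervalIntegral.integral_const_mul, integral_const_mul]
  ring

end BondiSachsMetric

end BondiSachs

end

theorem mainTheorem5 (I : Set ℝ) (hI : IsOpen I) (hI' : I.OrdConnected) (h0 : (0 : ℝ) ∈ I)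
    (ρ₀ : ℝ) (hρ₀ : 0 < ρ₀) (g : BondiSachs.BondiSachsMetric I ρ₀) (hvac : g.IsVacuum)
    (a : BondiSachs.E) :
    (∀ u ∈ I, ∀ x ∈ BondiSachs.S2,
      BondiSachs.scriExtDeriv (g.omega (BondiSachs.rotation a)) (u, x) =
        (-(1 / 4) * g.newsLie (BondiSachs.rotation a) u x) •
          BondiSachs.wedge (BondiSachs.areaForm x) BondiSachs.du) ∧
    ∀ f : BondiSachs.E → ℝ, BondiSachs.SmoothOnSphere f → (∀ x ∈ BondiSachs.S2, f x ∈ I) →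
      g.angMom (BondiSachs.rotation a) f =
        BondiSachs.sectionIntegral f (g.omega (BondiSachs.rotation a)) := by 
  have hA := BondiSachs.crossMatrix_antisymm a
  rw [BondiSachs.rotation_eq_linField]
  exact ⟨fun u hu x hx => BondiSachs.BondiSachsMetric.scriExtDeriv_omega hI hρ₀ hvac hA hu hx,
    fun f hf hfI => BondiSachs.BondiSachsMetric.angMom_eq_sectionIntegral hI hI' h0 hρ₀ hvac hA hf hfI⟩
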